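/- Throughout $n\ge 0$, $m\neq 0$ is an integer, $m^*=\max(m,-m-1)$, $u_i=e^{2x_i}$ $(1\le i\le n)$, $v=e^{2y}$, $\nu\in\mathbb C^n$, $\mu\in\mathbb C$; powers of $u_i$ and $v$ are taken as $u_i^{s}=e^{2sx_i}$, $v^s=e^{2sy}$. Put $$A(u)=\prod_{i<j}(u_i-u_j),\quad A(u,v)=\prod_{i=1}^n(u_i-v),\quad A^*(w,u)=\prod_{i\le j}(w_i-u_j)\prod_{i>j}(u_j-w_i),$$ $$C_{k}(\nu)=\prod_{l=1}^{k}\prod_{i<j}(\nu_i-\nu_j-l),\qquad C(\nu,\mu)=\prod_{i=1}^n\Big(\nu_i-\mu-\frac{1+m}{2}\Big),\qquad \binom{a}{k}=\frac{a(a-1)\cdots(a-k+1)}{k!}.$$ The trigonometric Baker–Akhiezer (BA) function $\Phi^{(n)}_m(u,\nu)$ is the function of the form $$\Phi^{(n)}_m=\frac{Q(u,\nu)}{A(u)^{m^*}C_{m^*}(\nu)}\,u_1^{\nu_1}\cdots u_n^{\nu_n},$$ where $Q$ is a polynomial whose leading term in $\nu$ is $A(u)^{m^*}A(\nu)^{m^*}$,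 which satisfies $$\Big(-\sum_i\partial_{x_i}^2+\sum_{i<j}\frac{2m(m+1)}{\sinh^2(x_i-x_j)}\Big)\Phi^{(n)}_m=-4\sum_i\nu_i^2\;\Phi^{(n)}_m$$ and is normalised by $Q/(A(u)^{m^*}C_{m^*}(\nu))\to1$ when $x\to\infty$ in the chamber $x_1>\dots>x_n$ (all $x_i-x_j\to+\infty$, $i<j$). The deformed trigonometric BA function $\Phi^{(n,1)}_m(u,v,\nu,\mu)$ is the function of the form $$\Phi^{(n,1)}_m=\frac{Q(u,v,\nu,\mu)}{A(u)^{m^*}A(u,v)\,C_{m^*}(\nu)\,C(\nu,\mu)}\,u_1^{\nu_1}\cdots u_n^{\nu_n}v^{\mu/m},$$ where $Q$ is a polynomial whose leading term in $(\nu,\mu)$ is $A(u)^{m^*}A(u,v)A(\nu)^{m^*}A(\nu,\mu)$, which satisfies $$\Big(-\sum_i\partial_{x_i}^2-m\,\partial_y^2+\sum_{i<j}\frac{2m(m+1)}{\sinh^2(x_i-x_j)}+\sum_i\frac{2(m+1)}{\sinh^2(x_i-y)}\Big)\Phi^{(n,1)}_m=-4\Big(\sum_i\nu_i^2+\frac{\mu^2}{m}\Big)\Phi^{(n,1)}_m$$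 and is normalised by $Q/(A(u)^{m^*}A(u,v)C_{m^*}(\nu)C(\nu,\mu))\to1$ at infinity in the chamber $x_1>\dots>x_n>y$ (all $x_i-x_j\to+\infty$ for $i<j$, and all $x_i-y\to+\infty$). **Theorem.** Let $\Phi^{(n)}_m$ be the trigonometric BA function and $\Phi^{(n,1)}_m$ the deformed trigonometric BA function. (1) Let $m$ be a positive integer. Suppose that the $u_i$ have pairwise different arguments, that $A(u,v)\ne0$, $C_m(\nu)\neq0$, and that $\operatorname{Re}(\nu_i-\mu)>\frac{m+1}2+m(n-1)$ for all $i$. Let $\gamma^*$ be the contour $w_i=\tau_iu_i$, $\tau_i\in[0,1]$, the powers of $w_i$ (also those in $\Phi^{(n)}_m(w,\nu)$) being continued from $u_i$ along the segment. Then the following integral converges absolutely and $$\Phi^{(n,1)}_m=C_7\,\frac{\prod_{i}u_i^{\mu+\frac{1-m}2}\,v^{\frac\mu m}}{A(u)^mA(u,v)}\int_{\gamma^*}\frac{A^*(w,u)^mA(w,v)}{A(w)^m}\prod_{i}w_i^{-\mu-\frac{m+3}2}\;\Phi^{(n)}_m(w,\nu)\,dw,$$ $$C_7^{-1}=(-1)^{nm}\prod_{k=1}^n\frac{\Gamma(m+1)\,\Gamma\big(\nu_k-\mu+\frac{1-m}2\big)}{\Gamma\big(\nu_k-\mu+\frac{m+3}2\big)}.$$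 (2) Let $m=-m^*-1$ with an integer $m^*\ge0$. Suppose that the $u_i$ are distinct, that $A(u,v)\ne0$, $C_{m^*}(\nu)\ne0$, $C(\nu,\mu)\neq0$, and that $\binom{\nu_i-\mu+m^*/2}{m^*}\ne0$ for all $i$. Let $\sigma^*$ be the product of the circles $|w_i-u_i|=\epsilon$, the powers of $w_i$ being continued from $u_i$. Then for all sufficiently small $\epsilon>0$ $$\Phi^{(n,1)}_m=C_8\,\frac{\prod_{i}u_i^{\mu+\frac{m^*+2}2}\,v^{\frac\mu m}A(u)^{m^*+1}}{A(u,v)}\int_{\sigma^*}\frac{A(w)^{m^*+1}A(w,v)}{A^*(w,u)^{m^*+1}}\prod_{i}w_i^{-\mu+\frac{m^*}2-1}\;\Phi^{(n)}_m(w,\nu)\,dw,$$ $$C_8^{-1}=(2\pi i)^n\prod_{i=1}^n\binom{\nu_i-\mu+\frac{m^*}2}{m^*}.$$ -/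

import Mathlib

open MeasureTheory Filter Topology

noncomputable section

namespace TrigBA

/-- `A(x) = ∏_{i<j} (x_i - x_j)`. -/
def vdm {R : Type*} [CommRing R] {n : ℕ} (x : Fin n → R) : R :=
  ∏ i, ∏ j ∈ Finset.Ioi i, (x i - x j)

/-- `A(x, y) = ∏_i (x_i - y)` for a single extra variable `y`. -/
def cross {R : Type*} [CommRing R] {n : ℕ} (x : Fin n → R) (y : R) : R :=
  ∏ i, (x i - y)

/-- `A^*(w, u) = ∏_{i ≤ j} (w_i - u_j) ∏_{i > j} (u_j - w_i)`. -/
def crossStar {n : ℕ} (w u : Fin n → ℂ) : ℂ :=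
  (∏ i, ∏ j ∈ Finset.Ici i, (w i - u j)) * ∏ i, ∏ j ∈ Finset.Iio i, (u j - w i)

/-- `m^* = max (m, -m-1)`, which is a natural number for every integer `m`. -/
def mstar (m : ℤ) : ℕ := (max m (-m - 1)).toNat

/-- `C_k(ν) = ∏_{l=1}^k ∏_{i<j} (ν_i - ν_j - l)`. -/
def normC {n : ℕ} (k : ℕ) (ν : Fin n → ℂ) : ℂ :=
  ∏ l ∈ Finset.Icc 1 k, ∏ i, ∏ j ∈ Finset.Ioi i, (ν i - ν j - (l : ℂ))

/-- `C(ν, μ) = ∏_i (ν_i - μ - (1+m)/2)`. -/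
def normCdef {n : ℕ} (m : ℤ) (ν : Fin n → ℂ) (μ : ℂ) : ℂ :=
  ∏ i, (ν i - μ - (1 + (m : ℂ)) / 2)

/-- `a (a-1) ⋯ (a-k+1) / k!`. -/
def binom (a : ℂ) (k : ℕ) : ℂ :=
  (∏ j ∈ Finset.range k, (a - (j : ℂ))) / (k.factorial : ℂ)

/-- The exponential variable `e^{2x}`. -/
def expo (x : ℂ) : ℂ := Complex.exp (2 * x)

/-- The power `u ^ s = e^{2 s x}` of `u = e^{2x}`, in the branch given by `x`. -/
def powx (x s : ℂ) : ℂ := Complex.exp (2 * x * s)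

/-- `L` is the leading term (homogeneous part of highest degree) of `Q`. -/
def HasLeadingTerm {σ R : Type*} [CommRing R] (Q L : MvPolynomial σ R) : Prop :=
  ∃ d : ℕ, L.IsHomogeneous d ∧ Q.totalDegree ≤ d ∧ MvPolynomial.homogeneousComponent d Q = L

/-- The second partial derivative `∂²f/∂x_i²` of a function of complex variables. -/
def partial2 {n : ℕ} (f : (Fin n → ℂ) → ℂ) (i : Fin n) (x : Fin n → ℂ) : ℂ :=
  iteratedDeriv 2 (fun t : ℂ => f (Function.update x i t)) (x i)

/-- The Sutherland operator
`-Δ + ∑_{i<j} 2 m (m+1) / sinh² (x_i - x_j)`. -/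
def sutherland {n : ℕ} (m : ℤ) (f : (Fin n → ℂ) → ℂ) (x : Fin n → ℂ) : ℂ :=
  -(∑ i, partial2 f i x)
    + (∑ i, ∑ j ∈ Finset.Ioi i,
        2 * (m : ℂ) * ((m : ℂ) + 1) / Complex.sinh (x i - x j) ^ 2) * f x

/-- The deformed operator
`-∑ ∂²/∂x_i² - m ∂²/∂y² + ∑_{i<j} 2m(m+1)/sinh²(x_i-x_j) + ∑_i 2(m+1)/sinh²(x_i-y)`. -/
def defSutherland {n : ℕ} (m : ℤ) (f : (Fin n → ℂ) → ℂ → ℂ) (x : Fin n → ℂ) (y : ℂ) : ℂ :=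
  -(∑ i, partial2 (fun x' => f x' y) i x)
    - (m : ℂ) * iteratedDeriv 2 (fun t : ℂ => f x t) y
    + ((∑ i, ∑ j ∈ Finset.Ioi i,
          2 * (m : ℂ) * ((m : ℂ) + 1) / Complex.sinh (x i - x j) ^ 2)
        + ∑ i, 2 * ((m : ℂ) + 1) / Complex.sinh (x i - y) ^ 2) * f x y

/-- Going to infinity in the chamber `x_1 > ⋯ > x_n`: all differences `x_i - x_j` with `i < j`
tend to `+∞`. -/
def chamber (n : ℕ) : Filter (Fin n → ℝ) :=
  ⨅ i : Fin n, ⨅ j ∈ Finset.Ioi i, comap (fun x => x i - x j) atTop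

/-- Going to infinity in the chamber `x_1 > ⋯ > x_n > y`. -/
def chamberDef (n : ℕ) : Filter ((Fin n → ℝ) × ℝ) :=
  comap Prod.fst (chamber n) ⊓ ⨅ i : Fin n, comap (fun p => p.1 i - p.2) atTop

/-- `Φ(x, ν)`, in the coordinates `u_i = e^{2 x_i}`, is the trigonometric Baker-Akhiezer function
`Φ^{(n)}_m` of type `A_{n-1}`: the eigenfunction of the Sutherland operator of the form
`Q(u, ν) u^ν / (A(u)^{m^*} C_{m^*}(ν))`, with `Q` a polynomial whose leading term in `ν` is
`A(u)^{m^*} A(ν)^{m^*}`, normalised at infinity in the Weyl chamber.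
In `Q` the outer variables are the `ν_i` and the coefficients are polynomials in the `u_i`. -/
def IsTrigBA (n : ℕ) (m : ℤ) (Φ : (Fin n → ℂ) → (Fin n → ℂ) → ℂ) : Prop :=
  ∃ Q : MvPolynomial (Fin n) (MvPolynomial (Fin n) ℂ),
    HasLeadingTerm Q
      (MvPolynomial.C (vdm (fun i => MvPolynomial.X i) ^ mstar m) *
        vdm (fun i => MvPolynomial.X i) ^ mstar m) ∧
    (∀ x ν : Fin n → ℂ, vdm (fun i => expo (x i)) ≠ 0 → normC (mstar m) ν ≠ 0 →
      Φ x ν = MvPolynomial.eval₂ (MvPolynomial.eval fun i => expo (x i)) ν Q /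
          (vdm (fun i => expo (x i)) ^ mstar m * normC (mstar m) ν) *
        ∏ i, powx (x i) (ν i)) ∧
    (∀ x ν : Fin n → ℂ, vdm (fun i => expo (x i)) ≠ 0 → normC (mstar m) ν ≠ 0 →
      sutherland m (fun x' => Φ x' ν) x = -4 * (∑ i, ν i ^ 2) * Φ x ν) ∧
    (∀ ν : Fin n → ℂ, normC (mstar m) ν ≠ 0 →
      Tendsto (fun x : Fin n → ℝ =>
        MvPolynomial.eval₂ (MvPolynomial.eval fun i => expo (x i : ℂ)) ν Q /
          (vdm (fun i => expo (x i : ℂ)) ^ mstar m * normC (mstar m) ν)) (chamber n) (𝓝 1))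

/-- The point `(a_1, …, a_n, b)`, with `b` at the index `none`. -/
def adjoin {R : Type*} {n : ℕ} (a : Fin n → R) (b : R) : Option (Fin n) → R :=
  fun o => o.elim b a

/-- `F(x, y, ν, μ)`, in the coordinates `u_i = e^{2 x_i}`, `v = e^{2y}`, is the deformed
trigonometric Baker-Akhiezer function `Φ^{(n,1)}_m`: the eigenfunction of the deformed operator of
the form `Q(u, v, ν, μ) u^ν v^{μ/m} / (A(u)^{m^*} A(u,v) C_{m^*}(ν) C(ν,μ))`, with `Q` a polynomial
whose leading term in `(ν, μ)` is `A(u)^{m^*} A(u,v) A(ν)^{m^*} A(ν,μ)`, normalised at infinity in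
the chamber.
In `Q` the outer variables are `ν_i, μ` and the coefficients are polynomials in `u_i, v`. -/
def IsDefTrigBA (n : ℕ) (m : ℤ) (F : (Fin n → ℂ) → ℂ → (Fin n → ℂ) → ℂ → ℂ) : Prop :=
  ∃ Q : MvPolynomial (Option (Fin n)) (MvPolynomial (Option (Fin n)) ℂ),
    HasLeadingTerm Q
      (MvPolynomial.C (vdm (fun i : Fin n => MvPolynomial.X (some i)) ^ mstar m *
          cross (fun i : Fin n => MvPolynomial.X (some i)) (MvPolynomial.X none)) *
        (vdm (fun i : Fin n => MvPolynomial.X (some i)) ^ mstar m *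
          cross (fun i : Fin n => MvPolynomial.X (some i)) (MvPolynomial.X none))) ∧
    (∀ (x : Fin n → ℂ) (y : ℂ) (ν : Fin n → ℂ) (μ : ℂ),
      vdm (fun i => expo (x i)) ≠ 0 → cross (fun i => expo (x i)) (expo y) ≠ 0 →
      normC (mstar m) ν ≠ 0 → normCdef m ν μ ≠ 0 →
      F x y ν μ =
        MvPolynomial.eval₂ (MvPolynomial.eval (adjoin (fun i => expo (x i)) (expo y)))
            (adjoin ν μ) Q /
          (vdm (fun i => expo (x i)) ^ mstar m * cross (fun i => expo (x i)) (expo y) *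
            normC (mstar m) ν * normCdef m ν μ) *
        ((∏ i, powx (x i) (ν i)) * powx y (μ / (m : ℂ)))) ∧
    (∀ (x : Fin n → ℂ) (y : ℂ) (ν : Fin n → ℂ) (μ : ℂ),
      vdm (fun i => expo (x i)) ≠ 0 → cross (fun i => expo (x i)) (expo y) ≠ 0 →
      normC (mstar m) ν ≠ 0 → normCdef m ν μ ≠ 0 →
      defSutherland m (fun x' y' => F x' y' ν μ) x y =
        -4 * ((∑ i, ν i ^ 2) + μ ^ 2 / (m : ℂ)) * F x y ν μ) ∧
    (∀ (ν : Fin n → ℂ) (μ : ℂ), normC (mstar m) ν ≠ 0 → normCdef m ν μ ≠ 0 →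
      Tendsto (fun p : (Fin n → ℝ) × ℝ =>
        MvPolynomial.eval₂
            (MvPolynomial.eval (adjoin (fun i => expo (p.1 i : ℂ)) (expo (p.2 : ℂ))))
            (adjoin ν μ) Q /
          (vdm (fun i => expo (p.1 i : ℂ)) ^ mstar m *
            cross (fun i => expo (p.1 i : ℂ)) (expo (p.2 : ℂ)) *
            normC (mstar m) ν * normCdef m ν μ)) (chamberDef n) (𝓝 1))

/-- The logarithmic coordinate `z` with `e^{2z} = w`, continued from `x` (where `e^{2x} = u`) along
the straight path from `u` to `w`; it is used where `w/u` is positive or close to `1`. -/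
def liftLog (x w : ℂ) : ℂ := x + Complex.log (w / expo x) / 2

/-- The integrand of the Selberg-type integral,
`A^*(w,u)^m A(w,v) / A(w)^m ∏ w_i^{-μ-(m+3)/2} Φ(w, ν)`. -/
def selbergIntegrand {n : ℕ} (m : ℕ) (Φ : (Fin n → ℂ) → (Fin n → ℂ) → ℂ)
    (x : Fin n → ℂ) (y : ℂ) (ν : Fin n → ℂ) (μ : ℂ) (w : Fin n → ℂ) : ℂ :=
  crossStar w (fun i => expo (x i)) ^ m * cross w (expo y) / vdm w ^ m *
    (∏ i, powx (liftLog (x i) (w i)) (-μ - ((m : ℂ) + 3) / 2)) *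
    Φ (fun i => liftLog (x i) (w i)) ν

/-- The integrand of the iterated residue, with `s = m^*`,
`A(w)^{s+1} A(w,v) / A^*(w,u)^{s+1} ∏ w_i^{-μ+s/2-1} Φ(w, ν)`. -/
def residueIntegrand {n : ℕ} (s : ℕ) (Φ : (Fin n → ℂ) → (Fin n → ℂ) → ℂ)
    (x : Fin n → ℂ) (y : ℂ) (ν : Fin n → ℂ) (μ : ℂ) (w : Fin n → ℂ) : ℂ :=
  vdm w ^ (s + 1) * cross w (expo y) / crossStar w (fun i => expo (x i)) ^ (s + 1) *
    (∏ i, powx (liftLog (x i) (w i)) (-μ + (s : ℂ) / 2 - 1)) *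
    Φ (fun i => liftLog (x i) (w i)) ν

/-- The integral of `f(w) dw_1 ⋯ dw_n` over `w_i = τ_i u_i`, `τ ∈ [0,1]^n`, is the integral over
the cube of this function. -/
def segmentPullback {n : ℕ} (f : (Fin n → ℂ) → ℂ) (u : Fin n → ℂ) (τ : Fin n → ℝ) : ℂ :=
  f (fun i => (τ i : ℂ) * u i) * ∏ i, u i

end TrigBA

end

open MeasureTheory Filter Topology
open scoped Real
open Complex (Gamma I I_ne_zero abs_im_le_norm abs_re_le_norm add_im add_re arg continuous_ofReal
  exp exp_add exp_int_mul exp_log exp_ne_zero exp_ofReal_re exp_sub exp_sum exp_zero im imLm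
  im_mul_ofReal log log_one mul_im mul_re neg_re norm_I norm_exp norm_real ofReal_exp ofReal_neg
  ofReal_one ofReal_re ofReal_zero one_re re re_ofReal_mul real_smul sinh slitPlane_ne_zero sub_im
  sub_re)
open Finset (Ici Iio Ioi card_univ induction_on measurable_prod mem_Ioi mem_filter mem_range
  mem_univ mul_prod_erase mul_sum ne_of_mem_erase prod_congr prod_const prod_const_one
  prod_div_distrib prod_insert prod_le_one prod_mul_distrib prod_ne_zero_iff prod_nonneg prod_pow
  prod_pow_eq_pow_sum prod_zpow range single_le_sum sum_add_distrib sum_comm sum_comm' sum_congr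
  sum_const sum_div sum_eq_zero sum_filter sum_ite_eq sum_ite_eq' sum_le_sum sum_mul sum_mul_sum
  sum_neg_distrib sum_nonneg sum_sub_distrib univ)
open Function (Injective comp comp_def update update_eq_self update_of_ne update_self)
open Metric (ball ball_mem_nhds closedBall isOpen_ball isOpen_iff mem_ball mem_ball_self
  mem_closedBall_self)
open MvPolynomial (coeff coeff_C_mul coeff_sum coeff_zero continuous_eval eval eval_eq'
  eval_monomial eval₂ eval₂_add eval₂_mul funext_set mem_support_iff weightedHomogeneousComponent)
open Set (Icc Ioc Ioo indicator_of_notMem)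
open Polynomial (coeff_X_pow coeff_eq_zero_of_natDegree_lt eval_C eval_X eval_add eval_eq_sum_range
  eval_eq_sum_range' eval_finsetSum eval_mul eval_pow eval_prod eval_sub finsetSum_coeff
  natDegree_mul_le)
open Real (exp_le_exp exp_nat_mul exp_neg exp_pos norm_eq_abs norm_of_nonneg one_le_exp pi_pos sin
  two_pi_pos)

noncomputable section

namespace TrigBA

/-- The points `e^{2 x_i}`. -/
local notation:max "expos(" x ")" => fun i => expo (x i)

/-- The points `e^{2 x_i - σ_i}`. -/
local notation:max "shifted(" σ ", " x ")" => fun i => expo (x i - σ i / 2)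

/-- The product of Lebesgue measures restricted to `S`. -/
local notation:max "pow(" n ", " S ")" => Measure.pi fun _ : Fin n => Measure.restrict (volume : Measure ℝ) S

/-- Constant polynomials. -/
local notation "𝐂" => MvPolynomial.C

/-- Polynomials in `u_i`. -/
local notation:max "Poly(" n ")" => MvPolynomial (Fin n) ℂ

/-- Polynomials in `u_i` and `v`. -/
local notation:max "DefPoly(" n ")" => MvPolynomial (Option (Fin n)) ℂ

variable {n : ℕ} {ν : Fin n → ℂ} {μ : ℂ} {P : Polynomial Poly(n)}
  {P' : Polynomial DefPoly(n)} {Φ : (Fin n → ℂ) → (Fin n → ℂ) → ℂ}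
  {F : (Fin n → ℂ) → ℂ → (Fin n → ℂ) → ℂ → ℂ}

/-! ### The kernel function identity -/

/-! Put M = m in part (1) and M = -m^*-1 in part (2). Both right-hand sides are integrals over z of
K(z, x, y) Φ(z), where the kernel K (`ker`) is a product of powers of differences of the points
e^{2z_i}, e^{2x_i}, e^{2y} and an exponential. Give these 2n+1 points the charges 1, -1, -1/M. Up to
constant factors and shifts, the logarithmic derivatives of K are the fields of this system with the
interaction coth, and the addition formula for coth makes all three-body terms collapse
(`sum_charge_sq`). Hence the deformed operator in (x, y) and the Sutherland operator in z agree on K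
up to the scalar -4μ²/M (`kernel_identity`).

Write z = x - σ/2, with σ on a contour that does not depend on x. The deformed operator applied to
KΦ then gives the wanted eigenvalue times KΦ plus a divergence in σ (`defSutherland_dressed`). The
divergence integrates to zero: on the half-lines σ_i > 0, where w_i = e^{-σ_i} u_i runs over the
segment, by decay and by the zero of (e^{-σ_i}-1)^M at 0; on small loops around u_i because they are
closed. So the integral is an eigenfunction of the deformed operator (`Contour.eigenAt`).

It remains to identify it with the deformed BA function. Replace ν by ν + (T-1)κ with κ = (n, n-1,
…, 1), and let g_T be the difference of the two sides after clearing denominators and dividing by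
the plane wave (`lineDiff`). The equation for g_T contains the first-order term 4 Σ ν_i ∂_i, which
grows with T, so the derivative of g_T along κ is of order 1/T times a bound for g_T (`flow_bound`).
Therefore the leading coefficient of g_T as T → ∞ is constant along the flow x + rκ into the
chamber. By the normalisations of Φ and F and an explicit one-variable integral, g_T itself tends to
0 along this flow (`Line.tendsto`). As all estimates are uniform along the flow, the leading
coefficient is zero (`limit_eq_zero`); then so is the next one, and so on.

What the coefficients are depends on the contour. On loops the pole of order m^*+1 annihilates all
high powers of σ_i, so the exponential series breaks off and g_T is a polynomial in T; its
coefficients vanish by descending induction (`Line.loopCoeff_eq_zero`). On the real contour g_T is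
T^J times the Laplace transform of r^n times a density holomorphic in a strip around the half-line
(`lineDiff_eq_integral`). Watson's lemma reads the expansion of g_T off the Taylor coefficients of
the density, which therefore all vanish (`Line.quot_density_eq_zero`). So the density is zero, and
g_T = 0 for every T for which the integrals converge; T = 1 is the given ν.

Uniform estimates require that no two points meet along the flow. This holds when the imaginary
parts of the x_i and y are distinct modulo π (`Gap`). The condition is removed at the end by
continuity: in part (1) y is moved, in part (2) x is moved, where the loop integrals do not depend
on the radii. -/

/-- `coth (a - b)` in exponential coordinates. -/
def cth (a b : ℂ) : ℂ := (a + b) / (a - b)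

/-- Division by zero returns 0 here, which is the value compatible with antisymmetry; it lets the
diagonal stay in all later sums. -/
theorem cth_self (a : ℂ) : cth a a = 0 := by simp [cth]

theorem cth_symm (a b : ℂ) : cth a b = -cth b a := by
  rcases eq_or_ne a b with rfl | h
  · simp [cth_self]
  · have h1 := sub_ne_zero.2 h
    have h2 := sub_ne_zero.2 h.symm
    unfold cth
    field_simp
    ring

/-- The addition formula for coth, for three arguments with sum zero. It is the only property of the
interaction that the kernel identity uses besides antisymmetry. -/
theorem cth_cyclic {a b c : ℂ} (hab : a ≠ b) (hbc : b ≠ c) (hca : c ≠ a) :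
    cth a b * cth a c + cth b a * cth b c + cth c a * cth c b = 1 := by
  have h1 := sub_ne_zero.2 hab
  have h2 := sub_ne_zero.2 hbc
  have h3 := sub_ne_zero.2 hca
  rw [cth_symm b a, cth_symm a c, cth_symm c b]
  unfold cth
  field_simp
  ring

/-- Expanding the square gives a sum over triples with one distinguished index. Averaging over the
choice of that index produces the cyclic expression of `cth_cyclic`, equal to 1 on distinct triples,
so only a constant and two-body corrections from coinciding indices survive. -/
theorem sum_charge_sq {ι : Type*} [Fintype ι] [DecidableEq ι] (e U : ι → ℂ)
    (hU : Injective U) :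
    ∑ j, e j * (∑ k, e k * cth (U j) (U k)) ^ 2
      = ((∑ j, e j) ^ 3 + 2 * ∑ j, e j ^ 3) / 3
        + ∑ j, ∑ k, e j * e k ^ 2 * (cth (U j) (U k) ^ 2 - 1) := by
  set c : ι → ι → ℂ := fun j k => cth (U j) (U k) with hc
  -- If exactly two indices agree, the cyclic sum is a single square. If all three agree it is 0 = 1
  -- + 3·(-1) + 2, which explains the last term.
  have key : ∀ j k l : ι, c j k * c j l + c k j * c k l + c l j * c l k =
      1 + (if k = l then (c j k ^ 2 - 1) else 0) + (if j = k then (c l j ^ 2 - 1) else 0)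
        + (if l = j then (c k l ^ 2 - 1) else 0) + (if j = k then if k = l then 2 else 0 else 0) := by
    intro j k l
    by_cases h1 : j = k
    · subst h1
      by_cases h2 : j = l
      · subst h2; simp [hc, cth_self]; norm_num
      · simp [hc, cth_self, h2, Ne.symm h2, sq]
    · by_cases h2 : k = l
      · subst h2
        simp [hc, cth_self, h1, Ne.symm h1, sq]
      · by_cases h3 : l = j
        · subst h3
          simp [hc, cth_self, h1, h2, sq]
        · simp only [h1, h2, h3, if_false, add_zero]
          exact cth_cyclic (hU.ne h1) (hU.ne h2) (hU.ne h3)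
  have e1 : ∑ j, e j * (∑ k, e k * c j k) ^ 2
      = ∑ j, ∑ k, ∑ l, e j * e k * e l * (c j k * c j l) := by
    refine sum_congr rfl fun j _ => ?_
    rw [sq, sum_mul_sum, mul_sum]
    refine sum_congr rfl fun k _ => ?_
    rw [mul_sum]
    exact sum_congr rfl fun l _ => by ring
  have e2 : ∑ j, ∑ k, ∑ l, e j * e k * e l * (c j k * c j l)
      = ∑ j, ∑ k, ∑ l, e j * e k * e l * (c k j * c k l) := by
    rw [sum_comm]
    exact sum_congr rfl fun j _ => sum_congr rfl fun k _ =>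
      sum_congr rfl fun l _ => by ring
  have e3 : ∑ j, ∑ k, ∑ l, e j * e k * e l * (c j k * c j l)
      = ∑ j, ∑ k, ∑ l, e j * e k * e l * (c l j * c l k) := by
    rw [Finset.sum_comm_cycle]
    refine sum_congr rfl fun j _ => ?_
    rw [sum_comm]
    exact sum_congr rfl fun k _ =>
      sum_congr rfl fun l _ => by ring
  have e4 : 3 * ∑ j, e j * (∑ k, e k * c j k) ^ 2 =
      ∑ j, ∑ k, ∑ l, e j * e k * e l *
        (c j k * c j l + c k j * c k l + c l j * c l k) := by
    simp only [mul_add, sum_add_distrib]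
    rw [← e2, ← e3, ← e1]; ring
  have e5 : (∑ j, e j) ^ 3 = ∑ j, ∑ k, ∑ l, e j * e k * e l := by
    rw [pow_succ, sq, sum_mul_sum, sum_mul]
    refine sum_congr rfl fun j _ => ?_
    rw [sum_mul_sum]
  have e6 : 3 * ∑ j, e j * (∑ k, e k * c j k) ^ 2 =
      (∑ j, e j) ^ 3 + 3 * (∑ j, ∑ k, e j * e k ^ 2 * (c j k ^ 2 - 1)) + 2 * ∑ j, e j ^ 3 := by
    rw [e4, e5]
    simp only [key, mul_add, sum_add_distrib, mul_one, mul_ite, mul_zero,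
      sum_ite_eq, sum_ite_eq', mem_univ, if_true]
    have a1 : ∑ x, ∑ x_1, ∑ x_2, (if x = x_1 then e x * e x_1 * e x_2 * (c x_2 x ^ 2 - 1) else 0)
        = ∑ j, ∑ k, e j * e k ^ 2 * (c j k ^ 2 - 1) := by
      rw [sum_comm' (t' := univ) (s' := fun _ => univ) (by simp)]
      have : ∀ y x : ι, ∑ x_2, (if x = y then e x * e y * e x_2 * (c x_2 x ^ 2 - 1) else 0)
          = if x = y then ∑ x_2, e x * e y * e x_2 * (c x_2 x ^ 2 - 1) else 0 := by
        intro y x; split_ifs <;> simp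
      simp only [this, sum_ite_eq', mem_univ, if_true]
      rw [sum_comm]
      exact sum_congr rfl fun j _ => sum_congr rfl fun k _ => by ring
    have a2 : ∑ x, ∑ x_1, e x * e x_1 * e x * (c x_1 x ^ 2 - 1)
        = ∑ j, ∑ k, e j * e k ^ 2 * (c j k ^ 2 - 1) := by
      rw [sum_comm]
      exact sum_congr rfl fun j _ => sum_congr rfl fun k _ => by ring
    have a3 : ∑ x, ∑ x_1, e x * e x_1 * e x_1 * (c x x_1 ^ 2 - 1)
        = ∑ j, ∑ k, e j * e k ^ 2 * (c j k ^ 2 - 1) :=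
      sum_congr rfl fun j _ => sum_congr rfl fun k _ => by ring
    have a4 : ∑ x, ∑ x_1, ∑ x_2,
        (if x = x_1 then if x_1 = x_2 then e x * e x_1 * e x_2 * 2 else 0 else 0)
        = 2 * ∑ j, e j ^ 3 := by
      have : ∀ x y : ι, ∑ x_2, (if x = y then if y = x_2 then e x * e y * e x_2 * 2 else 0 else 0)
          = if x = y then e x * e y * e y * 2 else 0 := by
        intro x y; split_ifs <;> simp
      simp only [this, sum_ite_eq, mem_univ, if_true, mul_sum]
      exact sum_congr rfl fun j _ => by ring
    rw [a1, a2, a3, a4]; ring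
  linear_combination e6 / 3

/-- Action equals reaction. This disposes of the terms linear in μ in the kernel identity. -/
theorem sum_charge_antisymm {ι : Type*} [Fintype ι] (e U : ι → ℂ) :
    ∑ j, e j * ∑ k, e k * cth (U j) (U k) = 0 := by
  have h : ∑ j, e j * ∑ k, e k * cth (U j) (U k) = -∑ j, e j * ∑ k, e k * cth (U j) (U k) := by
    conv_lhs => simp only [mul_sum]
    rw [sum_comm]
    simp only [mul_sum, ← sum_neg_distrib]
    exact sum_congr rfl fun j _ => sum_congr rfl fun k _ => by
      rw [cth_symm (U k)]; ring
  linear_combination h / 2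

/-- The logarithmic derivative of the kernel in `z_i`. -/
def logZ (M : ℤ) (μ : ℂ) (w u : Fin n → ℂ) (v : ℂ) (i : Fin n) : ℂ :=
  M * (∑ j, cth (w i) (u j) - ∑ j, cth (w i) (w j)) + cth (w i) v - 2 * μ

/-- The logarithmic derivative of the kernel in `x_i`. -/
def logX (M : ℤ) (μ : ℂ) (w u : Fin n → ℂ) (v : ℂ) (i : Fin n) : ℂ :=
  -M * (∑ j, cth (w j) (u i) + ∑ j, cth (u i) (u j)) - cth (u i) v + 2 * μ

/-- The logarithmic derivative of the kernel in `y`. -/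
def logY (M : ℤ) (μ : ℂ) (w u : Fin n → ℂ) (v : ℂ) : ℂ :=
  -(∑ i, cth (w i) v) + ∑ i, cth (u i) v + 2 * μ / M

/-- The `2n+1` points `w_i, u_i, v`. -/
def pts (w u : Fin n → ℂ) (v : ℂ) : Option (Fin n ⊕ Fin n) → ℂ
  | none => v
  | some (Sum.inl i) => w i
  | some (Sum.inr i) => u i

/-- The charges of the `2n+1` points. -/
def chg (M : ℤ) : Option (Fin n ⊕ Fin n) → ℂ
  | none => -1 / M
  | some (Sum.inl _) => 1
  | some (Sum.inr _) => -1

/-- The quotient by the kernel of (deformed operator in x, y minus Sutherland operator in z) applied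
to it, written out with the squares of the logarithmic derivatives, their derivatives and the
potentials. The coefficients of the second derivatives in z, x, y are 1, -1, -M, which is M² times
the charge once each field is scaled as in the logarithmic derivatives; thus the squares form the
left side of `sum_charge_sq`, and its two-body terms are exactly the remaining ones. -/
theorem kernel_identity {M : ℤ} (hM : M ≠ 0) (μ : ℂ) (w u : Fin n → ℂ) (v : ℂ)
    (hinj : Injective (pts w u v)) :
    ∑ i, (logZ M μ w u v i ^ 2 - logX M μ w u v i ^ 2) - M * logY M μ w u v ^ 2
      + M * ∑ i, ((∑ j, (1 - cth (w j) (u i) ^ 2) * (-1)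
          + (∑ j, (1 - cth (u i) (u j) ^ 2) - 1) + (1 - cth (u i) v ^ 2) / M)
        + ((∑ j, (1 - cth (w i) (u j) ^ 2))
          - (∑ j, (1 - cth (w i) (w j) ^ 2) - 1) + (1 - cth (w i) v ^ 2) / M))
      - M * (∑ i, (1 - cth (w i) v ^ 2) - ∑ i, (1 - cth (u i) v ^ 2))
      + (M * (M + 1) * ∑ i, ∑ j ∈ univ.erase i, (cth (u i) (u j) ^ 2 - 1)
        + 2 * (M + 1) * ∑ i, (cth (u i) v ^ 2 - 1))
      - M * (M + 1) * ∑ i, ∑ j ∈ univ.erase i, (cth (w i) (w j) ^ 2 - 1)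
      = -4 * μ ^ 2 / M := by
  have hM' : (M : ℂ) ≠ 0 := by exact_mod_cast hM
  have h1 := sum_charge_sq (chg M) (pts w u v) hinj
  have h2 := sum_charge_antisymm (chg M) (pts w u v)
  simp only [Fintype.sum_option, Fintype.sum_sum_type, pts, chg] at h1 h2
  have er : ∀ g : Fin n → Fin n → ℂ, ∑ i, ∑ j ∈ univ.erase i, g i j
      = ∑ i, ∑ j, g i j - ∑ i, g i i := by
    intro g
    rw [← sum_sub_distrib]
    exact sum_congr rfl fun i _ => by
      rw [← Finset.add_sum_erase _ _ (mem_univ i)]; ring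
  rw [er, er]
  have s1 : ∑ i, ∑ j, cth (u i) (w j) ^ 2 = ∑ i, ∑ j, cth (w i) (u j) ^ 2 := by
    rw [sum_comm]
    exact sum_congr rfl fun i _ => sum_congr rfl fun j _ => by
      rw [cth_symm]; ring
  have s2 : ∑ i, ∑ j, cth (w j) (u i) ^ 2 = ∑ i, ∑ j, cth (w i) (u j) ^ 2 := by
    rw [sum_comm]
  have s3 : ∀ i, ∑ j, cth (w j) (u i) = - ∑ j, cth (u i) (w j) := fun i => by
    rw [← sum_neg_distrib]
    exact sum_congr rfl fun j _ => cth_symm _ _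
  have s4 : ∑ i, cth v (w i) ^ 2 = ∑ i, cth (w i) v ^ 2 :=
    sum_congr rfl fun i _ => by rw [cth_symm]; ring
  have s5 : ∑ i, cth v (u i) ^ 2 = ∑ i, cth (u i) v ^ 2 :=
    sum_congr rfl fun i _ => by rw [cth_symm]; ring
  have s6 : ∑ i, cth v (w i) = - ∑ i, cth (w i) v := by
    rw [← sum_neg_distrib]
    exact sum_congr rfl fun j _ => cth_symm _ _
  have s7 : ∑ i, cth v (u i) = - ∑ i, cth (u i) v := by
    rw [← sum_neg_distrib]
    exact sum_congr rfl fun j _ => cth_symm _ _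
  -- `Sz` and `Sx` are the fields at the charges w_i and u_i. The logarithmic derivatives are -(M Sz
  -- + 2μ) and M Sx + 2μ.
  set Sz : Fin n → ℂ := fun i => -1 / (M : ℂ) * cth (w i) v
    + (∑ j, 1 * cth (w i) (w j) + ∑ j, -1 * cth (w i) (u j)) with hSz
  set Sx : Fin n → ℂ := fun i => -1 / (M : ℂ) * cth (u i) v
    + (∑ j, 1 * cth (u i) (w j) + ∑ j, -1 * cth (u i) (u j)) with hSx
  have z1 : ∀ i, logZ M μ w u v i ^ 2 = M ^ 2 * Sz i ^ 2 + 4 * μ * M * Sz i + 4 * μ ^ 2 := by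
    intro i
    simp only [logZ, hSz, one_mul, neg_mul, sum_neg_distrib]
    field_simp
    ring
  have z2 : ∀ i, logX M μ w u v i ^ 2 = M ^ 2 * Sx i ^ 2 + 4 * μ * M * Sx i + 4 * μ ^ 2 := by
    intro i
    simp only [logX, hSx, one_mul, neg_mul, sum_neg_distrib, s3]
    field_simp
    ring
  have z3 : M * logY M μ w u v ^ 2 = (∑ i, cth (u i) v - ∑ i, cth (w i) v) ^ 2 * M
      + 4 * μ * (∑ i, cth (u i) v - ∑ i, cth (w i) v) + 4 * μ ^ 2 / M := by
    simp only [logY]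
    field_simp
    ring
  have g1 : ∑ j, 1 * Sz j ^ 2 = ∑ j, Sz j ^ 2 := by simp
  have g2 : ∑ j, -1 * Sx j ^ 2 = -∑ j, Sx j ^ 2 := by simp
  have g3 : ∑ j, 1 * Sz j = ∑ j, Sz j := by simp
  have g4 : ∑ j, -1 * Sx j = -∑ j, Sx j := by simp
  rw [g1, g2] at h1
  rw [g3, g4] at h2
  rw [z3, sum_congr rfl fun i _ => congrArg₂ (· - ·) (z1 i) (z2 i)]
  clear_value Sz Sx
  simp only [cth_self, mul_add, add_mul, sum_add_distrib, sum_sub_distrib, mul_sub,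
    sub_mul, ← mul_sum, add_sq, sub_sq, s1, s2, s4, s5, s6, s7,
    ← sum_div, sub_div, add_div, sum_const, card_univ, Fintype.card_fin,
    nsmul_eq_mul, sum_neg_distrib, mul_neg, neg_mul, one_mul, mul_one, one_pow, neg_sq,
    mul_pow] at h1 h2 ⊢
  field_simp at h1 h2 ⊢
  linear_combination h1 / 3 + 4 * μ * h2

/-! ### Logarithmic derivatives -/

/-- `f` has logarithmic derivative `L` at `t`. -/
def HasLog (f : ℂ → ℂ) (L t : ℂ) : Prop := HasDerivAt f (L * f t) t

theorem HasLog.mul {f g : ℂ → ℂ} {K L t : ℂ} (hf : HasLog f K t) (hg : HasLog g L t) :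
    HasLog (fun s => f s * g s) (K + L) t := by
  unfold HasLog at *
  convert! HasDerivAt.mul hf hg using 1
  ring

theorem HasLog.inv {f : ℂ → ℂ} {K t : ℂ} (hf : HasLog f K t) (h0 : f t ≠ 0) :
    HasLog (fun s => (f s)⁻¹) (-K) t := by
  unfold HasLog at *
  convert! HasDerivAt.inv hf h0 using 1
  field_simp

theorem HasLog.div {f g : ℂ → ℂ} {K L t : ℂ} (hf : HasLog f K t) (hg : HasLog g L t)
    (h0 : g t ≠ 0) : HasLog (fun s => f s / g s) (K - L) t := by
  simp only [div_eq_mul_inv, sub_eq_add_neg]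
  exact hf.mul (hg.inv h0)

theorem HasLog.zpow {f : ℂ → ℂ} {K t : ℂ} (hf : HasLog f K t) (h0 : f t ≠ 0) (m : ℤ) :
    HasLog (fun s => f s ^ m) (m * K) t := by
  unfold HasLog at *
  have := (hasDerivAt_zpow m (f t) (Or.inl h0)).comp t hf
  convert! this using 1
  rw [zpow_sub_one₀ h0]
  field_simp

theorem HasLog.exp {f : ℂ → ℂ} {K t : ℂ} (hf : HasDerivAt f K t) :
    HasLog (fun s => exp (f s)) K t := by
  unfold HasLog
  convert! hf.cexp using 1
  ring

theorem HasLog.prod {ι : Type*} (s : Finset ι) {f : ι → ℂ → ℂ} {K : ι → ℂ} {t : ℂ}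
    (hf : ∀ i ∈ s, HasLog (f i) (K i) t) :
    HasLog (fun r => ∏ i ∈ s, f i r) (∑ i ∈ s, K i) t := by
  classical
  induction s using induction_on with
  | empty => simpa [HasLog] using hasDerivAt_const t (1 : ℂ)
  | insert a s ha ih =>
    simp only [prod_insert ha, Finset.sum_insert ha]
    exact (hf a (Finset.mem_insert_self a s)).mul
      (ih fun i hi => hf i (Finset.mem_insert_of_mem hi))

theorem hasDerivAt_expo {a : ℂ → ℂ} {α t : ℂ} (ha : HasDerivAt a α t) :
    HasDerivAt (fun s => expo (a s)) (2 * α * expo (a t)) t := by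
  unfold expo
  convert! (ha.const_mul 2).cexp using 1
  ring

/-- The difference e^{2a} - e^{2b} is e^{a+b} times a hyperbolic sine, whence a constant part and a
coth part. The exponential factor of `ker` is tuned to cancel the constant parts. -/
theorem hasLog_expo_sub {a b : ℂ → ℂ} {α β t : ℂ} (ha : HasDerivAt a α t) (hb : HasDerivAt b β t)
    (h : expo (a t) ≠ expo (b t)) :
    HasLog (fun s => expo (a s) - expo (b s))
      ((α + β) + (α - β) * cth (expo (a t)) (expo (b t))) t := by
  unfold HasLog cth
  convert! (hasDerivAt_expo ha).sub (hasDerivAt_expo hb) using 1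
  have := sub_ne_zero.2 h
  field_simp
  ring

theorem hasDerivAt_cth {a b : ℂ → ℂ} {α β t : ℂ} (ha : HasDerivAt a α t) (hb : HasDerivAt b β t)
    (h : expo (a t) ≠ expo (b t)) :
    HasDerivAt (fun s => cth (expo (a s)) (expo (b s)))
      ((α - β) * (1 - cth (expo (a t)) (expo (b t)) ^ 2)) t := by
  unfold cth
  have := sub_ne_zero.2 h
  convert! ((hasDerivAt_expo ha).add (hasDerivAt_expo hb)).div
    ((hasDerivAt_expo ha).sub (hasDerivAt_expo hb)) this using 1
  simp only [Pi.add_apply, Pi.sub_apply]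
  field_simp
  ring

/-- By antisymmetry of coth the summand is a sum of an (i, j) part and the same expression with i
and j exchanged, so the sum over i < j unfolds to all ordered pairs of distinct indices. -/
theorem sum_Ioi_log (α : Fin n → ℂ) (w : Fin n → ℂ) :
    ∑ i, ∑ j ∈ Ioi i, ((α i + α j) + (α i - α j) * cth (w i) (w j))
      = ∑ i, α i * ((n : ℂ) - 1 + ∑ j, cth (w i) (w j)) := by
  have h := Finset.sum_sum_Ioi_add_eq_sum_sum_off_diag (fun i j : Fin n => α j * (1 + cth (w j) (w i)))
  have e : ∀ i j, α i + α j + (α i - α j) * cth (w i) (w j)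
      = α i * (1 + cth (w i) (w j)) + α j * (1 + cth (w j) (w i)) := fun i j => by
    rw [cth_symm (w j)]; ring
  simp only [e]
  rw [h]
  refine sum_congr rfl fun i _ => ?_
  rw [← mul_sum]
  congr 1
  rw [sum_add_distrib]
  congr 1
  · rw [sum_const, Finset.card_compl, Finset.card_singleton, Fintype.card_fin, nsmul_eq_mul,
      Nat.cast_sub (by have := i.2; omega)]
    simp
  · rw [← Finset.sum_compl_add_sum {i}]; simp [cth_self]

/-- The Cauchy-type kernel function intertwining the deformed and undeformed operators. -/
def ker (M : ℤ) (μ : ℂ) (z x : Fin n → ℂ) (y : ℂ) : ℂ :=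
  crossStar expos(z) expos(x) ^ M
      * cross expos(z) (expo y)
      / (vdm expos(z) ^ M * vdm expos(x) ^ M
        * cross expos(x) (expo y))
    * exp (2 * ((∑ i, x i) * (μ + (1 - M) / 2) - (∑ i, z i) * (μ + (M + 1) / 2)
      + y * (μ / M)))

theorem vdm_ne_zero {w : Fin n → ℂ} (h : Injective w) : vdm w ≠ 0 :=
  prod_ne_zero_iff.2 fun _ _ => prod_ne_zero_iff.2 fun _ hj =>
    sub_ne_zero.2 (h.ne (mem_Ioi.1 hj).ne)

theorem crossStar_ne_zero {w u : Fin n → ℂ} (h : ∀ i j, w i ≠ u j) : crossStar w u ≠ 0 :=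
  mul_ne_zero
    (prod_ne_zero_iff.2 fun i _ => prod_ne_zero_iff.2 fun j _ =>
      sub_ne_zero.2 (h i j))
    (prod_ne_zero_iff.2 fun i _ => prod_ne_zero_iff.2 fun j _ =>
      sub_ne_zero.2 (h i j).symm)

theorem cross_ne_zero {w : Fin n → ℂ} {v : ℂ} (h : ∀ i, w i ≠ v) : cross w v ≠ 0 :=
  prod_ne_zero_iff.2 fun i _ => sub_ne_zero.2 (h i)

/-- All variables move along arbitrary curves at once. One computation then covers the three motions
needed: x_i together with z_i, z_i alone, and y alone. -/
theorem hasLog_ker {M : ℤ} (μ : ℂ) {z x : ℂ → Fin n → ℂ} {y : ℂ → ℂ}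
    {α ξ : Fin n → ℂ} {η t : ℂ} (hz : ∀ i, HasDerivAt (fun s => z s i) (α i) t)
    (hx : ∀ i, HasDerivAt (fun s => x s i) (ξ i) t) (hy : HasDerivAt y η t)
    (hinj : Injective
      (pts (fun i => expo (z t i)) (fun i => expo (x t i)) (expo (y t)))) :
    HasLog (fun s => ker M μ (z s) (x s) (y s))
      (∑ i, α i * logZ M μ (fun i => expo (z t i)) (fun i => expo (x t i)) (expo (y t)) i
        + ∑ i, ξ i * logX M μ (fun i => expo (z t i)) (fun i => expo (x t i)) (expo (y t)) i
        + η * logY M μ (fun i => expo (z t i)) (fun i => expo (x t i)) (expo (y t))) t := by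
  have iz : ∀ i j, i ≠ j → expo (z t i) ≠ expo (z t j) := fun i j h he =>
    h (by simpa using @hinj (some (Sum.inl i)) (some (Sum.inl j)) he)
  have ix : ∀ i j, i ≠ j → expo (x t i) ≠ expo (x t j) := fun i j h he =>
    h (by simpa using @hinj (some (Sum.inr i)) (some (Sum.inr j)) he)
  have izx : ∀ i j, expo (z t i) ≠ expo (x t j) := fun i j he => by
    simpa using @hinj (some (Sum.inl i)) (some (Sum.inr j)) he
  have izy : ∀ i, expo (z t i) ≠ expo (y t) := fun i he => by
    simpa using @hinj (some (Sum.inl i)) none he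
  have ixy : ∀ i, expo (x t i) ≠ expo (y t) := fun i he => by
    simpa using @hinj (some (Sum.inr i)) none he
  have n1 := vdm_ne_zero (w := fun i => expo (z t i)) fun i j h => by_contra fun c => iz i j c h
  have n2 := vdm_ne_zero (w := fun i => expo (x t i)) fun i j h => by_contra fun c => ix i j c h
  have n3 := crossStar_ne_zero (w := fun i => expo (z t i)) (u := fun i => expo (x t i)) izx
  have n4 := cross_ne_zero (w := fun i => expo (x t i)) ixy
  have l1 : HasLog (fun s => vdm (fun i => expo (z s i))) _ t :=
    HasLog.prod univ fun i _ => HasLog.prod (Ioi i) fun j hj =>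
      hasLog_expo_sub (hz i) (hz j) (iz i j (mem_Ioi.1 hj).ne)
  have l2 : HasLog (fun s => vdm (fun i => expo (x s i))) _ t :=
    HasLog.prod univ fun i _ => HasLog.prod (Ioi i) fun j hj =>
      hasLog_expo_sub (hx i) (hx j) (ix i j (mem_Ioi.1 hj).ne)
  rw [sum_Ioi_log α (fun i => expo (z t i))] at l1
  rw [sum_Ioi_log ξ (fun i => expo (x t i))] at l2
  have l3 : HasLog (fun s => cross (fun i => expo (z s i)) (expo (y s))) _ t :=
    HasLog.prod univ fun i _ => hasLog_expo_sub (hz i) hy (izy i)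
  have l4 : HasLog (fun s => cross (fun i => expo (x s i)) (expo (y s))) _ t :=
    HasLog.prod univ fun i _ => hasLog_expo_sub (hx i) hy (ixy i)
  have l5 : HasLog (fun s => crossStar (fun i => expo (z s i)) (fun i => expo (x s i))) _ t :=
    HasLog.mul
      (HasLog.prod univ fun i _ => HasLog.prod (Ici i) fun j _ =>
        hasLog_expo_sub (hz i) (hx j) (izx i j))
      (HasLog.prod univ fun i _ => HasLog.prod (Iio i) fun j _ =>
        hasLog_expo_sub (hx j) (hz i) (izx i j).symm)
  have l6 : HasLog (fun s => exp (2 * ((∑ i, x s i) * (μ + (1 - M) / 2)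
      - (∑ i, z s i) * (μ + (M + 1) / 2) + y s * (μ / M)))) _ t :=
    HasLog.exp ((((HasDerivAt.fun_sum fun i _ => hx i).mul_const (μ + (1 - M) / 2)).sub
      ((HasDerivAt.fun_sum fun i _ => hz i).mul_const (μ + (M + 1) / 2))).add
      (hy.mul_const (μ / M)) |>.const_mul 2)
  have key := (((l5.zpow n3 M).mul l3).div (((l1.zpow n1 M).mul (l2.zpow n2 M)).mul l4)
    (mul_ne_zero (mul_ne_zero (zpow_ne_zero _ n1) (zpow_ne_zero _ n2)) n4)).mul l6
  convert! key using 1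
  have e5 : ∑ i, ∑ j ∈ Ici i, (α i + ξ j + (α i - ξ j) * cth (expo (z t i)) (expo (x t j)))
      + ∑ i, ∑ j ∈ Iio i, (ξ j + α i + (ξ j - α i) * cth (expo (x t j)) (expo (z t i)))
      = ∑ i, α i * (n + ∑ j, cth (expo (z t i)) (expo (x t j)))
        + ∑ i, ξ i * (n - ∑ j, cth (expo (z t j)) (expo (x t i))) := by
    have e0 : ∀ i j, ξ j + α i + (ξ j - α i) * cth (expo (x t j)) (expo (z t i))
        = α i + ξ j + (α i - ξ j) * cth (expo (z t i)) (expo (x t j)) := fun i j => by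
      rw [cth_symm (expo (x t j))]; ring
    simp only [e0]
    rw [← sum_add_distrib]
    have e1 : ∀ (i : Fin n) (g : Fin n → ℂ), ∑ j ∈ Ici i, g j + ∑ j ∈ Iio i, g j
        = ∑ j, g j := fun i g => by
      rw [add_comm, ← Finset.sum_union (by
        rw [Finset.disjoint_left]; intro a; simp)]
      congr 1
      ext a; simp [lt_or_ge]
    simp only [e1]
    have e2 : ∀ i j, α i + ξ j + (α i - ξ j) * cth (expo (z t i)) (expo (x t j))
      = α i * (1 + cth (expo (z t i)) (expo (x t j)))
        + ξ j * (1 - cth (expo (z t i)) (expo (x t j))) := fun i j => by ring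
    simp only [e2, sum_add_distrib]
    congr 1
    · simp [← mul_sum, sum_add_distrib]
    · rw [sum_comm]
      simp [← mul_sum, sum_sub_distrib]
  rw [e5]
  have ez : ∀ i, α i * logZ M μ (fun i => expo (z t i)) (fun i => expo (x t i)) (expo (y t)) i
      = M * (α i * ∑ j, cth (expo (z t i)) (expo (x t j)))
        - M * (α i * ∑ j, cth (expo (z t i)) (expo (z t j)))
        + α i * cth (expo (z t i)) (expo (y t)) - 2 * μ * α i := fun i => by
    simp only [logZ]; ring
  have ex : ∀ i, ξ i * logX M μ (fun i => expo (z t i)) (fun i => expo (x t i)) (expo (y t)) i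
      = -(M * (ξ i * ∑ j, cth (expo (z t j)) (expo (x t i))))
        - M * (ξ i * ∑ j, cth (expo (x t i)) (expo (x t j)))
        - ξ i * cth (expo (x t i)) (expo (y t)) + 2 * μ * ξ i := fun i => by
    simp only [logX]; ring
  simp only [ez, ex, logY, sum_add_distrib, sum_sub_distrib, ← mul_sum, mul_add,
    mul_sub, sub_mul, sum_neg_distrib, sum_const, ← sum_mul,
    card_univ, Fintype.card_fin, nsmul_eq_mul, mul_one]
  ring

/-! ### The differential equation for the dressed kernel -/

/-- The sum of the logarithmic derivatives in `z_i` and `x_i`, which has no pole at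
`z_i = x_i`. -/
def logZX (M : ℤ) (w u : Fin n → ℂ) (v : ℂ) (i : Fin n) : ℂ :=
  M * (∑ j, (cth (w i) (u j) - cth (w j) (u i) - cth (w i) (w j) - cth (u i) (u j)))
    + cth (w i) v - cth (u i) v

theorem logZX_eq (M : ℤ) (μ : ℂ) (w u : Fin n → ℂ) (v : ℂ) (i : Fin n) :
    logZX M w u v i = logZ M μ w u v i + logX M μ w u v i := by
  simp only [logZX, logZ, logX, sum_sub_distrib]
  ring

theorem hasDerivAt_logZX {M : ℤ} {z x : ℂ → Fin n → ℂ} {y : ℂ → ℂ}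
    {α ξ : Fin n → ℂ} {η t : ℂ} (hz : ∀ i, HasDerivAt (fun s => z s i) (α i) t)
    (hx : ∀ i, HasDerivAt (fun s => x s i) (ξ i) t) (hy : HasDerivAt y η t)
    (hinj : Injective
      (pts (fun i => expo (z t i)) (fun i => expo (x t i)) (expo (y t)))) (i : Fin n) :
    HasDerivAt (fun s => logZX M (fun i => expo (z s i)) (fun i => expo (x s i)) (expo (y s)) i)
      (M * (∑ j, ((α i - ξ j) * (1 - cth (expo (z t i)) (expo (x t j)) ^ 2)
          - (α j - ξ i) * (1 - cth (expo (z t j)) (expo (x t i)) ^ 2)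
          - (α i - α j) * (1 - cth (expo (z t i)) (expo (z t j)) ^ 2)
          - (ξ i - ξ j) * (1 - cth (expo (x t i)) (expo (x t j)) ^ 2)))
        + (α i - η) * (1 - cth (expo (z t i)) (expo (y t)) ^ 2)
        - (ξ i - η) * (1 - cth (expo (x t i)) (expo (y t)) ^ 2)) t := by
  have izx : ∀ i j, expo (z t i) ≠ expo (x t j) := fun i j he => by
    simpa using @hinj (some (Sum.inl i)) (some (Sum.inr j)) he
  have izy : ∀ i, expo (z t i) ≠ expo (y t) := fun i he => by
    simpa using @hinj (some (Sum.inl i)) none he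
  have ixy : ∀ i, expo (x t i) ≠ expo (y t) := fun i he => by
    simpa using @hinj (some (Sum.inr i)) none he
  have d1 : ∀ j, HasDerivAt (fun s => cth (expo (z s i)) (expo (z s j)))
      ((α i - α j) * (1 - cth (expo (z t i)) (expo (z t j)) ^ 2)) t := fun j => by
    rcases eq_or_ne i j with rfl | h
    · simpa [cth_self] using hasDerivAt_const t (0 : ℂ)
    · exact hasDerivAt_cth (hz i) (hz j) fun he => h (by
        simpa using @hinj (some (Sum.inl i)) (some (Sum.inl j)) he)
  have d2 : ∀ j, HasDerivAt (fun s => cth (expo (x s i)) (expo (x s j)))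
      ((ξ i - ξ j) * (1 - cth (expo (x t i)) (expo (x t j)) ^ 2)) t := fun j => by
    rcases eq_or_ne i j with rfl | h
    · simpa [cth_self] using hasDerivAt_const t (0 : ℂ)
    · exact hasDerivAt_cth (hx i) (hx j) fun he => h (by
        simpa using @hinj (some (Sum.inr i)) (some (Sum.inr j)) he)
  unfold logZX
  exact (((HasDerivAt.fun_sum fun j _ => (((hasDerivAt_cth (hz i) (hx j) (izx i j)).sub
    (hasDerivAt_cth (hz j) (hx i) (izx j i))).sub (d1 j)).sub (d2 j)).const_mul (M : ℂ)).add
      (hasDerivAt_cth (hz i) hy (izy i))).sub (hasDerivAt_cth (hx i) hy (ixy i))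

/-- Second derivative of a product of a function with known logarithmic derivative and an
analytic one. -/
theorem iteratedDeriv_two_hasLog_mul {K B Λ : ℂ → ℂ} {Λ' t : ℂ}
    (hK : ∀ᶠ s in 𝓝 t, HasLog K (Λ s) s) (hΛ : HasDerivAt Λ Λ' t) (hB : AnalyticAt ℂ B t) :
    iteratedDeriv 2 (fun s => K s * B s) t
      = (Λ' + Λ t ^ 2) * (K t * B t) + 2 * Λ t * (K t * deriv B t) + K t * iteratedDeriv 2 B t := by
  have h1 : deriv (fun s => K s * B s) =ᶠ[𝓝 t] fun s => Λ s * K s * B s + K s * deriv B s := by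
    filter_upwards [hK, hB.eventually_analyticAt] with s hs hb
    exact (HasDerivAt.mul hs hb.differentiableAt.hasDerivAt).deriv
  rw [iteratedDeriv_succ, iteratedDeriv_one, h1.deriv_eq, iteratedDeriv_succ, iteratedDeriv_one]
  have hKt : HasDerivAt K (Λ t * K t) t := hK.self_of_nhds
  have := ((hΛ.mul hKt).mul hB.differentiableAt.hasDerivAt).add
    (hKt.mul hB.deriv.differentiableAt.hasDerivAt)
  refine (this.deriv.trans ?_)
  simp only [Pi.mul_apply]
  ring

/-- The shift c is σ_i/2 when z_i = x_i - σ_i/2 is dragged along with x_i, and 0 otherwise. -/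
theorem hasDerivAt_update (x : Fin n → ℂ) (i : Fin n) (c t : ℂ) (j : Fin n) :
    HasDerivAt (fun s => update x i (s - c) j) ((Pi.single i 1 : Fin n → ℂ) j) t := by
  rcases eq_or_ne j i with rfl | h
  · simpa using (hasDerivAt_id t).sub_const c
  · simpa [h] using hasDerivAt_const t (x j)

theorem continuous_expo : Continuous expo := by unfold expo; fun_prop

theorem eventually_injective_pts {z x : ℂ → Fin n → ℂ} {y : ℂ → ℂ} {t : ℂ}
    (hz : ∀ i, ContinuousAt (fun s => z s i) t) (hx : ∀ i, ContinuousAt (fun s => x s i) t)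
    (hy : ContinuousAt y t) (hinj : Injective
      (pts (fun i => expo (z t i)) (fun i => expo (x t i)) (expo (y t)))) :
    ∀ᶠ s in 𝓝 t, Injective
      (pts (fun i => expo (z s i)) (fun i => expo (x s i)) (expo (y s))) := by
  have hc : ∀ k, ContinuousAt
      (fun s => pts (fun i => expo (z s i)) (fun i => expo (x s i)) (expo (y s)) k) t := by
    rintro (_ | i | i)
    · exact continuous_expo.continuousAt.comp hy
    · exact continuous_expo.continuousAt.comp (hz i)
    · exact continuous_expo.continuousAt.comp (hx i)
  have : ∀ᶠ s in 𝓝 t, ∀ k l, k ≠ l →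
      pts (fun i => expo (z s i)) (fun i => expo (x s i)) (expo (y s)) k ≠
      pts (fun i => expo (z s i)) (fun i => expo (x s i)) (expo (y s)) l := by
    simp only [eventually_all]
    intro k l hkl
    have := ((hc k).sub (hc l)).eventually_ne (sub_ne_zero.2 (hinj.ne hkl))
    filter_upwards [this] with s hs h
    exact hs (sub_eq_zero.2 h)
  filter_upwards [this] with s hs k l h
  by_contra hne
  exact hs k l hne h

/-- The dressed kernel. -/
def dressed (M : ℤ) (μ : ℂ) (Φ : (Fin n → ℂ) → ℂ) (σ x : Fin n → ℂ) (y : ℂ) : ℂ :=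
  ker M μ (fun j => x j - σ j / 2) x y * Φ (fun j => x j - σ j / 2)

/-- The flux through the faces `σ_i = const`. -/
def flux (M : ℤ) (μ : ℂ) (Φ : (Fin n → ℂ) → ℂ) (i : Fin n) (σ x : Fin n → ℂ) (y : ℂ) : ℂ :=
  4 * logZX M (fun j => expo (x j - σ j / 2)) (fun j => expo (x j)) (expo y) i
    * dressed M μ Φ σ x y

theorem coth_sq_sub_one {a b : ℂ} (h : expo a ≠ expo b) :
    cth (expo a) (expo b) ^ 2 - 1 = 1 / sinh (a - b) ^ 2 := by
  have h1 := sub_ne_zero.2 h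
  have ea := exp_ne_zero a
  have eb := exp_ne_zero b
  have h2 : sinh (a - b) = (expo a - expo b) / (2 * exp a * exp b) := by
    rw [sinh, neg_sub, exp_sub, exp_sub]
    unfold expo
    rw [two_mul, two_mul, exp_add, exp_add]
    field_simp
  rw [h2]
  have e3 : expo a = exp a ^ 2 := by
    rw [expo, two_mul, exp_add, sq]
  have e4 : expo b = exp b ^ 2 := by
    rw [expo, two_mul, exp_add, sq]
  unfold cth
  rw [e3, e4] at h1 ⊢
  generalize exp a = A at *
  generalize exp b = B at *
  field_simp
  ring

/-- Since z = x - σ/2, a derivative in x_i acts on the dressed kernel as D_i = ∂_{z_i} + ∂_{x_i}.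
Trading D_i² for ∂_{x_i}² - ∂_{z_i}² costs a total z_i-derivative, that is a σ_i-derivative, of (D_i
K) Φ; the kernel identity and the equation of Φ take care of the rest. The integration by parts is
thus already performed pointwise. -/
theorem defSutherland_dressed {M : ℤ} (hM : M ≠ 0) (μ E : ℂ) (Φ : (Fin n → ℂ) → ℂ)
    (σ x : Fin n → ℂ) (y : ℂ)
    (hinj : Injective
      (pts shifted(σ, x) expos(x) (expo y)))
    (hΦ : ∀ i, AnalyticAt ℂ (fun t => Φ (update (fun j => x j - σ j / 2) i t))
      (x i - σ i / 2))
    (hE : sutherland M Φ (fun j => x j - σ j / 2) = E * Φ (fun j => x j - σ j / 2)) :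
    (∀ i, DifferentiableAt ℂ (fun s => flux M μ Φ i (update σ i s) x y) (σ i)) ∧
    defSutherland M (dressed M μ Φ σ) x y = (E - 4 * (μ ^ 2 / M)) * dressed M μ Φ σ x y
      + ∑ i, deriv (fun s => flux M μ Φ i (update σ i s) x y) (σ i) := by
  have hM' : (M : ℂ) ≠ 0 := by exact_mod_cast hM
  set z : Fin n → ℂ := fun j => x j - σ j / 2 with hz
  set w : Fin n → ℂ := fun j => expo (z j) with hw
  set u : Fin n → ℂ := fun j => expo (x j) with hu
  set v := expo y with hv
  set Φ1 : Fin n → ℂ := fun i => deriv (fun t => Φ (update z i t)) (z i) with hΦ1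
  have izz : ∀ i j, i ≠ j → w i ≠ w j := fun i j h he =>
    h (by simpa using @hinj (some (Sum.inl i)) (some (Sum.inl j)) he)
  have ixx : ∀ i j, i ≠ j → u i ≠ u j := fun i j h he =>
    h (by simpa using @hinj (some (Sum.inr i)) (some (Sum.inr j)) he)
  have ixy : ∀ i, u i ≠ v := fun i he => by
    simpa using @hinj (some (Sum.inr i)) none he
  have shift : ∀ i t, (fun j => update x i t j - σ j / 2)
      = update z i (t - σ i / 2) := fun i t => by
    funext j
    rcases eq_or_ne j i with rfl | h <;> simp [*]
  -- second derivatives in `x_i`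
  have px : ∀ i, partial2 (fun x' => dressed M μ Φ σ x' y) i x
      = ((M * (∑ j, ((1 - (Pi.single i 1 : Fin n → ℂ) j) * (1 - cth (w i) (u j) ^ 2)
          - ((Pi.single i 1 : Fin n → ℂ) j - 1) * (1 - cth (w j) (u i) ^ 2)
          - (1 - (Pi.single i 1 : Fin n → ℂ) j) * (1 - cth (w i) (w j) ^ 2)
          - (1 - (Pi.single i 1 : Fin n → ℂ) j) * (1 - cth (u i) (u j) ^ 2)))
        + (1 - cth (w i) v ^ 2) - (1 - cth (u i) v ^ 2))
        + (logZ M μ w u v i + logX M μ w u v i) ^ 2) * (ker M μ z x y * Φ z)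
        + 2 * (logZ M μ w u v i + logX M μ w u v i) * (ker M μ z x y * Φ1 i)
        + ker M μ z x y * partial2 Φ i z := by
    intro i
    have e1 : ∀ t, update z i (t - σ i / 2) = fun j => update z i (t - σ i / 2) j :=
      fun t => rfl
    have hx0 : update x i (x i) = x := update_eq_self i x
    have hz0 : update z i (x i - σ i / 2) = z := update_eq_self i z
    have hB : AnalyticAt ℂ (fun t => Φ (update z i (t - σ i / 2))) (x i) :=
      AnalyticAt.fun_comp (f := fun t => t - σ i / 2) (hΦ i) (by fun_prop)
    have hKc : ∀ᶠ s in 𝓝 (x i), Injective (pts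
        (fun j => expo (update z i (s - σ i / 2) j))
        (fun j => expo (update x i (s - 0) j)) (expo y)) := by
      refine eventually_injective_pts (y := fun _ => y)
        (fun j => (hasDerivAt_update z i _ _ j).continuousAt)
        (fun j => (hasDerivAt_update x i 0 _ j).continuousAt) continuousAt_const ?_
      simpa only [hz0, sub_zero, hx0] using hinj
    have key := iteratedDeriv_two_hasLog_mul (t := x i)
      (K := fun t => ker M μ (update z i (t - σ i / 2)) (update x i (t - 0)) y)
      (B := fun t => Φ (update z i (t - σ i / 2)))
      (Λ := fun t => logZX M (fun j => expo (update z i (t - σ i / 2) j))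
        (fun j => expo (update x i (t - 0) j)) (expo y) i)
      (by
        filter_upwards [hKc] with s hs
        have := hasLog_ker (M := M) μ (y := fun _ => y) (fun j => hasDerivAt_update z i (σ i / 2) s j)
          (fun j => hasDerivAt_update x i 0 s j) (hasDerivAt_const s y) hs
        convert! this using 1
        rw [logZX_eq M μ]
        simp [Pi.single_apply])
      (hasDerivAt_logZX (y := fun _ => y) (fun j => hasDerivAt_update z i (σ i / 2) (x i) j)
          (fun j => hasDerivAt_update x i 0 (x i) j) (hasDerivAt_const _ y) hKc.self_of_nhds i) hB
    have d1 : deriv (fun t => Φ (update z i (t - σ i / 2))) (x i) = Φ1 i :=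
      deriv_comp_sub_const (f := fun t => Φ (update z i t)) _ _
    have d2 : iteratedDeriv 2 (fun t => Φ (update z i (t - σ i / 2))) (x i)
        = partial2 Φ i z := by
      have := congrFun (iteratedDeriv_comp_sub_const 2 (fun t => Φ (update z i t))
        (σ i / 2)) (x i)
      exact this
    rw [d1, d2] at key
    simp only [hz0, sub_zero, hx0, Pi.single_eq_same, sub_zero, one_mul] at key
    unfold partial2 dressed
    simp only [shift]
    rw [← logZX_eq]
    exact key
  -- second derivative in `y`
  have py : iteratedDeriv 2 (fun t => dressed M μ Φ σ x t) y
      = ((∑ i, (1 - cth (w i) v ^ 2) - ∑ i, (1 - cth (u i) v ^ 2)) + logY M μ w u v ^ 2)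
        * (ker M μ z x y * Φ z) := by
    have hKc : ∀ᶠ s in 𝓝 y, Injective (pts w u (expo s)) :=
      eventually_injective_pts (z := fun _ => z) (x := fun _ => x) (y := fun s => s)
        (fun j => continuousAt_const) (fun j => continuousAt_const) continuousAt_id hinj
    have izv : ∀ i, w i ≠ v := fun i he => by
      simpa using @hinj (some (Sum.inl i)) none he
    have hL : HasDerivAt (fun t => logY M μ w u (expo t))
        (∑ i, (1 - cth (w i) v ^ 2) - ∑ i, (1 - cth (u i) v ^ 2)) y := by
      unfold logY
      have := (((HasDerivAt.fun_sum (u := univ) fun i _ => hasDerivAt_cth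
        (hasDerivAt_const y (z i)) (hasDerivAt_id y) (izv i)).neg).add
        (HasDerivAt.fun_sum (u := univ) fun i _ => hasDerivAt_cth
        (hasDerivAt_const y (x i)) (hasDerivAt_id y) (ixy i))).add_const (2 * μ / M)
      convert! this using 1
      simp only [zero_sub, neg_mul, one_mul, sum_neg_distrib, id, neg_neg]
      ring
    have key := iteratedDeriv_two_hasLog_mul (t := y) (K := fun t => ker M μ z x t)
      (B := fun t => Φ z) (Λ := fun t => logY M μ w u (expo t))
      (by
        filter_upwards [hKc] with s hs
        have := hasLog_ker (M := M) μ (z := fun _ => z) (x := fun _ => x) (y := fun t => t)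
          (fun j => hasDerivAt_const s (z j)) (fun j => hasDerivAt_const s (x j))
          (hasDerivAt_id s) hs
        convert! this using 1
        simp [hw, hu]) hL analyticAt_const
    simp only [deriv_const, mul_zero, add_zero, iteratedDeriv_const] at key
    exact key.trans (by simp [hv])
  -- the fluxes
  have pf : ∀ i, HasDerivAt (fun s => flux M μ Φ i (update σ i s) x y)
      (-2 * ((M * (∑ j, ((1 - cth (w i) (u j) ^ 2)
          - (Pi.single i 1 : Fin n → ℂ) j * (1 - cth (w j) (u i) ^ 2)
          - (1 - (Pi.single i 1 : Fin n → ℂ) j) * (1 - cth (w i) (w j) ^ 2)))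
        + (1 - cth (w i) v ^ 2)) * (ker M μ z x y * Φ z)
        + (logZ M μ w u v i + logX M μ w u v i) * (logZ M μ w u v i * ker M μ z x y * Φ z
          + ker M μ z x y * Φ1 i))) (σ i) := by
    intro i
    have hz0 : update z i (z i) = z := update_eq_self i z
    have hinj' : Injective (pts
        (fun j => expo (update z i (z i - 0) j))
        (fun j => expo (x j)) (expo y)) := by
      simpa only [sub_zero, hz0] using hinj
    have k1 := hasDerivAt_logZX (M := M) (x := fun _ => x) (y := fun _ => y)
      (fun j => hasDerivAt_update z i 0 (z i) j)
      (fun j => hasDerivAt_const (z i) (x j)) (hasDerivAt_const _ y) hinj' i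
    have k2 : HasDerivAt _ _ _ := hasLog_ker (M := M) μ (x := fun _ => x) (y := fun _ => y)
      (fun j => hasDerivAt_update z i 0 (z i) j)
      (fun j => hasDerivAt_const (z i) (x j)) (hasDerivAt_const _ y) hinj'
    have k3 : HasDerivAt (fun t => Φ (update z i t)) (Φ1 i) (z i) :=
      (hΦ i).differentiableAt.hasDerivAt
    have k4 := k1.mul (k2.mul k3)
    have k5 : HasDerivAt (fun s => x i - s / 2) (-(1 / 2)) (σ i) :=
      ((hasDerivAt_id (σ i)).div_const 2).const_sub (x i)
    have k6 := (HasDerivAt.comp (h := fun s => x i - s / 2) (σ i) (by exact k4) k5).const_mul 4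
    have sh2 : ∀ s, (fun j => x j - update σ i s j / 2)
        = update z i (x i - s / 2) := fun s => by
      funext j
      rcases eq_or_ne j i with rfl | h <;> simp [*]
    have sh3 : ∀ s, (fun j => expo (x j - update σ i s j / 2))
        = fun j => expo (update z i (x i - s / 2) j) := fun s => by
      funext j; rw [← congrFun (sh2 s) j]
    convert! k6 using 1
    · funext s
      simp only [flux, dressed, sh2, sh3, comp, Pi.mul_apply, sub_zero]
      ring
    · have hz1 : update z i (x i - σ i / 2) = z := update_eq_self i z
      simp only [Pi.mul_apply, sub_zero, hz0, Pi.single_eq_same, neg_mul, Pi.single_apply, ite_mul,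
        one_mul, zero_mul, sum_ite_eq', mem_univ, if_true, Finset.sum_const_zero, add_zero, sub_self]
      rw [logZX_eq M μ]
      simp only [hw, hu, hv]
      ring
  refine ⟨fun i => (pf i).differentiableAt, ?_⟩
  have hk := kernel_identity hM μ w u v hinj
  have hV : ∀ a : Fin n → ℂ, (∀ i j, i ≠ j → expo (a i) ≠ expo (a j)) →
      ∑ i, ∑ j ∈ Ioi i, 2 * (M : ℂ) * ((M : ℂ) + 1) / sinh (a i - a j) ^ 2
      = (M : ℂ) * ((M : ℂ) + 1) * ∑ i, ∑ j ∈ univ.erase i,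
        (cth (expo (a i)) (expo (a j)) ^ 2 - 1) := by
    intro a ha
    have h := Finset.sum_sum_Ioi_add_eq_sum_sum_off_diag
      (fun j i : Fin n => cth (expo (a i)) (expo (a j)) ^ 2 - 1)
    simp only [Finset.erase_eq, ← Finset.compl_eq_univ_sdiff]
    rw [← h, mul_sum]
    refine sum_congr rfl fun i _ => ?_
    rw [mul_sum]
    refine sum_congr rfl fun j hj => ?_
    rw [cth_symm (expo (a j)), neg_sq, coth_sq_sub_one (ha i j (mem_Ioi.1 hj).ne)]
    ring
  have hV2 : ∑ i, 2 * ((M : ℂ) + 1) / sinh (x i - y) ^ 2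
      = 2 * ((M : ℂ) + 1) * ∑ i, (cth (u i) v ^ 2 - 1) := by
    rw [mul_sum]
    refine sum_congr rfl fun i _ => ?_
    rw [coth_sq_sub_one (ixy i)]; ring
  unfold sutherland at hE
  rw [hV z izz] at hE
  unfold defSutherland
  rw [hV x ixx, hV2, py]
  simp only [px, fun i => (pf i).deriv]
  have hd : dressed M μ Φ σ x y = ker M μ z x y * Φ z := rfl
  rw [hd]
  -- For D = ∂_z + ∂_x this is -D²(KΦ) = ((∂_z² - ∂_x²)K) Φ - K ∂_z²Φ - 2 ∂_z((DK)Φ), divided out by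
  -- logarithmic derivatives; and -2 ∂_z = 4 ∂_σ.
  have hi : ∀ i, -(((M * (∑ j, ((1 - (Pi.single i 1 : Fin n → ℂ) j) * (1 - cth (w i) (u j) ^ 2)
          - ((Pi.single i 1 : Fin n → ℂ) j - 1) * (1 - cth (w j) (u i) ^ 2)
          - (1 - (Pi.single i 1 : Fin n → ℂ) j) * (1 - cth (w i) (w j) ^ 2)
          - (1 - (Pi.single i 1 : Fin n → ℂ) j) * (1 - cth (u i) (u j) ^ 2)))
        + (1 - cth (w i) v ^ 2) - (1 - cth (u i) v ^ 2))
        + (logZ M μ w u v i + logX M μ w u v i) ^ 2) * (ker M μ z x y * Φ z)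
        + 2 * (logZ M μ w u v i + logX M μ w u v i) * (ker M μ z x y * Φ1 i)
        + ker M μ z x y * partial2 Φ i z)
      = ((logZ M μ w u v i ^ 2 - logX M μ w u v i ^ 2)
        + M * ((∑ j, (1 - cth (w j) (u i) ^ 2) * (-1)
          + (∑ j, (1 - cth (u i) (u j) ^ 2) - 1) + (1 - cth (u i) v ^ 2) / M)
        + ((∑ j, (1 - cth (w i) (u j) ^ 2))
          - (∑ j, (1 - cth (w i) (w j) ^ 2) - 1) + (1 - cth (w i) v ^ 2) / M)))
          * (ker M μ z x y * Φ z) - ker M μ z x y * partial2 Φ i z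
      + (-2 * ((M * (∑ j, ((1 - cth (w i) (u j) ^ 2)
          - (Pi.single i 1 : Fin n → ℂ) j * (1 - cth (w j) (u i) ^ 2)
          - (1 - (Pi.single i 1 : Fin n → ℂ) j) * (1 - cth (w i) (w j) ^ 2)))
        + (1 - cth (w i) v ^ 2)) * (ker M μ z x y * Φ z)
        + (logZ M μ w u v i + logX M μ w u v i) * (logZ M μ w u v i * ker M μ z x y * Φ z
          + ker M μ z x y * Φ1 i))) := by
    intro i
    simp only [sub_mul, mul_sub, sum_sub_distrib, Pi.single_apply, ite_mul, one_mul, zero_mul,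
      sum_ite_eq', mem_univ, if_true, cth_self, mul_neg, mul_one,
      sum_neg_distrib, mul_add, mul_div_cancel₀ _ hM']
    ring
  have hs := sum_congr (s₁ := univ) rfl fun i _ => hi i
  rw [sum_neg_distrib] at hs
  have gen : ∀ (a b p d : Fin n → ℂ) (k K m : ℂ), ∑ i, ((a i + m * b i) * k - K * p i + d i)
      = (∑ i, a i + m * ∑ i, b i) * k - K * ∑ i, p i + ∑ i, d i := fun a b p d k K m => by
    simp only [sum_add_distrib, sum_sub_distrib, ← sum_mul, ← mul_sum]
  replace hs := hs.trans (gen _ _ _ _ _ _ _)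
  rw [hs]
  linear_combination (ker M μ z x y * Φ z) * hk + ker M μ z x y * hE

/-! ### Holomorphic dependence of integrals on a parameter -/

section param
variable {X : Type*} [MeasurableSpace X] {m : Measure X}

/-- A family of holomorphic functions on `B(c, R)`, dominated by an integrable function. -/
structure HoloFam (m : Measure X) (f : X → ℂ → ℂ) (c : ℂ) (R : ℝ) : Prop where
  diff : ∀ᵐ ξ ∂m, DifferentiableOn ℂ (f ξ) (ball c R)
  meas : ∀ t ∈ ball c R, AEStronglyMeasurable (fun ξ => f ξ t) m
  bound : ∃ b : X → ℝ, Integrable b m ∧ ∀ᵐ ξ ∂m, ∀ t ∈ ball c R, ‖f ξ t‖ ≤ b ξ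

variable {f : X → ℂ → ℂ} {c : ℂ} {R : ℝ}

theorem HoloFam.integrable (h : HoloFam m f c R) {t : ℂ} (ht : t ∈ ball c R) :
    Integrable (fun ξ => f ξ t) m := by
  obtain ⟨b, hb, hle⟩ := h.bound
  exact hb.mono' (h.meas t ht) (hle.mono fun ξ hξ => hξ t ht)

/-- Cauchy's estimate turns the dominating function into one for the derivatives on a smaller disc,
so the notion is stable under differentiation and can be iterated. -/
theorem HoloFam.deriv (h : HoloFam m f c R) {t : ℂ} (ht : t ∈ ball c R) :
    HasDerivAt (fun s => ∫ ξ, f ξ s ∂m) (∫ ξ, deriv (f ξ) t ∂m) t ∧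
      ∃ ρ > 0, ball t ρ ⊆ ball c R ∧ HoloFam m (fun ξ => _root_.deriv (f ξ)) t ρ := by
  obtain ⟨b, hb, hle⟩ := h.bound
  obtain ⟨r, hr, hrR⟩ := isOpen_iff.1 isOpen_ball t ht
  set ρ := r / 2 with hρ
  have hρ0 : 0 < ρ := by positivity
  have hsub : ∀ s ∈ ball t ρ, closedBall s (ρ / 2) ⊆ ball c R := by
    intro s hs p hp
    apply hrR
    rw [mem_ball] at hs ⊢
    rw [Metric.mem_closedBall] at hp
    have := dist_triangle p s t
    linarith
  have hbd : ∀ᵐ ξ ∂m, ∀ s ∈ ball t ρ, ‖_root_.deriv (f ξ) s‖ ≤ b ξ / (ρ / 2) := by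
    filter_upwards [h.diff, hle] with ξ hd hξ s hs
    refine Complex.norm_deriv_le_of_forall_mem_sphere_norm_le (by positivity) ?_ fun p hp =>
      hξ p (hsub s hs (Metric.sphere_subset_closedBall hp))
    refine DifferentiableOn.diffContOnCl ?_
    rw [closure_ball _ (by positivity)]
    exact hd.mono (hsub s hs)
  have hms : ∀ s ∈ ball t ρ, AEStronglyMeasurable (fun ξ => _root_.deriv (f ξ) s) m := by
    intro s hs
    have hsR : s ∈ ball c R := hsub s hs (mem_closedBall_self (by positivity))
    -- Measurability of the derivative: it is a limit of difference quotients along a sequence of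
    -- steps, each of which keeps the point inside the disc.
    set e : ℕ → ℂ := fun k => ((ρ / 4 * (1 / ((k : ℝ) + 1)) : ℝ) : ℂ) with he
    have he0 : ∀ k, e k ≠ 0 := fun k => by
      simp only [he]; norm_cast; positivity
    have het : Tendsto e atTop (𝓝[≠] 0) := by
      refine tendsto_nhdsWithin_iff.2 ⟨?_, Eventually.of_forall he0⟩
      have : Tendsto (fun k : ℕ => ρ / 4 * (1 / ((k : ℝ) + 1))) atTop (𝓝 (ρ / 4 * 0)) :=
        tendsto_one_div_add_atTop_nhds_zero_nat.const_mul _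
      rw [mul_zero] at this
      exact (continuous_ofReal.tendsto 0).comp this
    have hmem : ∀ k, s + e k ∈ ball c R := fun k => by
      apply hsub s hs
      rw [Metric.mem_closedBall, dist_self_add_left]
      simp only [he, norm_real, norm_eq_abs]
      rw [abs_of_pos (by positivity)]
      have : (1 : ℝ) / ((k : ℝ) + 1) ≤ 1 := by
        rw [div_le_one (by positivity)]; linarith [k.cast_nonneg (α := ℝ)]
      nlinarith
    refine aestronglyMeasurable_of_tendsto_ae atTop
      (f := fun k ξ => (e k)⁻¹ • (f ξ (s + e k) - f ξ s))
      (fun k => by exact ((h.meas _ (hmem k)).sub (h.meas s hsR)).const_smul (e k)⁻¹) ?_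
    filter_upwards [h.diff] with ξ hd
    have hda : HasDerivAt (f ξ) (_root_.deriv (f ξ) s) s :=
      (hd.differentiableAt (isOpen_ball.mem_nhds hsR)).hasDerivAt
    exact (hasDerivAt_iff_tendsto_slope_zero.1 hda).comp het
  refine ⟨(hasDerivAt_integral_of_dominated_loc_of_deriv_le (ball_mem_nhds t hρ0)
    (F' := fun s ξ => _root_.deriv (f ξ) s) (bound := fun ξ => b ξ / (ρ / 2))
    ?_ (h.integrable ht) (hms t (mem_ball_self hρ0)) ?_ (hb.div_const _) ?_).2, ρ, hρ0, ?_, ?_⟩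
  · filter_upwards [isOpen_ball.mem_nhds ht] with s hs using h.meas s hs
  · filter_upwards [hbd] with ξ hξ s hs using hξ s hs
  · filter_upwards [h.diff] with ξ hd s hs
    exact (hd.differentiableAt (isOpen_ball.mem_nhds
      (hsub s hs (mem_closedBall_self (by positivity))))).hasDerivAt
  · exact fun s hs => hsub s hs (mem_closedBall_self (by positivity))
  · refine ⟨?_, hms, fun ξ => b ξ / (ρ / 2), hb.div_const _, hbd⟩
    filter_upwards [h.diff] with ξ hd
    exact (hd.deriv isOpen_ball).mono
      fun s hs => hsub s hs (mem_closedBall_self (by positivity))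

theorem HoloFam.differentiableOn (h : HoloFam m f c R) :
    DifferentiableOn ℂ (fun s => ∫ ξ, f ξ s ∂m) (ball c R) := fun _ ht =>
  (h.deriv ht).1.differentiableAt.differentiableWithinAt

theorem HoloFam.integrable_deriv (h : HoloFam m f c R) {t : ℂ} (ht : t ∈ ball c R) :
    Integrable (fun ξ => _root_.deriv (f ξ) t) m := by
  obtain ⟨-, ρ, hρ, -, h'⟩ := h.deriv ht
  exact h'.integrable (mem_ball_self hρ)

theorem HoloFam.iteratedDeriv_two (h : HoloFam m f c R) {t : ℂ} (ht : t ∈ ball c R) :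
    Integrable (fun ξ => iteratedDeriv 2 (f ξ) t) m ∧
    iteratedDeriv 2 (fun s => ∫ ξ, f ξ s ∂m) t = ∫ ξ, iteratedDeriv 2 (f ξ) t ∂m := by
  obtain ⟨-, ρ, hρ, hsub, h'⟩ := h.deriv ht
  have e : ∀ g : ℂ → ℂ, iteratedDeriv 2 g = _root_.deriv (_root_.deriv g) := fun g => by
    rw [iteratedDeriv_succ, iteratedDeriv_one]
  simp only [e]
  refine ⟨h'.integrable_deriv (mem_ball_self hρ), ?_⟩
  rw [← (h'.deriv (mem_ball_self hρ)).1.deriv]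
  refine Filter.EventuallyEq.deriv_eq ?_
  filter_upwards [ball_mem_nhds t hρ] with s hs
  exact (h.deriv (hsub hs)).1.deriv

end param

/-! ### Behaviour of polynomials at infinity in the chamber -/

theorem tendsto_pow_div_pow_atTop (i N : ℕ) (h : i ≤ N) :
    Tendsto (fun q : ℝ => (q : ℂ) ^ i / (q : ℂ) ^ N) atTop (𝓝 (if i = N then 1 else 0)) := by
  have h1 : ∀ᶠ q : ℝ in atTop, ((q⁻¹ : ℝ) : ℂ) ^ (N - i) = (q : ℂ) ^ i / (q : ℂ) ^ N := by
    filter_upwards [eventually_gt_atTop 0] with q hq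
    have : (q : ℂ) ≠ 0 := by exact_mod_cast hq.ne'
    obtain ⟨k, rfl⟩ := Nat.exists_eq_add_of_le h
    rw [Nat.add_sub_cancel_left, pow_add, Complex.ofReal_inv, inv_pow]
    field_simp
  refine Tendsto.congr' h1 ?_
  have h2 : Tendsto (fun q : ℝ => ((q⁻¹ : ℝ) : ℂ) ^ (N - i)) atTop (𝓝 ((0 : ℝ) : ℂ) |>.map (· ^ (N - i))) := by
    rw [← comp_def (fun z : ℂ => z ^ (N - i))]
    exact Filter.Tendsto.comp tendsto_map ((continuous_ofReal.tendsto 0).comp tendsto_inv_atTop_zero)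
  refine h2.trans ?_
  have h3 := (continuous_pow (M := ℂ) (N - i)).tendsto ((0 : ℝ) : ℂ)
  refine le_trans h3 (le_of_eq ?_)
  congr 1
  split_ifs with hi
  · simp [hi]
  · rw [ofReal_zero, zero_pow (by omega)]

/-- After subtracting L X^D, a nonzero coefficient in degree D or above would make the leading
coefficient both nonzero and a limit equal to 0. -/
theorem coeff_of_tendsto_div_pow (p : Polynomial ℂ) (D : ℕ) (L : ℂ)
    (h : Tendsto (fun q : ℝ => p.eval (q : ℂ) / (q : ℂ) ^ D) atTop (𝓝 L)) :
    (∀ d, D < d → p.coeff d = 0) ∧ p.coeff D = L := by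
  set g := p - Polynomial.C L * Polynomial.X ^ D with hg
  have hq : ∀ᶠ q : ℝ in atTop, (q : ℂ) ≠ 0 := by
    filter_upwards [eventually_gt_atTop 0] with q hq
    exact_mod_cast hq.ne'
  have h0 : Tendsto (fun q : ℝ => g.eval (q : ℂ) / (q : ℂ) ^ D) atTop (𝓝 0) := by
    rw [← sub_self L]
    refine (h.sub_const L).congr' ?_
    filter_upwards [hq] with q hq
    simp only [hg, eval_sub, eval_mul, eval_C,
      eval_pow, eval_X]
    field_simp
  have key : ∀ d, D ≤ d → g.coeff d = 0 := by
    by_contra! hc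
    obtain ⟨d, hd, hne⟩ := hc
    have hN : D ≤ g.natDegree := hd.trans (Polynomial.le_natDegree_of_ne_zero hne)
    have h1 : Tendsto (fun q : ℝ => g.eval (q : ℂ) / (q : ℂ) ^ g.natDegree) atTop
        (𝓝 g.leadingCoeff) := by
      have : (fun q : ℝ => g.eval (q : ℂ) / (q : ℂ) ^ g.natDegree) = fun q : ℝ =>
          ∑ i ∈ range (g.natDegree + 1), g.coeff i * ((q : ℂ) ^ i / (q : ℂ) ^ g.natDegree) := by
        funext q
        rw [eval_eq_sum_range, sum_div]
        exact sum_congr rfl fun i _ => by ring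
      rw [this]
      have h2 := tendsto_finsetSum (range (g.natDegree + 1)) fun i hi =>
        (tendsto_pow_div_pow_atTop i g.natDegree
          (Nat.lt_succ_iff.1 (mem_range.1 hi))).const_mul (g.coeff i)
      convert! h2 using 2
      simp
    have h3 : Tendsto (fun q : ℝ => g.eval (q : ℂ) / (q : ℂ) ^ g.natDegree) atTop (𝓝 0) := by
      have := h0.mul (tendsto_pow_div_pow_atTop D g.natDegree hN)
      rw [zero_mul] at this
      refine this.congr' ?_
      filter_upwards [hq] with q hq
      field_simp
    have h4 := tendsto_nhds_unique h1 h3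
    rw [Polynomial.leadingCoeff_eq_zero] at h4
    exact hne (by rw [h4]; simp)
  constructor
  · intro d hd
    have := key d hd.le
    simpa [hg, coeff_X_pow, hd.ne'] using this
  · have := key D le_rfl
    simpa [hg, sub_eq_zero] using this

/-- The weight of a monomial. -/
def wt {ι : Type*} (k : ι → ℕ) (α : ι →₀ ℕ) : ℕ := Finsupp.weight k α

theorem expo_add (a b : ℂ) : expo (a + b) = expo a * expo b := by
  unfold expo; rw [mul_add, exp_add]

theorem expo_ne_zero (a : ℂ) : expo a ≠ 0 := exp_ne_zero _

theorem expo_mul_nat (a : ℂ) (k : ℕ) : expo (a * k) = expo a ^ k := by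
  unfold expo; rw [← Complex.exp_nat_mul]; congr 1; ring

section
variable {ι : Type*} [Fintype ι]

theorem prod_mul_pow_weight (k : ι → ℕ) (α : ι →₀ ℕ) (u : ι → ℂ) (q : ℂ) :
    ∏ i, (u i * q ^ k i) ^ α i = (∏ i, u i ^ α i) * q ^ wt k α := by
  simp only [mul_pow, prod_mul_distrib, ← pow_mul]
  rw [prod_pow_eq_pow_sum]
  congr 2
  rw [wt, Finsupp.weight_apply, Finsupp.sum_fintype _ _ (by simp)]
  exact sum_congr rfl fun i _ => by simp [mul_comm]

theorem eval_mul_pow (k : ι → ℕ) (P : MvPolynomial ι ℂ) (u : ι → ℂ) (q : ℂ) :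
    eval (fun i => u i * q ^ k i) P
      = ∑ α ∈ P.support, P.coeff α * (∏ i, u i ^ α i) * q ^ wt k α := by
  rw [eval_eq']
  exact sum_congr rfl fun α _ => by rw [prod_mul_pow_weight, mul_assoc]

/-- Along u_i q^{k_i} the polynomial becomes one in q whose coefficients are the weighted
homogeneous components. The limit therefore forces the components of weight above D to vanish and
the one of weight D to be a monomial. -/
theorem coeff_of_tendsto_chamber (k : ι → ℕ) (P : MvPolynomial ι ℂ) (D : ℕ) (l : ι →₀ ℕ) (c : ℂ)
   
    (h : ∀ a : ι → ℝ, Tendsto (fun q : ℝ =>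
      eval (fun i => expo (a i) * (q : ℂ) ^ k i) P / (q : ℂ) ^ D) atTop
      (𝓝 (c * ∏ i, expo (a i) ^ l i))) :
    (∀ α, D < wt k α → P.coeff α = 0) ∧
      ∀ α, wt k α = D → P.coeff α = if α = l then c else 0 := by
  classical
  have hp : ∀ a : ι → ℝ, ∀ d, eval expos(a)
      (weightedHomogeneousComponent k d P)
      = (∑ α ∈ P.support, Polynomial.C (P.coeff α * ∏ i, expo (a i) ^ α i)
        * Polynomial.X ^ wt k α : Polynomial ℂ).coeff d := by
    intro a d
    rw [MvPolynomial.weightedHomogeneousComponent_apply, map_sum]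
    simp only [finsetSum_coeff, Polynomial.coeff_C_mul, coeff_X_pow,
      eval_monomial, mul_ite, mul_one, mul_zero]
    rw [sum_filter]
    refine sum_congr rfl fun α _ => ?_
    rw [Finsupp.prod_fintype _ _ (by simp)]
    by_cases hd : d = wt k α
    · rw [if_pos hd, if_pos (show Finsupp.weight k α = d from hd.symm)]
    · rw [if_neg hd, if_neg (show ¬ Finsupp.weight k α = d from Ne.symm hd)]
  have hc : ∀ a : ι → ℝ, _ := fun a => coeff_of_tendsto_div_pow
    (∑ α ∈ P.support, Polynomial.C (P.coeff α * ∏ i, expo (a i) ^ α i)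
        * Polynomial.X ^ wt k α) D _ (by
      refine (h a).congr fun q => ?_
      rw [eval_mul_pow, eval_finsetSum]
      simp only [eval_mul, eval_C, eval_pow, eval_X])
  -- The normalisation is known only at real positions, i.e. positive u_i; these are enough points
  -- to determine a polynomial.
  have hinf : ∀ i : ι, (Set.range fun a : ℝ => expo (a : ℂ)).Infinite := fun i => by
    refine Set.infinite_range_of_injective fun a b hab => ?_
    unfold expo at hab
    have : Real.exp (2 * a) = Real.exp (2 * b) := by
      apply_fun re at hab
      rw [show (2 : ℂ) * (a : ℂ) = ((2 * a : ℝ) : ℂ) by push_cast; ring,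
        show (2 : ℂ) * (b : ℂ) = ((2 * b : ℝ) : ℂ) by push_cast; ring,
        exp_ofReal_re, exp_ofReal_re] at hab
      exact hab
    simpa using Real.exp_injective this
  have hfun : ∀ p q : MvPolynomial ι ℂ, (∀ a : ι → ℝ, eval expos(a) p
      = eval expos(a) q) → p = q := by
    intro p q hpq
    refine funext_set (s := fun _ => Set.range fun a : ℝ => expo (a : ℂ)) hinf ?_
    intro x hx
    choose a ha using fun i => hx i (Set.mem_univ i)
    have : x = fun i => expo (a i) := funext fun i => (ha i).symm
    rw [this]
    exact hpq a
  constructor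
  · intro α hα
    have hz : weightedHomogeneousComponent k (wt k α) P = 0 := hfun _ _ fun a => by
      rw [hp, (hc a).1 _ hα, map_zero]
    have := congrArg (coeff α) hz
    rwa [MvPolynomial.coeff_weightedHomogeneousComponent, if_pos (show Finsupp.weight k α = wt k α from rfl),
      coeff_zero] at this
  · intro α hα
    have hz : weightedHomogeneousComponent k D P = MvPolynomial.monomial l c :=
      hfun _ _ fun a => by
        rw [hp, (hc a).2, eval_monomial, Finsupp.prod_fintype _ _ (by simp)]
    have := congrArg (coeff α) hz
    rw [MvPolynomial.coeff_weightedHomogeneousComponent,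
      if_pos (show Finsupp.weight k α = D from hα), MvPolynomial.coeff_monomial] at this
    simpa [eq_comm] using this

end

/-! ### Baker-Akhiezer functions along a line of spectral parameters -/

section
variable {ι : Type*}

/-- The value at `T` and `u` of a polynomial in `T` with coefficients polynomial in `u`. -/
def ev (P : Polynomial (MvPolynomial ι ℂ)) (T : ℂ) (u : ι → ℂ) : ℂ :=
  eval u (P.eval (𝐂 T))

theorem ev_eq_sum (P : Polynomial (MvPolynomial ι ℂ)) (T : ℂ) (u : ι → ℂ) :
    ev P T u = ∑ k ∈ range (P.natDegree + 1), eval u (P.coeff k) * T ^ k := by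
  rw [ev, eval_eq_sum_range, map_sum]
  simp

/-- On a line of spectral parameters the numerator Q is a polynomial in the single variable T over
the polynomials in u; from here on only its coefficients are used. -/
theorem exists_ev_eq {τ : Type*} (Q : MvPolynomial τ (MvPolynomial ι ℂ)) (a b : τ → ℂ) :
    ∃ P : Polynomial (MvPolynomial ι ℂ), ∀ (T : ℂ) (u : ι → ℂ),
      eval₂ (eval u) (fun i => a i + T * b i) Q = ev P T u := by
  refine ⟨eval₂ Polynomial.C (fun i => Polynomial.C (𝐂 (a i)) +
    Polynomial.X * Polynomial.C (𝐂 (b i))) Q, fun T u => ?_⟩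
  induction Q using MvPolynomial.induction_on with
  | C a => simp [ev]
  | add p q hp hq => simp only [eval₂_add, hp, hq, ev, eval_add, map_add]
  | mul_X p i hp =>
    simp [eval₂_mul, hp, ev]
    exact Or.inl (mul_comm _ _)

variable [Fintype ι]

/-- The weights of the coefficients of a polynomial with prescribed behaviour at infinity are
bounded. -/
theorem coeff_coeff_eq_zero (k : ι → ℕ) (P : Polynomial (MvPolynomial ι ℂ)) (D : ℕ) (l : ι →₀ ℕ)
    (c : ℝ → ℂ) (h : ∀ᶠ T : ℝ in atTop, ∀ a : ι → ℝ, Tendsto (fun q : ℝ =>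
      ev P T (fun i => expo (a i) * (q : ℂ) ^ k i) / (q : ℂ) ^ D) atTop
      (𝓝 (c T * ∏ i, expo (a i) ^ l i))) (j : ℕ) (α : ι →₀ ℕ) (hα : D < wt k α) :
    (P.coeff j).coeff α = 0 := by
  classical
  -- The coefficient of a fixed monomial in u, as a polynomial in T. It vanishes at all large real
  -- T, hence identically, so the weight bound also holds for the T excluded by the denominators.
  set p : Polynomial ℂ := ∑ j ∈ range (P.natDegree + 1),
    Polynomial.C ((P.coeff j).coeff α) * Polynomial.X ^ j with hp
  have h1 : ∀ T : ℂ, coeff α (P.eval (𝐂 T)) = p.eval T := fun T => by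
    rw [eval_eq_sum_range, coeff_sum, hp, eval_finsetSum]
    refine sum_congr rfl fun j _ => ?_
    rw [← map_pow, mul_comm, coeff_C_mul, mul_comm]
    simp
  obtain ⟨T1, hT1⟩ := eventually_atTop.1 h
  have h2 : p = 0 := by
    refine Polynomial.eq_zero_of_infinite_isRoot p (Set.Infinite.mono (s := (fun T : ℝ => (T : ℂ)) '' Set.Ici T1) ?_
      ((Set.Ici_infinite T1).image Complex.ofReal_injective.injOn))
    rintro _ ⟨T, hT, rfl⟩
    have := (coeff_of_tendsto_chamber k _ D l (c T) (hT1 T hT)).1 α hα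
    rw [h1] at this
    exact this
  have h3 := congrArg (fun p => Polynomial.coeff p j) h2
  simp only [hp, finsetSum_coeff, Polynomial.coeff_C_mul, coeff_X_pow,
    mul_ite, mul_one, mul_zero, sum_ite_eq, Polynomial.coeff_zero] at h3
  by_cases hj : j ∈ range (P.natDegree + 1)
  · rwa [if_pos hj] at h3
  · rw [coeff_eq_zero_of_natDegree_lt (by simpa using hj), coeff_zero]

/-- The limit is known for positive u only, but it pins down the coefficients, and these give the
limit for complex u. -/
theorem tendsto_ev_chamber (k : ι → ℕ) (P : Polynomial (MvPolynomial ι ℂ)) (D : ℕ) (l : ι →₀ ℕ)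
    (c T : ℂ) (hl : wt k l = D) (h : ∀ a : ι → ℝ, Tendsto (fun q : ℝ =>
      ev P T (fun i => expo (a i) * (q : ℂ) ^ k i) / (q : ℂ) ^ D) atTop
      (𝓝 (c * ∏ i, expo (a i) ^ l i))) (u : ι → ℂ) :
    Tendsto (fun q : ℝ => ev P T (fun i => u i * (q : ℂ) ^ k i) / (q : ℂ) ^ D) atTop
      (𝓝 (c * ∏ i, u i ^ l i)) := by
  classical
  obtain ⟨h1, h2⟩ := coeff_of_tendsto_chamber k _ D l c h
  set R := P.eval (𝐂 T) with hR
  have h3 : ∀ q : ℝ, ev P T (fun i => u i * (q : ℂ) ^ k i) / (q : ℂ) ^ D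
      = ∑ α ∈ R.support, R.coeff α * (∏ i, u i ^ α i) * ((q : ℂ) ^ wt k α / (q : ℂ) ^ D) := by
    intro q
    rw [ev, ← hR, eval_mul_pow, sum_div]
    exact sum_congr rfl fun α _ => by ring
  simp only [h3]
  have h4 := tendsto_finsetSum R.support fun α hα => (tendsto_pow_div_pow_atTop (wt k α) D (by
    by_contra hc
    exact mem_support_iff.1 hα (h1 α (not_le.1 hc)))).const_mul
      (R.coeff α * ∏ i, u i ^ α i)
  convert! h4 using 2
  simp only [mul_ite, mul_one, mul_zero]
  rw [← sum_filter]
  have h5 : ∀ α ∈ R.support.filter (fun α => wt k α = D), R.coeff α * ∏ i, u i ^ α i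
      = if α = l then c * ∏ i, u i ^ l i else 0 := by
    intro α hα
    rw [h2 α (mem_filter.1 hα).2]
    split_ifs with he
    · rw [he]
    · simp
  rw [sum_congr rfl h5, sum_ite_eq']
  split_ifs with hm
  · rfl
  · have : R.coeff l = 0 := by
      by_contra hne
      exact hm (mem_filter.2 ⟨mem_support_iff.2 hne, hl⟩)
    rw [h2 l hl, if_pos rfl] at this
    rw [this, zero_mul]

/-- The weight bound caps the growth in q by q^D, uniformly for u in a polydisc; the dependence on
the polydisc is left explicit because Y later carries the position on the contour. -/
theorem norm_eval_le (k : ι → ℕ) (p : MvPolynomial ι ℂ) (D : ℕ)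
    (hp : ∀ α, D < wt k α → p.coeff α = 0) :
    ∃ C : ℝ, 0 ≤ C ∧ ∀ (u : ι → ℂ) (q Y : ℝ), 1 ≤ q → 1 ≤ Y → (∀ i, ‖u i‖ ≤ Y) →
      ‖eval (fun i => u i * (q : ℂ) ^ k i) p‖ ≤ C * Y ^ p.totalDegree * q ^ D := by
  refine ⟨∑ α ∈ p.support, ‖p.coeff α‖, sum_nonneg fun _ _ => norm_nonneg _,
    fun u q Y hq hY hu => ?_⟩
  rw [eval_mul_pow, sum_mul, sum_mul]
  refine (norm_sum_le _ _).trans (sum_le_sum fun α hα => ?_)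
  have hD : wt k α ≤ D := by
    by_contra hc
    exact mem_support_iff.1 hα (hp α (not_le.1 hc))
  rw [norm_mul, norm_mul, norm_pow, norm_real, norm_eq_abs,
    abs_of_nonneg (by linarith), norm_prod]
  have h1 : ∏ i, ‖u i ^ α i‖ ≤ Y ^ p.totalDegree := by
    calc ∏ i, ‖u i ^ α i‖ ≤ ∏ i, Y ^ α i := Finset.prod_le_prod (fun _ _ => norm_nonneg _)
          fun i _ => by rw [norm_pow]; exact pow_le_pow_left₀ (norm_nonneg _) (hu i) _
      _ = Y ^ (∑ i, α i) := prod_pow_eq_pow_sum _ _ _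
      _ ≤ Y ^ p.totalDegree := by
        refine pow_le_pow_right₀ hY ?_
        have := MvPolynomial.le_totalDegree hα
        rwa [Finsupp.sum_fintype _ _ (by simp)] at this
  gcongr
end

/-- The weights `n, n - 1, …, 1`. -/
def kap {n : ℕ} (i : Fin n) : ℕ := n - i

theorem kap_pos {n : ℕ} (i : Fin n) : 0 < kap i := by unfold kap; omega

theorem kap_lt {n : ℕ} {i j : Fin n} (h : i < j) : kap j < kap i := by
  unfold kap; have := Fin.lt_def.1 h; omega

/-- The line of spectral parameters through `ν`. -/
def lineν {n : ℕ} (ν : Fin n → ℂ) (T : ℂ) (i : Fin n) : ℂ := ν i + (T - 1) * kap i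

/-- The weight of the Vandermonde product. -/
def vdmWt (n : ℕ) : ℕ := ∑ i : Fin n, ∑ _j ∈ Ioi i, kap i

theorem tendsto_sub_div_chamber {a b : ℕ} (h : b < a) (u v : ℂ) :
    Tendsto (fun q : ℝ => (u * (q : ℂ) ^ a - v * (q : ℂ) ^ b) / (q : ℂ) ^ a) atTop (𝓝 u) := by
  have := ((tendsto_pow_div_pow_atTop a a le_rfl).const_mul u).sub
    ((tendsto_pow_div_pow_atTop b a h.le).const_mul v)
  rw [if_pos rfl, if_neg h.ne, mul_one, mul_zero, sub_zero] at this
  exact this.congr fun q => by ring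

theorem tendsto_vdm_chamber {n : ℕ} (u : Fin n → ℂ) :
    Tendsto (fun q : ℝ => vdm (fun i => u i * (q : ℂ) ^ kap i) / (q : ℂ) ^ vdmWt n) atTop
      (𝓝 (∏ i, u i ^ (Ioi i).card)) := by
  have := tendsto_finsetProd univ fun (i : Fin n) _ =>
    tendsto_finsetProd (Ioi i) fun j hj =>
      tendsto_sub_div_chamber (kap_lt (mem_Ioi.1 hj)) (u i) (u j)
  simp only [prod_const] at this
  refine this.congr fun q => ?_
  simp only [vdm, vdmWt, prod_div_distrib, prod_pow_eq_pow_sum]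

theorem tendsto_cross_chamber {n : ℕ} (u : Fin n → ℂ) (v : ℂ) :
    Tendsto (fun q : ℝ => cross (fun i => u i * (q : ℂ) ^ kap i) v / (q : ℂ) ^ (∑ i : Fin n, kap i))
      atTop (𝓝 (∏ i, u i)) := by
  have := tendsto_finsetProd univ fun (i : Fin n) _ =>
      tendsto_sub_div_chamber (kap_pos i) (u i) v
  refine this.congr fun q => ?_
  simp only [cross, pow_zero, mul_one, prod_div_distrib, prod_pow_eq_pow_sum]

theorem eventually_add_mul_ne_zero {a b : ℂ} (hb : b ≠ 0) :
    ∀ᶠ T : ℝ in atTop, a + ((T : ℂ) - 1) * b ≠ 0 := by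
  have h : Set.Subsingleton {T : ℝ | a + ((T : ℂ) - 1) * b = 0} := by
    intro S hS T hT
    have h1 : ((S : ℂ) - T) * b = 0 := by
      simp only [Set.mem_ofPred_eq] at hS hT
      linear_combination hS - hT
    have := (mul_eq_zero.1 h1).resolve_right hb
    exact_mod_cast sub_eq_zero.1 this
  rcases h.eq_empty_or_singleton with h | ⟨T0, h⟩
  · exact Eventually.of_forall fun T hT => by
      have : T ∈ ({T : ℝ | a + ((T : ℂ) - 1) * b = 0}) := hT
      rw [h] at this
      exact this
  · filter_upwards [eventually_gt_atTop T0] with T hT hc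
    have : T ∈ ({T : ℝ | a + ((T : ℂ) - 1) * b = 0}) := hc
    rw [h] at this
    exact hT.ne' this

theorem eventually_normC_lineν {n : ℕ} (k : ℕ) (ν : Fin n → ℂ) :
    ∀ᶠ T : ℝ in atTop, normC k (lineν ν T) ≠ 0 := by
  unfold normC
  simp only [prod_ne_zero_iff, eventually_all_finset, mem_univ, true_imp_iff,
    eventually_all]
  intro l _ i j hj
  have hk : (kap i : ℂ) - kap j ≠ 0 := by
    rw [sub_ne_zero]
    exact_mod_cast (kap_lt (mem_Ioi.1 hj)).ne'
  filter_upwards [eventually_add_mul_ne_zero (a := ν i - ν j - l) hk] with T hT h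
  exact hT (by rw [← h, lineν, lineν]; ring)

theorem eventually_normCdef_lineν {n : ℕ} (m : ℤ) (ν : Fin n → ℂ) (μ : ℂ) :
    ∀ᶠ T : ℝ in atTop, normCdef m (lineν ν T) μ ≠ 0 := by
  unfold normCdef
  simp only [prod_ne_zero_iff, mem_univ, true_imp_iff, eventually_all]
  intro i
  have hk : (kap i : ℂ) ≠ 0 := by exact_mod_cast (kap_pos i).ne'
  filter_upwards [eventually_add_mul_ne_zero (a := ν i - μ - (1 + (m : ℂ)) / 2) hk] with T hT h
  exact hT (by rw [← h, lineν]; ring)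

/-- The exponential parametrisation of a ray in the chamber. -/
theorem expo_ray (a : ℂ) (k : ℕ) {q : ℝ} (hq : 0 < q) :
    expo (a + (Real.log q / 2 : ℝ) * k) = expo a * (q : ℂ) ^ k := by
  have h : expo ((Real.log q / 2 : ℝ) : ℂ) = q := by
    rw [expo, show (2 : ℂ) * ((Real.log q / 2 : ℝ) : ℂ) = ((Real.log q : ℝ) : ℂ) by push_cast; ring,
      ← ofReal_exp, Real.exp_log hq]
  rw [expo_add, expo_mul_nat, h]

theorem tendsto_ray_chamber {n : ℕ} (a : Fin n → ℝ) :
    Tendsto (fun q : ℝ => fun i : Fin n => a i + Real.log q / 2 * kap i) atTop (chamber n) := by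
  unfold chamber
  simp only [tendsto_iInf, tendsto_comap_iff]
  intro i j hj
  have hk : (0 : ℝ) < (kap i : ℝ) - kap j := by
    rw [sub_pos]; exact_mod_cast kap_lt (mem_Ioi.1 hj)
  have h1 : Tendsto (fun q : ℝ => (a i - a j) + Real.log q * (((kap i : ℝ) - kap j) / 2)) atTop atTop :=
    tendsto_const_nhds.add_atTop (Real.tendsto_log_atTop.atTop_mul_const (by positivity))
  refine h1.congr fun q => ?_
  simp only [comp]
  ring

theorem tendsto_ray_chamberDef {n : ℕ} (a : Fin n → ℝ) (b : ℝ) :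
    Tendsto (fun q : ℝ => ((fun i : Fin n => a i + Real.log q / 2 * kap i), b)) atTop
      (chamberDef n) := by
  unfold chamberDef
  simp only [tendsto_inf, tendsto_iInf, tendsto_comap_iff]
  refine ⟨tendsto_ray_chamber a, fun i => ?_⟩
  have hk : (0 : ℝ) < (kap i : ℝ) := by exact_mod_cast kap_pos i
  have h1 : Tendsto (fun q : ℝ => (a i - b) + Real.log q * ((kap i : ℝ) / 2)) atTop atTop :=
    tendsto_const_nhds.add_atTop (Real.tendsto_log_atTop.atTop_mul_const (by positivity))
  refine h1.congr fun q => ?_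
  simp only [comp]
  ring

/-- The exponents of the leading monomial of the Vandermonde product. -/
def leadExp (n k : ℕ) : Fin n →₀ ℕ := Finsupp.equivFunOnFinite.symm fun i => k * (Ioi i).card

theorem wt_leadExp (n k : ℕ) : wt kap (leadExp n k) = k * vdmWt n := by
  rw [wt, Finsupp.weight_apply, Finsupp.sum_fintype _ _ (by simp), vdmWt, mul_sum]
  refine sum_congr rfl fun i _ => ?_
  simp [leadExp, mul_assoc]

theorem vdm_ray_ne_zero {n : ℕ} (a : Fin n → ℝ) :
    ∀ᶠ q : ℝ in atTop, vdm (fun i => expo (a i) * (q : ℂ) ^ kap i) ≠ 0 := by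
  have h := tendsto_vdm_chamber expos(a)
  have h0 : ∏ i, expo (a i) ^ (Ioi i).card ≠ 0 :=
    prod_ne_zero_iff.2 fun i _ => pow_ne_zero _ (expo_ne_zero _)
  filter_upwards [h.eventually_ne h0] with q hq hc
  exact hq (by rw [hc, zero_div])

theorem cross_ray_ne_zero {n : ℕ} (a : Fin n → ℝ) (v : ℂ) :
    ∀ᶠ q : ℝ in atTop, cross (fun i => expo (a i) * (q : ℂ) ^ kap i) v ≠ 0 := by
  have h := tendsto_cross_chamber expos(a) v
  have h0 : ∏ i, expo (a i) ≠ 0 := prod_ne_zero_iff.2 fun i _ => expo_ne_zero _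
  filter_upwards [h.eventually_ne h0] with q hq hc
  exact hq (by rw [hc, zero_div])

/-- A Baker-Akhiezer function along a line of spectral parameters. -/
theorem IsTrigBA.line {n : ℕ} {m : ℤ} {Φ : (Fin n → ℂ) → (Fin n → ℂ) → ℂ} (h : IsTrigBA n m Φ)
    (ν : Fin n → ℂ) : ∃ P : Polynomial Poly(n),
      (∀ (T : ℂ) (x : Fin n → ℂ), vdm expos(x) ≠ 0 →
        normC (mstar m) (lineν ν T) ≠ 0 →
        Φ x (lineν ν T) = ev P T expos(x) /
          (vdm expos(x) ^ mstar m * normC (mstar m) (lineν ν T)) *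
          ∏ i, powx (x i) (lineν ν T i)) ∧
      (∀ j α, mstar m * vdmWt n < wt kap α → (P.coeff j).coeff α = 0) ∧
      (∀ T : ℂ, normC (mstar m) (lineν ν T) ≠ 0 → ∀ u : Fin n → ℂ,
        Tendsto (fun q : ℝ => ev P T (fun i => u i * (q : ℂ) ^ kap i) / (q : ℂ) ^ (mstar m * vdmWt n))
          atTop (𝓝 (normC (mstar m) (lineν ν T) * ∏ i, u i ^ (mstar m * (Ioi i).card)))) := by
  obtain ⟨Q, -, hform, -, hlim⟩ := h
  obtain ⟨P, hP⟩ := exists_ev_eq Q (fun i => ν i - kap i) (fun i => (kap i : ℂ))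
  have hl : ∀ T : ℂ, (fun i => ν i - kap i + T * kap i) = lineν ν T := fun T => by
    funext i; rw [lineν]; ring
  simp only [hl] at hP
  have hreal : ∀ T : ℂ, normC (mstar m) (lineν ν T) ≠ 0 → ∀ a : Fin n → ℝ, Tendsto (fun q : ℝ =>
      ev P T (fun i => expo (a i) * (q : ℂ) ^ kap i) / (q : ℂ) ^ (mstar m * vdmWt n)) atTop
      (𝓝 (normC (mstar m) (lineν ν T) * ∏ i, expo (a i) ^ leadExp n (mstar m) i)) := by
    intro T hT a
    -- The normalised quotient tends to 1 and A(u)^{m^*} grows like its leading monomial;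
    -- multiplying the two gives the growth of the numerator.
    have h1 := ((hlim (lineν ν T) hT).comp (tendsto_ray_chamber a)).mul
      (((tendsto_vdm_chamber fun i => expo (a i)).pow (mstar m)).const_mul
        (normC (mstar m) (lineν ν T)))
    rw [one_mul, ← prod_pow] at h1
    simp only [← pow_mul, mul_comm _ (mstar m)] at h1
    refine h1.congr' ?_
    filter_upwards [eventually_gt_atTop 0, vdm_ray_ne_zero a] with q hq hv
    have he : ∀ i, expo ((a i + Real.log q / 2 * kap i : ℝ) : ℂ) = expo (a i) * (q : ℂ) ^ kap i :=
      fun i => by rw [← expo_ray _ _ hq]; push_cast; rfl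
    simp only [comp, he, hP]
    have hq' : (q : ℂ) ≠ 0 := by exact_mod_cast hq.ne'
    rw [div_pow, ← pow_mul, mul_comm (vdmWt n)]
    field_simp
  refine ⟨P, fun T x hx hT => ?_, coeff_coeff_eq_zero kap P _ (leadExp n (mstar m))
    (fun T => normC (mstar m) (lineν ν T)) ?_, fun T hT u => ?_⟩
  · rw [hform x _ hx hT, hP]
  · filter_upwards [eventually_normC_lineν (mstar m) ν] with T hT a
    exact hreal T hT a
  · exact tendsto_ev_chamber kap P _ (leadExp n (mstar m)) _ T (wt_leadExp n _) (hreal T hT) u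

/-- The weights for the deformed function. -/
def kapDef {n : ℕ} : Option (Fin n) → ℕ := adjoin kap 0

/-- The exponents of the leading monomial for the deformed function. -/
def leadExpDef (n k : ℕ) : Option (Fin n) →₀ ℕ :=
  Finsupp.equivFunOnFinite.symm (adjoin (fun i => k * (Ioi i).card + 1) 0)

theorem wt_leadExpDef (n k : ℕ) :
    wt kapDef (leadExpDef n k) = k * vdmWt n + ∑ i : Fin n, kap i := by
  rw [wt, Finsupp.weight_apply, Finsupp.sum_fintype _ _ (by simp), vdmWt, mul_sum,
    ← sum_add_distrib, Fintype.sum_option]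
  simp [leadExpDef, kapDef, adjoin, add_mul, mul_assoc]

theorem adjoin_mul_pow {n : ℕ} (u : Fin n → ℂ) (v q : ℂ) :
    (fun o => adjoin u v o * q ^ kapDef o) = adjoin (fun i => u i * q ^ kap i) v := by
  funext o
  cases o <;> simp [adjoin, kapDef]

/-- A deformed Baker-Akhiezer function along a line of spectral parameters. -/
theorem IsDefTrigBA.line {n : ℕ} {m : ℤ} {F : (Fin n → ℂ) → ℂ → (Fin n → ℂ) → ℂ → ℂ}
    (h : IsDefTrigBA n m F) (ν : Fin n → ℂ) (μ : ℂ) :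
    ∃ P : Polynomial DefPoly(n),
      (∀ (T : ℂ) (x : Fin n → ℂ) (y : ℂ), vdm expos(x) ≠ 0 →
        cross expos(x) (expo y) ≠ 0 →
        normC (mstar m) (lineν ν T) ≠ 0 → normCdef m (lineν ν T) μ ≠ 0 →
        F x y (lineν ν T) μ = ev P T (adjoin expos(x) (expo y)) /
          (vdm expos(x) ^ mstar m * cross expos(x) (expo y) *
            normC (mstar m) (lineν ν T) * normCdef m (lineν ν T) μ) *
          ((∏ i, powx (x i) (lineν ν T i)) * powx y (μ / (m : ℂ)))) ∧
      (∀ j α, mstar m * vdmWt n + ∑ i : Fin n, kap i < wt kapDef α → (P.coeff j).coeff α = 0) ∧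
      (∀ T : ℂ, normC (mstar m) (lineν ν T) ≠ 0 → normCdef m (lineν ν T) μ ≠ 0 →
        ∀ (u : Fin n → ℂ) (v : ℂ),
        Tendsto (fun q : ℝ => ev P T (adjoin (fun i => u i * (q : ℂ) ^ kap i) v) /
            (q : ℂ) ^ (mstar m * vdmWt n + ∑ i : Fin n, kap i))
          atTop (𝓝 (normC (mstar m) (lineν ν T) * normCdef m (lineν ν T) μ *
            ∏ i, u i ^ (mstar m * (Ioi i).card + 1)))) := by
  obtain ⟨Q, -, hform, -, hlim⟩ := h
  -- The base point ν - κ makes T = 1 the given parameter. The direction has component 0 at μ, which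
  -- stays fixed.
  obtain ⟨P, hP⟩ := exists_ev_eq Q (adjoin (fun i => ν i - kap i) μ)
    (adjoin (fun i => (kap i : ℂ)) 0)
  have hl : ∀ T : ℂ, (fun o => adjoin (fun i => ν i - kap i) μ o
      + T * adjoin (fun i => (kap i : ℂ)) 0 o) = adjoin (lineν ν T) μ := fun T => by
    funext o
    cases o
    · simp [adjoin]
    · simp [adjoin, lineν]; ring
  simp only [hl] at hP
  have hreal : ∀ T : ℂ, normC (mstar m) (lineν ν T) ≠ 0 → normCdef m (lineν ν T) μ ≠ 0 →
      ∀ a : Option (Fin n) → ℝ, Tendsto (fun q : ℝ =>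
      ev P T (fun o => expo (a o) * (q : ℂ) ^ kapDef o) /
        (q : ℂ) ^ (mstar m * vdmWt n + ∑ i : Fin n, kap i)) atTop
      (𝓝 (normC (mstar m) (lineν ν T) * normCdef m (lineν ν T) μ *
        ∏ o, expo (a o) ^ leadExpDef n (mstar m) o)) := by
    intro T hT hT' a
    have h1 := ((hlim (lineν ν T) μ hT hT').comp
      (tendsto_ray_chamberDef (fun i => a (some i)) (a none))).mul
      ((((tendsto_vdm_chamber fun i => expo (a (some i))).pow (mstar m)).mul
        (tendsto_cross_chamber (fun i => expo (a (some i))) (expo (a none)))).const_mul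
        (normC (mstar m) (lineν ν T) * normCdef m (lineν ν T) μ))
    rw [one_mul, ← prod_pow, ← prod_mul_distrib] at h1
    simp only [← pow_mul, mul_comm _ (mstar m), ← pow_succ] at h1
    rw [Fintype.prod_option]
    have e0 : leadExpDef n (mstar m) none = 0 := rfl
    have e1 : ∀ i, leadExpDef n (mstar m) (some i) = mstar m * (Ioi i).card + 1 :=
      fun i => rfl
    simp only [e0, e1, pow_zero, one_mul]
    refine h1.congr' ?_
    filter_upwards [eventually_gt_atTop 0, vdm_ray_ne_zero fun i => a (some i),
      cross_ray_ne_zero (fun i => a (some i)) (expo (a none))] with q hq hv hv'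
    have he : ∀ i, expo ((a (some i) + Real.log q / 2 * kap i : ℝ) : ℂ)
        = expo (a (some i)) * (q : ℂ) ^ kap i :=
      fun i => by rw [← expo_ray _ _ hq]; push_cast; rfl
    have hadj : (fun o => expo (a o) * (q : ℂ) ^ kapDef o)
        = adjoin (fun i => expo (a (some i)) * (q : ℂ) ^ kap i) (expo (a none)) := by
      rw [← adjoin_mul_pow]
      funext o
      cases o <;> rfl
    simp only [comp, he, hP, hadj]
    have hq' : (q : ℂ) ≠ 0 := by exact_mod_cast hq.ne'
    rw [div_pow, ← pow_mul, mul_comm (vdmWt n), pow_add]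
    field_simp
  refine ⟨P, fun T x y hx hxy hT hT' => ?_, coeff_coeff_eq_zero kapDef P _ (leadExpDef n (mstar m))
    (fun T => normC (mstar m) (lineν ν T) * normCdef m (lineν ν T) μ) ?_, fun T hT hT' u v => ?_⟩
  · rw [hform x y _ μ hx hxy hT hT', hP]
  · filter_upwards [eventually_normC_lineν (mstar m) ν, eventually_normCdef_lineν m ν μ]
      with T hT hT' a
    exact hreal T hT hT' a
  · have := tendsto_ev_chamber kapDef P _ (leadExpDef n (mstar m)) _ T (wt_leadExpDef n _)
      (hreal T hT hT') (adjoin u v)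
    simp only [adjoin_mul_pow, Fintype.prod_option] at this
    convert! this using 3
    exact (one_mul _).symm

/-! ### Eigenfunctions of the deformed operator and the flow in the chamber -/

/-- The flow towards infinity in the chamber. -/
def flow {n : ℕ} (x : Fin n → ℂ) (r : ℂ) (i : Fin n) : ℂ := x i + r * kap i

theorem flow_zero {n : ℕ} (x : Fin n → ℂ) : flow x 0 = x := by funext i; simp [flow]

theorem flow_flow {n : ℕ} (x : Fin n → ℂ) (r s : ℂ) : flow (flow x r) s = flow x (r + s) := by
  funext i; simp only [flow]; ring

/-- The potential of the deformed operator. -/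
def potential {n : ℕ} (M : ℤ) (x : Fin n → ℂ) (y : ℂ) : ℂ :=
  (∑ i, ∑ j ∈ Ioi i, 2 * (M : ℂ) * ((M : ℂ) + 1) / sinh (x i - x j) ^ 2)
    + ∑ i, 2 * ((M : ℂ) + 1) / sinh (x i - y) ^ 2

/-- Eigenfunctions of the deformed operator which are holomorphic on discs of radius `δ` in the
coordinate lines through a point. -/
structure EigenAt {n : ℕ} (M : ℤ) (c : ℂ) (f : (Fin n → ℂ) → ℂ → ℂ) (x : Fin n → ℂ) (y : ℂ)
    (δ : ℝ) : Prop where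
  dx : ∀ i, DifferentiableOn ℂ (fun t => f (update x i t) y) (ball (x i) δ)
  dy : DifferentiableOn ℂ (fun t => f x t) (ball y δ)
  flow : HasDerivAt (fun r : ℂ => f (flow x r) y)
    (∑ i, kap i * deriv (fun t => f (update x i t) y) (x i)) 0
  eq : -(∑ i, partial2 (fun x' => f x' y) i x) - (M : ℂ) * iteratedDeriv 2 (fun t : ℂ => f x t) y
    + potential M x y * f x y = c * f x y

section
variable {M : ℤ} {c : ℂ} {f g : (Fin n → ℂ) → ℂ → ℂ} {x : Fin n → ℂ} {y : ℂ} {δ : ℝ}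

theorem analyticAt_of_ball {h : ℂ → ℂ} {z : ℂ} (hδ : 0 < δ)
    (hd : DifferentiableOn ℂ h (ball z δ)) : AnalyticAt ℂ h z :=
  hd.analyticAt (ball_mem_nhds z hδ)

theorem EigenAt.const_mul (hf : EigenAt M c f x y δ) (hδ : 0 < δ) (a : ℂ) :
    EigenAt M c (fun x y => a * f x y) x y δ where
  dx i := (hf.dx i).const_mul a
  dy := hf.dy.const_mul a
  flow := by
    convert! hf.flow.const_mul a using 1
    rw [mul_sum]
    refine sum_congr rfl fun i _ => ?_
    rw [deriv_const_mul _ (analyticAt_of_ball hδ (hf.dx i)).differentiableAt]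
    ring
  eq := by
    have h1 : ∀ i, partial2 (fun x' => a * f x' y) i x = a * partial2 (fun x' => f x' y) i x :=
      fun i => iteratedDeriv_const_mul_field _ _
    have h2 : iteratedDeriv 2 (fun t : ℂ => a * f x t) y = a * iteratedDeriv 2 (fun t : ℂ => f x t) y :=
      iteratedDeriv_const_mul_field _ _
    simp only [h1, h2, ← mul_sum]
    linear_combination a * hf.eq

theorem EigenAt.sub (hf : EigenAt M c f x y δ) (hg : EigenAt M c g x y δ) (hδ : 0 < δ) :
    EigenAt M c (fun x y => f x y - g x y) x y δ where
  dx i := (hf.dx i).sub (hg.dx i)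
  dy := hf.dy.sub hg.dy
  flow := by
    convert! hf.flow.sub hg.flow using 1
    rw [← sum_sub_distrib]
    refine sum_congr rfl fun i _ => ?_
    rw [deriv_fun_sub (analyticAt_of_ball hδ (hf.dx i)).differentiableAt
      (analyticAt_of_ball hδ (hg.dx i)).differentiableAt]
    ring
  eq := by
    have h1 : ∀ i, partial2 (fun x' => f x' y - g x' y) i x
        = partial2 (fun x' => f x' y) i x - partial2 (fun x' => g x' y) i x :=
      fun i => iteratedDeriv_fun_sub (analyticAt_of_ball hδ (hf.dx i)).contDiffAt
        (analyticAt_of_ball hδ (hg.dx i)).contDiffAt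
    have h2 : iteratedDeriv 2 (fun t : ℂ => f x t - g x t) y
        = iteratedDeriv 2 (fun t : ℂ => f x t) y - iteratedDeriv 2 (fun t : ℂ => g x t) y :=
      iteratedDeriv_fun_sub (analyticAt_of_ball hδ hf.dy).contDiffAt
        (analyticAt_of_ball hδ hg.dy).contDiffAt
    simp only [h1, h2, sum_sub_distrib]
    linear_combination hf.eq - hg.eq

/-- Integrals of families of functions which satisfy the equation up to a total divergence. -/
theorem EigenAt.integral {X : Type*} [MeasurableSpace X] {m : Measure X}
    {f : X → (Fin n → ℂ) → ℂ → ℂ} {W : Fin n → X → ℂ} (hδ : 0 < δ)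
    (hx : ∀ i, HoloFam m (fun ξ t => f ξ (update x i t) y) (x i) δ)
    (hy : HoloFam m (fun ξ t => f ξ x t) y δ)
    (hr : ∃ ρ > 0, HoloFam m (fun ξ r => f ξ (TrigBA.flow x r) y) 0 ρ)
    (hr' : ∀ᵐ ξ ∂m, HasDerivAt (fun r : ℂ => f ξ (TrigBA.flow x r) y)
      (∑ i, kap i * deriv (fun t => f ξ (update x i t) y) (x i)) 0)
    (hp : ∀ᵐ ξ ∂m, defSutherland M (f ξ) x y = c * f ξ x y + ∑ i, W i ξ)
    (hW : ∀ i, ∫ ξ, W i ξ ∂m = 0) (hWi : ∀ i, Integrable (W i) m) :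
    EigenAt M c (fun x y => ∫ ξ, f ξ x y ∂m) x y δ where
  dx i := (hx i).differentiableOn
  dy := hy.differentiableOn
  flow := by
    obtain ⟨ρ, hρ, hr⟩ := hr
    have h1 := (hr.deriv (mem_ball_self hρ)).1
    convert! h1 using 1
    have h2 : ∀ᵐ ξ ∂m, deriv (fun r : ℂ => f ξ (TrigBA.flow x r) y) 0
        = ∑ i, kap i * deriv (fun t => f ξ (update x i t) y) (x i) :=
      hr'.mono fun ξ h => h.deriv
    rw [integral_congr_ae h2, integral_finsetSum]
    · refine sum_congr rfl fun i _ => ?_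
      rw [integral_const_mul, ((hx i).deriv (mem_ball_self hδ)).1.deriv]
    · exact fun i _ => ((hx i).integrable_deriv (mem_ball_self hδ)).const_mul _
  eq := by
    have hi : Integrable (fun ξ => f ξ x y) m := hy.integrable (mem_ball_self hδ)
    have h1 : ∀ i, _ := fun i => (hx i).iteratedDeriv_two (mem_ball_self hδ)
    have h2 := hy.iteratedDeriv_two (mem_ball_self hδ)
    have h3 : ∫ ξ, defSutherland M (f ξ) x y ∂m = c * ∫ ξ, f ξ x y ∂m := by
      rw [integral_congr_ae hp, integral_add (hi.const_mul c) (integrable_finsetSum _ fun i _ => hWi i),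
        integral_const_mul, integral_finsetSum _ fun i _ => hWi i]
      simp [hW]
    rw [← h3]
    unfold partial2
    simp only [h1, h2]
    rw [← integral_finsetSum _ fun i _ => (h1 i).1, ← integral_const_mul, ← integral_const_mul,
      ← integral_neg, ← integral_sub, ← integral_add]
    · rfl
    · exact (Integrable.neg (integrable_finsetSum _ fun i _ => (h1 i).1)).sub (h2.1.const_mul _)
    · exact hi.const_mul _
    · exact Integrable.neg (integrable_finsetSum _ fun i _ => (h1 i).1)
    · exact h2.1.const_mul _

/-- The exponential factor of an eigenfunction. -/
def planeWave (M : ℤ) (ν : Fin n → ℂ) (μ : ℂ) (x : Fin n → ℂ) (y : ℂ) : ℂ :=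
  (∏ i, powx (x i) (ν i)) * powx y (μ / M)

theorem planeWave_ne_zero (M : ℤ) (ν : Fin n → ℂ) (μ : ℂ) (x : Fin n → ℂ) (y : ℂ) :
    planeWave M ν μ x y ≠ 0 :=
  mul_ne_zero (prod_ne_zero_iff.2 fun _ _ => exp_ne_zero _) (exp_ne_zero _)

theorem planeWave_update (M : ℤ) (ν : Fin n → ℂ) (μ : ℂ) (x : Fin n → ℂ) (y : ℂ) (i : Fin n) (t : ℂ) :
    planeWave M ν μ (update x i t) y
      = exp (2 * ν i * (t - x i)) * planeWave M ν μ x y := by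
  unfold planeWave
  rw [← mul_assoc, ← mul_prod_erase _ _ (mem_univ i),
    ← mul_prod_erase (a := i) _ (fun i => powx (x i) (ν i)) (mem_univ i), ← mul_assoc]
  congr 2
  · rw [update_self, powx, powx, ← exp_add]; congr 1; ring
  · refine prod_congr rfl fun j hj => ?_
    rw [update_of_ne (ne_of_mem_erase hj)]

theorem planeWave_snd (M : ℤ) (ν : Fin n → ℂ) (μ : ℂ) (x : Fin n → ℂ) (y t : ℂ) :
    planeWave M ν μ x t = exp (2 * (μ / M) * (t - y)) * planeWave M ν μ x y := by
  unfold planeWave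
  rw [mul_left_comm]
  congr 1
  rw [powx, powx, ← exp_add]; congr 1; ring

theorem iteratedDeriv_two_exp_mul {h : ℂ → ℂ} {z : ℂ} (hh : AnalyticAt ℂ h z) (a b : ℂ) :
    iteratedDeriv 2 (fun t => h t * (exp (a * (t - z)) * b)) z
      = (iteratedDeriv 2 h z + 2 * a * deriv h z + a ^ 2 * h z) * b := by
  have hK : ∀ s, HasLog (fun t => exp (a * (t - z)) * b) a s := fun s => by
    have h1 : HasDerivAt (fun t => a * (t - z)) (a * 1) s :=
      ((hasDerivAt_id s).sub_const z).const_mul a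
    have := (h1.cexp).mul_const b
    unfold HasLog
    convert! this using 1
    ring
  have := iteratedDeriv_two_hasLog_mul (t := z) (Eventually.of_forall hK) (hasDerivAt_const z a) hh
  simp only [mul_comm (h _)]
  rw [this]
  simp
  ring

/-- The equation for an eigenfunction divided by its exponential factor. -/
theorem EigenAt.reduced {ν : Fin n → ℂ} {μ : ℂ} (hM : (M : ℂ) ≠ 0) (hδ : 0 < δ)
    (hf : EigenAt M (-4 * (∑ i, ν i ^ 2 + μ ^ 2 / M)) (fun x y => g x y * planeWave M ν μ x y) x y δ) :
    (∀ i, DifferentiableOn ℂ (fun t => g (update x i t) y) (ball (x i) δ)) ∧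
    DifferentiableOn ℂ (fun t => g x t) (ball y δ) ∧
    HasDerivAt (fun r : ℂ => g (TrigBA.flow x r) y)
      (∑ i, kap i * deriv (fun t => g (update x i t) y) (x i)) 0 ∧
    ∑ i, 4 * ν i * deriv (fun t => g (update x i t) y) (x i)
      = -(∑ i, partial2 (fun x' => g x' y) i x) - (M : ℂ) * iteratedDeriv 2 (fun t : ℂ => g x t) y
        - 4 * μ * deriv (fun t => g x t) y + potential M x y * g x y := by
  have hp0 := planeWave_ne_zero M ν μ x y
  have d1 : ∀ i, DifferentiableOn ℂ (fun t => g (update x i t) y) (ball (x i) δ) := by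
    intro i
    have h1 : DifferentiableOn ℂ (fun t => exp (2 * ν i * (t - x i)) * planeWave M ν μ x y)
      (ball (x i) δ) := by fun_prop
    refine ((hf.dx i).div h1 fun t _ => mul_ne_zero (exp_ne_zero _) hp0).congr fun t _ => ?_
    simp only [Pi.div_apply, planeWave_update]
    field_simp [exp_ne_zero]
  have d2 : DifferentiableOn ℂ (fun t => g x t) (ball y δ) := by
    have h1 : DifferentiableOn ℂ (fun t => exp (2 * (μ / M) * (t - y)) * planeWave M ν μ x y)
      (ball y δ) := by fun_prop
    refine (hf.dy.div h1 fun t _ => mul_ne_zero (exp_ne_zero _) hp0).congr fun t _ => ?_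
    simp only [Pi.div_apply]
    rw [planeWave_snd M ν μ x y t]
    field_simp [exp_ne_zero]
  have a1 := fun i => analyticAt_of_ball hδ (d1 i)
  have a2 := analyticAt_of_ball hδ d2
  have u0 : ∀ i, update x i (x i) = x := fun i => update_eq_self i x
  have e1 : ∀ i, deriv (fun t => g (update x i t) y * planeWave M ν μ (update x i t) y)
      (x i) = (deriv (fun t => g (update x i t) y) (x i) + 2 * ν i * g x y)
        * planeWave M ν μ x y := by
    intro i
    simp only [planeWave_update]
    have h1 : HasDerivAt (fun t => 2 * ν i * (t - x i)) (2 * ν i * 1) (x i) :=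
      ((hasDerivAt_id (x i)).sub_const (x i)).const_mul (2 * ν i)
    have h2 := (a1 i).differentiableAt.hasDerivAt.mul ((h1.cexp).mul_const (planeWave M ν μ x y))
    refine h2.deriv.trans ?_
    simp only [u0, sub_self, mul_zero, exp_zero]
    ring
  refine ⟨d1, d2, ?_, ?_⟩
  · have h0 : HasDerivAt (fun r : ℂ => planeWave M ν μ (TrigBA.flow x r) y)
        ((∑ i, 2 * ν i * kap i) * planeWave M ν μ x y) 0 := by
      have h1 : ∀ r, planeWave M ν μ (TrigBA.flow x r) y
          = exp ((∑ i, 2 * ν i * kap i) * r) * planeWave M ν μ x y := by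
        intro r
        unfold planeWave
        rw [← mul_assoc, sum_mul, exp_sum, ← prod_mul_distrib]
        congr 2
        funext i
        rw [powx, powx, ← exp_add, TrigBA.flow]; congr 1; ring
      simp only [h1]
      have h2 := (((hasDerivAt_id (0 : ℂ)).const_mul (∑ i, 2 * ν i * kap i)).cexp).mul_const
        (planeWave M ν μ x y)
      convert! h2 using 1
      simp
    have h1 := hf.flow.div h0 (by rw [flow_zero]; exact hp0)
    have h2 : (fun r : ℂ => g (TrigBA.flow x r) y) = (fun r : ℂ => g (TrigBA.flow x r) y
        * planeWave M ν μ (TrigBA.flow x r) y) / fun r : ℂ => planeWave M ν μ (TrigBA.flow x r) y := by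
      funext r
      rw [Pi.div_apply, mul_div_cancel_right₀ _ (planeWave_ne_zero _ _ _ _ _)]
    rw [h2]
    convert! h1 using 1
    simp only [e1, flow_zero]
    rw [eq_div_iff (pow_ne_zero 2 hp0)]
    have h3 : ∑ i, (kap i : ℂ) * ((deriv (fun t => g (update x i t) y) (x i) + 2 * ν i * g x y)
        * planeWave M ν μ x y) = (∑ i, (kap i : ℂ) * deriv (fun t => g (update x i t) y) (x i)
          + (∑ i, 2 * ν i * kap i) * g x y) * planeWave M ν μ x y := by
      rw [sum_mul, ← sum_add_distrib, sum_mul]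
      exact sum_congr rfl fun i _ => by ring
    rw [h3]
    ring
  · have e2 : ∀ i, partial2 (fun x' => g x' y * planeWave M ν μ x' y) i x
        = (partial2 (fun x' => g x' y) i x
          + 4 * ν i * deriv (fun t => g (update x i t) y) (x i) + 4 * ν i ^ 2 * g x y)
          * planeWave M ν μ x y := by
      intro i
      unfold partial2
      simp only [planeWave_update]
      rw [iteratedDeriv_two_exp_mul (a1 i), u0]
      ring
    have e3 : iteratedDeriv 2 (fun t => g x t * planeWave M ν μ x t) y
        = (iteratedDeriv 2 (fun t => g x t) y + 4 * (μ / M) * deriv (fun t => g x t) y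
          + 4 * (μ / M) ^ 2 * g x y) * planeWave M ν μ x y := by
      rw [show (fun t => g x t * planeWave M ν μ x t) = fun t => g x t *
        (exp (2 * (μ / M) * (t - y)) * planeWave M ν μ x y) from
          funext fun t => by rw [planeWave_snd M ν μ x y t], iteratedDeriv_two_exp_mul a2]
      ring
    -- Conjugation by the plane wave produces the zero-order terms 4ν_i² and 4μ²/M, which cancel the
    -- eigenvalue. What depends on ν afterwards is only the first-order term.
    have h := hf.eq
    simp only [e2, e3, ← sum_mul, sum_add_distrib] at h
    refine mul_right_cancel₀ hp0 ?_
    have h4 : ∑ i, 4 * ν i ^ 2 = 4 * ∑ i, ν i ^ 2 := (mul_sum _ _ _).symm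
    rw [h4] at h
    have h5 : (M : ℂ) * (4 * (μ / M) * deriv (fun t => g x t) y + 4 * (μ / M) ^ 2 * g x y)
        = 4 * μ * deriv (fun t => g x t) y + 4 * (μ ^ 2 / M) * g x y := by
      field_simp
    linear_combination -h - planeWave M ν μ x y * h5

theorem norm_iteratedDeriv_le_of_ball {h : ℂ → ℂ} {z : ℂ} {B : ℝ} (hδ : 0 < δ) (k : ℕ)
    (hd : DifferentiableOn ℂ h (ball z δ)) (hB : ∀ t ∈ ball z δ, ‖h t‖ ≤ B) :
    ‖iteratedDeriv k h z‖ ≤ k.factorial * B / (δ / 2) ^ k := by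
  have hs : closedBall z (δ / 2) ⊆ ball z δ :=
    Metric.closedBall_subset_ball (by linarith)
  refine Complex.norm_iteratedDeriv_le_of_forall_mem_sphere_norm_le k (by positivity) ?_
    fun t ht => hB t (hs (Metric.sphere_subset_closedBall ht))
  refine DifferentiableOn.diffContOnCl ?_
  rw [closure_ball _ (by positivity)]
  exact hd.mono hs

/-- Along the flow, a family of solutions with large spectral parameter varies little. -/
theorem flow_bound (M : ℤ) (hM : (M : ℂ) ≠ 0) (ν : Fin n → ℂ) (μ : ℂ) {δ : ℝ} (hδ : 0 < δ) (V : ℝ) :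
    ∃ C : ℝ, ∀ (T B R : ℝ) (x : Fin n → ℂ) (y : ℂ) (g : (Fin n → ℂ) → ℂ → ℂ), 1 < T → 0 ≤ R →
      (∀ r ∈ Icc 0 R, EigenAt M (-4 * (∑ i, lineν ν T i ^ 2 + μ ^ 2 / M))
        (fun x y => g x y * planeWave M (lineν ν T) μ x y) (TrigBA.flow x (r : ℝ)) y δ) →
      (∀ r ∈ Icc 0 R, ‖potential M (TrigBA.flow x (r : ℝ)) y‖ ≤ V) →
      (∀ r ∈ Icc 0 R, ∀ i, ∀ t ∈ ball (TrigBA.flow x (r : ℝ) i) δ,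
        ‖g (update (TrigBA.flow x (r : ℝ)) i t) y‖ ≤ B) →
      (∀ r ∈ Icc 0 R, ∀ t ∈ ball y δ, ‖g (TrigBA.flow x (r : ℝ)) t‖ ≤ B) →
      ‖g (TrigBA.flow x R) y - g x y‖ ≤ C * B * R / (T - 1) := by
  set a1 : ℝ := 1 / (δ / 2) with ha1
  set a2 : ℝ := 2 / (δ / 2) ^ 2 with ha2
  refine ⟨(∑ _i : Fin n, a2 + ‖(M : ℂ)‖ * a2 + ‖4 * μ‖ * a1 + V + ∑ i, ‖4 * ν i‖ * a1) / 4,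
    fun T B R x y g hT hR hE hV hBx hBy => ?_⟩
  set C := (∑ _i : Fin n, a2 + ‖(M : ℂ)‖ * a2 + ‖4 * μ‖ * a1 + V + ∑ i, ‖4 * ν i‖ * a1) / 4 with hC
  have hderiv : ∀ r ∈ Icc 0 R, ∃ d : ℂ, HasDerivAt (fun s : ℝ => g (TrigBA.flow x (s : ℝ)) y) d r ∧
      ‖d‖ ≤ C * B / (T - 1) := by
    intro r hr
    obtain ⟨d1, d2, h3, h4⟩ := (hE r hr).reduced hM hδ
    set X := TrigBA.flow x (r : ℝ) with hX
    refine ⟨∑ i, (kap i : ℂ) * deriv (fun t => g (update X i t) y) (X i), ?_, ?_⟩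
    · have h5 : HasDerivAt (fun s : ℂ => g (TrigBA.flow x s) y)
          (∑ i, (kap i : ℂ) * deriv (fun t => g (update X i t) y) (X i)) (r : ℂ) := by
        have h6 : HasDerivAt (fun s : ℂ => s - r) 1 (r : ℂ) := (hasDerivAt_id _).sub_const _
        have h7 : HasDerivAt (fun s : ℂ => g (TrigBA.flow X s) y)
          (∑ i, (kap i : ℂ) * deriv (fun t => g (update X i t) y) (X i)) ((r : ℂ) - r) := by
          rw [sub_self]; exact h3
        have h8 := HasDerivAt.comp (h := fun s : ℂ => s - r) (r : ℂ) h7 h6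
        rw [mul_one] at h8
        convert! h8 using 1
        funext s
        simp only [comp, hX, flow_flow]
        congr 2; ring
      exact h5.comp_ofReal
    · have hB0 : ‖g X y‖ ≤ B := hBy r hr y (mem_ball_self hδ)
      have b1 : ∀ i, ‖deriv (fun t => g (update X i t) y) (X i)‖ ≤ a1 * B := fun i => by
        have := norm_iteratedDeriv_le_of_ball hδ 1 (d1 i) (hBx r hr i)
        rw [iteratedDeriv_one] at this
        refine this.trans (le_of_eq ?_)
        simp [ha1]; ring
      have b2 : ∀ i, ‖partial2 (fun x' => g x' y) i X‖ ≤ a2 * B := fun i => by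
        have := norm_iteratedDeriv_le_of_ball hδ 2 (d1 i) (hBx r hr i)
        refine this.trans (le_of_eq ?_)
        simp [ha2, Nat.factorial]; ring
      have b3 : ‖deriv (fun t => g X t) y‖ ≤ a1 * B := by
        have := norm_iteratedDeriv_le_of_ball hδ 1 d2 (hBy r hr)
        rw [iteratedDeriv_one] at this
        refine this.trans (le_of_eq ?_)
        simp [ha1]; ring
      have b4 : ‖iteratedDeriv 2 (fun t => g X t) y‖ ≤ a2 * B := by
        have := norm_iteratedDeriv_le_of_ball hδ 2 d2 (hBy r hr)
        refine this.trans (le_of_eq ?_)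
        simp [ha2, Nat.factorial]; ring
      have hT1 : ((T : ℂ) - 1) ≠ 0 := by
        norm_cast; intro h; linarith
      -- In 4 Σ ν_i ∂_i the part proportional to T - 1 is the derivative along the flow. Solving for
      -- it gains the factor 1/(4(T-1)); all other terms are bounded by Cauchy's estimates on discs
      -- of radius δ.
      have key : (∑ i, (kap i : ℂ) * deriv (fun t => g (update X i t) y) (X i))
          = (-(∑ i, partial2 (fun x' => g x' y) i X) - (M : ℂ) * iteratedDeriv 2 (fun t : ℂ => g X t) y
            - 4 * μ * deriv (fun t => g X t) y + potential M X y * g X y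
            - ∑ i, 4 * ν i * deriv (fun t => g (update X i t) y) (X i)) / (4 * (T - 1)) := by
        rw [eq_div_iff (mul_ne_zero (by norm_num) hT1), ← h4, ← sum_sub_distrib, sum_mul]
        refine sum_congr rfl fun i _ => ?_
        rw [lineν]; ring
      rw [key, norm_div]
      have hden : ‖(4 : ℂ) * ((T : ℂ) - 1)‖ = 4 * (T - 1) := by
        rw [show (4 : ℂ) * ((T : ℂ) - 1) = ((4 * (T - 1) : ℝ) : ℂ) by push_cast; ring,
          norm_real, norm_eq_abs, abs_of_pos (by linarith)]
      rw [hden, div_le_div_iff₀ (by linarith) (by linarith)]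
      have hV' := hV r hr
      have n1 : ‖∑ i, partial2 (fun x' => g x' y) i X‖ ≤ ∑ _i : Fin n, a2 * B :=
        norm_sum_le_of_le _ fun i _ => b2 i
      have n2 : ‖∑ i, 4 * ν i * deriv (fun t => g (update X i t) y) (X i)‖
          ≤ ∑ i, ‖4 * ν i‖ * (a1 * B) := norm_sum_le_of_le _ fun i _ => by
        rw [norm_mul]; exact mul_le_mul_of_nonneg_left (b1 i) (norm_nonneg _)
      have n3 : ‖(M : ℂ) * iteratedDeriv 2 (fun t : ℂ => g X t) y‖ ≤ ‖(M : ℂ)‖ * (a2 * B) := by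
        rw [norm_mul]; exact mul_le_mul_of_nonneg_left b4 (norm_nonneg _)
      have n4 : ‖4 * μ * deriv (fun t => g X t) y‖ ≤ ‖4 * μ‖ * (a1 * B) := by
        rw [norm_mul]; exact mul_le_mul_of_nonneg_left b3 (norm_nonneg _)
      have n5 : ‖potential M X y * g X y‖ ≤ V * B := by
        rw [norm_mul]; exact mul_le_mul hV' hB0 (norm_nonneg _) ((norm_nonneg _).trans hV')
      have n6 : ‖-(∑ i, partial2 (fun x' => g x' y) i X) - (M : ℂ) * iteratedDeriv 2 (fun t : ℂ => g X t) y
            - 4 * μ * deriv (fun t => g X t) y + potential M X y * g X y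
            - ∑ i, 4 * ν i * deriv (fun t => g (update X i t) y) (X i)‖
          ≤ 4 * (C * B) := by
        refine (norm_sub_le _ _).trans ?_
        refine (add_le_add ((norm_add_le _ _).trans (add_le_add ((norm_sub_le _ _).trans
          (add_le_add ((norm_sub_le _ _).trans (add_le_add ((norm_neg _).trans_le n1) n3)) n4)) n5))
          n2).trans (le_of_eq ?_)
        rw [← sum_mul]
        simp only [← mul_assoc]
        rw [← sum_mul, hC]
        ring
      calc _ ≤ 4 * (C * B) * (T - 1) := by
            exact mul_le_mul_of_nonneg_right n6 (by linarith)
        _ = _ := by ring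
  choose! d hd hdb using hderiv
  have := norm_image_sub_le_of_norm_deriv_le_segment' (f := fun s : ℝ => g (TrigBA.flow x (s : ℝ)) y)
    (a := 0) (b := R) (fun r hr => (hd r hr).hasDerivWithinAt)
    (fun r hr => hdb r (Set.Ico_subset_Icc_self hr)) R (Set.right_mem_Icc.2 hR)
  simp only [ofReal_zero, flow_zero, sub_zero] at this
  refine this.trans (le_of_eq ?_)
  ring

end

/-! ### The rational part of the integrand -/

/-- The factor of the kernel which couples two indices. -/
def pairFactor (w u : Fin n → ℂ) (i j : Fin n) : ℂ :=
  (w i - u j) * (u i - w j) / ((w i - w j) * (u i - u j))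

/-- The rational part of the integrand. -/
def ratPart (M : ℤ) (k : ℕ) (p : Poly(n)) (w u : Fin n → ℂ) (v : ℂ) : ℂ :=
  (∏ i, ∏ j ∈ Ioi i, pairFactor w u i j) ^ M * (cross w v / cross u v)
    * (eval w p / vdm w ^ k)

/-- Quantitative separation of the points. -/
structure Sep (c : ℝ) (w u : Fin n → ℂ) (v : ℂ) : Prop where
  uu : ∀ i j, i ≠ j → c * ‖u i‖ ≤ ‖u i - u j‖
  ww : ∀ i j, i ≠ j → c * ‖w i‖ ≤ ‖w i - w j‖
  wu : ∀ i j, i ≠ j → c * ‖w i‖ ≤ ‖w i - u j‖ ∧ c * ‖u j‖ ≤ ‖w i - u j‖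
  uv : ∀ i, c * ‖u i‖ ≤ ‖u i - v‖ ∧ c * ‖v‖ ≤ ‖u i - v‖
  wv : ∀ i, c * ‖w i‖ ≤ ‖w i - v‖

theorem norm_zpow_le {f : ℂ} {L : ℝ} (h1 : ‖f‖ ≤ L) (h2 : ‖f⁻¹‖ ≤ L) (M : ℤ) :
    ‖f ^ M‖ ≤ L ^ M.natAbs := by
  rcases Int.natAbs_eq M with h | h
  · rw [h, zpow_natCast, norm_pow, Int.natAbs_natCast]
    exact pow_le_pow_left₀ (norm_nonneg _) h1 _
  · rw [h, zpow_neg, zpow_natCast, ← inv_pow, norm_pow, Int.natAbs_neg, Int.natAbs_natCast]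
    exact pow_le_pow_left₀ (norm_nonneg _) h2 _

/-- Up to constants and powers of Y, each of the four differences has the size of u_i, the point
that dominates in the chamber. The inverse is bounded as well because the exponent M may be
negative. -/
theorem norm_pairFactor_le {c A Y : ℝ} (hc : 0 < c) (hA : 1 ≤ A) (hY : 1 ≤ Y) {w u : Fin n → ℂ}
    {v : ℂ} (hs : Sep c w u v) {i j : Fin n} (hij : i ≠ j) (hu0 : 0 < ‖u i‖)
    (hu : ‖u j‖ ≤ A * ‖u i‖) (hw1 : ∀ i, Y⁻¹ * ‖u i‖ ≤ ‖w i‖) (hw2 : ∀ i, ‖w i‖ ≤ Y * ‖u i‖) :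
    ‖pairFactor w u i j‖ ≤ ((A + 1) / c) ^ 2 * Y ^ 3 ∧
      ‖(pairFactor w u i j)⁻¹‖ ≤ ((A + 1) / c) ^ 2 * Y ^ 3 := by
  set a := ‖u i‖ with ha
  have hY0 : 0 < Y := by linarith
  have wj : ‖w j‖ ≤ Y * (A * a) := (hw2 j).trans (mul_le_mul_of_nonneg_left hu hY0.le)
  have hYi : Y⁻¹ ≤ 1 := inv_le_one_of_one_le₀ hY
  have hYY : Y⁻¹ * Y = 1 := inv_mul_cancel₀ hY0.ne'
  -- upper bounds
  have A0 : 0 ≤ A * a := by positivity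
  have u1 : ‖w i - u j‖ ≤ (A + 1) * Y * a := by
    refine (norm_sub_le _ _).trans ?_
    nlinarith [hw2 i]
  have u2 : ‖u i - w j‖ ≤ (A + 1) * Y * a := by
    refine (norm_sub_le _ _).trans ?_
    nlinarith [hw2 i]
  have u3 : ‖w i - w j‖ ≤ (A + 1) * Y * a := by
    refine (norm_sub_le _ _).trans ?_
    nlinarith [hw2 i]
  have u4 : ‖u i - u j‖ ≤ (A + 1) * a := by
    refine (norm_sub_le _ _).trans ?_
    nlinarith
  -- lower bounds
  have l1 : c * (Y⁻¹ * a) ≤ ‖w i - u j‖ :=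
    (mul_le_mul_of_nonneg_left (hw1 i) hc.le).trans (hs.wu i j hij).1
  have l2 : c * a ≤ ‖u i - w j‖ := by
    rw [norm_sub_rev]; exact (hs.wu j i hij.symm).2
  have l3 : c * (Y⁻¹ * a) ≤ ‖w i - w j‖ :=
    (mul_le_mul_of_nonneg_left (hw1 i) hc.le).trans (hs.ww i j hij)
  have l4 : c * a ≤ ‖u i - u j‖ := hs.uu i j hij
  have hYa : 0 < Y⁻¹ * a := by positivity
  have p1 : 0 < c * (Y⁻¹ * a) := by positivity
  have p2 : 0 < c * a := by positivity
  constructor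
  · rw [pairFactor, norm_div, norm_mul, norm_mul]
    calc ‖w i - u j‖ * ‖u i - w j‖ / (‖w i - w j‖ * ‖u i - u j‖)
        ≤ ((A + 1) * Y * a) * ((A + 1) * Y * a) / ((c * (Y⁻¹ * a)) * (c * a)) := by gcongr
      _ = _ := by field_simp
  · rw [pairFactor, inv_div, norm_div, norm_mul, norm_mul]
    calc ‖w i - w j‖ * ‖u i - u j‖ / (‖w i - u j‖ * ‖u i - w j‖)
        ≤ ((A + 1) * Y * a) * ((A + 1) * a) / ((c * (Y⁻¹ * a)) * (c * a)) := by gcongr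
      _ = ((A + 1) / c) ^ 2 * Y ^ 2 := by field_simp
      _ ≤ _ := by gcongr; norm_num

theorem norm_prod_pairs_le (f : Fin n → Fin n → ℂ) {L : ℝ} (h : ∀ i j, i < j → ‖f i j‖ ≤ L) :
    ‖∏ i, ∏ j ∈ Ioi i, f i j‖ ≤ L ^ (∑ i : Fin n, (Ioi i).card) := by
  rw [norm_prod, ← prod_pow_eq_pow_sum]
  refine Finset.prod_le_prod (fun _ _ => norm_nonneg _) fun i _ => ?_
  rw [norm_prod, ← prod_const]
  exact Finset.prod_le_prod (fun _ _ => norm_nonneg _) fun j hj => h i j (mem_Ioi.1 hj)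

/-- By separation each factor w_i - w_j with i < j is at least a multiple of its dominating point
w_i, so nothing is lost in the power of q. -/
theorem le_norm_vdm {c b q : ℝ} (hc : 0 < c) (hb : 0 < b) (hq : 1 ≤ q) {w : Fin n → ℂ}
    (hs : ∀ i j, i ≠ j → c * ‖w i‖ ≤ ‖w i - w j‖) (hw : ∀ i, b * q ^ kap i ≤ ‖w i‖) :
    (c * b) ^ (∑ i : Fin n, (Ioi i).card) * q ^ vdmWt n ≤ ‖vdm w‖ := by
  rw [vdm, norm_prod, vdmWt, ← prod_pow_eq_pow_sum, ← prod_pow_eq_pow_sum,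
    ← prod_mul_distrib]
  refine Finset.prod_le_prod (fun _ _ => by positivity) fun i _ => ?_
  rw [norm_prod, ← prod_const, ← prod_pow_eq_pow_sum, ← prod_mul_distrib]
  refine Finset.prod_le_prod (fun _ _ => by positivity) fun j hj => ?_
  have := (mul_le_mul_of_nonneg_left (hw i) hc.le).trans (hs i j (mem_Ioi.1 hj).ne)
  linarith

theorem norm_cross_div_le {c Y : ℝ} (hc : 0 < c) (hY : 1 ≤ Y) {w u : Fin n → ℂ} {v : ℂ}
    (hs : Sep c w u v) (hu0 : ∀ i, 0 < ‖u i‖) (hw2 : ∀ i, ‖w i‖ ≤ Y * ‖u i‖) :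
    ‖cross w v / cross u v‖ ≤ (2 / c * Y) ^ n := by
  rw [cross, cross, ← prod_div_distrib, norm_prod]
  calc ∏ i, ‖(w i - v) / (u i - v)‖ ≤ ∏ _i : Fin n, (2 / c * Y) := by
        refine Finset.prod_le_prod (fun _ _ => norm_nonneg _) fun i _ => ?_
        have h1 : 0 < ‖u i - v‖ := lt_of_lt_of_le (mul_pos hc (hu0 i)) (hs.uv i).1
        rw [norm_div, div_le_iff₀ h1]
        have h2 : ‖u i‖ ≤ ‖u i - v‖ / c := by
          rw [le_div_iff₀ hc, mul_comm]; exact (hs.uv i).1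
        have h3 : ‖v‖ ≤ ‖u i - v‖ / c := by
          rw [le_div_iff₀ hc, mul_comm]; exact (hs.uv i).2
        have h4 : 0 ≤ ‖u i - v‖ / c := by positivity
        calc ‖w i - v‖ ≤ ‖w i‖ + ‖v‖ := norm_sub_le _ _
          _ ≤ Y * (‖u i - v‖ / c) + Y * (‖u i - v‖ / c) := by
            refine add_le_add ((hw2 i).trans (mul_le_mul_of_nonneg_left h2 (by linarith))) ?_
            nlinarith
          _ = _ := by ring
    _ = _ := by simp

/-- The rational part of the integrand is bounded uniformly in the chamber. -/
theorem norm_ratPart_le {c a A : ℝ} (hc : 0 < c) (ha : 0 < a) (haA : a ≤ A) (hA : 1 ≤ A) (M : ℤ)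
    (k : ℕ) (p : Poly(n)) (hp : ∀ α, k * vdmWt n < wt kap α → p.coeff α = 0) :
    ∃ (C : ℝ) (B : ℕ), 0 ≤ C ∧ ∀ (u ω : Fin n → ℂ) (v : ℂ) (q Y : ℝ), 1 ≤ q → 1 ≤ Y →
      (∀ i, a ≤ ‖u i‖ ∧ ‖u i‖ ≤ A) → (∀ i, Y⁻¹ ≤ ‖ω i‖ ∧ ‖ω i‖ ≤ Y) →
      Sep c (fun i => u i * ω i * (q : ℂ) ^ kap i) (fun i => u i * (q : ℂ) ^ kap i) v →
      ‖ratPart M k p (fun i => u i * ω i * (q : ℂ) ^ kap i) (fun i => u i * (q : ℂ) ^ kap i) v‖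
        ≤ C * Y ^ B := by
  obtain ⟨C1, hC1, hev⟩ := norm_eval_le kap p _ hp
  set N := ∑ i : Fin n, (Ioi i).card with hN
  refine ⟨(((A / a + 1) / c) ^ 2) ^ (N * M.natAbs) * (2 / c) ^ n *
    (C1 * A ^ p.totalDegree / (c * a) ^ (N * k)), 3 * (N * M.natAbs) + n + p.totalDegree + N * k,
    by positivity, fun u ω v q Y hq hY hu hω hs => ?_⟩
  have hq0 : 0 < q := by linarith
  have hY0 : 0 < Y := by linarith
  set U : Fin n → ℂ := fun i => u i * (q : ℂ) ^ kap i with hU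
  set W : Fin n → ℂ := fun i => u i * ω i * (q : ℂ) ^ kap i with hW
  have nq : ∀ k : ℕ, ‖(q : ℂ) ^ k‖ = q ^ k := fun k => by
    rw [norm_pow, norm_real, norm_eq_abs, abs_of_pos hq0]
  have nU : ∀ i, ‖U i‖ = ‖u i‖ * q ^ kap i := fun i => by simp only [hU, norm_mul, nq]
  have nW : ∀ i, ‖W i‖ = ‖ω i‖ * ‖U i‖ := fun i => by
    rw [nU]; simp only [hW, norm_mul, nq]; ring
  have hu0 : ∀ i, 0 < ‖u i‖ := fun i => ha.trans_le (hu i).1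
  have hU0 : ∀ i, 0 < ‖U i‖ := fun i => by rw [nU]; have := hu0 i; positivity
  have hw1 : ∀ i, Y⁻¹ * ‖U i‖ ≤ ‖W i‖ := fun i => by
    rw [nW]; exact mul_le_mul_of_nonneg_right (hω i).1 (norm_nonneg _)
  have hw2 : ∀ i, ‖W i‖ ≤ Y * ‖U i‖ := fun i => by
    rw [nW]; exact mul_le_mul_of_nonneg_right (hω i).2 (norm_nonneg _)
  have hUU : ∀ i j, i < j → ‖U j‖ ≤ A / a * ‖U i‖ := fun i j hij => by
    rw [nU, nU]
    calc ‖u j‖ * q ^ kap j ≤ A * q ^ kap i :=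
          mul_le_mul (hu j).2 (pow_le_pow_right₀ hq (kap_lt hij).le) (by positivity) (by linarith)
      _ = A / a * (a * q ^ kap i) := by field_simp
      _ ≤ A / a * (‖u i‖ * q ^ kap i) := by gcongr; exact (hu i).1
  have hAa : 1 ≤ A / a := by rw [le_div_iff₀ ha]; linarith
  set L := ((A / a + 1) / c) ^ 2 * Y ^ 3 with hL
  have hpair := fun i j (hij : i < j) =>
    norm_pairFactor_le hc hAa hY hs hij.ne (hU0 i) (hUU i j hij) hw1 hw2
  have b1 : ‖(∏ i, ∏ j ∈ Ioi i, pairFactor W U i j) ^ M‖ ≤ (L ^ N) ^ M.natAbs := by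
    refine norm_zpow_le (norm_prod_pairs_le _ fun i j hij => (hpair i j hij).1) ?_ M
    simp only [← Finset.prod_inv_distrib]
    exact norm_prod_pairs_le _ fun i j hij => (hpair i j hij).2
  have b2 := norm_cross_div_le hc hY hs hU0 hw2
  -- The weight bound of the numerator and the lower bound of A(w)^k carry the same power of q,
  -- which cancels; only powers of Y remain.
  have b3 : ‖eval W p / vdm W ^ k‖
      ≤ C1 * (A * Y) ^ p.totalDegree / ((c * (a / Y)) ^ N) ^ k := by
    have e1 : ‖eval W p‖ ≤ C1 * (A * Y) ^ p.totalDegree * q ^ (k * vdmWt n) := by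
      refine hev (fun i => u i * ω i) q (A * Y) hq (by nlinarith) fun i => ?_
      rw [norm_mul]
      exact mul_le_mul (hu i).2 (hω i).2 (norm_nonneg _) (by linarith)
    have e2 : (c * (a / Y)) ^ N * q ^ vdmWt n ≤ ‖vdm W‖ := by
      refine le_norm_vdm hc (by positivity) hq hs.ww fun i => ?_
      rw [nW, nU]
      calc a / Y * q ^ kap i = Y⁻¹ * (a * q ^ kap i) := by ring
        _ ≤ ‖ω i‖ * (‖u i‖ * q ^ kap i) := by
          have := (hu i).1
          have := (hω i).1
          gcongr
    have e3 : 0 < (c * (a / Y)) ^ N * q ^ vdmWt n := by positivity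
    rw [norm_div, norm_pow]
    calc ‖eval W p‖ / ‖vdm W‖ ^ k
        ≤ C1 * (A * Y) ^ p.totalDegree * q ^ (k * vdmWt n) / ((c * (a / Y)) ^ N * q ^ vdmWt n) ^ k := by
          gcongr
      _ = _ := by
        rw [mul_pow _ (q ^ vdmWt n), ← pow_mul q, mul_comm (vdmWt n)]
        field_simp
  rw [ratPart, norm_mul, norm_mul]
  calc _ ≤ (L ^ N) ^ M.natAbs * (2 / c * Y) ^ n *
        (C1 * (A * Y) ^ p.totalDegree / ((c * (a / Y)) ^ N) ^ k) := by gcongr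
    _ = _ := by
      rw [hL, ← pow_mul, ← pow_mul, mul_pow, mul_pow, mul_pow, ← pow_mul Y,
        show c * (a / Y) = c * a / Y from (mul_div_assoc _ _ _).symm, div_pow (c * a),
        pow_add, pow_add, pow_add]
      field_simp

/-- The behaviour of the rational part at infinity in the chamber. -/
theorem tendsto_ratPart (M : ℤ) (k : ℕ) (p : Poly(n)) (c : ℂ)
    (hp : ∀ u : Fin n → ℂ, Tendsto (fun q : ℝ =>
      eval (fun i => u i * (q : ℂ) ^ kap i) p / (q : ℂ) ^ (k * vdmWt n)) atTop
      (𝓝 (c * ∏ i, u i ^ (k * (Ioi i).card))))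
    (u ω : Fin n → ℂ) (v : ℂ) (hu : ∀ i, u i ≠ 0) (hω : ∀ i, ω i ≠ 0) :
    Tendsto (fun q : ℝ => ratPart M k p (fun i => u i * ω i * (q : ℂ) ^ kap i)
      (fun i => u i * (q : ℂ) ^ kap i) v) atTop (𝓝 (c * ∏ i, ω i)) := by
  have huω : ∀ i, u i * ω i ≠ 0 := fun i => mul_ne_zero (hu i) (hω i)
  -- In every difference the point with the smaller index dominates, and the dominating points
  -- cancel in the pair factor.
  have h1 : Tendsto (fun q : ℝ => ∏ i, ∏ j ∈ Ioi i,
      pairFactor (fun i => u i * ω i * (q : ℂ) ^ kap i) (fun i => u i * (q : ℂ) ^ kap i) i j)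
      atTop (𝓝 (∏ i : Fin n, ∏ j ∈ Ioi i, 1)) := by
    refine tendsto_finsetProd _ fun i _ => tendsto_finsetProd _ fun j hj => ?_
    have hk := kap_lt (mem_Ioi.1 hj)
    have := ((tendsto_sub_div_chamber hk (u i * ω i) (u j)).mul
      (tendsto_sub_div_chamber hk (u i) (u j * ω j))).div
      ((tendsto_sub_div_chamber hk (u i * ω i) (u j * ω j)).mul
      (tendsto_sub_div_chamber hk (u i) (u j))) (mul_ne_zero (huω i) (hu i))
    rw [div_self (mul_ne_zero (huω i) (hu i))] at this
    refine this.congr' ?_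
    filter_upwards [eventually_gt_atTop 0] with q hq
    have hq' : (q : ℂ) ≠ 0 := by exact_mod_cast hq.ne'
    simp only [Pi.div_apply, pairFactor]
    field_simp
  simp only [prod_const_one] at h1
  have h1' := h1.zpow₀ M (Or.inl one_ne_zero)
  rw [one_zpow] at h1'
  have h2 := (tendsto_cross_chamber (fun i => u i * ω i) v).div (tendsto_cross_chamber u v)
    (prod_ne_zero_iff.2 fun i _ => hu i)
  have h3 := (hp (fun i => u i * ω i)).div ((tendsto_vdm_chamber (fun i => u i * ω i)).pow k)
    (pow_ne_zero _ (prod_ne_zero_iff.2 fun i _ => pow_ne_zero _ (huω i)))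
  have h4 := (h1'.mul h2).mul h3
  have e : (1 * ((∏ i, u i * ω i) / ∏ i, u i)) * ((c * ∏ i, (u i * ω i) ^ (k * (Ioi i).card)) /
      (∏ i, (u i * ω i) ^ (Ioi i).card) ^ k) = c * ∏ i, ω i := by
    have e1 : (∏ i, (u i * ω i) ^ (Ioi i).card) ^ k
        = ∏ i, (u i * ω i) ^ (k * (Ioi i).card) := by
      rw [← prod_pow]
      exact prod_congr rfl fun i _ => by rw [← pow_mul, mul_comm k]
    have e2 : ∏ i, (u i * ω i) ^ (k * (Ioi i).card) ≠ 0 :=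
      prod_ne_zero_iff.2 fun i _ => pow_ne_zero _ (huω i)
    have e3 : ∏ i, u i ≠ 0 := prod_ne_zero_iff.2 fun i _ => hu i
    rw [e1, mul_div_cancel_right₀ _ e2,
      show ∏ i, u i * ω i = (∏ i, u i) * ∏ i, ω i from prod_mul_distrib,
      mul_div_cancel_left₀ _ e3]
    ring
  rw [e] at h4
  refine h4.congr' ?_
  filter_upwards [eventually_gt_atTop 0] with q hq
  have hq' : (q : ℂ) ≠ 0 := by exact_mod_cast hq.ne'
  simp only [Pi.div_apply, ratPart]
  rw [div_pow, ← pow_mul, mul_comm (vdmWt n), div_div_div_cancel_right₀ (pow_ne_zero _ hq'),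
    div_div_div_cancel_right₀ (pow_ne_zero _ hq')]

/-! ### Separation of points with different arguments -/

/-- If e^{2(b-a)} were close to 1, its principal logarithm would be small, so the imaginary part of
a - b would be close to a multiple of π. The real parts are arbitrary, so the constant is uniform
along the flow. -/
theorem exists_expo_sub_ge {d : ℝ} (hd : 0 < d) : ∃ c > 0, ∀ a b : ℂ,
    (∀ k : ℤ, d ≤ |(a - b).im - π * k|) → c * ‖expo a‖ ≤ ‖expo a - expo b‖ := by
  refine ⟨min (1 / 2) d, by positivity, fun a b h => ?_⟩
  by_contra! hc
  set t := 2 * (b - a) with ht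
  have e1 : expo a - expo b = expo a * -(exp t - 1) := by
    have : expo b = expo a * exp t := by
      rw [expo, expo, ← exp_add]; congr 1; rw [ht]; ring
    rw [this]; ring
  have hpos : 0 < ‖expo a‖ := norm_pos_iff.2 (expo_ne_zero a)
  rw [e1, norm_mul, norm_neg, mul_comm] at hc
  have h1 : ‖exp t - 1‖ < min (1 / 2) d := lt_of_mul_lt_mul_right hc hpos.le
  have h2 := h1.trans_le (min_le_left _ _)
  have h3 := h1.trans_le (min_le_right _ _)
  have h4 := Complex.norm_log_one_add_half_le_self h2.le
  rw [add_sub_cancel] at h4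
  obtain ⟨k, hk⟩ := Complex.exp_eq_exp_iff_exists_int.1 (exp_log (exp_ne_zero t))
  have h5 : (log (exp t)).im = t.im + k * (2 * π) := by
    rw [hk]; simp
  have h6 : |t.im + k * (2 * π)| < 2 * d := by
    rw [← h5]
    calc _ ≤ _ := abs_im_le_norm _
      _ ≤ 3 / 2 * ‖exp t - 1‖ := h4
      _ < 2 * d := by nlinarith [norm_nonneg (exp t - 1)]
  have h7 : t.im + k * (2 * π) = -2 * ((a - b).im - π * k) := by
    simp only [ht, mul_im, sub_im, Complex.re_ofNat, Complex.im_ofNat]; ring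
  rw [h7, abs_mul, abs_neg, abs_two] at h6
  linarith [h k]

/-- The points `x_i` and `y` have different imaginary parts modulo `π`. -/
structure Gap (d : ℝ) (x : Fin n → ℂ) (y : ℂ) : Prop where
  pos : 0 < d
  xx : ∀ i j, i ≠ j → ∀ k : ℤ, d ≤ |(x i - x j).im - π * k|
  xy : ∀ i, ∀ k : ℤ, d ≤ |(x i - y).im - π * k|

theorem gap_shift {d a b : ℝ} {p p' q q' : ℂ} (h : ∀ k : ℤ, d ≤ |(p - q).im - π * k|)
    (hp : |(p' - p).im| ≤ a) (hq : |(q' - q).im| ≤ b) (k : ℤ) :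
    d - (a + b) ≤ |(p' - q').im - π * k| := by
  have h1 : (p - q).im - π * k
      = ((p' - q').im - π * k) - (p' - p).im + (q' - q).im := by simp; ring
  have h2 := h k
  rw [h1] at h2
  have h3 := abs_add_le (((p' - q').im - π * k) - (p' - p).im) (q' - q).im
  have h4 := abs_sub ((p' - q').im - π * k) (p' - p).im
  linarith

theorem gap_symm {d : ℝ} {p q : ℂ} (h : ∀ k : ℤ, d ≤ |(p - q).im - π * k|) (k : ℤ) :
    d ≤ |(q - p).im - π * k| := by
  have := h (-k)
  rw [← abs_neg] at this
  convert! this using 2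
  push_cast [sub_im]
  ring

/-- The imaginary part of x moves by at most d/4 and that of σ/2 by at most d/8. Each point thus
moves by at most 3d/8, and a gap of d/4 survives between any two. -/
theorem Gap.exists_sep {d : ℝ} {x0 : Fin n → ℂ} {y0 : ℂ} (h : Gap d x0 y0) :
    ∃ c > 0, ∀ (σ x : Fin n → ℂ) (y : ℂ), (∀ i, |(x i - x0 i).im| ≤ d / 4) →
      |(y - y0).im| ≤ d / 4 → (∀ i, |(σ i).im| ≤ d / 4) →
      Sep c shifted(σ, x) expos(x) (expo y) := by
  have hd := h.pos
  obtain ⟨c, hc, hsep⟩ := exists_expo_sub_ge (d := d / 4) (by positivity)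
  refine ⟨c, hc, fun σ x y hx hy hσ => ?_⟩
  have hw : ∀ i, |(x i - σ i / 2 - x0 i).im| ≤ 3 * d / 8 := fun i => by
    have h1 : (x i - σ i / 2 - x0 i).im = (x i - x0 i).im - (σ i).im / 2 := by
      have : (σ i / 2).im = (σ i).im / 2 := by
        rw [show σ i / 2 = σ i * ((1 / 2 : ℝ) : ℂ) by push_cast; ring, im_mul_ofReal]; ring
      simp only [sub_im, this]; ring
    rw [h1]
    have := abs_sub (x i - x0 i).im ((σ i).im / 2)
    rw [abs_div, abs_two] at this
    have := hx i
    have := hσ i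
    linarith
  have hx' : ∀ i, |(x i - x0 i).im| ≤ 3 * d / 8 := fun i => (hx i).trans (by linarith)
  have hy' : |(y - y0).im| ≤ 3 * d / 8 := hy.trans (by linarith)
  have key : ∀ {p q p' q' : ℂ}, (∀ k : ℤ, d ≤ |(p - q).im - π * k|) →
      |(p' - p).im| ≤ 3 * d / 8 → |(q' - q).im| ≤ 3 * d / 8 →
      c * ‖expo p'‖ ≤ ‖expo p' - expo q'‖ ∧ c * ‖expo q'‖ ≤ ‖expo p' - expo q'‖ := by
    intro p q p' q' hpq hp hq
    have h1 : ∀ k : ℤ, d / 4 ≤ |(p' - q').im - π * k| := fun k =>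
      (by linarith : d / 4 ≤ d - (3 * d / 8 + 3 * d / 8)).trans (gap_shift hpq hp hq k)
    refine ⟨hsep _ _ h1, ?_⟩
    rw [norm_sub_rev]
    exact hsep _ _ (gap_symm h1)
  exact ⟨fun i j hij => (key (h.xx i j hij) (hx' i) (hx' j)).1,
    fun i j hij => (key (h.xx i j hij) (hw i) (hw j)).1,
    fun i j hij => key (h.xx i j hij) (hw i) (hx' j),
    fun i => key (h.xy i) (hx' i) hy', fun i => (key (h.xy i) (hw i) hy').1⟩

/-! ### The reduced integrand -/

/-- The integrand divided by its exponential factor. -/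
def reduced (M : ℤ) (k : ℕ) (p : Poly(n)) (b : Fin n → ℂ) (σ x : Fin n → ℂ)
    (y : ℂ) : ℂ :=
  (∏ i, exp (-σ i * b i) * (exp (-σ i) - 1) ^ M)
    * ratPart M k p shifted(σ, x) expos(x) (expo y)

/-- Relabelling the second product in A^* pairs (w_i - u_j) with (u_i - w_j) for i < j. The diagonal
that splits off is the only part that vanishes when w = u. -/
theorem crossStar_eq (w u : Fin n → ℂ) : crossStar w u
    = (∏ i, (w i - u i)) * ∏ i, ∏ j ∈ Ioi i, ((w i - u j) * (u i - w j)) := by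
  have h1 : ∏ i, ∏ j ∈ Iio i, (u j - w i) = ∏ i, ∏ j ∈ Ioi i, (u i - w j) := by
    rw [Finset.prod_comm' (t' := univ) (s' := fun j => Ioi j)]
    simp
  have h2 : ∀ i, ∏ j ∈ Ici i, (w i - u j)
      = (w i - u i) * ∏ j ∈ Ioi i, (w i - u j) := fun i =>
    (Finset.mul_prod_Ioi_eq_prod_Ici i (f := fun j => w i - u j)).symm
  simp only [crossStar, h1, h2, prod_mul_distrib]
  ring

theorem prod_pairFactor (w u : Fin n → ℂ) : ∏ i, ∏ j ∈ Ioi i, pairFactor w u i j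
    = (∏ i, ∏ j ∈ Ioi i, ((w i - u j) * (u i - w j))) / (vdm w * vdm u) := by
  simp only [pairFactor, vdm, prod_div_distrib, prod_mul_distrib]

theorem expo_sub_half (a s : ℂ) : expo (a - s / 2) = expo a * exp (-s) := by
  rw [expo, expo, ← exp_add]; congr 1; ring

/-- All dependence on σ outside the rational part collects into the Euler factors e^{-σ_i b_i}
(e^{-σ_i} - 1)^M, and all exponential dependence on x, y into the plane wave of the deformed
function. -/
theorem dressed_eq {M : ℤ} {k : ℕ} {p : Poly(n)} {μ N : ℂ} {ν : Fin n → ℂ}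
    {Φ : (Fin n → ℂ) → ℂ} {σ x : Fin n → ℂ} {y : ℂ}
    (hΦ : Φ (fun i => x i - σ i / 2) = eval shifted(σ, x) p /
      (vdm shifted(σ, x) ^ k * N) * ∏ i, powx (x i - σ i / 2) (ν i)) :
    dressed M μ Φ σ x y = reduced M k p (fun i => ν i - μ - (M + 1) / 2) σ x y
      * planeWave M ν μ x y / N := by
  unfold dressed reduced planeWave ker ratPart
  rw [hΦ, crossStar_eq, prod_pairFactor]
  set w : Fin n → ℂ := fun i => expo (x i - σ i / 2) with hw
  set u : Fin n → ℂ := fun i => expo (x i) with hu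
  have h1 : ∏ i, (w i - u i) = ∏ i, (u i * (exp (-σ i) - 1)) :=
    prod_congr rfl fun i _ => by simp only [hw, hu, expo_sub_half]; ring
  have h2 : (∏ i, (exp (-σ i * (ν i - μ - (M + 1) / 2)) * (exp (-σ i) - 1) ^ M))
      * ((∏ i, powx (x i) (ν i)) * powx y (μ / M))
      = (∏ i, (u i * (exp (-σ i) - 1))) ^ M *
        exp (2 * ((∑ i, x i) * (μ + (1 - M) / 2) - (∑ i, (x i - σ i / 2)) * (μ + (M + 1) / 2)
          + y * (μ / M))) * ∏ i, powx (x i - σ i / 2) (ν i) := by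
    rw [mul_add, exp_add, mul_sub, sum_mul, sum_mul, mul_sum,
      mul_sum, ← sum_sub_distrib, exp_sum, ← prod_zpow]
    rw [show powx y (μ / M) = exp (2 * (y * (μ / M))) by rw [powx]; congr 1; ring]
    rw [← mul_assoc, ← prod_mul_distrib,
      (by intros; ring : ∀ a b c d : ℂ, a * (b * c) * d = a * b * d * c),
      ← prod_mul_distrib, ← prod_mul_distrib]
    congr 1
    refine prod_congr rfl fun i _ => ?_
    have h3 : u i ^ M = exp (M * (2 * x i)) := by
      rw [exp_int_mul]; rfl
    rw [mul_zpow, h3]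
    simp only [powx]
    have h4 : ∀ a b c d e f : ℂ, a + c = d + e + f → exp a * b * exp c
        = exp d * b * exp e * exp f := fun a b c d e f h => by
      rw [mul_right_comm, ← exp_add, h, exp_add, exp_add]; ring
    apply h4
    ring
  have h3 : ∀ S PW U EX P2 PF cw cu vw vu e vk : ℂ, S * PW = U * EX * P2 →
      U * PF * cw / (vw * vu * cu) * EX * (e / (vk * N) * P2)
        = S * (PF / (vw * vu) * (cw / cu) * (e / vk)) * PW / N := by
    intro S PW U EX P2 PF cw cu vw vu e vk h
    linear_combination -(PF / (vw * vu) * (cw / cu) * (e / vk) / N) * h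
  rw [h1, mul_zpow, div_zpow, mul_zpow]
  exact h3 _ _ _ _ _ _ _ _ _ _ _ _ h2

/-! ### Holomorphy of the reduced integrand -/

section
variable {E : Type*} [NormedAddCommGroup E] [NormedSpace ℂ E]

theorem Sep.ne {c : ℝ} (hc : 0 < c) {w u : Fin n → ℂ} {v : ℂ} (h : Sep c w u v)
    (hw : ∀ i, w i ≠ 0) (hu : ∀ i, u i ≠ 0) :
    (∀ i j, i ≠ j → u i - u j ≠ 0) ∧ (∀ i j, i ≠ j → w i - w j ≠ 0) ∧
      (∀ i j, i ≠ j → w i - u j ≠ 0) ∧ (∀ i, u i - v ≠ 0) ∧ (∀ i, w i - v ≠ 0) := by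
  have key : ∀ {a b : ℂ}, a ≠ 0 → c * ‖a‖ ≤ ‖b‖ → b ≠ 0 := fun ha hb h0 => by
    rw [h0, norm_zero] at hb
    exact absurd hb (not_le.2 (mul_pos hc (norm_pos_iff.2 ha)))
  exact ⟨fun i j hij => key (hu i) (h.uu i j hij), fun i j hij => key (hw i) (h.ww i j hij),
    fun i j hij => key (hw i) (h.wu i j hij).1, fun i => key (hu i) (h.uv i).1,
    fun i => key (hw i) (h.wv i)⟩

theorem diffAt_zpow {f : E → ℂ} {x : E} (hf : DifferentiableAt ℂ f x) {M : ℤ}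
    (h : f x ≠ 0 ∨ 0 ≤ M) : DifferentiableAt ℂ (fun y => f y ^ M) x := by
  have h1 : DifferentiableAt ℂ (fun z : ℂ => z ^ M) (f x) := differentiableAt_zpow.2 h
  exact h1.comp x hf

theorem diffAt_div {f g : E → ℂ} {x : E} (hf : DifferentiableAt ℂ f x)
    (hg : DifferentiableAt ℂ g x) (h : g x ≠ 0) : DifferentiableAt ℂ (fun y => f y / g y) x := by
  simp only [div_eq_mul_inv]
  exact hf.mul (hg.inv h)

theorem diffAt_prod {ι : Type*} {s : Finset ι} {f : ι → E → ℂ} {x : E}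
    (hf : ∀ i ∈ s, DifferentiableAt ℂ (f i) x) : DifferentiableAt ℂ (fun y => ∏ i ∈ s, f i y) x := by
  classical
  induction s using induction_on with
  | empty => simp
  | insert a s ha ih =>
    simp only [prod_insert ha]
    exact (hf a (Finset.mem_insert_self a s)).mul (ih fun i hi => hf i (Finset.mem_insert_of_mem hi))

theorem differentiableAt_eval {f : E → Fin n → ℂ} {x : E} (p : Poly(n))
    (hf : ∀ i, DifferentiableAt ℂ (fun y => f y i) x) :
    DifferentiableAt ℂ (fun y => eval (f y) p) x := by
  simp only [eval_eq']
  fun_prop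

theorem differentiableAt_vdm {f : E → Fin n → ℂ} {x : E}
    (hf : ∀ i, DifferentiableAt ℂ (fun y => f y i) x) :
    DifferentiableAt ℂ (fun y => vdm (f y)) x := by
  unfold vdm
  fun_prop

theorem differentiableAt_cross {f : E → Fin n → ℂ} {g : E → ℂ} {x : E}
    (hf : ∀ i, DifferentiableAt ℂ (fun y => f y i) x) (hg : DifferentiableAt ℂ g x) :
    DifferentiableAt ℂ (fun y => cross (f y) (g y)) x := by
  unfold cross
  fun_prop

theorem differentiableAt_expo {f : E → ℂ} {x : E} (hf : DifferentiableAt ℂ f x) :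
    DifferentiableAt ℂ (fun y => expo (f y)) x := by
  unfold expo
  fun_prop

theorem differentiableAt_ratPart {w u : E → Fin n → ℂ} {v : E → ℂ} {x : E} (M : ℤ) (k : ℕ)
    (p : Poly(n)) (hw : ∀ i, DifferentiableAt ℂ (fun y => w y i) x)
    (hu : ∀ i, DifferentiableAt ℂ (fun y => u y i) x) (hv : DifferentiableAt ℂ v x)
    {c : ℝ} (hc : 0 < c) (hs : Sep c (w x) (u x) (v x)) (hw0 : ∀ i, w x i ≠ 0)
    (hu0 : ∀ i, u x i ≠ 0) : DifferentiableAt ℂ (fun y => ratPart M k p (w y) (u y) (v y)) x := by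
  obtain ⟨n1, n2, n3, n4, -⟩ := hs.ne hc hw0 hu0
  have hpf : ∀ i, ∀ j ∈ Ioi i, DifferentiableAt ℂ (fun y => pairFactor (w y) (u y) i j) x := by
    intro i j hj
    have hij := (mem_Ioi.1 hj).ne
    unfold pairFactor
    exact diffAt_div (((hw i).sub (hu j)).mul ((hu i).sub (hw j))) (((hw i).sub (hw j)).mul
      ((hu i).sub (hu j))) (mul_ne_zero (n2 i j hij) (n1 i j hij))
  have hp0 : ∏ i, ∏ j ∈ Ioi i, pairFactor (w x) (u x) i j ≠ 0 := by
    refine prod_ne_zero_iff.2 fun i _ => prod_ne_zero_iff.2 fun j hj => ?_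
    have hij := (mem_Ioi.1 hj).ne
    refine div_ne_zero (mul_ne_zero (n3 i j hij) ?_) (mul_ne_zero (n2 i j hij) (n1 i j hij))
    rw [← neg_sub]
    exact neg_ne_zero.2 (n3 j i hij.symm)
  have hP : DifferentiableAt ℂ (fun y => ∏ i, ∏ j ∈ Ioi i, pairFactor (w y) (u y) i j) x :=
    diffAt_prod fun i _ => diffAt_prod fun j hj => hpf i j hj
  unfold ratPart
  refine ((diffAt_zpow hP (Or.inl hp0)).mul (diffAt_div (differentiableAt_cross hw hv)
    (differentiableAt_cross hu hv) (prod_ne_zero_iff.2 fun i _ => n4 i))).mul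
    (diffAt_div (differentiableAt_eval p hw) ((differentiableAt_vdm hw).pow k) (pow_ne_zero _ ?_))
  exact prod_ne_zero_iff.2 fun i _ => prod_ne_zero_iff.2 fun j hj =>
    n2 i j (mem_Ioi.1 hj).ne

/-- The separation of the points which enter the integrand. -/
def SepAt (c : ℝ) (σ x : Fin n → ℂ) (y : ℂ) : Prop :=
  Sep c shifted(σ, x) expos(x) (expo y)

theorem differentiableAt_reduced {σ x : E → Fin n → ℂ} {y : E → ℂ} {t : E} (M : ℤ) (k : ℕ)
    (p : Poly(n)) (b : Fin n → ℂ) (hσ : ∀ i, DifferentiableAt ℂ (fun s => σ s i) t)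
    (hx : ∀ i, DifferentiableAt ℂ (fun s => x s i) t) (hy : DifferentiableAt ℂ y t)
    {c : ℝ} (hc : 0 < c) (hs : SepAt c (σ t) (x t) (y t))
    (hM : 0 ≤ M ∨ ∀ i, exp (-σ t i) ≠ 1) :
    DifferentiableAt ℂ (fun s => reduced M k p b (σ s) (x s) (y s)) t := by
  unfold reduced
  refine DifferentiableAt.mul ?_ (differentiableAt_ratPart M k p
    (fun i => differentiableAt_expo ((hx i).sub (diffAt_div (hσ i) (differentiableAt_const (2 : ℂ)) two_ne_zero)))
    (fun i => differentiableAt_expo (hx i)) (differentiableAt_expo hy) hc hs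
    (fun i => expo_ne_zero _) fun i => expo_ne_zero _)
  refine diffAt_prod fun i _ => ?_
  refine DifferentiableAt.mul (by have := hσ i; fun_prop) (diffAt_zpow ?_ ?_)
  · have := hσ i; fun_prop
  · rcases hM with hM | hM
    · exact Or.inr hM
    · exact Or.inl (sub_ne_zero.2 (hM i))

theorem differentiableAt_cth {a b : E → ℂ} {t : E} (ha : DifferentiableAt ℂ a t)
    (hb : DifferentiableAt ℂ b t) (h : a t - b t ≠ 0) :
    DifferentiableAt ℂ (fun s => cth (a s) (b s)) t := by
  unfold cth
  exact diffAt_div (ha.add hb) (ha.sub hb) h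

theorem differentiableAt_logZX {w u : E → Fin n → ℂ} {v : E → ℂ} {x : E} (M : ℤ)
    (hw : ∀ i, DifferentiableAt ℂ (fun y => w y i) x)
    (hu : ∀ i, DifferentiableAt ℂ (fun y => u y i) x) (hv : DifferentiableAt ℂ v x)
    {c : ℝ} (hc : 0 < c) (hs : Sep c (w x) (u x) (v x)) (hw0 : ∀ i, w x i ≠ 0)
    (hu0 : ∀ i, u x i ≠ 0) (i : Fin n) :
    DifferentiableAt ℂ (fun y => logZX M (w y) (u y) (v y) i) x := by
  obtain ⟨n1, n2, n3, n4, n5⟩ := hs.ne hc hw0 hu0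
  unfold logZX
  refine ((DifferentiableAt.const_mul (DifferentiableAt.fun_sum fun j _ => ?_) _).add
    (differentiableAt_cth (hw i) hv (n5 i))).sub (differentiableAt_cth (hu i) hv (n4 i))
  by_cases h : i = j
  · subst h
    simp only [cth_self, sub_self]
    exact differentiableAt_const _
  · exact (((differentiableAt_cth (hw i) (hu j) (n3 i j h)).sub
      (differentiableAt_cth (hw j) (hu i) (n3 j i (Ne.symm h)))).sub
      (differentiableAt_cth (hw i) (hw j) (n2 i j h))).sub (differentiableAt_cth (hu i) (hu j) (n1 i j h))

theorem norm_cth_le {c : ℝ} (hc : 0 < c) {a b : ℂ} (ha : a ≠ 0) (h1 : c * ‖a‖ ≤ ‖a - b‖)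
    (h2 : c * ‖b‖ ≤ ‖a - b‖) : ‖cth a b‖ ≤ 2 / c := by
  have h0 : 0 < ‖a - b‖ := lt_of_lt_of_le (mul_pos hc (norm_pos_iff.2 ha)) h1
  rw [cth, norm_div, div_le_div_iff₀ h0 hc]
  have := norm_add_le a b
  nlinarith

theorem Sep.wv' {c : ℝ} {w u : Fin n → ℂ} {v : ℂ} (h : Sep c w u v) (hc : 0 < c) (i : Fin n)
    (hc1 : c ≤ 1) : c / 2 * ‖v‖ ≤ ‖w i - v‖ := by
  have h1 := h.wv i
  have h2 : ‖v‖ ≤ ‖w i‖ + ‖w i - v‖ := by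
    have := norm_sub_le (w i) (w i - v); rwa [sub_sub_cancel] at this
  nlinarith [norm_nonneg (w i - v), norm_nonneg v, norm_nonneg (w i)]

/-- Every coth between separated points is at most of order 1/c. The j = i term, which could have a
pole at w_i = u_i, is identically zero. -/
theorem norm_logZX_le {c : ℝ} (hc : 0 < c) (hc1 : c ≤ 1) {w u : Fin n → ℂ} {v : ℂ} (M : ℤ)
    (hs : Sep c w u v) (hw0 : ∀ i, w i ≠ 0) (hu0 : ∀ i, u i ≠ 0) (i : Fin n) :
    ‖logZX M w u v i‖ ≤ ‖(M : ℂ)‖ * (n * (8 / c)) + 6 / c := by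
  have hc2 : 0 < c / 2 := by positivity
  have b1 : ‖cth (w i) v‖ ≤ 2 / (c / 2) := norm_cth_le hc2 (hw0 i)
    (by have := hs.wv i; nlinarith [norm_nonneg (w i)]) (hs.wv' hc i hc1)
  have b2 : ‖cth (u i) v‖ ≤ 2 / c := norm_cth_le hc (hu0 i) (hs.uv i).1 (hs.uv i).2
  have sw : ∀ {x : Fin n → ℂ}, (∀ i, x i ≠ 0) → (∀ i j, i ≠ j → c * ‖x i‖ ≤ ‖x i - x j‖) →
      ∀ i j, i ≠ j → ‖cth (x i) (x j)‖ ≤ 2 / c := fun {x} h0 h i j hij =>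
    norm_cth_le hc (h0 i) (h i j hij) (by rw [norm_sub_rev]; exact h j i hij.symm)
  have b3 : ∀ j, ‖cth (w i) (u j) - cth (w j) (u i) - cth (w i) (w j) - cth (u i) (u j)‖ ≤ 8 / c := by
    intro j
    by_cases h : i = j
    · subst h; simp only [cth_self, sub_self, norm_zero]; positivity
    · refine (norm_sub_le _ _).trans ?_
      have := norm_sub_le (cth (w i) (u j) - cth (w j) (u i)) (cth (w i) (w j))
      have := norm_sub_le (cth (w i) (u j)) (cth (w j) (u i))
      have h1 := norm_cth_le hc (hw0 i) (hs.wu i j h).1 (hs.wu i j h).2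
      have h2 := norm_cth_le hc (hw0 j) (hs.wu j i (Ne.symm h)).1 (hs.wu j i (Ne.symm h)).2
      have h3 := sw hw0 hs.ww i j h
      have h4 := sw hu0 hs.uu i j h
      have h5 : 8 / c = 2 / c + 2 / c + 2 / c + 2 / c := by ring
      linarith
  have b4 : ‖∑ j, (cth (w i) (u j) - cth (w j) (u i) - cth (w i) (w j) - cth (u i) (u j))‖
      ≤ n * (8 / c) := by
    refine (norm_sum_le_of_le _ fun j _ => b3 j).trans (le_of_eq ?_)
    simp
  rw [logZX]
  refine (norm_sub_le _ _).trans ?_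
  have h1 := norm_add_le ((M : ℂ) * ∑ j, (cth (w i) (u j) - cth (w j) (u i) - cth (w i) (w j)
    - cth (u i) (u j))) (cth (w i) v)
  rw [norm_mul] at h1
  have h2 := mul_le_mul_of_nonneg_left b4 (norm_nonneg (M : ℂ))
  have h3 : 6 / c = 2 / (c / 2) + 2 / c := by field_simp; norm_num
  linarith

end

/-! ### The integral is an eigenfunction -/

theorem hasDerivAt_flow {f : (Fin n → ℂ) → ℂ} {x : Fin n → ℂ} (hf : DifferentiableAt ℂ f x) :
    HasDerivAt (fun r : ℂ => f (flow x r))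
      (∑ i, kap i * deriv (fun t => f (update x i t)) (x i)) 0 := by
  have h1 : ∀ i, deriv (fun t => f (update x i t)) (x i)
      = fderiv ℂ f x (Pi.single i 1) := by
    intro i
    have h2 : HasDerivAt (fun t => update x i t) (Pi.single i 1) (x i) := by
      rw [hasDerivAt_pi]
      intro j
      simpa using hasDerivAt_update x i 0 (x i) j
    have h3 : HasFDerivAt f (fderiv ℂ f x) (update x i (x i)) := by
      rw [update_eq_self]; exact hf.hasFDerivAt
    exact (h3.comp_hasDerivAt (x i) h2).deriv
  have h4 : HasDerivAt (fun r : ℂ => flow x r) (fun i => (kap i : ℂ)) 0 := by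
    rw [hasDerivAt_pi]
    intro i
    simpa [flow] using ((hasDerivAt_id (0 : ℂ)).mul_const (kap i : ℂ)).const_add (x i)
  have h5 : HasFDerivAt f (fderiv ℂ f x) (flow x 0) := by
    rw [flow_zero]; exact hf.hasFDerivAt
  have h6 := h5.comp_hasDerivAt (0 : ℂ) h4
  convert! h6 using 1
  rw [pi_eq_sum_univ (fun i => (kap i : ℂ)), map_sum]
  refine sum_congr rfl fun i _ => ?_
  rw [h1, map_smul, smul_eq_mul]
  congr 2
  funext j
  simp [Pi.single_apply, eq_comm]

theorem sutherland_congr {M : ℤ} {f g : (Fin n → ℂ) → ℂ} {z : Fin n → ℂ} (h : f =ᶠ[𝓝 z] g) :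
    sutherland M f z = sutherland M g z := by
  have h1 : ∀ i, partial2 f i z = partial2 g i z := by
    intro i
    refine Filter.EventuallyEq.iteratedDeriv_eq 2 ?_
    have hc : Tendsto (fun t => update z i t) (𝓝 (z i)) (𝓝 z) := by
      have : Continuous fun t => update z i t := continuous_const.update i continuous_id
      simpa using this.tendsto (z i)
    exact hc.eventually h
  simp only [sutherland, h1, h.self_of_nhds]

/-- The explicit form of a Baker-Akhiezer function. -/
def baForm (k : ℕ) (N : ℂ) (p : Poly(n)) (ν z : Fin n → ℂ) : ℂ :=
  eval expos(z) p / (vdm expos(z) ^ k * N)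
    * ∏ i, powx (z i) (ν i)

theorem continuous_vdm_expo : Continuous fun z : Fin n → ℂ => vdm fun i => expo (z i) := by
  unfold vdm expo
  fun_prop

theorem differentiableAt_baForm (k : ℕ) {N : ℂ} (hN : N ≠ 0) (p : Poly(n))
    (ν : Fin n → ℂ) {z : Fin n → ℂ} (hz : vdm expos(z) ≠ 0) :
    DifferentiableAt ℂ (baForm k N p ν) z := by
  have hd : ∀ i, DifferentiableAt ℂ (fun z : Fin n → ℂ => expo (z i)) z := fun i =>
    differentiableAt_expo (by fun_prop)
  unfold baForm
  refine (diffAt_div (differentiableAt_eval p hd) (((differentiableAt_vdm hd).pow k).mul_const N)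
    (mul_ne_zero (pow_ne_zero _ hz) hN)).mul (diffAt_prod fun i _ => ?_)
  unfold powx
  fun_prop

theorem analyticAt_baForm (k : ℕ) {N : ℂ} (hN : N ≠ 0) (p : Poly(n))
    (ν : Fin n → ℂ) {z : Fin n → ℂ} (hz : vdm expos(z) ≠ 0) (i : Fin n) :
    AnalyticAt ℂ (fun t => baForm k N p ν (update z i t)) (z i) := by
  rw [Complex.analyticAt_iff_eventually_differentiableAt]
  have hc : Continuous fun t => update z i t := continuous_const.update i continuous_id
  have h1 : ∀ᶠ t in 𝓝 (z i), vdm (fun j => expo (update z i t j)) ≠ 0 := by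
    refine (continuous_vdm_expo.comp hc).continuousAt.eventually_ne ?_
    simpa using hz
  filter_upwards [h1] with t ht
  refine DifferentiableAt.comp (g := baForm k N p ν) t (differentiableAt_baForm k hN p ν ht) ?_
  rw [differentiableAt_pi]
  intro j
  have := (hasDerivAt_update z i 0 t j).differentiableAt
  simpa using this

/-- Separation says nothing about w_i against u_i with the same index; that case is what e^{-σ_i} ≠
1 excludes. -/
theorem SepAt.injective {c : ℝ} (hc : 0 < c) {σ x : Fin n → ℂ} {y : ℂ} (h : SepAt c σ x y)
    (hσ : ∀ i, exp (-σ i) ≠ 1) : Injective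
      (pts shifted(σ, x) expos(x) (expo y)) := by
  obtain ⟨n1, n2, n3, n4, n5⟩ := Sep.ne hc h (fun i => expo_ne_zero _) fun i => expo_ne_zero _
  have n6 : ∀ i j, expo (x i - σ i / 2) ≠ expo (x j) := by
    intro i j
    rcases eq_or_ne i j with rfl | hij
    · rw [expo_sub_half]
      intro he
      exact hσ i (mul_left_cancel₀ (expo_ne_zero (x i)) (by rw [he, mul_one]))
    · exact sub_ne_zero.1 (n3 i j hij)
  rintro (_ | i | i) (_ | j | j) h
  · rfl
  · exact absurd h.symm (sub_ne_zero.1 (n5 j))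
  · exact absurd h.symm (sub_ne_zero.1 (n4 j))
  · exact absurd h (sub_ne_zero.1 (n5 i))
  · by_contra hne
    exact n2 i j (fun hij => hne (by rw [hij])) (sub_eq_zero.2 h)
  · exact absurd h (n6 i j)
  · exact absurd h (sub_ne_zero.1 (n4 i))
  · exact absurd h.symm (n6 j i)
  · by_contra hne
    exact n1 i j (fun hij => hne (by rw [hij])) (sub_eq_zero.2 h)

theorem SepAt.vdm_ne_zero {c : ℝ} (hc : 0 < c) {σ x : Fin n → ℂ} {y : ℂ} (h : SepAt c σ x y) :
    vdm shifted(σ, x) ≠ 0 ∧ vdm expos(x) ≠ 0 ∧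
      cross expos(x) (expo y) ≠ 0 := by
  obtain ⟨n1, n2, n3, n4, n5⟩ := Sep.ne hc h (fun i => expo_ne_zero _) fun i => expo_ne_zero _
  exact ⟨prod_ne_zero_iff.2 fun i _ => prod_ne_zero_iff.2 fun j hj =>
      n2 i j (mem_Ioi.1 hj).ne,
    prod_ne_zero_iff.2 fun i _ => prod_ne_zero_iff.2 fun j hj =>
      n1 i j (mem_Ioi.1 hj).ne, prod_ne_zero_iff.2 fun i _ => n4 i⟩

theorem measurable_reduced {X : Type*} [MeasurableSpace X] (M : ℤ) (k : ℕ) (p : Poly(n))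
    (b : Fin n → ℂ) {σ : X → Fin n → ℂ} (hσ : ∀ i, Measurable fun ξ => σ ξ i) (x : Fin n → ℂ) (y : ℂ) :
    Measurable fun ξ => reduced M k p b (σ ξ) x y := by
  have hw : ∀ i, Measurable fun ξ => expo (x i - σ ξ i / 2) := fun i => by
    have := hσ i
    unfold expo
    fun_prop
  unfold reduced ratPart pairFactor cross vdm
  simp only [eval_eq']
  have hz : ∀ f : X → ℂ, Measurable f → Measurable fun ξ => f ξ ^ M := fun f hf => hf.pow_const M
  refine Measurable.mul ?_ (Measurable.mul (Measurable.mul (hz _ ?_) ?_) ?_)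
  · refine measurable_prod _ fun i _ => Measurable.mul ?_ (hz _ ?_)
    · have := hσ i; fun_prop
    · have := hσ i; fun_prop
  · fun_prop
  · fun_prop
  · fun_prop

/-- Integrals which vanish in one variable vanish. -/
theorem integral_pi_eq_zero {S : Set ℝ} (hS : MeasurableSet S) (i : Fin n) (W : (Fin n → ℝ) → ℂ)
    (h : ∀ ξ : Fin n → ℝ, (∀ j, j ≠ i → ξ j ∈ S) → ∫ t in S, W (update ξ i t) = 0) :
    ∫ ξ, W ξ ∂pow(n, S) = 0 := by
  obtain _ | n := n
  · exact i.elim0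
  -- For a non-integrable function the integral is 0 by convention, so integrability need not be
  -- assumed.
  by_cases hW : Integrable W (Measure.pi fun _ : Fin (n + 1) => (volume : Measure ℝ).restrict S)
  swap
  · exact integral_undef hW
  have hmp := (measurePreserving_piFinSuccAbove
    (fun _ : Fin (n + 1) => (volume : Measure ℝ).restrict S) i).symm
  have h1 := hmp.integral_comp (MeasurableEquiv.measurableEmbedding _) W
  rw [← h1]
  have h2 := (hmp.integrable_comp_emb (MeasurableEquiv.measurableEmbedding _) (g := W)).2 hW
  refine (integral_prod_symm _ h2).trans ?_
  refine integral_eq_zero_of_ae ?_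
  have h3 : ∀ᵐ r ∂pow(n, S), ∀ j, r j ∈ S := by
    rw [← Measure.restrict_pi_pi]
    filter_upwards [ae_restrict_mem (MeasurableSet.univ_pi fun _ => hS)] with r hr j
    exact hr j (Set.mem_univ j)
  filter_upwards [h3] with r hr
  have h4 := h (i.insertNth 0 r) fun j hj => by
    obtain ⟨j', rfl⟩ := Fin.exists_succAbove_eq hj
    simpa using hr j'
  refine Eq.trans ?_ h4
  exact integral_congr_ae (Eventually.of_forall fun t =>
    congrArg W (Fin.update_insertNth (α := fun _ => ℝ) i 0 t r).symm)

theorem HoloFam.mul_entire {X : Type*} [MeasurableSpace X] {m : Measure X} {f : X → ℂ → ℂ} {c : ℂ}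
    {R : ℝ} (h : HoloFam m f c R) {g : ℂ → ℂ} (hg : Differentiable ℂ g) :
    HoloFam m (fun ξ t => f ξ t * g t) c R := by
  obtain ⟨K, hK⟩ := (isCompact_closedBall c R).exists_bound_of_continuousOn hg.continuous.continuousOn
  obtain ⟨b, hb, hle⟩ := h.bound
  refine ⟨h.diff.mono fun ξ hξ => hξ.mul hg.differentiableOn, fun t ht => (h.meas t ht).mul_const _,
    fun ξ => b ξ * K, hb.mul_const K, hle.mono fun ξ hξ t ht => ?_⟩
  rw [norm_mul]
  exact mul_le_mul (hξ t ht) (hK t (Metric.ball_subset_closedBall ht)) (norm_nonneg _)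
    ((norm_nonneg _).trans (hξ t ht))

/-- The reduced flux through the faces `σ_i = const`. -/
def fluxRed {n : ℕ} (M : ℤ) (k : ℕ) (p : Poly(n)) (b x : Fin n → ℂ) (y : ℂ) (i : Fin n)
    (σ : Fin n → ℂ) : ℂ :=
  logZX M (fun j => expo (x j - σ j / 2)) (fun j => expo (x j)) (expo y) i * reduced M k p b σ x y

theorem differentiableAt_fluxRed {n : ℕ} {M : ℤ} (k : ℕ) (p : Poly(n)) (b : Fin n → ℂ)
    {x : Fin n → ℂ} {y : ℂ} (i : Fin n) {c : ℝ} (hc : 0 < c) {σ : ℂ → Fin n → ℂ} {t : ℂ}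
    (hσ : ∀ j, DifferentiableAt ℂ (fun s => σ s j) t) (hs : SepAt c (σ t) x y)
    (hM : 0 ≤ M ∨ ∀ j, exp (-σ t j) ≠ 1) :
    DifferentiableAt ℂ (fun s => fluxRed M k p b x y i (σ s)) t := by
  have k1 := differentiableAt_logZX (x := t) (u := fun _ j => expo (x j)) (v := fun _ => expo y)
    (w := fun s j => expo (x j - σ s j / 2)) M
    (fun j => differentiableAt_expo (DifferentiableAt.sub (differentiableAt_const (x j))
      (diffAt_div (hσ j) (differentiableAt_const (2 : ℂ)) two_ne_zero)))
    (fun j => differentiableAt_const _) (differentiableAt_const _) hc hs (fun i => expo_ne_zero _)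
    (fun i => expo_ne_zero _) i
  have k2 := differentiableAt_reduced (t := t) (σ := σ) (x := fun _ => x) (y := fun _ => y) M k p b hσ
    (fun j => differentiableAt_const _) (differentiableAt_const _) hc hs hM
  exact k1.mul k2

theorem measurable_logZX {n : ℕ} {X : Type*} [MeasurableSpace X] (M : ℤ) {w : X → Fin n → ℂ}
    (hw : ∀ i, Measurable fun ξ => w ξ i) (u : Fin n → ℂ) (v : ℂ) (i : Fin n) :
    Measurable fun ξ => logZX M (w ξ) u v i := by
  unfold logZX cth
  fun_prop

theorem measurable_fluxRed {n : ℕ} {X : Type*} [MeasurableSpace X] (M : ℤ) (k : ℕ)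
    (p : Poly(n)) (b x : Fin n → ℂ) (y : ℂ) (i : Fin n) {σ : X → Fin n → ℂ}
    (hσ : ∀ i, Measurable fun ξ => σ ξ i) : Measurable fun ξ => fluxRed M k p b x y i (σ ξ) := by
  have h1 : Measurable fun ξ => logZX M (fun j => expo (x j - σ ξ j / 2)) (fun j => expo (x j))
      (expo y) i := measurable_logZX M (w := fun ξ j => expo (x j - σ ξ j / 2)) (fun j => by
        have := hσ j
        unfold expo
        fun_prop) _ _ i
  exact h1.mul (measurable_reduced M k p b hσ x y)

/-- The flux is the integrand times a factor bounded in terms of the separation, so it inherits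
every bound and decay of the integrand. -/
theorem norm_fluxRed_le {n : ℕ} (M : ℤ) {c : ℝ} (hc : 0 < c) : ∃ K : ℝ, 0 ≤ K ∧ ∀ (k : ℕ)
    (p : Poly(n)) (b x : Fin n → ℂ) (y : ℂ) (i : Fin n) (σ : Fin n → ℂ),
    SepAt c σ x y → ‖fluxRed M k p b x y i σ‖ ≤ K * ‖reduced M k p b σ x y‖ := by
  set c1 := min c 1 with hc1
  have hc1p : 0 < c1 := by positivity
  refine ⟨‖(M : ℂ)‖ * (n * (8 / c1)) + 6 / c1, by positivity, fun k p b x y i σ h1 => ?_⟩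
  have hle : ∀ {a b : ℝ}, 0 ≤ a → c * a ≤ b → c1 * a ≤ b := fun ha hb =>
    (mul_le_mul_of_nonneg_right (min_le_left _ _) ha).trans hb
  have h1' : SepAt c1 σ x y := ⟨fun i j hij => hle (norm_nonneg _) (h1.uu i j hij),
    fun i j hij => hle (norm_nonneg _) (h1.ww i j hij),
    fun i j hij => ⟨hle (norm_nonneg _) (h1.wu i j hij).1, hle (norm_nonneg _) (h1.wu i j hij).2⟩,
    fun i => ⟨hle (norm_nonneg _) (h1.uv i).1, hle (norm_nonneg _) (h1.uv i).2⟩,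
    fun i => hle (norm_nonneg _) (h1.wv i)⟩
  rw [fluxRed, norm_mul]
  exact mul_le_mul_of_nonneg_right (norm_logZX_le hc1p (min_le_right _ _) M h1'
    (fun i => expo_ne_zero _) (fun i => expo_ne_zero _) i) (norm_nonneg _)

/-- Integrability of derivatives from a Cauchy estimate. -/
theorem integrable_deriv_shift {X : Type*} [MeasurableSpace X] {m : Measure X} {L : X → ℂ → ℂ}
    {J : X → ℂ} {a : X → ℂ} {δ : ℝ} (hδ : 0 < δ)
    (hL : ∀ᵐ ξ ∂m, DifferentiableOn ℂ (L ξ) (ball (a ξ) δ))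
    (hm : ∀ s : ℂ, AEStronglyMeasurable (fun ξ => L ξ (a ξ + s) * J ξ) m) {B : X → ℝ}
    (hB : Integrable B m) (hle : ∀ᵐ ξ ∂m, ∀ s ∈ ball (a ξ) δ, ‖L ξ s * J ξ‖ ≤ B ξ) :
    Integrable (fun ξ => deriv (L ξ) (a ξ) * J ξ) m := by
  have hball : ∀ (ξ : X), ∀ s ∈ ball (0 : ℂ) δ, a ξ + s ∈ ball (a ξ) δ :=
    fun ξ s hs => by simpa [dist_eq_norm] using hs
  have hfam : HoloFam m (fun ξ s => L ξ (a ξ + s) * J ξ) 0 δ := by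
    refine ⟨hL.mono fun ξ hξ => DifferentiableOn.mul_const ?_ _, fun s _ => hm s, B, hB,
      hle.mono fun ξ hξ s hs => hξ _ (hball ξ s hs)⟩
    exact hξ.comp (by fun_prop : Differentiable ℂ fun s => a ξ + s).differentiableOn (hball ξ)
  refine (hfam.integrable_deriv (mem_ball_self hδ)).congr (hL.mono fun ξ hξ => ?_)
  have h2 : HasDerivAt (L ξ) (deriv (L ξ) (a ξ)) (a ξ + 0) := by
    rw [add_zero]
    exact (hξ.differentiableAt (ball_mem_nhds _ hδ)).hasDerivAt
  have h3 : HasDerivAt (fun s : ℂ => a ξ + s) 1 0 := (hasDerivAt_id _).const_add _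
  have h4 := ((HasDerivAt.comp (h := fun s : ℂ => a ξ + s) 0 h2 h3).mul_const (J ξ)).deriv
  rw [mul_one] at h4
  exact h4

/-- The conditions on a family of contours under which the integral of the dressed kernel is an
eigenfunction. The points of the contour are `σ_i = γ_i(ξ_i)` with `ξ_i ∈ S`. -/
structure Contour {n : ℕ} (M : ℤ) (k : ℕ) (p : Poly(n)) (b : Fin n → ℂ) (S : Set ℝ)
    (γ γ' : Fin n → ℝ → ℂ) (x : Fin n → ℂ) (y : ℂ) (δ : ℝ) : Prop where
  pos : 0 < δ
  meas : MeasurableSet S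
  mγ : ∀ i, Measurable (γ i)
  mγ' : ∀ i, Measurable (γ' i)
  ne_one : ∀ i, ∀ t ∈ S, exp (-γ i t) ≠ 1
  near : ∃ c > 0, ∃ B : (Fin n → ℝ) → ℝ,
    Integrable B pow(n, S) ∧
    ∀ ξ : Fin n → ℝ, (∀ i, ξ i ∈ S) → ∀ (σ' x' : Fin n → ℂ) (y' : ℂ),
      (∀ i, ‖σ' i - γ i (ξ i)‖ < δ) → (∀ i, ‖x' i - x i‖ < δ) → ‖y' - y‖ < δ →
      SepAt c σ' x' y' ∧ (0 ≤ M ∨ ∀ i, exp (-σ' i) ≠ 1) ∧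
        ‖reduced M k p b σ' x' y' * ∏ i, γ' i (ξ i)‖ ≤ B ξ
  fluxInt : ∀ i, ∀ ξ : Fin n → ℝ, (∀ j, j ≠ i → ξ j ∈ S) → ∫ t in S, deriv (fun s =>
      fluxRed M k p b x y i (update (fun j => γ j (ξ j)) i s)) (γ i t) * γ' i t = 0

section
variable {M : ℤ} {k : ℕ} {p : Poly(n)} {S : Set ℝ}
  {γ γ' : Fin n → ℝ → ℂ} {x : Fin n → ℂ} {y : ℂ} {δ : ℝ}

theorem norm_update_sub_lt (a : Fin n → ℂ) (i : Fin n) (hδ : 0 < δ) {t : ℂ}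
    (ht : t ∈ ball (a i) δ) (j : Fin n) : ‖update a i t j - a j‖ < δ := by
  rcases eq_or_ne j i with rfl | h
  · simpa [dist_eq_norm] using ht
  · simpa [h] using hδ

set_option maxHeartbeats 400000 in
/-- The integral of the dressed kernel along a contour is an eigenfunction. -/
theorem Contour.eigenAt (hM : M ≠ 0) {N μ : ℂ} (hN : N ≠ 0) {ν : Fin n → ℂ}
    (h : Contour M k p (fun i => ν i - μ - (M + 1) / 2) S γ γ' x y δ)
    (hE : ∀ z : Fin n → ℂ, vdm expos(z) ≠ 0 → sutherland M (baForm k N p ν) z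
      = -4 * (∑ i, ν i ^ 2) * baForm k N p ν z) :
    EigenAt M (-4 * (∑ i, ν i ^ 2 + μ ^ 2 / M)) (fun x y =>
      (∫ ξ, reduced M k p (fun i => ν i - μ - (M + 1) / 2) (fun i => γ i (ξ i)) x y * ∏ i, γ' i (ξ i)
        ∂pow(n, S)) * planeWave M ν μ x y)
      x y δ := by
  set b : Fin n → ℂ := fun i => ν i - μ - (M + 1) / 2 with hb
  set m := pow(n, S) with hm
  have hδ := h.pos
  obtain ⟨c, hc, B, hBi, hnear⟩ := h.near
  have hS : ∀ᵐ ξ ∂m, ∀ i, ξ i ∈ S := by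
    rw [hm, ← Measure.restrict_pi_pi]
    filter_upwards [ae_restrict_mem (MeasurableSet.univ_pi fun _ => h.meas)] with ξ hξ i
    exact hξ i (Set.mem_univ i)
  have hmσ : ∀ i, Measurable fun ξ : Fin n → ℝ => γ i (ξ i) := fun i =>
    (h.mγ i).comp (measurable_pi_apply i)
  have hmJ : Measurable fun ξ : Fin n → ℝ => ∏ i, γ' i (ξ i) :=
    measurable_prod _ fun i _ => (h.mγ' i).comp (measurable_pi_apply i)
  have hself : ∀ (a : Fin n → ℂ) i, ‖a i - a i‖ < δ := fun a i => by simpa using hδ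
  have hselfy : ‖y - y‖ < δ := by simpa using hδ
  -- holomorphic families for the reduced integrand
  have fam : ∀ (X : ℂ → Fin n → ℂ) (Y : ℂ → ℂ) (a : ℂ) (ρ : ℝ),
      (∀ t ∈ ball a ρ, (∀ i, ‖X t i - x i‖ < δ) ∧ ‖Y t - y‖ < δ) →
      (∀ i, Differentiable ℂ fun t => X t i) → Differentiable ℂ Y →
      HoloFam m (fun ξ t => reduced M k p b (fun i => γ i (ξ i)) (X t) (Y t) * ∏ i, γ' i (ξ i)) a ρ := by
    intro X Y a ρ hXY hX hY
    refine ⟨?_, fun t ht => ?_, B, hBi, ?_⟩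
    · filter_upwards [hS] with ξ hξ t ht
      obtain ⟨h1, h2, -⟩ := hnear ξ hξ _ (X t) (Y t) (hself _) (hXY t ht).1 (hXY t ht).2
      have h3 := differentiableAt_reduced M k p b (σ := fun _ : ℂ => fun i => γ i (ξ i)) (x := X)
        (y := Y) (t := t) (fun i => differentiableAt_const _) (fun i => hX i t) (hY t) hc h1 h2
      exact (h3.mul_const _).differentiableWithinAt
    · exact ((measurable_reduced M k p b hmσ (X t) (Y t)).mul hmJ).aestronglyMeasurable
    · filter_upwards [hS] with ξ hξ t ht
      exact (hnear ξ hξ _ (X t) (Y t) (hself _) (hXY t ht).1 (hXY t ht).2).2.2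
  set f : (Fin n → ℝ) → (Fin n → ℂ) → ℂ → ℂ := fun ξ x y =>
    (reduced M k p b (fun i => γ i (ξ i)) x y * ∏ i, γ' i (ξ i)) * planeWave M ν μ x y with hf
  have hfd : ∀ ξ x y, f ξ x y = (N * ∏ i, γ' i (ξ i)) *
      dressed M μ (baForm k N p ν) (fun i => γ i (ξ i)) x y := by
    intro ξ x y
    rw [dressed_eq (M := M) (k := k) (p := p) (N := N) (ν := ν) rfl]
    have g : ∀ J R P : ℂ, R * J * P = N * J * (R * P / N) := fun J R P => by field_simp
    exact g _ _ _
  -- the flux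
  set L : (Fin n → ℂ) → Fin n → ℂ := fun σ i => fluxRed M k p b x y i σ with hL
  have hflux : ∀ σ i, flux M μ (baForm k N p ν) i σ x y = 4 * planeWave M ν μ x y / N * L σ i := by
    intro σ i
    rw [flux, dressed_eq (M := M) (k := k) (p := p) (N := N) (ν := ν) rfl]
    simp only [hL, fluxRed]
    ring
  set W : Fin n → (Fin n → ℝ) → ℂ := fun i ξ => (4 * planeWave M ν μ x y) *
    (deriv (fun s => L (update (fun j => γ j (ξ j)) i s) i) (γ i (ξ i)) * ∏ j, γ' j (ξ j))
    with hW
  have hLdiff : ∀ ξ : Fin n → ℝ, (∀ i, ξ i ∈ S) → ∀ i, DifferentiableOn ℂ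
      (fun s => L (update (fun j => γ j (ξ j)) i s) i) (ball (γ i (ξ i)) δ) := by
    intro ξ hξ i s hs
    obtain ⟨h1, h2, -⟩ := hnear ξ hξ (update (fun j => γ j (ξ j)) i s) x y
      (norm_update_sub_lt (fun j => γ j (ξ j)) i hδ hs) (hself x) hselfy
    have hu : ∀ j, DifferentiableAt ℂ (fun s => update (fun j => γ j (ξ j)) i s j) s := by
      intro j
      have := (hasDerivAt_update (fun j => γ j (ξ j)) i 0 s j).differentiableAt
      simpa using this
    have k1 := differentiableAt_fluxRed (M := M) k p b (x := x) (y := y) (t := s) i hc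
      (σ := fun s => update (fun j => γ j (ξ j)) i s) hu h1 h2
    exact k1.differentiableWithinAt
  have hWi : ∀ i, Integrable (W i) m := by
    intro i
    refine Integrable.const_mul ?_ _
    obtain ⟨K, hK0, hK⟩ := norm_fluxRed_le (n := n) M hc
    have hA : ∀ᵐ ξ ∂m, DifferentiableOn ℂ
        (fun s => L (update (fun j => γ j (ξ j)) i s) i) (ball (γ i (ξ i)) δ) :=
      hS.mono fun ξ hξ => hLdiff ξ hξ i
    have hB : ∀ s : ℂ, AEStronglyMeasurable (fun ξ : Fin n → ℝ =>
        L (update (fun j => γ j (ξ j)) i (γ i (ξ i) + s)) i * ∏ j, γ' j (ξ j)) m := by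
      intro s
      have hmu : ∀ j, Measurable fun ξ : Fin n → ℝ =>
          update (fun j => γ j (ξ j)) i (γ i (ξ i) + s) j := by
        intro j
        rcases eq_or_ne j i with rfl | hj
        · simpa using (hmσ j).add_const s
        · simpa [hj] using hmσ j
      exact (Measurable.mul (measurable_fluxRed M k p b x y i hmu) hmJ).aestronglyMeasurable
    have hC : ∀ᵐ ξ ∂m, ∀ s ∈ ball (γ i (ξ i)) δ,
        ‖L (update (fun j => γ j (ξ j)) i s) i * ∏ j, γ' j (ξ j)‖ ≤ K * B ξ := by
      filter_upwards [hS] with ξ hξ s hs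
      obtain ⟨h1, -, h3⟩ := hnear ξ hξ (update (fun j => γ j (ξ j)) i s) x y
        (norm_update_sub_lt (fun j => γ j (ξ j)) i hδ hs) (hself x) hselfy
      rw [norm_mul] at h3 ⊢
      calc _ ≤ (K * ‖reduced M k p b (update (fun j => γ j (ξ j)) i s) x y‖)
            * ‖∏ j, γ' j (ξ j)‖ := mul_le_mul_of_nonneg_right (hK _ _ _ _ _ _ _ h1) (norm_nonneg _)
        _ ≤ K * B ξ := by rw [mul_assoc]; exact mul_le_mul_of_nonneg_left h3 hK0
    exact integrable_deriv_shift (m := m) (a := fun ξ => γ i (ξ i))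
      (L := fun ξ s => L (update (fun j => γ j (ξ j)) i s) i)
      (J := fun ξ => ∏ j, γ' j (ξ j)) (B := fun ξ => K * B ξ) hδ hA hB (hBi.const_mul K) hC
  have hW0 : ∀ i, ∫ ξ, W i ξ ∂m = 0 := by
    intro i
    rw [hW, integral_const_mul]
    refine mul_eq_zero_of_right _ (integral_pi_eq_zero h.meas i _ fun ξ hξ => ?_)
    have h1 := h.fluxInt i ξ hξ
    have h2 : ∀ t, (fun j => γ j (update ξ i t j))
        = update (fun j => γ j (ξ j)) i (γ i t) := by
      intro t
      funext j
      rcases eq_or_ne j i with rfl | hj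
      · simp
      · simp [hj]
    have h3 : ∀ t, ∏ j, γ' j (update ξ i t j)
        = γ' i t * ∏ j ∈ univ.erase i, γ' j (ξ j) := by
      intro t
      rw [← mul_prod_erase _ _ (mem_univ i), update_self]
      congr 1
      exact prod_congr rfl fun j hj => by
        rw [update_of_ne (ne_of_mem_erase hj)]
    simp only [h2, h3, Function.update_idem, update_self, ← mul_assoc]
    rw [integral_mul_const, h1, zero_mul]
  have hupd : ∀ i, ∀ t, HasDerivAt (fun t => update x i t) (Pi.single i 1) t := by
    intro i t
    rw [hasDerivAt_pi]
    intro j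
    simpa using hasDerivAt_update x i 0 t j
  have hpw : ∀ i, Differentiable ℂ fun t => planeWave M ν μ (update x i t) y := by
    intro i
    simp only [planeWave_update]
    fun_prop
  have main : EigenAt M (-4 * (∑ i, ν i ^ 2 + μ ^ 2 / M)) (fun x y => ∫ ξ, f ξ x y ∂m) x y δ := by
    refine EigenAt.integral (W := W) hδ (fun i => ?_) ?_ ⟨δ / (n + 1), by positivity, ?_⟩ ?_ ?_ hW0 hWi
    · refine (fam (fun t => update x i t) (fun _ => y) (x i) δ (fun t ht =>
        ⟨norm_update_sub_lt x i hδ ht, hselfy⟩) (fun j t => ?_)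
        (differentiable_const _)).mul_entire (hpw i)
      simpa using (hasDerivAt_update x i 0 t j).differentiableAt
    · refine (fam (fun _ => x) (fun t => t) y δ (fun t ht => ⟨hself x, by
        simpa [dist_eq_norm] using ht⟩) (fun j => differentiable_const _) differentiable_id).mul_entire ?_
      unfold planeWave powx
      fun_prop
    · refine (fam (fun r => TrigBA.flow x r) (fun _ => y) 0 _ (fun r hr => ⟨fun i => ?_, hselfy⟩)
        (fun j => ?_) (differentiable_const _)).mul_entire ?_
      · rw [TrigBA.flow, add_sub_cancel_left, norm_mul]
        rw [mem_ball_zero_iff, lt_div_iff₀ (by positivity)] at hr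
        have h1 : ‖(kap i : ℂ)‖ ≤ n + 1 := by
          rw [Complex.norm_natCast]
          have : kap i ≤ n := Nat.sub_le _ _
          have : (kap i : ℝ) ≤ n := by exact_mod_cast this
          linarith
        calc _ ≤ ‖r‖ * (n + 1) := mul_le_mul_of_nonneg_left h1 (norm_nonneg _)
          _ < δ := hr
      · unfold TrigBA.flow; fun_prop
      · unfold planeWave powx TrigBA.flow; fun_prop
    · filter_upwards [hS] with ξ hξ
      refine hasDerivAt_flow (f := fun x => f ξ x y) ?_
      obtain ⟨h1, h2, -⟩ := hnear ξ hξ _ x y (hself _) (hself x) hselfy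
      have k1 := differentiableAt_reduced M k p b (σ := fun _ : Fin n → ℂ => fun i => γ i (ξ i))
        (x := fun x : Fin n → ℂ => x) (y := fun _ => y) (t := x)
        (fun i => differentiableAt_const _) (fun i => by fun_prop)
        (differentiableAt_const _) hc h1 h2
      have k2 : DifferentiableAt ℂ (fun x => planeWave M ν μ x y) x := by
        unfold planeWave powx
        fun_prop
      exact (k1.mul_const _).mul k2
    · filter_upwards [hS] with ξ hξ
      obtain ⟨h1, h2, -⟩ := hnear ξ hξ _ x y (hself _) (hself x) hselfy
      obtain ⟨v1, v2, v3⟩ := h1.vdm_ne_zero hc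
      have hP := (defSutherland_dressed hM μ (-4 * ∑ i, ν i ^ 2) (baForm k N p ν)
        (fun i => γ i (ξ i)) x y (h1.injective hc fun i => h.ne_one i _ (hξ i))
        (fun i => analyticAt_baForm k hN p ν v1 i) (hE _ v1)).2
      have e1 : defSutherland M (f ξ) x y = (N * ∏ i, γ' i (ξ i)) *
          defSutherland M (dressed M μ (baForm k N p ν) (fun i => γ i (ξ i))) x y := by
        have e2 : f ξ = fun x y => (N * ∏ i, γ' i (ξ i)) *
          dressed M μ (baForm k N p ν) (fun i => γ i (ξ i)) x y := by
          funext x y; exact hfd ξ x y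
        rw [e2]
        have e3 : ∀ i, partial2 (fun x' => (N * ∏ i, γ' i (ξ i)) *
          dressed M μ (baForm k N p ν) (fun i => γ i (ξ i)) x' y) i x = (N * ∏ i, γ' i (ξ i)) *
          partial2 (fun x' => dressed M μ (baForm k N p ν) (fun i => γ i (ξ i)) x' y) i x :=
          fun i => iteratedDeriv_const_mul_field _ _
        have e4 : iteratedDeriv 2 (fun t => (N * ∏ i, γ' i (ξ i)) *
          dressed M μ (baForm k N p ν) (fun i => γ i (ξ i)) x t) y = (N * ∏ i, γ' i (ξ i)) *
          iteratedDeriv 2 (fun t => dressed M μ (baForm k N p ν) (fun i => γ i (ξ i)) x t) y :=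
          iteratedDeriv_const_mul_field _ _
        simp only [defSutherland, e3, e4, ← mul_sum]
        ring
      have e5 : ∀ i, deriv (fun s => flux M μ (baForm k N p ν) i
          (update (fun j => γ j (ξ j)) i s) x y) (γ i (ξ i))
          = 4 * planeWave M ν μ x y / N *
            deriv (fun s => L (update (fun j => γ j (ξ j)) i s) i) (γ i (ξ i)) := by
        intro i
        simp only [hflux]
        exact deriv_const_mul _ ((hLdiff ξ hξ i).differentiableAt (ball_mem_nhds _ hδ))
      rw [e1, hP, hfd]
      simp only [e5, hW]
      rw [← mul_sum, ← mul_sum, ← sum_mul]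
      field_simp
      ring
  have hfin : (fun x y => ∫ ξ, f ξ x y ∂m) = fun x y =>
      (∫ ξ, reduced M k p b (fun i => γ i (ξ i)) x y * ∏ i, γ' i (ξ i) ∂m) * planeWave M ν μ x y := by
    funext x y
    simp only [hf]
    rw [integral_mul_const]
  rw [hfin] at main
  exact main

end

/-! ### Rigidity along the flow -/

theorem defSutherland_eq (M : ℤ) (f : (Fin n → ℂ) → ℂ → ℂ) (x : Fin n → ℂ) (y : ℂ) :
    defSutherland M f x y = -(∑ i, partial2 (fun x' => f x' y) i x)
      - (M : ℂ) * iteratedDeriv 2 (fun t : ℂ => f x t) y + potential M x y * f x y := rfl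

theorem continuous_cross_expo : Continuous fun z : (Fin n → ℂ) × ℂ =>
    cross (fun i => expo (z.1 i)) (expo z.2) := by
  unfold cross expo
  fun_prop

theorem eventually_update {x : Fin n → ℂ} {i : Fin n} {p : (Fin n → ℂ) → Prop}
    (h : ∀ᶠ z in 𝓝 x, p z) : ∀ᶠ t in 𝓝 (x i), p (update x i t) := by
  have hc : Tendsto (fun t => update x i t) (𝓝 (x i)) (𝓝 x) := by
    have : Continuous fun t => update x i t := continuous_const.update i continuous_id
    simpa using this.tendsto (x i)
  exact hc.eventually h

/-- Eigenfunctions which are given by a formula away from the singular locus. -/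
theorem eigenAt_of_formula {M : ℤ} {c a : ℂ} (ha : a ≠ 0) {f F : (Fin n → ℂ) → ℂ → ℂ}
    (hF : ∀ x y, vdm expos(x) ≠ 0 → cross expos(x) (expo y) ≠ 0 →
      F x y = a * f x y)
    (hf : ∀ x y, vdm expos(x) ≠ 0 → cross expos(x) (expo y) ≠ 0 →
      DifferentiableAt ℂ (fun z : (Fin n → ℂ) × ℂ => f z.1 z.2) (x, y))
    (hE : ∀ x y, vdm expos(x) ≠ 0 → cross expos(x) (expo y) ≠ 0 →
      defSutherland M F x y = c * F x y)
    {x : Fin n → ℂ} {y : ℂ} {δ : ℝ} (hδ : 0 < δ)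
    (hs : ∀ (x' : Fin n → ℂ) (y' : ℂ), (∀ i, ‖x' i - x i‖ < δ) → ‖y' - y‖ < δ →
      vdm expos(x') ≠ 0 ∧ cross expos(x') (expo y') ≠ 0) :
    EigenAt M c f x y δ := by
  have hx0 : ∀ i, ‖x i - x i‖ < δ := fun i => by simpa using hδ
  have hy0 : ‖y - y‖ < δ := by simpa using hδ
  obtain ⟨v0, c0⟩ := hs x y hx0 hy0
  have dX : DifferentiableAt ℂ (fun x => f x y) x :=
    (hf x y v0 c0).comp (f := fun x : Fin n → ℂ => (x, y)) x (by fun_prop)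
  refine ⟨fun i t ht => ?_, fun t ht => ?_, hasDerivAt_flow dX, ?_⟩
  · obtain ⟨v1, c1⟩ := hs _ y (norm_update_sub_lt x i hδ ht) hy0
    have h1 : DifferentiableAt ℂ (fun t => (update x i t, y)) t := by
      refine DifferentiableAt.prodMk ?_ (differentiableAt_const _)
      rw [differentiableAt_pi]
      intro j
      simpa using (hasDerivAt_update x i 0 t j).differentiableAt
    exact ((hf _ y v1 c1).comp (f := fun t => (update x i t, y)) t h1).differentiableWithinAt
  · obtain ⟨v1, c1⟩ := hs x t hx0 (by simpa [dist_eq_norm] using ht)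
    exact ((hf x t v1 c1).comp (f := fun t => (x, t)) t (by fun_prop)).differentiableWithinAt
  · have h1 : (fun x' => F x' y) =ᶠ[𝓝 x] fun x' => a * f x' y := by
      have e1 := continuous_vdm_expo.continuousAt.eventually_ne v0
      have e2 : ∀ᶠ x' in 𝓝 x, cross expos(x') (expo y) ≠ 0 :=
        (continuous_cross_expo.comp (f := fun x : Fin n → ℂ => (x, y))
          (by fun_prop)).continuousAt.eventually_ne c0
      filter_upwards [e1, e2] with x' h1 h2 using hF x' y h1 h2
    have h2 : (fun y' => F x y') =ᶠ[𝓝 y] fun y' => a * f x y' := by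
      have e2 : ∀ᶠ y' in 𝓝 y, cross expos(x) (expo y') ≠ 0 :=
        (continuous_cross_expo.comp (f := fun y : ℂ => (x, y))
          (by fun_prop)).continuousAt.eventually_ne c0
      filter_upwards [e2] with y' h2 using hF x y' v0 h2
    have h3 : ∀ i, partial2 (fun x' => F x' y) i x = a * partial2 (fun x' => f x' y) i x := fun i =>
      (Filter.EventuallyEq.iteratedDeriv_eq 2 (eventually_update (p := fun x' => F x' y = a * f x' y) h1)).trans
        (iteratedDeriv_const_mul_field _ _)
    have h4 : iteratedDeriv 2 (fun t => F x t) y = a * iteratedDeriv 2 (fun t => f x t) y :=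
      (Filter.EventuallyEq.iteratedDeriv_eq 2 h2).trans (iteratedDeriv_const_mul_field _ _)
    have h5 := hE x y v0 c0
    rw [defSutherland_eq, h4, hF x y v0 c0] at h5
    simp only [h3, ← mul_sum] at h5
    refine mul_left_cancel₀ ha ?_
    linear_combination h5

/-- The rational part of a deformed Baker-Akhiezer function. -/
def defRed (k : ℕ) (p : DefPoly(n)) (x : Fin n → ℂ) (y : ℂ) : ℂ :=
  eval (adjoin expos(x) (expo y)) p /
    (vdm expos(x) ^ k * cross expos(x) (expo y))

theorem differentiableAt_defRed (k : ℕ) (p : DefPoly(n)) {x : Fin n → ℂ} {y : ℂ}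
    (hv : vdm expos(x) ≠ 0) (hc : cross expos(x) (expo y) ≠ 0) :
    DifferentiableAt ℂ (fun z : (Fin n → ℂ) × ℂ => defRed k p z.1 z.2) (x, y) := by
  have hd : ∀ i, DifferentiableAt ℂ (fun z : (Fin n → ℂ) × ℂ => expo (z.1 i)) (x, y) := fun i =>
    differentiableAt_expo (by fun_prop)
  have hy : DifferentiableAt ℂ (fun z : (Fin n → ℂ) × ℂ => expo z.2) (x, y) :=
    differentiableAt_expo (by fun_prop)
  unfold defRed
  refine diffAt_div ?_ (((differentiableAt_vdm hd).pow k).mul (differentiableAt_cross hd hy))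
    (mul_ne_zero (pow_ne_zero _ hv) hc)
  simp only [eval_eq']
  refine DifferentiableAt.fun_sum fun α _ => DifferentiableAt.const_mul ?_ _
  refine diffAt_prod fun o _ => DifferentiableAt.pow ?_ _
  cases o with
  | none => exact hy
  | some i => exact hd i

/-- Φ is tied to its formula only off the singular locus. That set is open, so the derivatives agree
and the equation passes to the formula, which is visibly holomorphic. -/
theorem IsTrigBA.sutherland_baForm {M : ℤ} {Φ : (Fin n → ℂ) → (Fin n → ℂ) → ℂ} (h : IsTrigBA n M Φ)
    {ν : Fin n → ℂ} (hN : normC (mstar M) ν ≠ 0) {p : Poly(n)}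
    (hp : ∀ x : Fin n → ℂ, vdm expos(x) ≠ 0 →
      Φ x ν = baForm (mstar M) (normC (mstar M) ν) p ν x) (z : Fin n → ℂ)
    (hz : vdm expos(z) ≠ 0) :
    sutherland M (baForm (mstar M) (normC (mstar M) ν) p ν) z
      = -4 * (∑ i, ν i ^ 2) * baForm (mstar M) (normC (mstar M) ν) p ν z := by
  obtain ⟨Q, -, -, hE, -⟩ := h
  rw [← hp z hz, ← hE z ν hz hN]
  refine sutherland_congr ?_
  filter_upwards [continuous_vdm_expo.continuousAt.eventually_ne hz] with x hx using (hp x hx).symm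

theorem IsDefTrigBA.eigenAt {M : ℤ} {F : (Fin n → ℂ) → ℂ → (Fin n → ℂ) → ℂ → ℂ}
    (h : IsDefTrigBA n M F) {ν : Fin n → ℂ} {μ : ℂ} (hN : normC (mstar M) ν ≠ 0)
    (hN' : normCdef M ν μ ≠ 0) {p : DefPoly(n)}
    (hp : ∀ (x : Fin n → ℂ) (y : ℂ), vdm expos(x) ≠ 0 →
      cross expos(x) (expo y) ≠ 0 → F x y ν μ =
        (normC (mstar M) ν * normCdef M ν μ)⁻¹ * (defRed (mstar M) p x y * planeWave M ν μ x y))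
    {x : Fin n → ℂ} {y : ℂ} {δ : ℝ} (hδ : 0 < δ)
    (hs : ∀ (x' : Fin n → ℂ) (y' : ℂ), (∀ i, ‖x' i - x i‖ < δ) → ‖y' - y‖ < δ →
      vdm expos(x') ≠ 0 ∧ cross expos(x') (expo y') ≠ 0) :
    EigenAt M (-4 * (∑ i, ν i ^ 2 + μ ^ 2 / M))
      (fun x y => defRed (mstar M) p x y * planeWave M ν μ x y) x y δ := by
  obtain ⟨Q, -, -, hE, -⟩ := h
  refine eigenAt_of_formula (F := fun x y => F x y ν μ) (inv_ne_zero (mul_ne_zero hN hN')) hp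
    (fun x y hv hc => (differentiableAt_defRed _ p hv hc).mul ?_)
    (fun x y hv hc => hE x y ν μ hv hc hN hN') hδ hs
  unfold planeWave powx
  fun_prop

/-- 1/sinh² = coth² - 1, and coth is bounded by 2/c between separated points. -/
theorem norm_potential_le (M : ℤ) {c : ℝ} (hc : 0 < c) : ∃ V : ℝ, ∀ (w : Fin n → ℂ) (x : Fin n → ℂ)
    (y : ℂ), Sep c w expos(x) (expo y) → ‖potential M x y‖ ≤ V := by
  have key : ∀ a b : ℂ, c * ‖expo a‖ ≤ ‖expo a - expo b‖ → c * ‖expo b‖ ≤ ‖expo a - expo b‖ →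
      ‖1 / sinh (a - b) ^ 2‖ ≤ (2 / c) ^ 2 + 1 := by
    intro a b h1 h2
    have hpos : 0 < ‖expo a - expo b‖ :=
      (mul_pos hc (norm_pos_iff.2 (expo_ne_zero a))).trans_le h1
    rw [← coth_sq_sub_one (sub_ne_zero.1 (norm_pos_iff.1 hpos))]
    refine (norm_sub_le _ _).trans ?_
    rw [norm_one, norm_pow]
    gcongr
    rw [cth, norm_div, div_le_div_iff₀ hpos hc]
    have := norm_add_le (expo a) (expo b)
    nlinarith
  refine ⟨∑ i : Fin n, ∑ j ∈ Ioi i, ‖2 * (M : ℂ) * ((M : ℂ) + 1)‖ * ((2 / c) ^ 2 + 1)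
    + ∑ i : Fin n, ‖2 * ((M : ℂ) + 1)‖ * ((2 / c) ^ 2 + 1), fun w x y hs => ?_⟩
  refine (norm_add_le _ _).trans (add_le_add ?_ ?_)
  · refine norm_sum_le_of_le _ fun i _ => norm_sum_le_of_le _ fun j hj => ?_
    have hij := (mem_Ioi.1 hj).ne
    rw [div_eq_mul_one_div, norm_mul]
    refine mul_le_mul_of_nonneg_left (key _ _ (hs.uu i j hij) ?_) (norm_nonneg _)
    rw [norm_sub_rev]
    exact hs.uu j i hij.symm
  · refine norm_sum_le_of_le _ fun i _ => ?_
    rw [div_eq_mul_one_div, norm_mul]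
    exact mul_le_mul_of_nonneg_left (key _ _ (hs.uv i).1 (hs.uv i).2) (norm_nonneg _)

/-- A family of eigenfunctions which decays along the flow has vanishing limit as the spectral
parameter grows. -/
theorem limit_eq_zero {M : ℤ} (hM : (M : ℂ) ≠ 0) {ν : Fin n → ℂ} {μ : ℂ} {δ V T₁ C C' : ℝ} (hδ : 0 < δ)
    {x : Fin n → ℂ} {y : ℂ} {g : ℝ → (Fin n → ℂ) → ℂ → ℂ} {e : (Fin n → ℂ) → ℂ → ℂ}
    (hg : ∀ T, T₁ ≤ T → ∀ r : ℝ, 0 ≤ r → EigenAt M (-4 * (∑ i, lineν ν T i ^ 2 + μ ^ 2 / M))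
      (fun x y => g T x y * planeWave M (lineν ν T) μ x y) (flow x r) y δ)
    (hV : ∀ r : ℝ, 0 ≤ r → ‖potential M (flow x r) y‖ ≤ V)
    (hge : ∀ T, T₁ ≤ T → ∀ r : ℝ, 0 ≤ r → ∀ x' y', (∀ i, ‖x' i - x i‖ < δ) → ‖y' - y‖ < δ →
      ‖g T (flow x' r) y' - e (flow x' r) y'‖ ≤ C / T)
    (he : ∀ r : ℝ, 0 ≤ r → ∀ x' y', (∀ i, ‖x' i - x i‖ < δ) → ‖y' - y‖ < δ →
      ‖e (flow x' r) y'‖ ≤ C')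
    (hlim : ∀ T, T₁ ≤ T → Tendsto (fun r : ℝ => g T (flow x r) y) atTop (𝓝 0)) :
    e x y = 0 := by
  have hx0 : ∀ i, ‖x i - x i‖ < δ := fun i => by simpa using hδ
  have hy0 : ‖y - y‖ < δ := by simpa using hδ
  obtain ⟨K, hK⟩ := flow_bound (n := n) M hM ν μ hδ V
  have hCT : Tendsto (fun T : ℝ => C / T) atTop (𝓝 0) := tendsto_const_nhds.div_atTop tendsto_id
  have hgl : ∀ r : ℝ, 0 ≤ r → Tendsto (fun T => g T (flow x r) y) atTop (𝓝 (e (flow x r) y)) := by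
    intro r hr
    rw [tendsto_iff_norm_sub_tendsto_zero]
    refine squeeze_zero' (Eventually.of_forall fun _ => norm_nonneg _) ?_ hCT
    filter_upwards [eventually_ge_atTop T₁] with T hT using hge T hT r hr x y hx0 hy0
  have hgB : ∀ᶠ T : ℝ in atTop, ∀ r : ℝ, 0 ≤ r → ∀ x' y', (∀ i, ‖x' i - x i‖ < δ) → ‖y' - y‖ < δ →
      ‖g T (flow x' r) y'‖ ≤ C' + 1 := by
    filter_upwards [eventually_ge_atTop T₁, hCT.eventually (eventually_le_nhds one_pos)]
      with T hT hT1 r hr x' y' hx' hy'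
    have h1 := hge T hT r hr x' y' hx' hy'
    have h2 := he r hr x' y' hx' hy'
    have h3 := norm_add_le (g T (flow x' r) y' - e (flow x' r) y') (e (flow x' r) y')
    rw [sub_add_cancel] at h3
    linarith
  -- The flow is a translation, so a disc around a point of the flow line is the translate of a disc
  -- around x; the uniform bounds are stated in the latter form.
  have hshift : ∀ (r : ℝ) i (t : ℂ), t ∈ ball (flow x (r : ℂ) i) δ →
      ∃ x', (∀ i, ‖x' i - x i‖ < δ) ∧ update (flow x (r : ℂ)) i t = flow x' (r : ℂ) := by
    intro r i t ht
    refine ⟨flow (update (flow x (r : ℂ)) i t) (-r : ℂ), fun j => ?_, ?_⟩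
    · have := norm_update_sub_lt _ i hδ ht j
      convert! this using 2
      simp only [flow]
      ring
    · rw [flow_flow, neg_add_cancel, flow_zero]
  -- On a fixed stretch of the flow g_T varies by O(R/(T-1)), which disappears in the limit T → ∞.
  have hconst : ∀ R : ℝ, 0 ≤ R → e (flow x R) y = e x y := by
    intro R hR
    have h1 : Tendsto (fun T => ‖g T (flow x R) y - g T x y‖) atTop
        (𝓝 ‖e (flow x R) y - e x y‖) := by
      have := hgl 0 le_rfl
      simp only [ofReal_zero, flow_zero] at this
      exact ((hgl R hR).sub this).norm
    have h2 : Tendsto (fun T : ℝ => K * (C' + 1) * R / (T - 1)) atTop (𝓝 0) :=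
      tendsto_const_nhds.div_atTop (tendsto_atTop_add_const_right _ (-1) tendsto_id)
    have h3 : ‖e (flow x R) y - e x y‖ ≤ 0 := by
      refine le_of_tendsto_of_tendsto h1 h2 ?_
      filter_upwards [hgB, eventually_ge_atTop T₁, eventually_gt_atTop 1] with T hB hT hT1
      refine hK T (C' + 1) R x y (g T) hT1 hR (fun r hr => hg T hT r hr.1) (fun r hr => hV r hr.1)
        (fun r hr i t ht => ?_) fun r hr t ht => hB r hr.1 x t hx0 (by simpa [dist_eq_norm] using ht)
      obtain ⟨x', hx', heq⟩ := hshift r i t ht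
      rw [heq]
      exact hB r hr.1 x' y hx' hy0
    exact sub_eq_zero.1 (norm_le_zero_iff.1 h3)
  -- Here T is fixed and R → ∞: g_T decays, e does not change along the flow, and the two differ by
  -- at most C/T uniformly in R.
  have hle : ∀ T, T₁ ≤ T → ‖e x y‖ ≤ C / T := by
    intro T hT
    have h1 : Tendsto (fun R : ℝ => ‖g T (flow x R) y‖ + C / T) atTop (𝓝 (0 + C / T)) := by
      have := (hlim T hT).norm
      rw [norm_zero] at this
      exact this.add_const _
    rw [zero_add] at h1
    refine ge_of_tendsto h1 ?_
    filter_upwards [eventually_ge_atTop 0] with R hR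
    have h2 := hge T hT R hR x y hx0 hy0
    rw [hconst R hR] at h2
    have h3 := norm_sub_le (g T (flow x R) y) (g T (flow x R) y - e x y)
    rw [sub_sub_cancel] at h3
    linarith
  have : ‖e x y‖ ≤ 0 := ge_of_tendsto hCT (by
    filter_upwards [eventually_ge_atTop T₁] with T hT using hle T hT)
  exact norm_le_zero_iff.1 this

/-! ### Uniform estimates along the flow -/

theorem expo_flow (x : Fin n → ℂ) (r : ℝ) (i : Fin n) :
    expo (flow x r i) = expo (x i) * ((Real.exp (2 * r) : ℝ) : ℂ) ^ kap i := by
  have h : expo (r : ℂ) = ((Real.exp (2 * r) : ℝ) : ℂ) := by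
    rw [expo]; push_cast; rfl
  rw [flow, expo_add, expo_mul_nat, h]

theorem tendsto_exp_two_mul : Tendsto (fun r : ℝ => Real.exp (2 * r)) atTop atTop :=
  Real.tendsto_exp_atTop.comp (tendsto_id.const_mul_atTop two_pos)

theorem norm_expo (a : ℂ) : ‖expo a‖ = Real.exp (2 * a.re) := by
  rw [expo, norm_exp]; simp

/-- A point of the tube around the flow line of `x`. -/
structure Near (d : ℝ) (x : Fin n → ℂ) (y : ℂ) (x' : Fin n → ℂ) (y' : ℂ) : Prop where
  left : ∀ i, ‖x' i - x i‖ < d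
  right : ‖y' - y‖ < d

theorem near_self {d : ℝ} (hd : 0 < d) (x : Fin n → ℂ) (y : ℂ) : Near d x y x y :=
  ⟨fun i => by simpa using hd, by simpa using hd⟩

theorem im_flow_sub (x x' : Fin n → ℂ) (r : ℝ) (i : Fin n) :
    (flow x' r i - x i).im = (x' i - x i).im := by
  simp [flow]

theorem Gap.exists_sepAt {d : ℝ} {x : Fin n → ℂ} {y : ℂ} (h : Gap d x y) :
    ∃ c > 0, ∀ (r : ℝ) (x' : Fin n → ℂ) (y' : ℂ) (σ : Fin n → ℂ), Near (d / 4) x y x' y' →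
      (∀ i, |(σ i).im| ≤ d / 4) → SepAt c σ (flow x' r) y' := by
  obtain ⟨c, hc, hs⟩ := h.exists_sep
  refine ⟨c, hc, fun r x' y' σ hn hσ => hs σ _ y' (fun i => ?_) ?_ hσ⟩
  · rw [im_flow_sub]
    exact (abs_im_le_norm _).trans (hn.left i).le
  · exact (abs_im_le_norm _).trans hn.right.le

theorem Near.expo_bounds {d : ℝ} {x x' : Fin n → ℂ} {y y' : ℂ} (h : Near d x y x' y') :
    (∀ i, Real.exp (-2 * (∑ i, ‖x i‖ + ‖y‖ + d)) ≤ ‖expo (x' i)‖ ∧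
      ‖expo (x' i)‖ ≤ Real.exp (2 * (∑ i, ‖x i‖ + ‖y‖ + d))) ∧
      ‖expo y'‖ ≤ Real.exp (2 * (∑ i, ‖x i‖ + ‖y‖ + d)) := by
  have h0 : 0 ≤ ∑ i, ‖x i‖ := sum_nonneg fun _ _ => norm_nonneg _
  have hx : ∀ i, |(x' i).re| ≤ ∑ i, ‖x i‖ + ‖y‖ + d := fun i => by
    have h1 := (abs_re_le_norm (x' i)).trans (norm_le_norm_add_norm_sub' (x' i) (x i))
    have h2 := single_le_sum (f := fun i => ‖x i‖) (fun _ _ => norm_nonneg _) (mem_univ i)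
    have h3 := h.left i
    have h4 := norm_nonneg y
    linarith
  have hy : |y'.re| ≤ ∑ i, ‖x i‖ + ‖y‖ + d := by
    have h1 := (abs_re_le_norm y').trans (norm_le_norm_add_norm_sub' y' y)
    have h3 := h.right
    linarith
  refine ⟨fun i => ?_, ?_⟩
  · rw [norm_expo, exp_le_exp, exp_le_exp]
    have := abs_le.1 (hx i)
    constructor <;> linarith
  · rw [norm_expo, exp_le_exp]
    have := abs_le.1 hy
    linarith

/-- Uniform exponential bound for the rational part around a flow line. -/
def RatBound (d : ℝ) (M : ℤ) (k : ℕ) (p : Poly(n)) (x : Fin n → ℂ) (y : ℂ) (C : ℝ) (B : ℕ) : Prop :=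
  ∀ r : ℝ, 0 ≤ r → ∀ (x' : Fin n → ℂ) (y' : ℂ) (σ : Fin n → ℂ) (R : ℝ),
    Near (d / 4) x y x' y' → (∀ i, |(σ i).im| ≤ d / 4) → 0 ≤ R → (∀ i, |(σ i).re| ≤ R) →
    ‖ratPart M k p (fun i => expo (flow x' r i - σ i / 2)) (fun i => expo (flow x' r i)) (expo y')‖
      ≤ C * Real.exp (B * R)

theorem Gap.ratPart_le {d : ℝ} {x : Fin n → ℂ} {y : ℂ} (h : Gap d x y) (M : ℤ) (k : ℕ)
    (p : Poly(n)) (hp : ∀ α, k * vdmWt n < wt kap α → p.coeff α = 0) :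
    ∃ (C : ℝ) (B : ℕ), 0 ≤ C ∧ RatBound d M k p x y C B := by
  obtain ⟨c, hc, hs⟩ := h.exists_sepAt
  have h0 : 0 ≤ ∑ i, ‖x i‖ := sum_nonneg fun _ _ => norm_nonneg _
  have hS : 0 ≤ ∑ i, ‖x i‖ + ‖y‖ + d / 4 := by
    have := h.pos
    positivity
  obtain ⟨C, B, hC, hB⟩ := norm_ratPart_le (n := n) hc
    (exp_pos (-2 * (∑ i, ‖x i‖ + ‖y‖ + d / 4)))
    (A := Real.exp (2 * (∑ i, ‖x i‖ + ‖y‖ + d / 4))) (exp_le_exp.2 (by linarith))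
    (one_le_exp (by linarith)) M k p hp
  refine ⟨C, B, hC, fun r hr x' y' σ R hn hσ hR hσR => ?_⟩
  have hsep := hs r x' y' σ hn hσ
  unfold SepAt at hsep
  simp only [expo_sub_half, expo_flow, mul_right_comm _ _ (exp _)] at hsep ⊢
  have := hB expos(x') (fun i => exp (-σ i)) (expo y') (Real.exp (2 * r))
    (Real.exp R) (one_le_exp (by linarith)) (one_le_exp hR) hn.expo_bounds.1 (fun i => ?_) hsep
  · rwa [← exp_nat_mul] at this
  · rw [norm_exp, neg_re, ← exp_neg, exp_le_exp, exp_le_exp]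
    have := abs_le.1 (hσR i)
    constructor <;> linarith

/-- The rational part of the deformed function is bounded uniformly in the tube around a flow line. -/
theorem Gap.defRed_le {d : ℝ} {x : Fin n → ℂ} {y : ℂ} (h : Gap d x y) (k : ℕ)
    (p : DefPoly(n))
    (hp : ∀ α, k * vdmWt n + ∑ i : Fin n, kap i < wt kapDef α → p.coeff α = 0) :
    ∃ C : ℝ, 0 ≤ C ∧ ∀ r : ℝ, 0 ≤ r → ∀ (x' : Fin n → ℂ) (y' : ℂ), Near (d / 4) x y x' y' →
      ‖defRed k p (flow x' r) y'‖ ≤ C := by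
  obtain ⟨c, hc, hs⟩ := h.exists_sepAt
  have hd := h.pos
  have h0 : 0 ≤ ∑ i, ‖x i‖ := sum_nonneg fun _ _ => norm_nonneg _
  set S := ∑ i, ‖x i‖ + ‖y‖ + d / 4 with hS'
  have hS : 0 ≤ S := by positivity
  obtain ⟨C, hC, hev⟩ := norm_eval_le kapDef p _ hp
  set N := ∑ i : Fin n, (Ioi i).card with hN
  set a := Real.exp (-2 * S) with ha
  have ha0 : 0 < a := exp_pos _
  refine ⟨C * Real.exp (2 * S) ^ p.totalDegree / (((c * a) ^ N) ^ k * (c * a) ^ n), by positivity,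
    fun r hr x' y' hn => ?_⟩
  have hsep : Sep c (fun i => expo (flow x' r i)) (fun i => expo (flow x' r i)) (expo y') := by
    have := hs r x' y' (fun _ => 0) hn (fun i => by
      rw [Complex.zero_im, abs_zero]; positivity)
    simpa [SepAt] using this
  obtain ⟨b1, b2⟩ := hn.expo_bounds
  set q := Real.exp (2 * r) with hq
  have hq1 : 1 ≤ q := one_le_exp (by linarith)
  have hq0 : 0 < q := by linarith
  have hev' := hev (adjoin expos(x') (expo y')) q (Real.exp (2 * S)) hq1
    (one_le_exp (by linarith)) (fun o => by
      cases o with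
      | none => exact b2
      | some i => exact (b1 i).2)
  rw [adjoin_mul_pow] at hev'
  have nU : ∀ i, a * q ^ kap i ≤ ‖expo (flow x' r i)‖ := fun i => by
    rw [expo_flow, norm_mul, norm_pow, norm_real, norm_eq_abs, abs_of_pos hq0]
    exact mul_le_mul_of_nonneg_right (b1 i).1 (by positivity)
  have h1 := le_norm_vdm hc ha0 hq1 hsep.uu nU
  have h2 : (c * a) ^ n * q ^ (∑ i : Fin n, kap i) ≤ ‖cross (fun i => expo (flow x' r i)) (expo y')‖ := by
    rw [cross, norm_prod, ← prod_pow_eq_pow_sum,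
      show (c * a) ^ n = ∏ _i : Fin n, (c * a) by simp, ← prod_mul_distrib]
    refine Finset.prod_le_prod (fun i _ => by positivity) fun i _ => ?_
    calc c * a * q ^ kap i = c * (a * q ^ kap i) := by ring
      _ ≤ c * ‖expo (flow x' r i)‖ := mul_le_mul_of_nonneg_left (nU i) hc.le
      _ ≤ _ := (hsep.uv i).1
  have h3 : (fun i => expo (flow x' r i)) = fun i => expo (x' i) * (q : ℂ) ^ kap i :=
    funext fun i => expo_flow x' r i
  rw [defRed, norm_div, norm_mul, norm_pow]
  calc _ ≤ C * Real.exp (2 * S) ^ p.totalDegree * q ^ (k * vdmWt n + ∑ i : Fin n, kap i) /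
        (((c * a) ^ N * q ^ vdmWt n) ^ k * ((c * a) ^ n * q ^ (∑ i : Fin n, kap i))) := by
        rw [h3] at h1 h2 ⊢
        gcongr
    _ = _ := by
      rw [mul_pow _ (q ^ vdmWt n), ← pow_mul q, mul_comm (vdmWt n), pow_add]
      field_simp

theorem tendsto_ratPart_flow (M : ℤ) (k : ℕ) (p : Poly(n)) (c : ℂ)
    (hp : ∀ u : Fin n → ℂ, Tendsto (fun q : ℝ =>
      eval (fun i => u i * (q : ℂ) ^ kap i) p / (q : ℂ) ^ (k * vdmWt n)) atTop
      (𝓝 (c * ∏ i, u i ^ (k * (Ioi i).card)))) (x σ : Fin n → ℂ) (y : ℂ) :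
    Tendsto (fun r : ℝ => ratPart M k p (fun i => expo (flow x r i - σ i / 2))
      (fun i => expo (flow x r i)) (expo y)) atTop (𝓝 (c * ∏ i, exp (-σ i))) := by
  have h1 := (tendsto_ratPart M k p c hp expos(x) (fun i => exp (-σ i)) (expo y)
    (fun i => expo_ne_zero _) fun i => exp_ne_zero _).comp tendsto_exp_two_mul
  refine h1.congr fun r => ?_
  simp only [comp, expo_sub_half, expo_flow, mul_right_comm _ _ (exp _)]

theorem tendsto_defRed_flow (k : ℕ) (p : DefPoly(n)) (c : ℂ)
    (hp : ∀ (u : Fin n → ℂ) (v : ℂ), Tendsto (fun q : ℝ =>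
      eval (adjoin (fun i => u i * (q : ℂ) ^ kap i) v) p /
        (q : ℂ) ^ (k * vdmWt n + ∑ i : Fin n, kap i)) atTop
      (𝓝 (c * ∏ i, u i ^ (k * (Ioi i).card + 1)))) (x : Fin n → ℂ) (y : ℂ) :
    Tendsto (fun r : ℝ => defRed k p (flow x r) y) atTop (𝓝 c) := by
  have h0 : ∏ i, expo (x i) ^ (k * (Ioi i).card + 1) ≠ 0 :=
    prod_ne_zero_iff.2 fun i _ => pow_ne_zero _ (expo_ne_zero _)
  have e : (∏ i, expo (x i) ^ (Ioi i).card) ^ k * ∏ i, expo (x i)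
      = ∏ i, expo (x i) ^ (k * (Ioi i).card + 1) := by
    rw [← prod_pow, ← prod_mul_distrib]
    exact prod_congr rfl fun i _ => by rw [← pow_mul, pow_succ, mul_comm k]
  have h1 := (hp expos(x) (expo y)).div
    (((tendsto_vdm_chamber expos(x)).pow k).mul
      (tendsto_cross_chamber expos(x) (expo y))) (by rw [e]; exact h0)
  rw [e, mul_div_cancel_right₀ _ h0] at h1
  refine (h1.comp tendsto_exp_two_mul).congr fun r => ?_
  have hq : ((Real.exp (2 * r) : ℝ) : ℂ) ≠ 0 := by
    exact_mod_cast (exp_pos _).ne'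
  simp only [comp, Pi.div_apply, defRed, expo_flow]
  rw [pow_add, div_pow, ← pow_mul, mul_comm (vdmWt n), div_mul_div_comm,
    div_div_div_cancel_right₀ (mul_ne_zero (pow_ne_zero _ hq) (pow_ne_zero _ hq))]

/-! ### The difference of the two sides along a line of spectral parameters -/

section

/-- The exponents of the integrand along a line of spectral parameters. -/
def lineExp (M : ℤ) (ν : Fin n → ℂ) (μ T : ℂ) (i : Fin n) : ℂ := lineν ν T i - μ - (M + 1) / 2

/-- The integral of the reduced integrand. -/
def redInt (M : ℤ) (k : ℕ) (p : Poly(n)) (b : Fin n → ℂ) (S : Set ℝ)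
    (γ γ' : Fin n → ℝ → ℂ) (x : Fin n → ℂ) (y : ℂ) : ℂ :=
  ∫ ξ, reduced M k p b (fun i => γ i (ξ i)) x y * ∏ i, γ' i (ξ i)
    ∂pow(n, S)

/-- The polynomials which describe a pair of Baker-Akhiezer functions along a line of spectral
parameters. -/
structure Line (M : ℤ) (Φ : (Fin n → ℂ) → (Fin n → ℂ) → ℂ)
    (F : (Fin n → ℂ) → ℂ → (Fin n → ℂ) → ℂ → ℂ) (ν : Fin n → ℂ) (μ : ℂ)
    (P : Polynomial Poly(n)) (P' : Polynomial DefPoly(n)) :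
    Prop where
  ba : IsTrigBA n M Φ
  form : ∀ (T : ℂ) (x : Fin n → ℂ), vdm expos(x) ≠ 0 →
    normC (mstar M) (lineν ν T) ≠ 0 → Φ x (lineν ν T)
      = baForm (mstar M) (normC (mstar M) (lineν ν T)) (P.eval (𝐂 T)) (lineν ν T) x
  weight : ∀ j α, mstar M * vdmWt n < wt kap α → (P.coeff j).coeff α = 0
  lim : ∀ T : ℂ, normC (mstar M) (lineν ν T) ≠ 0 → ∀ u : Fin n → ℂ,
    Tendsto (fun q : ℝ => eval (fun i => u i * (q : ℂ) ^ kap i)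
      (P.eval (𝐂 T)) / (q : ℂ) ^ (mstar M * vdmWt n))
      atTop (𝓝 (normC (mstar M) (lineν ν T) * ∏ i, u i ^ (mstar M * (Ioi i).card)))
  dba : IsDefTrigBA n M F
  form' : ∀ (T : ℂ) (x : Fin n → ℂ) (y : ℂ), vdm expos(x) ≠ 0 →
    cross expos(x) (expo y) ≠ 0 →
    normC (mstar M) (lineν ν T) ≠ 0 → normCdef M (lineν ν T) μ ≠ 0 →
    F x y (lineν ν T) μ = (normC (mstar M) (lineν ν T) * normCdef M (lineν ν T) μ)⁻¹ *
      (defRed (mstar M) (P'.eval (𝐂 T)) x y * planeWave M (lineν ν T) μ x y)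
  weight' : ∀ j α, mstar M * vdmWt n + ∑ i : Fin n, kap i < wt kapDef α → (P'.coeff j).coeff α = 0
  lim' : ∀ T : ℂ, normC (mstar M) (lineν ν T) ≠ 0 → normCdef M (lineν ν T) μ ≠ 0 →
    ∀ (u : Fin n → ℂ) (v : ℂ), Tendsto (fun q : ℝ =>
      eval (adjoin (fun i => u i * (q : ℂ) ^ kap i) v) (P'.eval (𝐂 T)) /
        (q : ℂ) ^ (mstar M * vdmWt n + ∑ i : Fin n, kap i))
      atTop (𝓝 (normC (mstar M) (lineν ν T) * normCdef M (lineν ν T) μ *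
        ∏ i, u i ^ (mstar M * (Ioi i).card + 1)))

theorem exists_line {M : ℤ} {Φ : (Fin n → ℂ) → (Fin n → ℂ) → ℂ}
    {F : (Fin n → ℂ) → ℂ → (Fin n → ℂ) → ℂ → ℂ} (hΦ : IsTrigBA n M Φ) (hF : IsDefTrigBA n M F)
    (ν : Fin n → ℂ) (μ : ℂ) : ∃ P P', Line M Φ F ν μ P P' := by
  obtain ⟨P, h1, h2, h3⟩ := hΦ.line ν
  obtain ⟨P', h4, h5, h6⟩ := hF.line ν μ
  refine ⟨P, P', hΦ, h1, h2, h3, hF, fun T x y a b c d => ?_, h5, h6⟩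
  rw [h4 T x y a b c d, defRed, planeWave, ev]
  field_simp

variable {M : ℤ} {S : Set ℝ} {γ γ' : Fin n → ℝ → ℂ}

/-- The difference of the two sides, with the denominators cleared. -/
def lineDiff (M : ℤ) (ν : Fin n → ℂ) (μ : ℂ) (P : Polynomial Poly(n))
    (P' : Polynomial DefPoly(n)) (S : Set ℝ) (γ γ' : Fin n → ℝ → ℂ)
    (c₁ c₂ T : ℂ) (x : Fin n → ℂ) (y : ℂ) : ℂ :=
  c₁ * redInt M (mstar M) (P.eval (𝐂 T)) (lineExp M ν μ T) S γ γ' x y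
    - c₂ * defRed (mstar M) (P'.eval (𝐂 T)) x y

/-- The integral and the deformed BA function share the eigenvalue and the plane wave, so every
linear combination with constants in x, y is again an eigenfunction of this form. -/
theorem Line.eigenAt (h : Line M Φ F ν μ P P') (hM : M ≠ 0) {T : ℂ}
    (hN : normC (mstar M) (lineν ν T) ≠ 0) (hN' : normCdef M (lineν ν T) μ ≠ 0) (c₁ c₂ : ℂ)
    {x : Fin n → ℂ} {y : ℂ} {δ : ℝ}
    (hs : ∀ (x' : Fin n → ℂ) (y' : ℂ), (∀ i, ‖x' i - x i‖ < δ) → ‖y' - y‖ < δ →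
      vdm expos(x') ≠ 0 ∧ cross expos(x') (expo y') ≠ 0)
    (hC : Contour M (mstar M) (P.eval (𝐂 T)) (lineExp M ν μ T) S γ γ' x y δ) :
    EigenAt M (-4 * (∑ i, lineν ν T i ^ 2 + μ ^ 2 / M)) (fun x y =>
      lineDiff M ν μ P P' S γ γ' c₁ c₂ T x y * planeWave M (lineν ν T) μ x y) x y δ := by
  have h1 := (hC.eigenAt hM hN (h.ba.sutherland_baForm hN fun x hx => h.form T x hx hN)).const_mul
    hC.pos c₁
  have h2 := (h.dba.eigenAt hN hN' (fun x y hv hc => h.form' T x y hv hc hN hN') hC.pos hs).const_mul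
    hC.pos c₂
  have h3 := h1.sub h2 hC.pos
  convert! h3 using 1
  funext x y
  simp only [lineDiff, redInt, show lineExp M ν μ T = fun i => lineν ν T i - μ - (M + 1) / 2 from rfl]
  ring

/-- Deep in the chamber the rational part of the integrand tends to a multiple of ∏ e^{-σ_i}, so by
dominated convergence the integral factorises into one-variable integrals. The condition `hc` says
that the constants in front match these against the normalisation of F. -/
theorem Line.tendsto (h : Line M Φ F ν μ P P') {T : ℂ}
    (hN : normC (mstar M) (lineν ν T) ≠ 0) (hN' : normCdef M (lineν ν T) μ ≠ 0) {c₁ c₂ : ℂ}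
    (hS : MeasurableSet S) (hγ : ∀ i, Measurable (γ i)) (hγ' : ∀ i, Measurable (γ' i))
    (hc : c₁ * ∏ i, ∫ t in S, exp (-γ i t * (lineExp M ν μ T i + 1)) *
      (exp (-γ i t) - 1) ^ M * γ' i t = c₂ * normCdef M (lineν ν T) μ)
    {B : (Fin n → ℝ) → ℝ} (hB : Integrable B pow(n, S))
    {x : Fin n → ℂ} {y : ℂ} (hle : ∀ r : ℝ, 0 ≤ r → ∀ ξ : Fin n → ℝ, (∀ i, ξ i ∈ S) →
      ‖reduced M (mstar M) (P.eval (𝐂 T)) (lineExp M ν μ T) (fun i => γ i (ξ i)) (flow x r) y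
        * ∏ i, γ' i (ξ i)‖ ≤ B ξ) :
    Tendsto (fun r : ℝ => lineDiff M ν μ P P' S γ γ' c₁ c₂ T (flow x r) y) atTop (𝓝 0) := by
  set m := pow(n, S) with hm
  have hSm : ∀ᵐ ξ ∂m, ∀ i, ξ i ∈ S := by
    rw [hm, ← Measure.restrict_pi_pi]
    filter_upwards [ae_restrict_mem (MeasurableSet.univ_pi fun _ => hS)] with ξ hξ i
    exact hξ i (Set.mem_univ i)
  have hmσ : ∀ i, Measurable fun ξ : Fin n → ℝ => γ i (ξ i) := fun i =>
    (hγ i).comp (measurable_pi_apply i)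
  have hmJ : Measurable fun ξ : Fin n → ℝ => ∏ i, γ' i (ξ i) :=
    measurable_prod _ fun i _ => (hγ' i).comp (measurable_pi_apply i)
  have h1 : Tendsto (fun r : ℝ => redInt M (mstar M) (P.eval (𝐂 T)) (lineExp M ν μ T)
      S γ γ' (flow x r) y) atTop (𝓝 (∫ ξ, (∏ i, exp (-γ i (ξ i) * lineExp M ν μ T i)
        * (exp (-γ i (ξ i)) - 1) ^ M) * (normC (mstar M) (lineν ν T) *
          ∏ i, exp (-γ i (ξ i))) * ∏ i, γ' i (ξ i) ∂m)) := by
    refine tendsto_integral_filter_of_dominated_convergence B ?_ ?_ hB ?_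
    · exact Eventually.of_forall fun r =>
        ((measurable_reduced _ _ _ _ hmσ _ _).mul hmJ).aestronglyMeasurable
    · filter_upwards [eventually_ge_atTop 0] with r hr
      filter_upwards [hSm] with ξ hξ using hle r hr ξ hξ
    · refine Eventually.of_forall fun ξ => ?_
      exact ((tendsto_ratPart_flow M _ _ _ (h.lim T hN) x (fun i => γ i (ξ i)) y).const_mul _).mul_const _
  have h2 := tendsto_defRed_flow _ _ _ (h.lim' T hN hN') x y
  have h3 := (h1.const_mul c₁).sub (h2.const_mul c₂)
  have h4 : ∫ ξ, (∏ i, exp (-γ i (ξ i) * lineExp M ν μ T i)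
        * (exp (-γ i (ξ i)) - 1) ^ M) * (normC (mstar M) (lineν ν T) *
          ∏ i, exp (-γ i (ξ i))) * ∏ i, γ' i (ξ i) ∂m
      = normC (mstar M) (lineν ν T) * ∏ i, ∫ t in S, exp (-γ i t * (lineExp M ν μ T i + 1)) *
      (exp (-γ i t) - 1) ^ M * γ' i t := by
    rw [hm, ← integral_fintype_prod_eq_prod, ← integral_const_mul]
    refine integral_congr_ae (Eventually.of_forall fun ξ => ?_)
    simp only [mul_add, mul_one, exp_add, prod_mul_distrib]
    ring
  rw [h4] at h3
  have h5 : c₁ * (normC (mstar M) (lineν ν T) * ∏ i, ∫ t in S, exp (-γ i t *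
      (lineExp M ν μ T i + 1)) * (exp (-γ i t) - 1) ^ M * γ' i t)
      - c₂ * (normC (mstar M) (lineν ν T) * normCdef M (lineν ν T) μ) = 0 := by
    linear_combination normC (mstar M) (lineν ν T) * hc
  rw [h5] at h3
  exact h3

end

/-! ### Estimates along a line of spectral parameters and the real contour -/

/-- The rational part is linear in the numerator. Expanding in T leaves finitely many functions
independent of T, each of which has uniform bounds. -/
theorem ratPart_eval_C (M : ℤ) (k : ℕ) (P : Polynomial Poly(n)) (T : ℂ)
    (w u : Fin n → ℂ) (v : ℂ) : ratPart M k (P.eval (𝐂 T)) w u v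
      = ∑ j ∈ range (P.natDegree + 1), T ^ j * ratPart M k (P.coeff j) w u v := by
  have := ev_eq_sum P T w
  rw [ev] at this
  simp only [ratPart, this, sum_div, mul_sum]
  exact sum_congr rfl fun j _ => by ring

theorem defRed_eval_C (k : ℕ) (P : Polynomial DefPoly(n)) (T : ℂ)
    (x : Fin n → ℂ) (y : ℂ) : defRed k (P.eval (𝐂 T)) x y
      = ∑ j ∈ range (P.natDegree + 1), T ^ j * defRed k (P.coeff j) x y := by
  have := ev_eq_sum P T (adjoin expos(x) (expo y))
  rw [ev] at this
  simp only [defRed, this, sum_div]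
  exact sum_congr rfl fun j _ => by ring

/-- Uniform bounds for the coefficients of the rational part. -/
theorem Gap.ratPart_coeff_le {d : ℝ} {x : Fin n → ℂ} {y : ℂ} (h : Gap d x y) (M : ℤ) (k : ℕ)
    (P : Polynomial Poly(n))
    (hP : ∀ j α, k * vdmWt n < wt kap α → (P.coeff j).coeff α = 0) :
    ∃ (C : ℝ) (B : ℕ), 0 ≤ C ∧ ∀ j, RatBound d M k (P.coeff j) x y C B := by
  choose C B hC hB using fun j => h.ratPart_le M k (P.coeff j) (hP j)
  refine ⟨∑ j ∈ range (P.natDegree + 1), C j, (range (P.natDegree + 1)).sup B,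
    sum_nonneg fun j _ => hC j, fun j r hr x' y' σ R hn hσ hR hσR => ?_⟩
  by_cases hj : j ∈ range (P.natDegree + 1)
  · refine (hB j r hr x' y' σ R hn hσ hR hσR).trans ?_
    have h1 : (B j : ℝ) ≤ ((range (P.natDegree + 1)).sup B : ℕ) := by
      exact_mod_cast Finset.le_sup hj
    have h2 := single_le_sum (f := C) (fun j _ => hC j) hj
    gcongr
    exact sum_nonneg fun j _ => hC j
  · have h0 : P.coeff j = 0 := coeff_eq_zero_of_natDegree_lt (by simpa using hj)
    rw [h0]
    simp only [ratPart, map_zero, zero_div, mul_zero, norm_zero]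
    exact mul_nonneg (sum_nonneg fun j _ => hC j) (exp_pos _).le

theorem Gap.defRed_coeff_le {d : ℝ} {x : Fin n → ℂ} {y : ℂ} (h : Gap d x y) (k : ℕ)
    (P : Polynomial DefPoly(n))
    (hP : ∀ j α, k * vdmWt n + ∑ i : Fin n, kap i < wt kapDef α → (P.coeff j).coeff α = 0) :
    ∃ C : ℝ, 0 ≤ C ∧ ∀ j, ∀ r : ℝ, 0 ≤ r → ∀ (x' : Fin n → ℂ) (y' : ℂ), Near (d / 4) x y x' y' →
      ‖defRed k (P.coeff j) (flow x' r) y'‖ ≤ C := by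
  choose C hC hB using fun j => h.defRed_le k (P.coeff j) (hP j)
  refine ⟨∑ j ∈ range (P.natDegree + 1), C j,
    sum_nonneg fun j _ => hC j, fun j r hr x' y' hn => ?_⟩
  by_cases hj : j ∈ range (P.natDegree + 1)
  · exact (hB j r hr x' y' hn).trans (single_le_sum (f := C) (fun j _ => hC j) hj)
  · have h0 : P.coeff j = 0 := coeff_eq_zero_of_natDegree_lt (by simpa using hj)
    rw [h0]
    simp only [defRed, map_zero, zero_div, norm_zero]
    exact sum_nonneg fun j _ => hC j

/-- The growth exponent B is the same for all T and only the constant depends on T. Since the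
exponents Re b_i grow with T, they eventually exceed B and the real integral converges. -/
theorem Gap.ratPart_line_le {d : ℝ} {x : Fin n → ℂ} {y : ℂ} (h : Gap d x y) (M : ℤ) (k : ℕ)
    (P : Polynomial Poly(n))
    (hP : ∀ j α, k * vdmWt n < wt kap α → (P.coeff j).coeff α = 0) :
    ∃ B : ℕ, ∀ T : ℂ, ∃ C : ℝ, 0 ≤ C ∧ RatBound d M k (P.eval (𝐂 T)) x y C B := by
  obtain ⟨C, B, hC, hB⟩ := h.ratPart_coeff_le M k P hP
  refine ⟨B, fun T => ⟨∑ j ∈ range (P.natDegree + 1), ‖T‖ ^ j * C,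
    sum_nonneg fun j _ => by positivity, fun r hr x' y' σ R hn hσ hR hσR => ?_⟩⟩
  rw [ratPart_eval_C, sum_mul]
  refine norm_sum_le_of_le _ fun j _ => ?_
  rw [norm_mul, norm_pow, mul_assoc]
  exact mul_le_mul_of_nonneg_left (hB j r hr x' y' σ R hn hσ hR hσR) (by positivity)

theorem norm_exp_neg_mul_le {σ b : ℂ} {t δ : ℝ} (h : ‖σ - t‖ ≤ δ) :
    ‖exp (-σ * b)‖ ≤ Real.exp (δ * ‖b‖) * Real.exp (-t * b.re) := by
  rw [norm_exp, ← Real.exp_add, exp_le_exp]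
  have h1 : -σ * b = -((σ - t) * b) + ((-t : ℝ) : ℂ) * b := by push_cast; ring
  rw [h1, add_re, re_ofReal_mul, neg_re]
  have h2 := abs_re_le_norm ((σ - t) * b)
  rw [norm_mul] at h2
  have h3 := (abs_le.1 h2).1
  have h4 := mul_le_mul_of_nonneg_right h (norm_nonneg b)
  linarith

theorem norm_exp_neg_sub_one_le {σ : ℂ} {t δ : ℝ} (ht : 0 ≤ t) (h : ‖σ - t‖ ≤ δ) :
    ‖exp (-σ) - 1‖ ≤ Real.exp δ + 1 := by
  refine (norm_sub_le _ _).trans ?_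
  rw [norm_one, norm_exp, neg_re]
  gcongr
  have h1 := (abs_le.1 ((abs_re_le_norm _).trans h)).1
  rw [sub_re, ofReal_re] at h1
  linarith

/-- An integral of a derivative over the half-line which vanishes. -/
theorem integral_Ioi_deriv_eq_zero {L : ℂ → ℂ} {δ c K : ℝ} (hδ : 0 < δ) (hc : 0 < c)
    (hd : ∀ t : ℝ, 0 ≤ t → DifferentiableOn ℂ L (ball t δ))
    (hb : ∀ t : ℝ, 0 ≤ t → ∀ s ∈ ball (t : ℂ) δ, ‖L s‖ ≤ K * Real.exp (-c * t)) (h0 : L 0 = 0) :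
    ∫ t in Set.Ioi (0 : ℝ), deriv L t = 0 := by
  have hdt : ∀ t : ℝ, 0 ≤ t → AnalyticAt ℂ L t := fun t ht => analyticAt_of_ball hδ (hd t ht)
  have hderiv : ∀ t : ℝ, 0 ≤ t → HasDerivAt (fun t : ℝ => L t) (deriv L t) t := fun t ht =>
    (hdt t ht).differentiableAt.hasDerivAt.comp_ofReal
  have hexp : IntegrableOn (fun t : ℝ => K / (δ / 2) * Real.exp (-c * t)) (Set.Ioi 0) :=
    ((integrableOn_exp_mul_Ioi (neg_lt_zero.2 hc) 0)).const_mul _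
  have hint : IntegrableOn (fun t : ℝ => deriv L t) (Set.Ioi 0) := by
    refine hexp.mono' ?_ ?_
    · refine ContinuousOn.aestronglyMeasurable (fun t ht => ?_) measurableSet_Ioi
      exact ((hdt t (le_of_lt ht)).deriv.continuousAt.comp
        continuous_ofReal.continuousAt).continuousWithinAt
    · filter_upwards [ae_restrict_mem measurableSet_Ioi] with t ht
      have h1 := norm_iteratedDeriv_le_of_ball hδ 1 (hd t (le_of_lt ht)) (hb t (le_of_lt ht))
      rw [iteratedDeriv_one] at h1
      refine h1.trans (le_of_eq ?_)
      simp
      ring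
  have hlim : Tendsto (fun t : ℝ => L t) atTop (𝓝 0) := by
    have h1 : Tendsto (fun t : ℝ => K * Real.exp (-c * t)) atTop (𝓝 (K * 0)) :=
      (Real.tendsto_exp_atBot.comp (tendsto_id.const_mul_atTop_of_neg (neg_lt_zero.2 hc))).const_mul K
    rw [mul_zero] at h1
    refine squeeze_zero_norm' ?_ h1
    filter_upwards [eventually_ge_atTop 0] with t ht using hb t ht t (mem_ball_self hδ)
  have := integral_Ioi_of_hasDerivAt_of_tendsto' (f := fun t : ℝ => L t)
    (fun t ht => hderiv t ht) hint hlim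
  rw [this]
  simp [h0]

theorem integrable_prod_exp {a : Fin n → ℝ} (ha : ∀ i, 0 < a i) (K : ℝ) :
    Integrable (fun ξ : Fin n → ℝ => K * ∏ i, Real.exp (-a i * ξ i))
      pow(n, (Set.Ioi 0)) :=
  (Integrable.fintype_prod fun i => (integrableOn_exp_mul_Ioi (neg_lt_zero.2 (ha i)) 0)).const_mul K

/-- The bound for the integrand near the real contour. -/
theorem norm_reduced_le_real {M : ℤ} (hM : 0 ≤ M) {k : ℕ} {p : Poly(n)} {b : Fin n → ℂ}
    {C δ : ℝ} {B : ℕ} {σ x : Fin n → ℂ} {y : ℂ} {ξ : Fin n → ℝ}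
    (hξ : ∀ i, 0 ≤ ξ i) (hσ : ∀ i, ‖σ i - ξ i‖ ≤ δ)
    (h : ‖ratPart M k p shifted(σ, x) expos(x) (expo y)‖
      ≤ C * Real.exp (B * (∑ i, ξ i + δ))) :
    ‖reduced M k p b σ x y‖ ≤ (∏ i, Real.exp (δ * ‖b i‖) * (Real.exp δ + 1) ^ M.toNat) * C *
      Real.exp (B * δ) * ∏ i, Real.exp (-((b i).re - B) * ξ i) := by
  obtain ⟨m, rfl⟩ := Int.eq_ofNat_of_zero_le hM
  rw [reduced, norm_mul, norm_prod]
  have h1 : ∏ i, ‖exp (-σ i * b i) * (exp (-σ i) - 1) ^ (m : ℤ)‖ ≤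
      ∏ i, (Real.exp (δ * ‖b i‖) * (Real.exp δ + 1) ^ m) * Real.exp (-ξ i * (b i).re) := by
    refine Finset.prod_le_prod (fun _ _ => norm_nonneg _) fun i _ => ?_
    rw [norm_mul, zpow_natCast, norm_pow, mul_right_comm]
    exact mul_le_mul (norm_exp_neg_mul_le (hσ i))
      (pow_le_pow_left₀ (norm_nonneg _) (norm_exp_neg_sub_one_le (hξ i) (hσ i)) _) (by positivity)
      (by positivity)
  refine (mul_le_mul h1 h (norm_nonneg _) (by positivity)).trans (le_of_eq ?_)
  rw [prod_mul_distrib, mul_add, Real.exp_add, mul_sum, Real.exp_sum]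
  have h2 : ∏ i, Real.exp (-((b i).re - B) * ξ i)
      = (∏ i, Real.exp (-ξ i * (b i).re)) * ∏ i, Real.exp (B * ξ i) := by
    rw [← prod_mul_distrib]
    refine prod_congr rfl fun i _ => ?_
    rw [← Real.exp_add]; congr 1; ring
  rw [h2, Int.toNat_natCast]
  ring

theorem abs_re_le_sum {σ : Fin n → ℂ} {ξ : Fin n → ℝ} {δ : ℝ} (hξ : ∀ i, 0 ≤ ξ i)
    (hσ : ∀ i, ‖σ i - ξ i‖ ≤ δ) (i : Fin n) : |(σ i).re| ≤ ∑ i, ξ i + δ := by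
  have h1 := (abs_re_le_norm _).trans (hσ i)
  rw [sub_re, ofReal_re] at h1
  have h2 := single_le_sum (f := ξ) (fun i _ => hξ i) (mem_univ i)
  have h3 := hξ i
  have h4 := abs_le.1 h1
  exact abs_le.2 ⟨by linarith, by linarith⟩

/-- Every point close to the flow line is carried back by the flow to a point close to x, where the
uniform estimates apply. -/
theorem Near.of_flow {δ d : ℝ} (hδ : δ ≤ d) {x x' : Fin n → ℂ} {y y' : ℂ} {r : ℝ}
    (hx : ∀ i, ‖x' i - flow x r i‖ < δ) (hy : ‖y' - y‖ < δ) :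
    Near d x y (flow x' (-r : ℂ)) y' ∧ flow (flow x' (-r : ℂ)) r = x' := by
  refine ⟨⟨fun i => ?_, hy.trans_le hδ⟩, by rw [flow_flow, neg_add_cancel, flow_zero]⟩
  have := (hx i).trans_le hδ
  convert! this using 2
  simp only [flow]
  ring

/-- The real contour. -/
theorem Gap.contour_real {d : ℝ} {x : Fin n → ℂ} {y : ℂ} (h : Gap d x y) {M : ℤ} (hM : 0 < M) {k : ℕ}
    {p : Poly(n)} {b : Fin n → ℂ} {C : ℝ} {B : ℕ}
    (hB : RatBound d M k p x y C B) (hb : ∀ i, (B : ℝ) < (b i).re) {r : ℝ} (hr : 0 ≤ r) :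
    Contour M k p b (Set.Ioi 0) (fun _ t => (t : ℂ)) (fun _ _ => 1) (flow x r) y (d / 4) := by
  have hd := h.pos
  have hδ : 0 < d / 4 := by positivity
  obtain ⟨c, hc, hsep⟩ := h.exists_sepAt
  have him : ∀ {σ : Fin n → ℂ} {ξ : Fin n → ℝ}, (∀ i, ‖σ i - ξ i‖ ≤ d / 4) →
      ∀ i, |(σ i).im| ≤ d / 4 := by
    intro σ ξ hσ i
    have := (abs_im_le_norm _).trans (hσ i)
    simpa using this
  have hbound : ∀ ξ : Fin n → ℝ, (∀ i, 0 ≤ ξ i) → ∀ (σ' x' : Fin n → ℂ) (y' : ℂ),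
      (∀ i, ‖σ' i - ξ i‖ < d / 4) → (∀ i, ‖x' i - flow x r i‖ < d / 4) → ‖y' - y‖ < d / 4 →
      SepAt c σ' x' y' ∧ ‖reduced M k p b σ' x' y'‖ ≤ (∏ i, Real.exp (d / 4 * ‖b i‖) *
        (Real.exp (d / 4) + 1) ^ M.toNat) * C * Real.exp (B * (d / 4)) *
          ∏ i, Real.exp (-((b i).re - B) * ξ i) := by
    intro ξ hξ σ' x' y' hσ hx hy
    obtain ⟨h1, h2⟩ := Near.of_flow le_rfl hx hy
    have hσ' : ∀ i, ‖σ' i - ξ i‖ ≤ d / 4 := fun i => (hσ i).le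
    constructor
    · have := hsep r _ y' σ' h1 (him hσ')
      rwa [h2] at this
    · refine norm_reduced_le_real hM.le hξ hσ' ?_
      have := hB r hr _ y' σ' (∑ i, ξ i + d / 4) h1 (him hσ')
        (add_nonneg (sum_nonneg fun i _ => hξ i) hδ.le) (abs_re_le_sum hξ hσ')
      rwa [h2] at this
  refine ⟨hδ, measurableSet_Ioi, fun _ => Complex.measurable_ofReal, fun _ => measurable_const,
    fun i t ht => ?_, ?_, fun i ξ hξ => ?_⟩
  · rw [← ofReal_neg, ← ofReal_exp]
    norm_cast
    exact (Real.exp_lt_one_iff.2 (neg_lt_zero.2 ht)).ne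
  · refine ⟨c, hc, _, integrable_prod_exp (a := fun i => (b i).re - B) (fun i => sub_pos.2 (hb i))
      ((∏ i, Real.exp (d / 4 * ‖b i‖) * (Real.exp (d / 4) + 1) ^ M.toNat) * C * Real.exp (B * (d / 4))),
      fun ξ hξ σ' x' y' hσ hx hy => ?_⟩
    obtain ⟨h1, h2⟩ := hbound ξ (fun i => le_of_lt (hξ i)) σ' x' y' hσ hx hy
    exact ⟨h1, Or.inl hM.le, by simpa using h2⟩
  · simp only [mul_one]
    obtain ⟨K, hK0, hK⟩ := norm_fluxRed_le (n := n) M hc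
    set A := (∏ i, Real.exp (d / 4 * ‖b i‖) * (Real.exp (d / 4) + 1) ^ M.toNat) * C *
      Real.exp (B * (d / 4)) with hA
    have hx0 : ∀ j, ‖flow x r j - flow x r j‖ < d / 4 := fun j => by simpa using hδ
    have hy0 : ‖y - y‖ < d / 4 := by simpa using hδ
    have hpt : ∀ t : ℝ, 0 ≤ t → ∀ s ∈ ball (t : ℂ) (d / 4),
        (∀ j, 0 ≤ update ξ i t j) ∧ ∀ j, ‖update (fun j => (ξ j : ℂ)) i s j
          - (update ξ i t j : ℝ)‖ < d / 4 := by
      intro t ht s hs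
      constructor
      · intro j
        rcases eq_or_ne j i with rfl | hj
        · simpa using ht
        · simpa [hj] using le_of_lt (hξ j hj)
      · intro j
        rcases eq_or_ne j i with rfl | hj
        · simpa [dist_eq_norm] using hs
        · simpa [hj] using hδ
    refine integral_Ioi_deriv_eq_zero (δ := d / 4) (c := (b i).re - B)
      (K := K * (A * ∏ j ∈ univ.erase i, Real.exp (-((b j).re - B) * ξ j))) hδ
      (sub_pos.2 (hb i)) (fun t ht s hs => ?_) (fun t ht s hs => ?_) ?_
    · obtain ⟨p1, p2⟩ := hpt t ht s hs
      obtain ⟨h1, -⟩ := hbound _ p1 _ (flow x r) y p2 hx0 hy0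
      refine (differentiableAt_fluxRed k p b i hc (fun j => ?_) h1 (Or.inl hM.le)).differentiableWithinAt
      have := (hasDerivAt_update (fun j => (ξ j : ℂ)) i 0 s j).differentiableAt
      simpa using this
    · obtain ⟨p1, p2⟩ := hpt t ht s hs
      obtain ⟨h1, h2⟩ := hbound _ p1 _ (flow x r) y p2 hx0 hy0
      refine (hK k p b _ y i _ h1).trans ?_
      rw [mul_assoc K]
      refine mul_le_mul_of_nonneg_left (h2.trans (le_of_eq ?_)) hK0
      rw [← mul_prod_erase _ _ (mem_univ i), update_self, mul_assoc A,
        mul_comm (Real.exp _)]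
      congr 2
      exact prod_congr rfl fun j hj => by
        rw [update_of_ne (ne_of_mem_erase hj)]
    -- The boundary term at σ_i = 0 vanishes through (e^{-σ_i} - 1)^M, because M > 0.
    · rw [fluxRed, reduced, Finset.prod_eq_zero (mem_univ i), zero_mul, mul_zero]
      rw [update_self, neg_zero, exp_zero, sub_self, zero_zpow _ hM.ne', mul_zero]

/-! ### A form of Watson's lemma -/

section

/-- The iterated difference quotients at the origin. -/
def quot (f : ℂ → ℂ) : ℕ → ℂ → ℂ
  | 0 => f
  | k + 1 => dslope (quot f k) 0

theorem quot_eq (f : ℂ → ℂ) (k : ℕ) (z : ℂ) : quot f k z = quot f k 0 + z * quot f (k + 1) z := by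
  have := sub_smul_dslope (quot f k) 0 z
  rw [sub_zero, smul_eq_mul] at this
  rw [quot, this]
  ring

theorem quot_eq_pow_mul {f : ℂ → ℂ} {k : ℕ} (h : ∀ j < k, quot f j 0 = 0) (z : ℂ) :
    f z = z ^ k * quot f k z := by
  induction k with
  | zero => simp [quot]
  | succ k ih =>
    rw [ih fun j hj => h j (hj.trans k.lt_succ_self), quot_eq, h k k.lt_succ_self]
    ring

variable {f : ℂ → ℂ} {δ A B : ℝ}

/-- The Schwarz lemma: each difference quotient costs a factor 2/δ on the same disc, with no
shrinking of the radius. -/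
theorem norm_quot_le (hδ : 0 < δ) (hd : DifferentiableOn ℂ f (ball 0 δ))
    (hA : ∀ z ∈ ball (0 : ℂ) δ, ‖f z‖ ≤ A) (k : ℕ) :
    DifferentiableOn ℂ (quot f k) (ball 0 δ) ∧
      ∀ z ∈ ball (0 : ℂ) δ, ‖quot f k z‖ ≤ A * (2 / δ) ^ k := by
  induction k with
  | zero => exact ⟨hd, fun z hz => by simpa [quot] using hA z hz⟩
  | succ k ih =>
    obtain ⟨h1, h2⟩ := ih
    refine ⟨(Complex.differentiableOn_dslope (ball_mem_nhds 0 hδ)).2 h1, fun z hz => ?_⟩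
    have h3 : Set.MapsTo (quot f k) (ball 0 δ)
        (closedBall (quot f k 0) (2 * (A * (2 / δ) ^ k))) := fun w hw => by
      rw [mem_closedBall_iff_norm]
      have := norm_sub_le (quot f k w) (quot f k 0)
      have := h2 w hw
      have := h2 0 (mem_ball_self hδ)
      linarith
    refine (Complex.norm_dslope_le_div_of_mapsTo_ball h1 h3 hz).trans (le_of_eq ?_)
    rw [pow_succ]
    ring

/-- If all iterated quotients vanish at 0 then f(z) is z^k times the k-th quotient for every k,
hence at most A(2|z|/δ)^k, which tends to 0 for |z| < δ/2. -/
theorem eq_zero_of_quot (hδ : 0 < δ) (hd : DifferentiableOn ℂ f (ball 0 δ))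
    (hA : ∀ z ∈ ball (0 : ℂ) δ, ‖f z‖ ≤ A) (h : ∀ k, quot f k 0 = 0) {z : ℂ}
    (hz : ‖z‖ < δ / 2) : f z = 0 := by
  have h1 : ∀ k : ℕ, ‖f z‖ ≤ A * (2 * ‖z‖ / δ) ^ k := fun k => by
    rw [quot_eq_pow_mul (k := k) (fun j _ => h j) z, norm_mul, norm_pow]
    have := (norm_quot_le hδ hd hA k).2 z (by rw [mem_ball_zero_iff]; linarith)
    calc _ ≤ ‖z‖ ^ k * (A * (2 / δ) ^ k) := by gcongr
      _ = _ := by rw [div_pow, div_pow, mul_pow]; ring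
  have h2 : Tendsto (fun k : ℕ => A * (2 * ‖z‖ / δ) ^ k) atTop (𝓝 (A * 0)) :=
    (tendsto_pow_atTop_nhds_zero_of_lt_one (by positivity)
      (by rw [div_lt_one hδ]; linarith)).const_mul A
  rw [mul_zero] at h2
  exact norm_le_zero_iff.1 (ge_of_tendsto' h2 h1)

/-- The Taylor remainder on the whole half-line. For r < δ it is the next quotient times r^{k+1};
for r ≥ δ both terms are bounded separately, as (2r/δ)^{k+1} ≥ 1 pays for the missing power, and the
sum of two terms gives the factor 2. -/
theorem norm_sub_quot_le (hδ : 0 < δ) (hB : 0 ≤ B) (hd : DifferentiableOn ℂ f (ball 0 δ))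
    (hA : ∀ z ∈ ball (0 : ℂ) δ, ‖f z‖ ≤ A) (hf : ∀ r : ℝ, 0 ≤ r → ‖f r‖ ≤ A * Real.exp (B * r))
    {k : ℕ} (h : ∀ j < k, quot f j 0 = 0) {r : ℝ} (hr : 0 ≤ r) :
    ‖f r - quot f k 0 * r ^ k‖ ≤ 2 * A * (2 / δ) ^ (k + 1) * (r ^ (k + 1) * Real.exp (B * r)) := by
  have hA0 : 0 ≤ A := (norm_nonneg _).trans (hA 0 (mem_ball_self hδ))
  have he : 1 ≤ Real.exp (B * r) := one_le_exp (by positivity)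
  rcases lt_or_ge r δ with hrδ | hrδ
  · have hz : (r : ℂ) ∈ ball (0 : ℂ) δ := by
      rw [mem_ball_zero_iff, norm_real, norm_eq_abs, abs_of_nonneg hr]; exact hrδ
    have h1 : f r - quot f k 0 * r ^ k = r ^ (k + 1) * quot f (k + 1) r := by
      rw [quot_eq_pow_mul h, quot_eq f k]
      ring
    rw [h1, norm_mul, norm_pow, norm_real, norm_eq_abs, abs_of_nonneg hr]
    have h2 := (norm_quot_le hδ hd hA (k + 1)).2 _ hz
    calc r ^ (k + 1) * ‖quot f (k + 1) r‖ ≤ r ^ (k + 1) * (A * (2 / δ) ^ (k + 1)) := by gcongr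
      _ = A * (2 / δ) ^ (k + 1) * (r ^ (k + 1) * 1) := by ring
      _ ≤ 2 * A * (2 / δ) ^ (k + 1) * (r ^ (k + 1) * Real.exp (B * r)) := by
        gcongr
        linarith
  · have h1 : 1 ≤ r / δ := by rwa [le_div_iff₀ hδ, one_mul]
    have h2 : ‖f r‖ ≤ A * (2 / δ) ^ (k + 1) * (r ^ (k + 1) * Real.exp (B * r)) := by
      have h3 : 1 ≤ (2 / δ * r) ^ (k + 1) := one_le_pow₀ (by
        rw [div_mul_eq_mul_div, le_div_iff₀ hδ]; linarith)
      calc ‖f r‖ ≤ A * Real.exp (B * r) * 1 := by rw [mul_one]; exact hf r hr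
        _ ≤ A * Real.exp (B * r) * (2 / δ * r) ^ (k + 1) := by gcongr
        _ = _ := by rw [mul_pow]; ring
    have h4 : ‖quot f k 0 * (r : ℂ) ^ k‖ ≤ A * (2 / δ) ^ (k + 1) * (r ^ (k + 1) * Real.exp (B * r)) := by
      rw [norm_mul, norm_pow, norm_real, norm_eq_abs, abs_of_nonneg hr]
      calc ‖quot f k 0‖ * r ^ k ≤ A * (2 / δ) ^ k * r ^ k * (1 * 1) := by
            rw [mul_one, mul_one]
            gcongr
            exact (norm_quot_le hδ hd hA k).2 0 (mem_ball_self hδ)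
        _ ≤ A * (2 / δ) ^ k * r ^ k * (2 / δ * r * Real.exp (B * r)) := by
            gcongr
            rw [div_mul_eq_mul_div, le_div_iff₀ hδ]
            linarith
        _ = _ := by ring
    refine (norm_sub_le _ _).trans ?_
    linarith

theorem integrableOn_pow_mul_exp (N : ℕ) {a : ℝ} (ha : 0 < a) :
    IntegrableOn (fun r : ℝ => r ^ N * Real.exp (-(a * r))) (Set.Ioi 0) ∧
      ∫ r in Set.Ioi (0 : ℝ), r ^ N * Real.exp (-(a * r)) = N.factorial / a ^ (N + 1) := by
  have h1 : ∫ r in Set.Ioi (0 : ℝ), r ^ N * Real.exp (-(a * r)) = N.factorial / a ^ (N + 1) := by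
    have := Real.integral_rpow_mul_exp_neg_mul_Ioi (a := N + 1) (by positivity) ha
    simp only [add_sub_cancel_right, Real.rpow_natCast] at this
    rw [this, Real.Gamma_nat_eq_factorial]
    norm_cast
    rw [one_div, inv_pow]
    ring
  refine ⟨?_, h1⟩
  by_contra hc
  rw [integral_undef hc] at h1
  have : (0 : ℝ) < N.factorial / a ^ (N + 1) := by positivity
  linarith

theorem integrable_watson (N : ℕ) {T : ℝ} (hB : B < T)
    (hc : ContinuousOn (fun r : ℝ => f r) (Set.Ioi 0))
    (hf : ∀ r : ℝ, 0 ≤ r → ‖f r‖ ≤ A * Real.exp (B * r)) :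
    IntegrableOn (fun r : ℝ => exp (-(T * r)) * (r ^ N * f r)) (Set.Ioi 0) := by
  refine (((integrableOn_pow_mul_exp N (sub_pos.2 hB)).1).const_mul A).mono' ?_ ?_
  · refine ContinuousOn.aestronglyMeasurable (ContinuousOn.mul (by fun_prop)
      (ContinuousOn.mul (by fun_prop) hc)) measurableSet_Ioi
  · filter_upwards [ae_restrict_mem measurableSet_Ioi] with r hr
    have hr0 : 0 ≤ r := le_of_lt hr
    have h1 : ‖exp (-((T : ℂ) * r))‖ = Real.exp (-(T * r)) := by
      rw [norm_exp]; simp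
    rw [norm_mul, norm_mul, norm_pow, norm_real, norm_eq_abs, abs_of_nonneg hr0, h1]
    calc _ ≤ Real.exp (-(T * r)) * (r ^ N * (A * Real.exp (B * r))) := by
          gcongr; exact hf r hr0
      _ = A * (r ^ N * (Real.exp (-(T * r)) * Real.exp (B * r))) := by ring
      _ = _ := by rw [← Real.exp_add]; congr 3; ring

/-- The leading asymptotics of a Laplace integral, with a uniform error. -/
theorem watson (N k : ℕ) (hδ : 0 < δ) (hB : 0 ≤ B) : ∀ {f : ℂ → ℂ},
    DifferentiableOn ℂ f (ball 0 δ) → (∀ z ∈ ball (0 : ℂ) δ, ‖f z‖ ≤ A) →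
    ContinuousOn (fun r : ℝ => f r) (Set.Ioi 0) → (∀ r : ℝ, 0 ≤ r → ‖f r‖ ≤ A * Real.exp (B * r)) →
    (∀ j < k, quot f j 0 = 0) → ∀ T : ℝ, 0 < T → 2 * B ≤ T →
    ‖(T : ℂ) ^ (N + k + 1) * (∫ r in Set.Ioi (0 : ℝ), exp (-(T * r)) * (r ^ N * f r))
      - (N + k).factorial * quot f k 0‖
      ≤ 2 * A * (2 / δ) ^ (k + 1) * (N + k + 1).factorial * 2 ^ (N + k + 2) / T := by
  intro f hd hA hc hf h T hT hBT
  have hA0 : 0 ≤ A := (norm_nonneg _).trans (hA 0 (mem_ball_self hδ))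
  have hTB : 0 < T - B := by linarith
  obtain ⟨i1, e1⟩ := integrableOn_pow_mul_exp (N + k) hT
  obtain ⟨i2, e2⟩ := integrableOn_pow_mul_exp (N + k + 1) hTB
  have hT0 : (T : ℂ) ≠ 0 := by exact_mod_cast hT.ne'
  have hI := integrable_watson N (by linarith : B < T) hc hf
  have hJ : IntegrableOn (fun r : ℝ => exp (-(T * r)) * (r ^ N * (quot f k 0 * r ^ k)))
      (Set.Ioi 0) := by
    refine (i1.ofReal.mul_const (quot f k 0)).congr (Eventually.of_forall fun r => ?_)
    simp only [RCLike.ofReal_eq_complex_ofReal]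
    push_cast
    ring
  have e3 : ∫ r in Set.Ioi (0 : ℝ), exp (-(T * r)) * (r ^ N * (quot f k 0 * r ^ k))
      = quot f k 0 * ((N + k).factorial / (T : ℂ) ^ (N + k + 1)) := by
    have : ((∫ r in Set.Ioi (0 : ℝ), r ^ (N + k) * Real.exp (-(T * r)) : ℝ) : ℂ)
        = (N + k).factorial / (T : ℂ) ^ (N + k + 1) := by rw [e1]; push_cast; rfl
    rw [← this, ← integral_complex_ofReal, ← integral_const_mul]
    refine integral_congr_ae (Eventually.of_forall fun r => ?_)
    push_cast
    ring
  have e4 : (T : ℂ) ^ (N + k + 1) * (∫ r in Set.Ioi (0 : ℝ), exp (-(T * r)) * (r ^ N * f r))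
      - (N + k).factorial * quot f k 0 = (T : ℂ) ^ (N + k + 1) * ∫ r in Set.Ioi (0 : ℝ),
        exp (-(T * r)) * (r ^ N * (f r - quot f k 0 * r ^ k)) := by
    have : ∀ r : ℝ, exp (-(T * r)) * (r ^ N * (f r - quot f k 0 * r ^ k))
      = exp (-(T * r)) * (r ^ N * f r) - exp (-(T * r)) * (r ^ N * (quot f k 0 * r ^ k)) :=
      fun r => by ring
    simp only [this]
    rw [integral_sub hI hJ, e3, mul_sub]
    field_simp
  set K := 2 * A * (2 / δ) ^ (k + 1) with hK
  have hK0 : 0 ≤ K := by positivity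
  have e5 : ‖∫ r in Set.Ioi (0 : ℝ), exp (-(T * r)) * (r ^ N * (f r - quot f k 0 * r ^ k))‖
      ≤ K * ((N + k + 1).factorial / (T - B) ^ (N + k + 1 + 1)) := by
    rw [← e2, ← integral_const_mul]
    refine norm_integral_le_of_norm_le (i2.const_mul K) ?_
    filter_upwards [ae_restrict_mem measurableSet_Ioi] with r hr
    have hr0 : 0 ≤ r := le_of_lt hr
    have h1 : ‖exp (-((T : ℂ) * r))‖ = Real.exp (-(T * r)) := by
      rw [norm_exp]; simp
    rw [norm_mul, norm_mul, norm_pow, norm_real, norm_eq_abs, abs_of_nonneg hr0, h1]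
    calc _ ≤ Real.exp (-(T * r)) * (r ^ N * (K * (r ^ (k + 1) * Real.exp (B * r)))) := by
          gcongr; exact norm_sub_quot_le hδ hB hd hA hf h hr0
      _ = K * (r ^ (N + k + 1) * (Real.exp (-(T * r)) * Real.exp (B * r))) := by
          rw [add_assoc N k 1, pow_add r N]; ring
      _ = _ := by rw [← Real.exp_add]; congr 3; ring
  rw [e4, norm_mul, norm_pow, norm_real, norm_eq_abs, abs_of_pos hT]
  -- This is where T ≥ 2B enters: the shifted exponent T - B is replaced by T/2, so the error is a
  -- constant over T.
  have h6 : T / 2 ≤ T - B := by linarith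
  calc _ ≤ T ^ (N + k + 1) * (K * ((N + k + 1).factorial / (T - B) ^ (N + k + 1 + 1))) := by gcongr
    _ ≤ T ^ (N + k + 1) * (K * ((N + k + 1).factorial / (T / 2) ^ (N + k + 1 + 1))) := by gcongr
    _ = _ := by
      rw [div_pow]
      field_simp
      ring

end

/-! ### Reduction of Laplace integrals over the orthant to one variable -/

/-- The weight of a point in the direction of the flow. -/
def kdot (σ : Fin n → ℝ) : ℝ := ∑ i, kap i * σ i

theorem measurable_kdot : Measurable (kdot : (Fin n → ℝ) → ℝ) := by
  unfold kdot
  fun_prop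

theorem kdot_nonneg {σ : Fin n → ℝ} (h : ∀ i, 0 < σ i) : 0 ≤ kdot σ :=
  sum_nonneg fun i _ => mul_nonneg (Nat.cast_nonneg _) (h i).le

theorem kdot_smul (r : ℝ) (σ : Fin n → ℝ) : kdot (r • σ) = r * kdot σ := by
  simp only [kdot, Pi.smul_apply, smul_eq_mul, mul_sum]
  exact sum_congr rfl fun i _ => by ring

/-- The simplex cut out of the orthant by the weight. -/
def simplex (n : ℕ) : Set (Fin n → ℝ) := {ω | (∀ i, 0 < ω i) ∧ kdot ω < 1}

theorem measurableSet_simplex : MeasurableSet (simplex n) := by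
  have h : simplex n = (⋂ i, {ω | 0 < ω i}) ∩ {ω | kdot ω < 1} := by
    ext ω
    simp [simplex]
  rw [h]
  exact MeasurableSet.inter (MeasurableSet.iInter fun i => measurableSet_lt measurable_const
    (measurable_pi_apply i)) (measurableSet_lt measurable_kdot measurable_const)

theorem simplex_lt_one {ω : Fin n → ℝ} (h : ω ∈ simplex n) (i : Fin n) : ω i < 1 := by
  have h1 := single_le_sum (f := fun i => (kap i : ℝ) * ω i)
    (fun i _ => mul_nonneg (Nat.cast_nonneg _) (h.1 i).le) (mem_univ i)
  have h2 : (1 : ℝ) ≤ kap i := by exact_mod_cast kap_pos i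
  have h3 := h.2
  have h4 := h.1 i
  unfold kdot at h3
  nlinarith

theorem volume_simplex_lt_top : volume (simplex n) < ⊤ := by
  refine (measure_mono (t := Icc 0 1) fun ω h => ?_).trans_lt measure_Icc_lt_top
  exact ⟨fun i => (h.1 i).le, fun i => (simplex_lt_one h i).le⟩

theorem pi_restrict_Ioi : pow(n, (Set.Ioi 0))
    = volume.restrict {σ : Fin n → ℝ | ∀ i, 0 < σ i} := by
  rw [← Measure.restrict_pi_pi, ← volume_pi]
  congr 1
  ext σ
  simp

/-- The density along rays. -/
def radial (l : ℕ) (h : (Fin n → ℂ) → ℂ) (r : ℂ) : ℂ :=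
  ∫ ω in simplex n, (r * (1 - (kdot ω : ℂ))) ^ l / l.factorial * h fun i => r * ω i

/-- Division by T^{l+1} is convolution with s^l/l!, so the right side is a Laplace transform in r of
an integral over the part of the orthant with κ·σ < r. Scaling σ = rω turns that region into a fixed
simplex, at the price of r^n. The free parameter l will absorb the different powers of T occurring
in the two sides. -/
theorem laplace_radial (l : ℕ) {T : ℝ} (hT : 0 < T) {h : (Fin n → ℂ) → ℂ}
    (hm : Measurable fun σ : Fin n → ℝ => h fun i => (σ i : ℂ))
    (hi : Integrable (fun σ : Fin n → ℝ => exp (-(T * (kdot σ : ℂ))) * h fun i => (σ i : ℂ))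
      pow(n, (Set.Ioi 0))) :
    IntegrableOn (fun r : ℝ => exp (-(T * r)) * (r ^ n * radial l h r)) (Set.Ioi 0) ∧
    ∫ r in Set.Ioi (0 : ℝ), exp (-(T * r)) * (r ^ n * radial l h r)
      = ((T : ℂ) ^ (l + 1))⁻¹ * ∫ σ : Fin n → ℝ, exp (-(T * (kdot σ : ℂ))) *
        h (fun i => (σ i : ℂ)) ∂pow(n, (Set.Ioi 0)) := by
  rw [pi_restrict_Ioi] at hi ⊢
  set O : Set (Fin n → ℝ) := {σ | ∀ i, 0 < σ i} with hO
  have hOm : MeasurableSet O := by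
    simp only [hO, Set.ofPred_forall]
    exact MeasurableSet.iInter fun i => measurableSet_lt measurable_const (measurable_pi_apply i)
  set H : (Fin n → ℝ) → ℂ := fun σ => exp (-(T * (kdot σ : ℂ))) * h fun i => (σ i : ℂ) with hH
  set G : ℝ → ℂ := (Set.Ioi (0 : ℝ)).indicator
    fun s => ((s ^ l * Real.exp (-(T * s)) : ℝ) : ℂ) / l.factorial with hG
  obtain ⟨g1, g2⟩ := integrableOn_pow_mul_exp l hT
  have hGi : Integrable G := by
    rw [hG, integrable_indicator_iff measurableSet_Ioi]
    exact (g1.ofReal).div_const _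
  have hGm : Measurable G := by
    refine Measurable.indicator ?_ measurableSet_Ioi
    fun_prop
  have hGv : ∫ s, G s = ((T : ℂ) ^ (l + 1))⁻¹ := by
    rw [hG, integral_indicator measurableSet_Ioi, integral_div, integral_complex_ofReal, g2]
    have : (l.factorial : ℂ) ≠ 0 := by exact_mod_cast l.factorial_ne_zero
    push_cast
    field_simp
  have hHm : Measurable H := by
    refine Measurable.mul ?_ hm
    have := measurable_kdot (n := n)
    fun_prop
  -- Fubini for this function gives the identity: integrating over r first yields T^{-(l+1)} times
  -- the integral of H, integrating over σ first yields the density along rays.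
  set Ψ : (Fin n → ℝ) × ℝ → ℂ := fun z => G (z.2 - kdot z.1) * H z.1 with hΨ
  have hΨi : Integrable Ψ ((volume.restrict O).prod volume) := by
    have a1 : Measurable fun z : (Fin n → ℝ) × ℝ => z.2 - kdot z.1 :=
      measurable_snd.sub (measurable_kdot.comp measurable_fst)
    have a2 : Measurable fun z : (Fin n → ℝ) × ℝ => G (z.2 - kdot z.1) := hGm.comp a1
    have a3 : Measurable fun z : (Fin n → ℝ) × ℝ => H z.1 := hHm.comp measurable_fst
    have hmeas : Measurable Ψ := Measurable.mul a2 a3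
    rw [integrable_prod_iff hmeas.aestronglyMeasurable]
    refine ⟨Eventually.of_forall fun σ => (hGi.comp_sub_right (kdot σ)).mul_const (H σ), ?_⟩
    have : ∀ σ, ∫ r, ‖Ψ (σ, r)‖ = (∫ s, ‖G s‖) * ‖H σ‖ := fun σ => by
      simp only [hΨ, norm_mul]
      rw [integral_mul_const, integral_sub_right_eq_self (fun s => ‖G s‖)]
    simp only [this]
    exact hi.norm.const_mul _
  have e1 : ∫ σ in O, ∫ r, Ψ (σ, r) = ((T : ℂ) ^ (l + 1))⁻¹ * ∫ σ in O, H σ := by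
    rw [← integral_const_mul]
    refine integral_congr_ae (Eventually.of_forall fun σ => ?_)
    simp only [hΨ]
    rw [integral_mul_const, integral_sub_right_eq_self G, hGv]
  have e2 : ∀ r : ℝ, ∫ σ in O, Ψ (σ, r) = (Set.Ioi (0 : ℝ)).indicator
      (fun r : ℝ => exp (-(T * r)) * (r ^ n * radial l h r)) r := by
    intro r
    by_cases hr : r ∈ Set.Ioi (0 : ℝ)
    · have hr0 : 0 < r := hr
      rw [Set.indicator_of_mem hr]
      set Q : (Fin n → ℝ) → ℂ := fun σ => O.indicator (fun σ => Ψ (σ, r)) σ with hQ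
      -- The substitution σ = rω. The cutoff κ·σ < r in G becomes κ·ω < 1, which is the simplex.
      have h1 : ∫ σ in O, Ψ (σ, r) = r ^ n * ∫ ω, Q (r • ω) := by
        rw [Measure.integral_comp_smul, Module.finrank_fin_fun, abs_of_pos (by positivity),
          ← integral_indicator hOm, real_smul]
        have : (r : ℂ) ^ n ≠ 0 := pow_ne_zero _ (by exact_mod_cast hr0.ne')
        push_cast
        rw [mul_inv_cancel_left₀ this]
      have h2 : ∀ ω, Q (r • ω) = (simplex n).indicator (fun ω => exp (-(T * r)) *
          ((r * (1 - (kdot ω : ℂ))) ^ l / l.factorial * h fun i => r * ω i)) ω := by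
        intro ω
        have hO' : r • ω ∈ O ↔ ∀ i, 0 < ω i := by
          simp only [hO, Set.mem_ofPred_eq, Pi.smul_apply, smul_eq_mul]
          exact forall_congr' fun i => mul_pos_iff_of_pos_left hr0
        by_cases hω : ∀ i, 0 < ω i
        · simp only [hQ]
          rw [Set.indicator_of_mem (hO'.2 hω)]
          simp only [hΨ, hG, hH, kdot_smul]
          by_cases hk : kdot ω < 1
          · rw [Set.indicator_of_mem (show ω ∈ simplex n from ⟨hω, hk⟩), Set.indicator_of_mem
              (show r - r * kdot ω ∈ Set.Ioi 0 by
                have : 0 < r * (1 - kdot ω) := mul_pos hr0 (by linarith)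
                rw [Set.mem_Ioi]; linarith)]
            have h3 : exp (-((T : ℂ) * r)) = exp (-(T * (r - r * kdot ω))) *
                exp (-(T * (r * kdot ω))) := by rw [← exp_add]; congr 1; ring
            rw [h3]
            simp only [Pi.smul_apply, smul_eq_mul]
            push_cast
            ring
          · rw [indicator_of_notMem (fun hc : ω ∈ simplex n => hk hc.2), indicator_of_notMem,
              zero_mul]
            rw [Set.mem_Ioi, not_lt]
            nlinarith
        · simp only [hQ]
          rw [indicator_of_notMem (fun hc : ω ∈ simplex n => hω hc.1),
            indicator_of_notMem (fun hc => hω (hO'.1 hc))]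
      rw [h1]
      simp only [h2]
      rw [integral_indicator measurableSet_simplex, integral_const_mul, radial]
      ring
    · rw [indicator_of_notMem hr]
      refine (setIntegral_congr_fun hOm fun σ hσ => ?_).trans (integral_zero _ _)
      have : r - kdot σ ∉ Set.Ioi (0 : ℝ) := by
        have := kdot_nonneg hσ
        rw [Set.mem_Ioi, not_lt] at hr ⊢
        linarith
      simp only [hΨ, hG]
      rw [indicator_of_notMem this, zero_mul]
  have e3 : ∫ σ in O, ∫ r, Ψ (σ, r) = ∫ r, ∫ σ in O, Ψ (σ, r) :=
    integral_integral_swap (f := fun σ r => Ψ (σ, r)) hΨi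
  have e4 := hΨi.integral_prod_right
  simp only [e2] at e3 e4
  rw [integral_indicator measurableSet_Ioi] at e3
  exact ⟨(integrable_indicator_iff measurableSet_Ioi).1 e4, by rw [← e3, e1]⟩

/-- Holomorphy and bounds of the density along rays. -/
theorem radial_spec (l : ℕ) {h : (Fin n → ℂ) → ℂ} {δ C : ℝ} {B : ℝ} (hδ : 0 < δ)
    (hm : ∀ r : ℂ, Measurable fun σ : Fin n → ℝ => h fun i => r * σ i)
    (hd : ∀ σ : Fin n → ℂ, (∀ i, |(σ i).im| ≤ δ) → DifferentiableAt ℂ h σ)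
    (hB : ∀ (σ : Fin n → ℂ) (R : ℝ), (∀ i, |(σ i).im| ≤ δ) → 0 ≤ R → (∀ i, |(σ i).re| ≤ R) →
      ‖h σ‖ ≤ C * Real.exp (B * R)) :
    DifferentiableOn ℂ (radial l h) {r | |r.im| < δ} ∧ ∀ r : ℂ, |r.im| ≤ δ →
      ‖radial l h r‖ ≤ (volume (simplex n)).toReal * (Real.exp ‖r‖ * (C * Real.exp (B * |r.re|))) := by
  have him : ∀ {r : ℂ} {ω : Fin n → ℝ}, |r.im| ≤ δ → ω ∈ simplex n → ∀ i, |(r * ω i).im| ≤ δ := by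
    intro r ω hr hω i
    rw [im_mul_ofReal, abs_mul, abs_of_pos (hω.1 i)]
    have := simplex_lt_one hω i
    nlinarith [abs_nonneg r.im, hω.1 i]
  have hbd : ∀ r : ℂ, |r.im| ≤ δ → ∀ ω ∈ simplex n,
      ‖(r * (1 - (kdot ω : ℂ))) ^ l / l.factorial * h fun i => r * ω i‖
        ≤ Real.exp ‖r‖ * (C * Real.exp (B * |r.re|)) := by
    intro r hr ω hω
    have h1 : ‖1 - (kdot ω : ℂ)‖ ≤ 1 := by
      rw [← ofReal_one, ← Complex.ofReal_sub, norm_real, norm_eq_abs]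
      have := kdot_nonneg hω.1
      have := hω.2
      exact abs_le.2 ⟨by linarith, by linarith⟩
    have h2 : ‖(r * (1 - (kdot ω : ℂ))) ^ l / l.factorial‖ ≤ Real.exp ‖r‖ := by
      rw [norm_div, norm_pow, norm_mul, Complex.norm_natCast]
      refine le_trans ?_ (Real.pow_div_factorial_le_exp ‖r‖ (norm_nonneg r) l)
      have : ‖r‖ * ‖1 - (kdot ω : ℂ)‖ ≤ ‖r‖ := mul_le_of_le_one_right (norm_nonneg r) h1
      gcongr
    rw [norm_mul]
    refine mul_le_mul h2 (hB _ _ (him hr hω) (abs_nonneg _) fun i => ?_) (norm_nonneg _) (exp_pos _).le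
    rw [Complex.re_mul_ofReal, abs_mul, abs_of_pos (hω.1 i)]
    exact mul_le_of_le_one_right (abs_nonneg _) (simplex_lt_one hω i).le
  have hfin : IsFiniteMeasure ((volume : Measure (Fin n → ℝ)).restrict (simplex n)) :=
    ⟨by rw [Measure.restrict_apply_univ]; exact volume_simplex_lt_top⟩
  constructor
  · intro r hr
    have hopen : IsOpen {r : ℂ | |r.im| < δ} := isOpen_lt (by fun_prop) continuous_const
    obtain ⟨ρ, hρ, hsub⟩ := isOpen_iff.1 hopen r hr
    have hC : 0 ≤ C := by
      have := (norm_nonneg _).trans (hB 0 0 (fun i => by simpa using hδ.le) le_rfl fun i => by simp)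
      simpa using this
    have hfam : HoloFam (volume.restrict (simplex n)) (fun (ω : Fin n → ℝ) (r : ℂ) =>
        (r * (1 - (kdot ω : ℂ))) ^ l / l.factorial * h fun i => r * ω i) r ρ := by
      refine ⟨?_, fun s hs => ?_, fun _ => Real.exp (‖r‖ + ρ) * (C * Real.exp (|B| * (‖r‖ + ρ))),
        integrable_const _, ?_⟩
      · filter_upwards [ae_restrict_mem measurableSet_simplex] with ω hω s hs
        have h1 := hd _ (him (hsub hs).le hω)
        have h2 : DifferentiableAt ℂ (fun r : ℂ => fun i => r * (ω i : ℂ)) s := by fun_prop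
        exact (DifferentiableAt.mul (by fun_prop) (h1.comp s h2)).differentiableWithinAt
      · refine Measurable.aestronglyMeasurable (Measurable.mul ?_ (hm s))
        have := measurable_kdot (n := n)
        fun_prop
      · filter_upwards [ae_restrict_mem measurableSet_simplex] with ω hω s hs
        have hs' : ‖s‖ ≤ ‖r‖ + ρ := by
          have h1 := norm_le_norm_add_norm_sub' s r
          rw [mem_ball, dist_eq_norm] at hs
          linarith
        refine (hbd s (hsub hs).le ω hω).trans ?_
        have h2 : B * |s.re| ≤ |B| * (‖r‖ + ρ) :=
          mul_le_mul (le_abs_self B) ((abs_re_le_norm s).trans hs') (abs_nonneg _) (abs_nonneg _)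
        gcongr
    exact (hfam.differentiableOn.differentiableAt (ball_mem_nhds r hρ)).differentiableWithinAt
  · intro r hr
    refine (norm_integral_le_of_norm_le_const (C := Real.exp ‖r‖ * (C * Real.exp (B * |r.re|)))
      ?_).trans (le_of_eq ?_)
    · filter_upwards [ae_restrict_mem measurableSet_simplex] with ω hω using hbd r hr ω hω
    · rw [measureReal_restrict_apply_univ, measureReal_def]
      ring

/-! ### The real contour: the density of the difference along rays -/

section

theorem lineExp_eq (M : ℤ) (ν : Fin n → ℂ) (μ T : ℂ) (i : Fin n) :
    lineExp M ν μ T i = lineExp M ν μ 0 i + T * kap i := by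
  simp only [lineExp, lineν]
  ring

/-- Along the line T enters only through e^{-T κ·σ} and polynomially; this is what makes the
integral a Laplace transform in T. -/
theorem reduced_line (M : ℤ) (k : ℕ) (P : Polynomial Poly(n)) (ν : Fin n → ℂ)
    (μ T : ℂ) (σ : Fin n → ℂ) (x : Fin n → ℂ) (y : ℂ) :
    reduced M k (P.eval (𝐂 T)) (lineExp M ν μ T) σ x y
      = exp (-(T * ∑ i, kap i * σ i)) * ∑ j ∈ range (P.natDegree + 1),
        T ^ j * reduced M k (P.coeff j) (lineExp M ν μ 0) σ x y := by
  have h : ∏ i, exp (-σ i * lineExp M ν μ T i) * (exp (-σ i) - 1) ^ M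
      = exp (-(T * ∑ i, kap i * σ i)) *
        ∏ i, exp (-σ i * lineExp M ν μ 0 i) * (exp (-σ i) - 1) ^ M := by
    rw [mul_sum, ← sum_neg_distrib, exp_sum, ← prod_mul_distrib]
    refine prod_congr rfl fun i _ => ?_
    rw [← mul_assoc, ← exp_add, lineExp_eq]
    congr 2
    ring
  simp only [reduced]
  rw [h, ratPart_eval_C, mul_assoc]
  congr 1
  rw [mul_sum]
  exact sum_congr rfl fun j _ => by ring

theorem ofReal_kdot (σ : Fin n → ℝ) : ((kdot σ : ℝ) : ℂ) = ∑ i, kap i * (σ i : ℂ) := by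
  rw [kdot]; push_cast; rfl

/-- The constant 1 written as T^n ∏ κ_i times a Laplace integral over the orthant. This puts the
term of the deformed BA function, which is no integral, into the same form as the other. -/
theorem integral_exp_kdot {T : ℝ} (hT : 0 < T) :
    Integrable (fun σ : Fin n → ℝ => exp (-(T * (kdot σ : ℂ))))
      pow(n, (Set.Ioi 0)) ∧
    ((T : ℂ) ^ n * ∏ i : Fin n, (kap i : ℂ)) * ∫ σ : Fin n → ℝ, exp (-(T * (kdot σ : ℂ)))
      ∂pow(n, (Set.Ioi 0)) = 1 := by
  have h1 : ∀ σ : Fin n → ℝ, exp (-(T * (kdot σ : ℂ)))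
      = ∏ i, ((Real.exp (-(T * kap i * σ i)) : ℝ) : ℂ) := fun σ => by
    rw [ofReal_kdot, mul_sum, ← sum_neg_distrib, exp_sum]
    exact prod_congr rfl fun i _ => by push_cast; congr 1; ring
  have hk : ∀ i : Fin n, 0 < T * kap i := fun i => mul_pos hT (by exact_mod_cast kap_pos i)
  have h2 : ∀ i : Fin n, IntegrableOn (fun s : ℝ => Real.exp (-(T * kap i * s))) (Set.Ioi 0) ∧
      ∫ s in Set.Ioi (0 : ℝ), Real.exp (-(T * kap i * s)) = 1 / (T * kap i) := fun i => by
    have := integrableOn_pow_mul_exp 0 (hk i)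
    simpa using this
  simp only [h1]
  refine ⟨Integrable.fintype_prod fun i => (h2 i).1.ofReal, ?_⟩
  rw [integral_fintype_prod_eq_prod (fun (i : Fin n) (s : ℝ) => ((Real.exp (-(T * kap i * s)) : ℝ) : ℂ)),
    show (T : ℂ) ^ n = ∏ _i : Fin n, (T : ℂ) by simp, ← prod_mul_distrib,
    ← prod_mul_distrib]
  refine Finset.prod_eq_one fun i _ => ?_
  rw [integral_complex_ofReal, (h2 i).2]
  have h3 : (T : ℂ) * kap i ≠ 0 := by exact_mod_cast (hk i).ne'
  push_cast
  rw [mul_one_div, div_self h3]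

variable {M : ℤ}

/-- The density along rays of the difference of the two sides. -/
def density (M : ℤ) (ν : Fin n → ℂ) (μ : ℂ) (P : Polynomial Poly(n))
    (P' : Polynomial DefPoly(n)) (q : Polynomial ℂ) (c : ℂ) (J : ℕ)
    (x : Fin n → ℂ) (y r : ℂ) : ℂ :=
  (∑ a ∈ range (q.natDegree + 1), ∑ b ∈ range (P.natDegree + 1),
    q.coeff a * radial (J - 1 - (a + b))
      (fun σ => reduced M (mstar M) (P.coeff b) (lineExp M ν μ 0) σ x y) r)
  - ∑ b ∈ range (P'.natDegree + 1),
    c * (∏ i : Fin n, (kap i : ℂ)) * radial (n := n) (J - 1 - (b + n))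
      (fun _ => defRed (mstar M) (P'.coeff b) x y) r

/-- The difference is a sum of powers of T times Laplace integrals. Choosing l = J-1-s for the power
T^s makes all of them T^J times a Laplace transform, so that they merge into a single density. Only
absolute convergence at the given T is needed. -/
theorem lineDiff_eq_integral {q : Polynomial ℂ} {c : ℂ} {J : ℕ}
    (hJ : q.natDegree + P.natDegree + P'.natDegree + n + 1 ≤ J) {T : ℝ} (hT : 0 < T)
    {x : Fin n → ℂ} {y : ℂ} (hi : ∀ b, Integrable (fun σ : Fin n → ℝ =>
      exp (-(T * (kdot σ : ℂ))) * reduced M (mstar M) (P.coeff b) (lineExp M ν μ 0)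
        (fun i => (σ i : ℂ)) x y) pow(n, (Set.Ioi 0))) :
    lineDiff M ν μ P P' (Set.Ioi 0) (fun _ t => (t : ℂ)) (fun _ _ => 1) (q.eval (T : ℂ)) c T x y
      = (T : ℂ) ^ J * ∫ r in Set.Ioi (0 : ℝ), exp (-(T * r)) *
        (r ^ n * density M ν μ P P' q c J x y r) := by
  have hT0 : (T : ℂ) ≠ 0 := by exact_mod_cast hT.ne'
  set m := Measure.pi fun _ : Fin n => (volume : Measure ℝ).restrict (Set.Ioi 0) with hm
  set h : ℕ → (Fin n → ℂ) → ℂ := fun b σ => reduced M (mstar M) (P.coeff b) (lineExp M ν μ 0) σ x y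
    with hh
  set f : ℕ → ℂ := fun b => defRed (mstar M) (P'.coeff b) x y with hf
  have hmeas : ∀ b, Measurable fun σ : Fin n → ℝ => h b fun i => (σ i : ℂ) := fun b =>
    measurable_reduced _ _ _ _ (fun i => by fun_prop) _ _
  have A := fun l b => laplace_radial l hT (hmeas b) (hi b)
  obtain ⟨i0, e0⟩ := integral_exp_kdot (n := n) hT
  have A' := fun l b => laplace_radial (n := n) l hT (h := fun _ => f b) measurable_const
    (i0.mul_const (f b))
  have e1 : redInt M (mstar M) (P.eval (𝐂 (T : ℂ))) (lineExp M ν μ T) (Set.Ioi 0)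
      (fun _ t => (t : ℂ)) (fun _ _ => 1) x y = ∑ b ∈ range (P.natDegree + 1), (T : ℂ) ^ b *
        ∫ σ, exp (-(T * (kdot σ : ℂ))) * h b (fun i => (σ i : ℂ)) ∂m := by
    simp only [redInt, prod_const_one, mul_one, reduced_line, ← ofReal_kdot]
    simp only [← integral_const_mul]
    rw [← integral_finsetSum _ fun b _ => (hi b).const_mul _]
    refine integral_congr_ae (Eventually.of_forall fun σ => ?_)
    beta_reduce
    rw [mul_sum]
    exact sum_congr rfl fun b _ => by ring
  have e2 : ∫ r in Set.Ioi (0 : ℝ), exp (-(T * r)) * (r ^ n * density M ν μ P P' q c J x y r)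
      = (∑ a ∈ range (q.natDegree + 1), ∑ b ∈ range (P.natDegree + 1), q.coeff a *
        ∫ r in Set.Ioi (0 : ℝ), exp (-(T * r)) * (r ^ n * radial (J - 1 - (a + b)) (h b) r))
      - ∑ b ∈ range (P'.natDegree + 1), c * (∏ i : Fin n, (kap i : ℂ)) *
        ∫ r in Set.Ioi (0 : ℝ), exp (-(T * r)) *
          (r ^ n * radial (n := n) (J - 1 - (b + n)) (fun _ => f b) r) := by
    simp only [← integral_const_mul]
    have j1 : ∀ a b, IntegrableOn (fun r : ℝ => q.coeff a * (exp (-(T * r)) *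
        (r ^ n * radial (J - 1 - (a + b)) (h b) r))) (Set.Ioi 0) := fun a b => (A _ b).1.const_mul _
    have j2 : ∀ b, IntegrableOn (fun r : ℝ => c * (∏ i : Fin n, (kap i : ℂ)) *
        (exp (-(T * r)) * (r ^ n * radial (n := n) (J - 1 - (b + n)) (fun _ => f b) r)))
        (Set.Ioi 0) := fun b => (A' _ b).1.const_mul _
    simp only [← integral_finsetSum _ fun b _ => j1 _ b]
    rw [← integral_finsetSum _ fun a _ => integrable_finsetSum _ fun b _ => j1 a b,
      ← integral_finsetSum _ fun b _ => j2 b, ← integral_sub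
      (integrable_finsetSum _ fun a _ => integrable_finsetSum _ fun b _ => j1 a b)
      (integrable_finsetSum _ fun b _ => j2 b)]
    refine integral_congr_ae (Eventually.of_forall fun r => ?_)
    simp only [density, mul_sub, mul_sum]
    congr 1
    · exact sum_congr rfl fun a _ => sum_congr rfl fun b _ => by ring
    · exact sum_congr rfl fun b _ => by ring
  -- The lower bound on J keeps the truncated subtraction J - 1 - s honest for all exponents that
  -- occur.
  have hpow : ∀ s, s + 1 ≤ J → (T : ℂ) ^ J * ((T : ℂ) ^ (J - 1 - s + 1))⁻¹ = T ^ s := fun s hs => by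
    rw [show (T : ℂ) ^ J = T ^ s * T ^ (J - 1 - s + 1) by rw [← pow_add]; congr 1; omega,
      mul_inv_cancel_right₀ (pow_ne_zero _ hT0)]
  rw [lineDiff, e1, defRed_eval_C, e2, eval_eq_sum_range, mul_sub, sum_mul_sum,
    mul_sum, mul_sum, mul_sum]
  congr 1
  · refine sum_congr rfl fun a ha => ?_
    rw [mul_sum]
    refine sum_congr rfl fun b hb => ?_
    rw [(A _ b).2]
    have := hpow (a + b) (by rw [mem_range] at ha hb; omega)
    rw [pow_add (T : ℂ) a b] at this
    linear_combination (-q.coeff a * ∫ σ, exp (-(T * (kdot σ : ℂ))) * h b (fun i => (σ i : ℂ)) ∂m)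
      * this
  · refine sum_congr rfl fun b hb => ?_
    rw [(A' _ b).2, integral_mul_const]
    have := hpow (b + n) (by rw [mem_range] at hb; omega)
    rw [pow_add] at this
    set J := ∫ σ : Fin n → ℝ, exp (-(T * (kdot σ : ℂ))) ∂m with hJ
    linear_combination (-c * (∏ i : Fin n, (kap i : ℂ)) * J * f b) * this - c * T ^ b * f b * e0

/-- Bounds for the coefficients of the reduced integrand on a strip. -/
theorem norm_reduced_le_strip (hM : 0 ≤ M) {k : ℕ} {p : Poly(n)} {b : Fin n → ℂ}
    {C δ R : ℝ} {B : ℕ} (hR : 0 ≤ R) {σ x : Fin n → ℂ} {y : ℂ}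
    (hσ : ∀ i, |(σ i).im| ≤ δ) (hσR : ∀ i, |(σ i).re| ≤ R)
    (h : ‖ratPart M k p shifted(σ, x) expos(x) (expo y)‖
      ≤ C * Real.exp (B * R)) :
    ‖reduced M k p b σ x y‖ ≤ ((∏ i, Real.exp (δ * ‖b i‖) * 2 ^ M.toNat) * C) *
      Real.exp ((∑ i, ‖b i‖ + n * M.toNat + B) * R) := by
  obtain ⟨m, rfl⟩ := Int.eq_ofNat_of_zero_le hM
  rw [Int.toNat_natCast]
  rw [reduced, norm_mul, norm_prod]
  have h1 : ∏ i, ‖exp (-σ i * b i) * (exp (-σ i) - 1) ^ (m : ℤ)‖ ≤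
      ∏ i, (Real.exp (δ * ‖b i‖) * 2 ^ m) * Real.exp (‖b i‖ * R + m * R) := by
    refine Finset.prod_le_prod (fun _ _ => norm_nonneg _) fun i _ => ?_
    have h2 : ‖σ i‖ ≤ R + δ := by
      have := Complex.norm_le_abs_re_add_abs_im (σ i)
      have := hσ i
      have := hσR i
      linarith
    have h3 : ‖exp (-σ i * b i)‖ ≤ Real.exp (δ * ‖b i‖) * Real.exp (‖b i‖ * R) := by
      refine (Complex.norm_exp_le_exp_norm _).trans ?_
      rw [← Real.exp_add, exp_le_exp, norm_mul, norm_neg]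
      nlinarith [norm_nonneg (b i)]
    have h4 : ‖exp (-σ i) - 1‖ ≤ 2 * Real.exp R := by
      refine (norm_sub_le _ _).trans ?_
      rw [norm_one, norm_exp, neg_re]
      have : Real.exp (-(σ i).re) ≤ Real.exp R :=
        exp_le_exp.2 (by linarith [(abs_le.1 (hσR i)).1])
      have := one_le_exp hR
      linarith
    rw [norm_mul, zpow_natCast, norm_pow]
    calc _ ≤ (Real.exp (δ * ‖b i‖) * Real.exp (‖b i‖ * R)) * (2 * Real.exp R) ^ m := by gcongr
      _ = _ := by rw [mul_pow, ← exp_nat_mul, Real.exp_add]; ring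
  refine (mul_le_mul h1 h (norm_nonneg _) (by positivity)).trans (le_of_eq ?_)
  rw [prod_mul_distrib, ← Real.exp_sum, sum_add_distrib, ← sum_mul,
    sum_const, card_univ, Fintype.card_fin, nsmul_eq_mul]
  have h5 : Real.exp ((∑ i, ‖b i‖ + n * m + B) * R)
      = Real.exp ((∑ i, ‖b i‖) * R + n * (m * R)) * Real.exp (B * R) := by
    rw [← Real.exp_add]; congr 1; ring
  rw [h5]
  ring

end

/-! ### The real contour: vanishing of the difference -/

section

/-- The Euler integral in exponential coordinates. -/
theorem integral_beta_exp (m : ℕ) : ∀ {b : ℂ}, -1 < b.re →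
    IntegrableOn (fun t : ℝ => exp (-t * (b + 1)) * (exp (-t) - 1) ^ m) (Set.Ioi 0) ∧
    (∏ l ∈ range (m + 1), (b + 1 + l)) * ∫ t in Set.Ioi (0 : ℝ),
      exp (-t * (b + 1)) * (exp (-t) - 1) ^ m = (-1) ^ m * m.factorial := by
  induction m with
  | zero =>
    intro b hb
    have h0 : (-(b + 1)).re < 0 := by simp; linarith
    have h1 : ∀ t : ℝ, exp (-t * (b + 1)) * (exp (-t) - 1) ^ 0
        = exp (-(b + 1) * t) := fun t => by rw [pow_zero, mul_one]; congr 1; ring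
    simp only [h1]
    refine ⟨integrableOn_exp_mul_complex_Ioi h0 0, ?_⟩
    rw [integral_exp_mul_complex_Ioi h0]
    have h2 : b + 1 ≠ 0 := fun h => by rw [h] at h0; simp at h0
    simp only [ofReal_zero, mul_zero, exp_zero]
    field_simp
    simp
  | succ m ih =>
    intro b hb
    obtain ⟨i1, e1⟩ := ih hb
    obtain ⟨i2, e2⟩ := ih (b := b + 1) (by simp; linarith)
    -- Multiplying out one factor e^{-t} - 1 gives the difference of the integrals at b + 1 and at
    -- b.
    have h1 : ∀ t : ℝ, exp (-t * (b + 1)) * (exp (-t) - 1) ^ (m + 1)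
        = exp (-t * (b + 1 + 1)) * (exp (-t) - 1) ^ m
          - exp (-t * (b + 1)) * (exp (-t) - 1) ^ m := fun t => by
      rw [show -(t : ℂ) * (b + 1 + 1) = -t * (b + 1) + -t by ring, exp_add]
      ring
    simp only [h1]
    refine ⟨i2.sub i1, ?_⟩
    rw [integral_sub i2 i1]
    set A := ∫ t in Set.Ioi (0 : ℝ), exp (-t * (b + 1 + 1)) * (exp (-t) - 1) ^ m
    set A' := ∫ t in Set.Ioi (0 : ℝ), exp (-t * (b + 1)) * (exp (-t) - 1) ^ m
    -- The product is peeled at its first factor for the integral at b + 1 and at its last factor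
    -- for the one at b; the difference of the two factors is -(m+1).
    have e3 : ∏ l ∈ range (m + 1 + 1), (b + 1 + (l : ℂ))
        = (b + 1) * ∏ l ∈ range (m + 1), (b + 1 + 1 + (l : ℂ)) := by
      rw [Finset.prod_range_succ', mul_comm]
      congr 1
      · simp
      · exact prod_congr rfl fun l _ => by push_cast; ring
    have e4 : ∏ l ∈ range (m + 1 + 1), (b + 1 + (l : ℂ))
        = (b + 1 + (m + 1)) * ∏ l ∈ range (m + 1), (b + 1 + (l : ℂ)) := by
      rw [Finset.prod_range_succ, mul_comm]
      push_cast
      rfl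
    rw [mul_sub]
    nth_rewrite 1 [e3]
    rw [e4, mul_assoc, e2, mul_assoc, e1, Nat.factorial_succ]
    push_cast
    ring

/-- Points of the tube around the flow line have a gap of their own, since the real flow leaves
imaginary parts unchanged. So an induction hypothesis about all points with a gap applies throughout
the tube. -/
theorem Gap.shrink {d δ : ℝ} {x x' : Fin n → ℂ} {y y' : ℂ} (h : Gap d x y) (h' : Near δ x y x' y')
    (hδ : 2 * δ < d) (r : ℝ) : Gap (d - 2 * δ) (flow x' r) y' := by
  have hx : ∀ i, |(flow x' r i - x i).im| ≤ δ := fun i => by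
    rw [im_flow_sub]
    exact (abs_im_le_norm _).trans (h'.left i).le
  have hy : |(y' - y).im| ≤ δ := (abs_im_le_norm _).trans h'.right.le
  refine ⟨by linarith, fun i j hij k => ?_, fun i k => ?_⟩
  · have := gap_shift (h.xx i j hij) (hx i) (hx j) k
    linarith
  · have := gap_shift (h.xy i) (hx i) hy k
    linarith

variable {M : ℤ}

theorem measurableSet_orthant : MeasurableSet {σ : Fin n → ℝ | ∀ i, 0 < σ i} := by
  have : {σ : Fin n → ℝ | ∀ i, 0 < σ i} = ⋂ i, {σ | 0 < σ i} := by ext; simp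
  rw [this]
  exact MeasurableSet.iInter fun i => measurableSet_lt measurable_const (measurable_pi_apply i)

/-- Integrability of the coefficients of the integrand. -/
theorem integrable_coeff (hM : 0 ≤ M) {k : ℕ} {p : Poly(n)} {C T : ℝ} {B : ℕ}
    {x : Fin n → ℂ} {y : ℂ} (hB : ∀ i, (B : ℝ) < (lineExp M ν μ T i).re)
    (hp : ∀ ξ : Fin n → ℝ, (∀ i, 0 ≤ ξ i) → ‖ratPart M k p (fun i => expo (x i - (ξ i : ℂ) / 2))
      expos(x) (expo y)‖ ≤ C * Real.exp (B * ∑ i, ξ i)) :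
    Integrable (fun σ : Fin n → ℝ => exp (-(T * (kdot σ : ℂ))) * reduced M k p
      (lineExp M ν μ 0) (fun i => (σ i : ℂ)) x y)
      pow(n, (Set.Ioi 0)) := by
  have h1 : ∀ σ : Fin n → ℝ, exp (-(T * (kdot σ : ℂ))) * reduced M k p
      (lineExp M ν μ 0) (fun i => (σ i : ℂ)) x y
      = reduced M k p (lineExp M ν μ T) (fun i => (σ i : ℂ)) x y := fun σ => by
    have := reduced_line M k (Polynomial.C p) ν μ T (fun i => (σ i : ℂ)) x y
    simpa [ofReal_kdot] using this.symm
  simp only [h1]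
  refine (integrable_prod_exp (fun i => sub_pos.2 (hB i)) ((∏ i, Real.exp (0 * ‖lineExp M ν μ T i‖) *
    (Real.exp 0 + 1) ^ M.toNat) * C * Real.exp (B * 0))).mono'
    (measurable_reduced M k p _ (fun i => by fun_prop) x y).aestronglyMeasurable ?_
  rw [pi_restrict_Ioi]
  filter_upwards [ae_restrict_mem measurableSet_orthant] with ξ hξ
  have hξ0 : ∀ i, 0 ≤ ξ i := fun i => (hξ i).le
  exact norm_reduced_le_real hM hξ0 (fun i => by simp) (by simpa using hp ξ hξ0)

/-- Bounds for the density along rays. -/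
theorem Gap.density_spec (hM : 0 ≤ M) {d : ℝ} {x : Fin n → ℂ} {y : ℂ} (h : Gap d x y)
    (hP : ∀ j α, mstar M * vdmWt n < wt kap α → (P.coeff j).coeff α = 0)
    (hP' : ∀ j α, mstar M * vdmWt n + ∑ i : Fin n, kap i < wt kapDef α → (P'.coeff j).coeff α = 0)
    (q : Polynomial ℂ) (c : ℂ) (J : ℕ) :
    ∃ A B : ℝ, 0 ≤ A ∧ 0 ≤ B ∧ ∀ r : ℝ, 0 ≤ r → ∀ (x' : Fin n → ℂ) (y' : ℂ), Near (d / 4) x y x' y' →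
      DifferentiableOn ℂ (density M ν μ P P' q c J (flow x' r) y') {s | |s.im| < d / 4} ∧
      ∀ s : ℂ, |s.im| ≤ d / 4 →
        ‖density M ν μ P P' q c J (flow x' r) y' s‖ ≤ A * Real.exp (B * ‖s‖) := by
  have hd := h.pos
  have hδ : 0 < d / 4 := by positivity
  obtain ⟨c0, hc0, hsep⟩ := h.exists_sepAt
  obtain ⟨C, B, hC, hCB⟩ := h.ratPart_coeff_le M (mstar M) P hP
  obtain ⟨C', hC', hCB'⟩ := h.defRed_coeff_le (mstar M) P' hP'
  set D := (∏ i, Real.exp (d / 4 * ‖lineExp M ν μ 0 i‖) * 2 ^ M.toNat) * C with hD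
  set B' : ℝ := ∑ i, ‖lineExp M ν μ 0 i‖ + n * M.toNat + B with hB'
  have hD0 : 0 ≤ D := mul_nonneg (prod_nonneg fun i _ => by positivity) hC
  have hB0 : 0 ≤ B' := add_nonneg (add_nonneg (sum_nonneg fun i _ => norm_nonneg _)
    (by positivity)) (by positivity)
  set V := (volume (simplex n)).toReal with hV
  have hV0 : 0 ≤ V := ENNReal.toReal_nonneg
  have key : ∀ r : ℝ, 0 ≤ r → ∀ (x' : Fin n → ℂ) (y' : ℂ), Near (d / 4) x y x' y' → ∀ l b,
      DifferentiableOn ℂ (radial l fun σ => reduced M (mstar M) (P.coeff b) (lineExp M ν μ 0) σ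
        (flow x' r) y') {s | |s.im| < d / 4} ∧ ∀ s : ℂ, |s.im| ≤ d / 4 →
        ‖radial l (fun σ => reduced M (mstar M) (P.coeff b) (lineExp M ν μ 0) σ
        (flow x' r) y') s‖ ≤ V * (Real.exp ‖s‖ * (D * Real.exp (B' * |s.re|))) := by
    intro r hr x' y' hn l b
    refine radial_spec l hδ (fun s => measurable_reduced _ _ _ _ (fun i => by fun_prop) _ _)
      (fun σ hσ => ?_) fun σ R hσ hR hσR => ?_
    · exact differentiableAt_reduced (σ := fun σ => σ) (x := fun _ => flow x' r) (y := fun _ => y') M _ _ _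
        (fun i => differentiableAt_apply i σ) (fun i => differentiableAt_const _)
        (differentiableAt_const _) hc0 (hsep r x' y' σ hn hσ) (Or.inl hM)
    · exact norm_reduced_le_strip hM hR hσ hσR (hCB b r hr x' y' σ R hn hσ hR hσR)
  have key' : ∀ r : ℝ, 0 ≤ r → ∀ (x' : Fin n → ℂ) (y' : ℂ), Near (d / 4) x y x' y' → ∀ l b,
      DifferentiableOn ℂ (radial (n := n) l fun _ => defRed (mstar M) (P'.coeff b) (flow x' r) y')
        {s | |s.im| < d / 4} ∧ ∀ s : ℂ, |s.im| ≤ d / 4 →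
        ‖radial (n := n) l (fun _ => defRed (mstar M) (P'.coeff b) (flow x' r) y') s‖
          ≤ V * (Real.exp ‖s‖ * (C' * Real.exp (0 * |s.re|))) := by
    intro r hr x' y' hn l b
    refine radial_spec l hδ (fun s => measurable_const) (fun σ hσ => differentiableAt_const _)
      fun σ R hσ hR hσR => ?_
    rw [zero_mul, Real.exp_zero, mul_one]
    exact hCB' b r hr x' y' hn
  refine ⟨(∑ a ∈ range (q.natDegree + 1), ∑ b ∈ range (P.natDegree + 1),
    ‖q.coeff a‖ * (V * D)) + ∑ b ∈ range (P'.natDegree + 1),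
    ‖c * ∏ i : Fin n, (kap i : ℂ)‖ * (V * C'), 1 + B', by positivity, by positivity,
    fun r hr x' y' hn => ⟨?_, fun s hs => ?_⟩⟩
  · unfold density
    refine DifferentiableOn.sub (DifferentiableOn.fun_sum fun a _ => DifferentiableOn.fun_sum fun b _ =>
      (key r hr x' y' hn _ b).1.const_mul _) (DifferentiableOn.fun_sum fun b _ =>
      (key' r hr x' y' hn _ b).1.const_mul _)
  · have hre := abs_re_le_norm s
    have e1 : Real.exp ‖s‖ * Real.exp (B' * |s.re|) ≤ Real.exp ((1 + B') * ‖s‖) := by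
      rw [← Real.exp_add, exp_le_exp]
      nlinarith
    have e2 : Real.exp ‖s‖ ≤ Real.exp ((1 + B') * ‖s‖) := by
      rw [exp_le_exp]
      nlinarith [norm_nonneg s]
    unfold density
    rw [add_mul, sum_mul, sum_mul]
    refine (norm_sub_le _ _).trans (add_le_add ((norm_sum_le _ _).trans (sum_le_sum fun a _ => ?_))
      ((norm_sum_le _ _).trans (sum_le_sum fun b _ => ?_)))
    · rw [sum_mul]
      refine (norm_sum_le _ _).trans (sum_le_sum fun b _ => ?_)
      rw [norm_mul, mul_assoc]
      refine mul_le_mul_of_nonneg_left (((key r hr x' y' hn _ b).2 s hs).trans ?_) (norm_nonneg _)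
      calc _ = V * D * (Real.exp ‖s‖ * Real.exp (B' * |s.re|)) := by ring
        _ ≤ _ := by gcongr
    · rw [norm_mul, mul_assoc]
      refine mul_le_mul_of_nonneg_left (((key' r hr x' y' hn _ b).2 s hs).trans ?_) (norm_nonneg _)
      rw [zero_mul, Real.exp_zero, mul_one]
      calc _ = V * C' * Real.exp ‖s‖ := by ring
        _ ≤ _ := by gcongr

end

/-! ### The real contour: vanishing of the density along rays -/

section
variable {m : ℕ}

/-- The polynomial which clears the denominators of the Euler integrals. -/
def betaPoly (m : ℕ) (ν : Fin n → ℂ) (μ : ℂ) : Polynomial ℂ :=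
  ∏ i, (Polynomial.C (lineExp m ν μ 0 i) + Polynomial.C (kap i : ℂ) * Polynomial.X) *
    ∏ l ∈ range (m + 1),
      (Polynomial.C (lineExp m ν μ 0 i + 1 + l) + Polynomial.C (kap i : ℂ) * Polynomial.X)

theorem eval_betaPoly (m : ℕ) (ν : Fin n → ℂ) (μ T : ℂ) : (betaPoly m ν μ).eval T
    = ∏ i, lineExp m ν μ T i * ∏ l ∈ range (m + 1), (lineExp m ν μ T i + 1 + l) := by
  simp only [betaPoly, eval_prod, eval_mul, eval_add,
    eval_C, eval_X]
  refine prod_congr rfl fun i _ => ?_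
  rw [lineExp_eq (m : ℤ) ν μ T i]
  congr 1
  · ring
  · exact prod_congr rfl fun l _ => by ring

/-- Besides the denominators of the Euler integrals, `betaPoly` contains the exponent b_i itself,
which is the i-th factor of C(ν, μ). This makes the right side the normalisation that `Line.tendsto`
asks for. -/
theorem betaPoly_mul_integral (m : ℕ) {ν : Fin n → ℂ} {μ T : ℂ} (h : ∀ i, -1 < (lineExp m ν μ T i).re) :
    (betaPoly m ν μ).eval T * ∏ i, ∫ t in Set.Ioi (0 : ℝ), exp (-(t : ℂ) * (lineExp m ν μ T i + 1)) *
      (exp (-(t : ℂ)) - 1) ^ (m : ℤ) * 1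
    = ((-1) ^ m * m.factorial : ℂ) ^ n * normCdef m (lineν ν T) μ := by
  rw [eval_betaPoly, ← prod_mul_distrib, normCdef,
    show ((-1) ^ m * m.factorial : ℂ) ^ n = ∏ _i : Fin n, ((-1) ^ m * m.factorial : ℂ) by simp,
    ← prod_mul_distrib]
  refine prod_congr rfl fun i _ => ?_
  have := (integral_beta_exp m (h i)).2
  simp only [zpow_natCast, mul_one]
  rw [mul_assoc, this, mul_comm, lineExp]
  push_cast
  ring

theorem lineDiff_mul {M : ℤ} {S : Set ℝ} {γ γ' : Fin n → ℝ → ℂ} (a c₁ c₂ T : ℂ) (x : Fin n → ℂ) (y : ℂ) :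
    lineDiff M ν μ P P' S γ γ' (a * c₁) (a * c₂) T x y = a * lineDiff M ν μ P P' S γ γ' c₁ c₂ T x y := by
  simp only [lineDiff]
  ring

theorem eventually_lt_lineExp (M : ℤ) (ν : Fin n → ℂ) (μ : ℂ) (B : ℝ) :
    ∀ᶠ T : ℝ in atTop, ∀ i, B < (lineExp M ν μ T i).re := by
  rw [eventually_all]
  intro i
  have h1 : Tendsto (fun T : ℝ => (lineExp M ν μ 0 i).re + T * kap i) atTop atTop :=
    tendsto_atTop_add_const_left _ _
      (tendsto_id.atTop_mul_const (by exact_mod_cast kap_pos i))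
  filter_upwards [h1.eventually (eventually_gt_atTop B)] with T hT
  rw [lineExp_eq]
  simpa using hT

/-- The Taylor coefficients of the density vanish. -/
theorem Line.quot_density_eq_zero (h : Line (m : ℤ) Φ F ν μ P P') (hm : 0 < m) {J : ℕ}
    (hJ : (betaPoly m ν μ).natDegree + P.natDegree + P'.natDegree + n + 1 ≤ J) (k : ℕ) :
    ∀ {d : ℝ} {x : Fin n → ℂ} {y : ℂ}, Gap d x y →
      quot (density m ν μ P P' (betaPoly m ν μ) (((-1) ^ m * m.factorial : ℂ) ^ n) J x y) k 0 = 0 := by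
  induction k using Nat.strong_induction_on with
  -- The hypothesis is about all points with a gap, not just (x, y): Watson's lemma is needed at
  -- every point of the tube around the flow line.
  | _ k ih =>
    intro d x y hg
    have hd := hg.pos
    have hδ : 0 < d / 4 := by positivity
    set q := betaPoly m ν μ with hq
    set c := ((-1) ^ m * m.factorial : ℂ) ^ n with hc
    have hM : (0 : ℤ) < (m : ℤ) := by exact_mod_cast hm
    obtain ⟨c0, hc0, hsep⟩ := hg.exists_sepAt
    obtain ⟨A, B, hA, hB, hAB⟩ := hg.density_spec (μ := μ) (ν := ν) hM.le h.weight h.weight' q c J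
    obtain ⟨B₁, hB₁⟩ := hg.ratPart_line_le m (mstar m) P h.weight
    obtain ⟨C₂, B₂, hC₂, hB₂⟩ := hg.ratPart_coeff_le m (mstar m) P h.weight
    have hev : ∀ᶠ T : ℝ in atTop, (normC (mstar m) (lineν ν T) ≠ 0 ∧ normCdef m (lineν ν T) μ ≠ 0) ∧
        (∀ i, (B₁ : ℝ) < (lineExp m ν μ T i).re) ∧ (∀ i, (B₂ : ℝ) < (lineExp m ν μ T i).re) ∧
        2 * B ≤ T ∧ 0 < T :=
      ((eventually_normC_lineν _ ν).and (eventually_normCdef_lineν m ν μ)).and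
        ((eventually_lt_lineExp _ ν μ _).and ((eventually_lt_lineExp _ ν μ _).and
          ((eventually_ge_atTop _).and (eventually_gt_atTop 0))))
    obtain ⟨T₁, hT₁⟩ := eventually_atTop.1 hev
    have hnear : ∀ x' y', (∀ i, ‖x' i - x i‖ < d / 4) → ‖y' - y‖ < d / 4 → Near (d / 4) x y x' y' :=
      fun x' y' h1 h2 => ⟨h1, h2⟩
    have hself := near_self hδ x y
    set A' := A * Real.exp (B * (d / 4)) with hA'
    have hAA' : A ≤ A' := le_mul_of_one_le_right hA (one_le_exp (by positivity))
    have hball : ball (0 : ℂ) (d / 4) ⊆ {s : ℂ | |s.im| < d / 4} := fun s hs => by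
      rw [mem_ball_zero_iff] at hs
      exact (abs_im_le_norm s).trans_lt hs
    have hbb : ∀ r : ℝ, 0 ≤ r → ∀ x' y', Near (d / 4) x y x' y' → ∀ z ∈ ball (0 : ℂ) (d / 4),
        ‖density m ν μ P P' q c J (flow x' r) y' z‖ ≤ A' := by
      intro r hr x' y' hn z hz
      refine ((hAB r hr x' y' hn).2 z (le_of_lt (hball hz))).trans ?_
      rw [mem_ball_zero_iff] at hz
      rw [hA']
      gcongr
    -- With the lower Taylor coefficients zero, the difference rescaled by T^{n+k+1-J} converges to
    -- (n+k)! times the k-th coefficient; this limit plays the role of e in `limit_eq_zero`.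
    have hkey : (((n + k).factorial : ℕ) : ℂ) * quot (density m ν μ P P' q c J x y) k 0 = 0 := by
      refine limit_eq_zero (M := m) (ν := ν) (μ := μ) (T₁ := T₁) (δ := d / 4)
        (g := fun T x y => ((T : ℂ) ^ (n + k + 1) * ((T : ℂ) ^ J)⁻¹) *
          lineDiff m ν μ P P' (Set.Ioi 0) (fun _ t => (t : ℂ)) (fun _ _ => 1) (q.eval (T : ℂ)) c T x y)
        (e := fun x y => (((n + k).factorial : ℕ) : ℂ) * quot (density m ν μ P P' q c J x y) k 0)
        (C := 2 * A' * (2 / (d / 4)) ^ (k + 1) * (n + k + 1).factorial * 2 ^ (n + k + 2))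
        (C' := (n + k).factorial * (A' * (2 / (d / 4)) ^ k))
        (V := (norm_potential_le (n := n) m hc0).choose)
        (by exact_mod_cast hm.ne') hδ ?_ ?_ ?_ ?_ ?_
      · intro T hT r hr
        obtain ⟨⟨hN, hN'⟩, hT1, hT2, hT3, hT4⟩ := hT₁ T hT
        obtain ⟨C, hC, hCB⟩ := hB₁ T
        simp only [← lineDiff_mul]
        refine h.eigenAt hM.ne' hN hN' _ _ (fun x' y' hx' hy' => ?_)
          (hg.contour_real hM hCB hT1 hr)
        obtain ⟨h1, h2⟩ := Near.of_flow le_rfl hx' hy'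
        have := (hsep r _ y' 0 h1 fun i => by simpa using hδ.le).vdm_ne_zero hc0
        rw [h2] at this
        exact this.2
      · intro r hr
        exact (norm_potential_le (n := n) m hc0).choose_spec _ _ _
          (hsep r x y 0 hself fun i => by simpa using hδ.le)
      · intro T hT r hr x' y' hx' hy'
        obtain ⟨⟨hN, hN'⟩, hT1, hT2, hT3, hT4⟩ := hT₁ T hT
        have hn := hnear x' y' hx' hy'
        obtain ⟨d1, d2⟩ := hAB r hr x' y' hn
        have hT0 : (T : ℂ) ≠ 0 := by exact_mod_cast hT4.ne'
        rw [lineDiff_eq_integral hJ hT4 fun b => integrable_coeff hM.le hT2 fun ξ hξ =>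
          hB₂ b r hr x' y' (fun i => ξ i) _ hn (fun i => by simpa using hδ.le)
          (sum_nonneg fun i _ => hξ i) fun i => by
            rw [ofReal_re, abs_of_nonneg (hξ i)]
            exact single_le_sum (fun j _ => hξ j) (mem_univ i),
          ← mul_assoc, inv_mul_cancel_right₀ (pow_ne_zero _ hT0)]
        -- The error O(1/T) of Watson's lemma depends only on the disc and the bound for the
        -- density, which are uniform in the tube.
        refine watson n k hδ hB (d1.mono hball) (hbb r hr x' y' hn) ?_ (fun s hs => ?_)
          (fun j hj => ih j hj (hg.shrink hn (by linarith [hg.pos]) r)) T hT4 hT3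
        · refine d1.continuousOn.comp continuous_ofReal.continuousOn fun s _ => ?_
          simpa using hδ
        · refine (d2 s (by simpa using hδ.le)).trans ?_
          rw [norm_real, norm_of_nonneg hs]
          gcongr
      · intro r hr x' y' hx' hy'
        have hn := hnear x' y' hx' hy'
        rw [norm_mul, Complex.norm_natCast]
        exact mul_le_mul_of_nonneg_left ((norm_quot_le hδ ((hAB r hr x' y' hn).1.mono hball)
          (hbb r hr x' y' hn) k).2 0 (mem_ball_self hδ)) (by positivity)
      · intro T hT
        obtain ⟨⟨hN, hN'⟩, hT1, hT2, hT3, hT4⟩ := hT₁ T hT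
        obtain ⟨C, hC, hCB⟩ := hB₁ T
        rw [show (0 : ℂ) = ((T : ℂ) ^ (n + k + 1) * ((T : ℂ) ^ J)⁻¹) * 0 by rw [mul_zero]]
        refine Tendsto.const_mul _ (h.tendsto hN hN' measurableSet_Ioi
          (fun _ => Complex.measurable_ofReal) (fun _ => measurable_const)
          (betaPoly_mul_integral m fun i => lt_of_le_of_lt (by linarith [B₁.cast_nonneg (α := ℝ)]) (hT1 i))
          (integrable_prod_exp (fun i => sub_pos.2 (hT1 i)) ((∏ i, Real.exp (0 * ‖lineExp m ν μ T i‖) *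
            (Real.exp 0 + 1) ^ (m : ℤ).toNat) * C * Real.exp (B₁ * 0))) fun r hr ξ hξ => ?_)
        have hξ0 : ∀ i, 0 ≤ ξ i := fun i => le_of_lt (hξ i)
        simp only [prod_const_one, mul_one]
        refine norm_reduced_le_real hM.le hξ0 (fun i => by simp) ?_
        rw [add_zero]
        exact hCB r hr x y (fun i => ξ i) _ hself (fun i => by simpa using hδ.le)
          (sum_nonneg fun i _ => hξ0 i) fun i => by
            rw [ofReal_re, abs_of_nonneg (hξ0 i)]
            exact single_le_sum (fun j _ => hξ0 j) (mem_univ i)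
    exact (mul_eq_zero.1 hkey).resolve_left (by exact_mod_cast (n + k).factorial_ne_zero)

/-- The density vanishes. -/
theorem Line.density_eq_zero (h : Line (m : ℤ) Φ F ν μ P P') (hm : 0 < m) {J : ℕ}
    (hJ : (betaPoly m ν μ).natDegree + P.natDegree + P'.natDegree + n + 1 ≤ J) {d : ℝ} {x : Fin n → ℂ}
    {y : ℂ} (hg : Gap d x y) (r : ℝ) :
    density m ν μ P P' (betaPoly m ν μ) (((-1) ^ m * m.factorial : ℂ) ^ n) J x y r = 0 := by
  have hδ : 0 < d / 4 := by linarith [hg.pos]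
  obtain ⟨A, B, hA, hB, hAB⟩ := hg.density_spec (M := m) (μ := μ) (ν := ν) (by positivity) h.weight
    h.weight' (betaPoly m ν μ) (((-1) ^ m * m.factorial : ℂ) ^ n) J
  obtain ⟨d1, d2⟩ := hAB 0 le_rfl x y (near_self hδ x y)
  rw [ofReal_zero, flow_zero] at d1 d2
  set f := density m ν μ P P' (betaPoly m ν μ) (((-1) ^ m * m.factorial : ℂ) ^ n) J x y with hf
  have hball : ball (0 : ℂ) (d / 4) ⊆ {s : ℂ | |s.im| < d / 4} := fun s hs => by
    rw [mem_ball_zero_iff] at hs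
    exact (abs_im_le_norm s).trans_lt hs
  have hopen : IsOpen {s : ℂ | |s.im| < d / 4} :=
    isOpen_lt (continuous_abs.comp Complex.continuous_im) continuous_const
  have hconv : Convex ℝ {s : ℂ | |s.im| < d / 4} := by
    have : {s : ℂ | |s.im| < d / 4} = imLm ⁻¹' ball 0 (d / 4) := by
      ext s; simp
    rw [this]
    exact (convex_ball _ _).linear_preimage _
  have h0 : f =ᶠ[𝓝 0] 0 := by
    filter_upwards [ball_mem_nhds (0 : ℂ) (half_pos hδ)] with z hz
    refine eq_zero_of_quot (A := A * Real.exp (B * (d / 4))) hδ (d1.mono hball) (fun s hs => ?_)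
      (fun k => h.quot_density_eq_zero hm hJ k hg) (mem_ball_zero_iff.1 hz)
    refine (d2 s (le_of_lt (hball hs))).trans ?_
    rw [mem_ball_zero_iff] at hs
    gcongr
  -- The density vanishes near 0; the identity theorem on the strip, which contains the real axis,
  -- does the rest.
  have := (d1.analyticOnNhd hopen).eqOn_zero_of_preconnected_of_eventuallyEq_zero hconv.isPreconnected
    (by simpa using hδ) h0
  exact this (by simpa using hδ)

end

/-! ### The real contour: sharp convergence and arbitrary position of the last variable -/

section

theorem abs_sin_le_abs_sub (a : ℝ) (k : ℤ) : |sin a| ≤ |a - π * k| := by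
  have h : |sin a| = |sin (a - π * k)| := by
    rw [mul_comm, Real.sin_sub_int_mul_pi, abs_mul, abs_zpow, abs_neg, abs_one, one_zpow, one_mul]
  rw [h]
  exact Real.abs_sin_le_abs

/-- Zeros of the sine are isolated, so an arbitrarily small motion of the imaginary parts with
nonzero relative speed produces a gap. -/
theorem eventually_sin_ne_zero (a : ℝ) {κ : ℝ} (hκ : κ ≠ 0) :
    ∀ᶠ t : ℝ in 𝓝[>] 0, sin (a + κ * t) ≠ 0 := by
  have hc : Tendsto (fun t : ℝ => a + κ * t) (𝓝[>] 0) (𝓝 (a + κ * 0)) :=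
    ((by fun_prop : Continuous fun t : ℝ => a + κ * t).tendsto 0).mono_left nhdsWithin_le_nhds
  rw [mul_zero, add_zero] at hc
  by_cases ha : sin a = 0
  · have hne : Tendsto (fun t : ℝ => κ * t) (𝓝[>] 0) (𝓝 (κ * 0)) :=
      ((by fun_prop : Continuous fun t : ℝ => κ * t).tendsto 0).mono_left nhdsWithin_le_nhds
    rw [mul_zero] at hne
    filter_upwards [hne.eventually (ball_mem_nhds 0 pi_pos), self_mem_nhdsWithin]
      with t ht ht0 h
    have h0 : κ * t ≠ 0 := mul_ne_zero hκ (ne_of_gt ht0)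
    rw [Real.sin_add, ha, zero_mul, zero_add] at h
    rcases mul_eq_zero.1 h with h | h
    · have := Real.sin_sq_add_cos_sq a
      rw [ha, h] at this
      norm_num at this
    · rw [Real.dist_eq, sub_zero, abs_lt] at ht
      exact h0 ((Real.sin_eq_zero_iff_of_lt_of_lt ht.1 ht.2).1 h)
  · exact (Real.continuous_sin.continuousAt.tendsto.comp hc).eventually_ne ha

/-- The distance of a real number to the multiples of π is at least the absolute value of its sine,
and there are finitely many pairs. -/
theorem exists_gap {x : Fin n → ℂ} {y : ℂ} (hx : ∀ i j, i ≠ j → sin (x i - x j).im ≠ 0)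
    (hy : ∀ i, sin (x i - y).im ≠ 0) : ∃ d, Gap d x y := by
  have h1 : ∀ᶠ d : ℝ in 𝓝[>] 0, ∀ i j, i ≠ j → d < |sin (x i - x j).im| := by
    simp only [eventually_all]
    intro i j hij
    exact nhdsWithin_le_nhds (gt_mem_nhds (abs_pos.2 (hx i j hij)))
  have h2 : ∀ᶠ d : ℝ in 𝓝[>] 0, ∀ i, d < |sin (x i - y).im| := by
    rw [eventually_all]
    exact fun i => nhdsWithin_le_nhds (gt_mem_nhds (abs_pos.2 (hy i)))
  obtain ⟨d, ⟨h3, h4⟩, h5⟩ := ((h1.and h2).and self_mem_nhdsWithin).exists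
  exact ⟨d, h5, fun i j hij k => (h3 i j hij).le.trans (abs_sin_le_abs_sub _ _),
    fun i k => (h4 i).le.trans (abs_sin_le_abs_sub _ _)⟩

/-- The reduced integrand without the factor which depends on the last variable. -/
def core (M : ℤ) (k : ℕ) (p : Poly(n)) (b σ x : Fin n → ℂ) : ℂ :=
  (∏ i, exp (-σ i * b i) * (exp (-σ i) - 1) ^ M) *
    ((∏ i, ∏ j ∈ Ioi i, pairFactor shifted(σ, x) expos(x) i j) ^ M *
      (eval shifted(σ, x) p / vdm shifted(σ, x) ^ k))

theorem reduced_eq_core (M : ℤ) (k : ℕ) (p : Poly(n)) (b σ x : Fin n → ℂ) (y : ℂ) :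
    reduced M k p b σ x y = core M k p b σ x * cross shifted(σ, x) (expo y)
      / cross expos(x) (expo y) := by
  simp only [reduced, ratPart, core]
  ring

/-- Each index lies in n - 1 pairs. This is the origin of m(n-1) in the convergence condition; for n
= 0 both sides are empty. -/
theorem prod_pairs_add (n : ℕ) (σ : Fin n → ℝ) :
    ∑ i, ∑ j ∈ Ioi i, (σ i + σ j) = ((n - 1 : ℕ) : ℝ) * ∑ i, σ i := by
  have h1 : ∑ i, ∑ j ∈ Ioi i, σ j = ∑ j, ∑ _i ∈ Iio j, σ j :=
    sum_comm' fun i j => by simp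
  simp only [sum_add_distrib]
  rw [h1, ← sum_add_distrib, mul_sum]
  refine sum_congr rfl fun i _ => ?_
  rw [sum_const, sum_const, Fin.card_Ioi, Fin.card_Iio, ← add_nsmul, nsmul_eq_mul]
  congr 2
  omega

/-- The sharp bound for the integrand on the real contour. -/
theorem exists_norm_core_le (m : ℕ) (p : Poly(n)) {x : Fin n → ℂ}
    (hx : ∀ i j, i ≠ j → sin (x i - x j).im ≠ 0) : ∃ C : ℝ, 0 ≤ C ∧ ∀ ξ : Fin n → ℝ,
    (∀ i, 0 ≤ ξ i) →
    ‖(∏ i, ∏ j ∈ Ioi i, pairFactor (fun i => expo (x i - (ξ i : ℂ) / 2)) expos(x) i j)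
        ^ (m : ℤ) * (eval (fun i => expo (x i - (ξ i : ℂ) / 2)) p /
          vdm (fun i => expo (x i - (ξ i : ℂ) / 2)) ^ m)‖
      ≤ C * Real.exp ((m * (n - 1) : ℕ) * ∑ i, ξ i) := by
  have h1 : ∀ᶠ d : ℝ in 𝓝[>] 0, ∀ i j, i ≠ j → d < |sin (x i - x j).im| := by
    simp only [eventually_all]
    intro i j hij
    exact nhdsWithin_le_nhds (gt_mem_nhds (abs_pos.2 (hx i j hij)))
  obtain ⟨d, h3, hd⟩ := (h1.and self_mem_nhdsWithin).exists
  obtain ⟨c, hc, hsep⟩ := exists_expo_sub_ge (d := d) hd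
  set U : ℝ := ∑ i, ‖expo (x i)‖ with hU
  have hUi : ∀ i, ‖expo (x i)‖ ≤ U := fun i =>
    single_le_sum (f := fun i => ‖expo (x i)‖) (fun _ _ => norm_nonneg _) (mem_univ i)
  have hU0 : 0 ≤ U := sum_nonneg fun _ _ => norm_nonneg _
  have hK : IsCompact (closedBall (0 : Fin n → ℂ) U) := isCompact_closedBall _ _
  obtain ⟨E, hE⟩ := hK.exists_bound_of_continuousOn (f := fun w => eval w p)
    (continuous_eval p).continuousOn
  have hE0 : 0 ≤ E := (norm_nonneg _).trans (hE 0 (mem_closedBall_self hU0))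
  set a : Fin n → Fin n → ℝ := fun i j => (2 * U * (2 * U) / ‖expo (x i) - expo (x j)‖) *
    (c ^ 2 * (‖expo (x i)‖ * ‖expo (x j)‖))⁻¹ with ha
  refine ⟨(∏ i, ∏ j ∈ Ioi i, a i j) ^ m * E, mul_nonneg (pow_nonneg (prod_nonneg fun i _ =>
    prod_nonneg fun j _ => by positivity) _) hE0, fun ξ hξ => ?_⟩
  set w : Fin n → ℂ := fun i => expo (x i - (ξ i : ℂ) / 2) with hw
  have hwn : ∀ i, ‖w i‖ = ‖expo (x i)‖ * Real.exp (-ξ i) := fun i => by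
    rw [show w i = expo (x i - (ξ i : ℂ) / 2) from rfl, expo_sub_half, norm_mul, ← ofReal_neg, ← ofReal_exp, norm_real,
      norm_of_nonneg (exp_pos _).le]
  have hwU : ∀ i, ‖w i‖ ≤ U := fun i => by
    rw [hwn]
    exact (mul_le_of_le_one_right (norm_nonneg _) (Real.exp_le_one_iff.2 (neg_nonpos.2 (hξ i)))).trans
      (hUi i)
  have hww : ∀ i j, i ≠ j → c * ‖w i‖ ≤ ‖w i - w j‖ := fun i j hij => by
    refine hsep _ _ fun k => ?_
    have := (h3 i j hij).le.trans (abs_sin_le_abs_sub _ k)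
    simpa using this
  -- Distributing A(w)^m over the pairs gives each pair the denominator (w_i - w_j)², bounded below
  -- by a multiple of |w_i||w_j|, while the numerators stay bounded. So every pair costs e^{ξ_i +
  -- ξ_j} and no more.
  have e1 : (∏ i, ∏ j ∈ Ioi i, pairFactor w expos(x) i j) ^ (m : ℤ) *
      (eval w p / vdm w ^ m) = (∏ i, ∏ j ∈ Ioi i,
        (pairFactor w expos(x) i j / (w i - w j))) ^ m * eval w p := by
    simp only [zpow_natCast, prod_div_distrib, vdm, div_pow]
    ring
  have e2 : ∀ i, ∀ j ∈ Ioi i, ‖pairFactor w expos(x) i j / (w i - w j)‖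
      ≤ a i j * Real.exp (ξ i + ξ j) := by
    intro i j hj
    have hij : i ≠ j := (mem_Ioi.1 hj).ne
    have w1 := hww i j hij
    have w2 := hww j i hij.symm
    rw [norm_sub_rev] at w2
    have n1 : ‖w i - expo (x j)‖ ≤ 2 * U := (norm_sub_le _ _).trans (by linarith [hwU i, hUi j])
    have n2 : ‖expo (x i) - w j‖ ≤ 2 * U := (norm_sub_le _ _).trans (by linarith [hwU j, hUi i])
    have n3 : c ^ 2 * (‖expo (x i)‖ * ‖expo (x j)‖) * Real.exp (-(ξ i + ξ j))
        ≤ ‖w i - w j‖ * ‖w i - w j‖ := by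
      refine le_trans (le_of_eq ?_) (mul_le_mul w1 w2 (by positivity) (norm_nonneg _))
      rw [hwn, hwn, neg_add, Real.exp_add]
      ring
    have p1 : 0 < ‖expo (x i)‖ := norm_pos_iff.2 (expo_ne_zero _)
    have p2 : 0 < ‖expo (x j)‖ := norm_pos_iff.2 (expo_ne_zero _)
    have e3 : ‖pairFactor w expos(x) i j / (w i - w j)‖
        = ‖w i - expo (x j)‖ * ‖expo (x i) - w j‖ / ‖expo (x i) - expo (x j)‖ *
          (‖w i - w j‖ * ‖w i - w j‖)⁻¹ := by
      simp only [pairFactor, norm_mul, norm_inv, div_eq_mul_inv, mul_inv]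
      ring
    rw [e3, ha, mul_assoc]
    refine mul_le_mul ?_ ?_ (by positivity) (by positivity)
    · gcongr
    · refine (inv_anti₀ (by positivity) n3).trans (le_of_eq ?_)
      rw [mul_inv, ← exp_neg, neg_neg]
  rw [e1, norm_mul, norm_pow]
  have e4 : ‖∏ i, ∏ j ∈ Ioi i, (pairFactor w expos(x) i j / (w i - w j))‖
      ≤ (∏ i, ∏ j ∈ Ioi i, a i j) * Real.exp ((n - 1 : ℕ) * ∑ i, ξ i) := by
    rw [← prod_pairs_add, Real.exp_sum]
    simp only [Real.exp_sum, norm_prod, ← prod_mul_distrib]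
    exact Finset.prod_le_prod (fun i _ => prod_nonneg fun j _ => norm_nonneg _)
      fun i _ => Finset.prod_le_prod (fun j _ => norm_nonneg _) fun j hj => e2 i j hj
  have e5 : ‖eval w p‖ ≤ E := hE w (by
    rw [mem_closedBall_zero_iff]
    exact (pi_norm_le_iff_of_nonneg hU0).2 hwU)
  calc _ ≤ ((∏ i, ∏ j ∈ Ioi i, a i j) * Real.exp ((n - 1 : ℕ) * ∑ i, ξ i)) ^ m * E :=
        mul_le_mul (pow_le_pow_left₀ (norm_nonneg _) e4 _) e5 (norm_nonneg _)
          (pow_nonneg ((norm_nonneg _).trans e4) _)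
    _ = _ := by
        rw [mul_pow, ← exp_nat_mul]
        push_cast
        rw [← mul_assoc (m : ℝ)]
        ring

theorem measurable_core {X : Type*} [MeasurableSpace X] (M : ℤ) (k : ℕ) (p : Poly(n))
    (b : Fin n → ℂ) {σ : X → Fin n → ℂ} (hσ : ∀ i, Measurable fun ξ => σ ξ i) (x : Fin n → ℂ) :
    Measurable fun ξ => core M k p b (σ ξ) x := by
  have hw : ∀ i, Measurable fun ξ => expo (x i - σ ξ i / 2) := fun i => by
    have := hσ i
    unfold expo
    fun_prop
  unfold core pairFactor vdm
  simp only [eval_eq']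
  have hz : ∀ f : X → ℂ, Measurable f → Measurable fun ξ => f ξ ^ M := fun f hf => hf.pow_const M
  refine Measurable.mul ?_ (Measurable.mul (hz _ ?_) ?_)
  · refine measurable_prod _ fun i _ => Measurable.mul ?_ (hz _ ?_)
    · have := hσ i; fun_prop
    · have := hσ i; fun_prop
  · fun_prop
  · fun_prop

theorem measurable_cross_sub (x : Fin n → ℂ) (v : ℂ) :
    Measurable fun ξ : Fin n → ℝ => cross (fun i => expo (x i - (ξ i : ℂ) / 2)) v := by
  unfold cross expo
  fun_prop

theorem norm_cross_sub_le (x : Fin n → ℂ) (v : ℂ) : ∀ᵐ ξ : Fin n → ℝ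
    ∂pow(n, (Set.Ioi 0)),
    ‖cross (fun i => expo (x i - (ξ i : ℂ) / 2)) v‖ ≤ ∏ i, (‖expo (x i)‖ + ‖v‖) := by
  rw [pi_restrict_Ioi]
  filter_upwards [ae_restrict_mem measurableSet_orthant] with ξ hξ
  rw [cross, norm_prod]
  refine Finset.prod_le_prod (fun _ _ => norm_nonneg _) fun i _ => (norm_sub_le _ _).trans ?_
  rw [expo_sub_half, norm_mul, ← ofReal_neg, ← ofReal_exp, norm_real,
    norm_of_nonneg (exp_pos _).le]
  exact add_le_add_left (mul_le_of_le_one_right (norm_nonneg _)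
    (Real.exp_le_one_iff.2 (neg_nonpos.2 (hξ i).le))) _

/-- The factor e^{-σ_i b_i} decays at rate Re b_i and must beat the growth rate m(n-1) of the
rational part; (e^{-σ_i} - 1)^m is bounded by 2^m. -/
theorem integrable_core (m : ℕ) (p : Poly(n)) {x b : Fin n → ℂ}
    (hx : ∀ i j, i ≠ j → sin (x i - x j).im ≠ 0) (hb : ∀ i, ((m * (n - 1) : ℕ) : ℝ) < (b i).re) :
    Integrable (fun σ : Fin n → ℝ => core m m p b (fun i => (σ i : ℂ)) x)
      pow(n, (Set.Ioi 0)) := by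
  obtain ⟨C, hC, hCB⟩ := exists_norm_core_le m p hx
  refine (integrable_prod_exp (fun i => sub_pos.2 (hb i)) (2 ^ (n * m) * C)).mono'
    (measurable_core _ _ _ _ (fun i => by fun_prop) _).aestronglyMeasurable ?_
  rw [pi_restrict_Ioi]
  filter_upwards [ae_restrict_mem measurableSet_orthant] with ξ hξ
  have hξ0 : ∀ i, 0 ≤ ξ i := fun i => (hξ i).le
  rw [core, norm_mul, norm_prod]
  have h1 : ∏ i, ‖exp (-(ξ i : ℂ) * b i) * (exp (-(ξ i : ℂ)) - 1) ^ (m : ℤ)‖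
      ≤ ∏ i, Real.exp (-ξ i * (b i).re) * 2 ^ m := by
    refine Finset.prod_le_prod (fun _ _ => norm_nonneg _) fun i _ => ?_
    rw [norm_mul, zpow_natCast, norm_pow]
    refine mul_le_mul (le_of_eq ?_) (pow_le_pow_left₀ (norm_nonneg _) ?_ _) (by positivity) (by positivity)
    · rw [norm_exp, ← ofReal_neg, re_ofReal_mul]
    · refine (norm_sub_le _ _).trans ?_
      rw [← ofReal_neg, ← ofReal_exp, norm_real, norm_one,
        norm_of_nonneg (exp_pos _).le]
      linarith [Real.exp_le_one_iff.2 (neg_nonpos.2 (hξ0 i))]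
  refine (mul_le_mul h1 (hCB ξ hξ0) (norm_nonneg _) (by positivity)).trans (le_of_eq ?_)
  rw [prod_mul_distrib, prod_const, card_univ, Fintype.card_fin, ← pow_mul,
    mul_comm m n, mul_sum]
  have h2 : ∏ i, Real.exp (-((b i).re - (m * (n - 1) : ℕ)) * ξ i)
      = (∏ i, Real.exp (-ξ i * (b i).re)) * Real.exp (∑ i, (m * (n - 1) : ℕ) * ξ i) := by
    rw [Real.exp_sum, ← prod_mul_distrib]
    exact prod_congr rfl fun i _ => by rw [← Real.exp_add]; congr 1; ring
  rw [h2]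
  ring

theorem integrable_core_mul_cross (m : ℕ) (p : Poly(n)) {x b : Fin n → ℂ}
    (hx : ∀ i j, i ≠ j → sin (x i - x j).im ≠ 0) (hb : ∀ i, ((m * (n - 1) : ℕ) : ℝ) < (b i).re)
    (v : ℂ) : Integrable (fun σ : Fin n → ℝ => core m m p b (fun i => (σ i : ℂ)) x
      * cross (fun i => expo (x i - (σ i : ℂ) / 2)) v)
      pow(n, (Set.Ioi 0)) :=
  (integrable_core m p hx hb).mul_bdd (measurable_cross_sub x v).aestronglyMeasurable
    (norm_cross_sub_le x v)

variable {m : ℕ}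

theorem lineν_one (ν : Fin n → ℂ) : lineν ν 1 = ν := by
  funext i
  simp [lineν]

/-- The identity for the real contour, for generic values of the last variable. -/
theorem Line.lineDiff_real_eq_zero (h : Line (m : ℤ) Φ F ν μ P P') (hm : 0 < m) {d : ℝ} {x : Fin n → ℂ}
    {y : ℂ} (hg : Gap d x y) (hb : ∀ i, ((m * (n - 1) : ℕ) : ℝ) < (lineExp m ν μ 1 i).re)
    (hx : ∀ i j, i ≠ j → sin (x i - x j).im ≠ 0) :
    lineDiff m ν μ P P' (Set.Ioi 0) (fun _ t => (t : ℂ)) (fun _ _ => 1) ((betaPoly m ν μ).eval 1)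
      (((-1) ^ m * m.factorial : ℂ) ^ n) 1 x y = 0 := by
  have hMm : mstar (m : ℤ) = m := by rw [mstar, max_eq_left (by omega), Int.toNat_natCast]
  have := lineDiff_eq_integral (M := m) (ν := ν) (μ := μ) (P := P) (P' := P') (q := betaPoly m ν μ)
    (c := ((-1) ^ m * m.factorial : ℂ) ^ n) le_rfl (T := 1) one_pos (x := x) (y := y) fun b => by
      rw [hMm]
      have h1 : ∀ ξ : Fin n → ℝ, exp (-(((1 : ℝ) : ℂ) * (kdot ξ : ℂ))) * reduced m m (P.coeff b)
          (lineExp m ν μ 0) (fun i => (ξ i : ℂ)) x y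
          = core m m (P.coeff b) (lineExp m ν μ 1) (fun i => (ξ i : ℂ)) x
            * (cross (fun i => expo (x i - (ξ i : ℂ) / 2)) (expo y) / cross expos(x) (expo y)) :=
        fun ξ => by
          have := reduced_line m m (Polynomial.C (P.coeff b)) ν μ 1 (fun i => (ξ i : ℂ)) x y
          rw [← mul_div_assoc, ← reduced_eq_core]
          simpa [ofReal_kdot] using this.symm
      simp only [h1, div_eq_mul_inv]
      simp only [← mul_assoc]
      exact (integrable_core_mul_cross m (P.coeff b) hx hb _).mul_const _
  simp only [ofReal_one] at this
  rw [this]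
  simp only [h.density_eq_zero hm le_rfl hg]
  simp

/-- The identity for the real contour. -/
theorem Line.integral_core_eq (h : Line (m : ℤ) Φ F ν μ P P') (hm : 0 < m) {x : Fin n → ℂ}
    {y : ℂ} (hb : ∀ i, ((m * (n - 1) : ℕ) : ℝ) < (lineExp m ν μ 1 i).re)
    (hx : ∀ i j, i ≠ j → sin (x i - x j).im ≠ 0) :
    (betaPoly m ν μ).eval 1 * ∫ σ : Fin n → ℝ, core m m (P.eval (𝐂 1)) (lineExp m ν μ 1)
      (fun i => (σ i : ℂ)) x * cross (fun i => expo (x i - (σ i : ℂ) / 2)) (expo y)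
      ∂pow(n, (Set.Ioi 0))
    = ((-1) ^ m * m.factorial : ℂ) ^ n * (eval (adjoin expos(x) (expo y))
      (P'.eval (𝐂 1)) / vdm expos(x) ^ m) := by
  have hMm : mstar (m : ℤ) = m := by rw [mstar, max_eq_left (by omega), Int.toNat_natCast]
  -- The argument of v may coincide with that of some u_i. Rotating v by a small angle restores the
  -- gap without changing |v|, so the same integrable bound serves for all t and the identity
  -- extends to t = 0.
  set z : ℝ → ℂ := fun t => y + t * I with hz
  have hzn : ∀ t, ‖expo (z t)‖ = ‖expo y‖ := fun t => by simp [hz, norm_expo]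
  have hzc : Continuous fun t => expo (z t) := by unfold expo; fun_prop
  set f : ℝ → ℂ := fun t => (betaPoly m ν μ).eval 1 * ∫ σ : Fin n → ℝ,
    core m m (P.eval (𝐂 1)) (lineExp m ν μ 1) (fun i => (σ i : ℂ)) x *
      cross (fun i => expo (x i - (σ i : ℂ) / 2)) (expo (z t))
      ∂pow(n, (Set.Ioi 0)) with hf
  set g : ℝ → ℂ := fun t => ((-1) ^ m * m.factorial : ℂ) ^ n * (eval
    (adjoin expos(x) (expo (z t))) (P'.eval (𝐂 1)) /
      vdm expos(x) ^ m) with hg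
  have hfc : Continuous f := by
    refine continuous_const.mul (continuous_of_dominated
      (bound := fun σ => ‖core m m (P.eval (𝐂 1)) (lineExp m ν μ 1) (fun i => (σ i : ℂ)) x‖ *
        ∏ i, (‖expo (x i)‖ + ‖expo y‖)) (fun t => ?_) (fun t => ?_) ?_ ?_)
    · exact (integrable_core_mul_cross m _ hx hb _).aestronglyMeasurable
    · filter_upwards [norm_cross_sub_le x (expo (z t))] with σ hσ
      rw [hzn] at hσ
      rw [norm_mul]
      exact mul_le_mul_of_nonneg_left hσ (norm_nonneg _)
    · exact (integrable_core m _ hx hb).norm.mul_const _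
    · refine Eventually.of_forall fun σ => continuous_const.mul ?_
      unfold cross
      exact continuous_finsetProd _ fun i _ => continuous_const.sub hzc
  have hgc : Continuous g := by
    refine continuous_const.mul (Continuous.div_const ((continuous_eval _).comp
      (continuous_pi fun o => ?_)) _)
    rcases o with _ | i
    · exact hzc
    · exact continuous_const
  have hev : ∀ᶠ t : ℝ in 𝓝[>] 0, f t = g t := by
    have h1 : ∀ᶠ t : ℝ in 𝓝[>] 0, ∀ i, sin (x i - z t).im ≠ 0 := by
      rw [eventually_all]
      intro i
      filter_upwards [eventually_sin_ne_zero (x i - y).im (κ := -1) (by norm_num)] with t ht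
      convert! ht using 2
      simp [hz]
      ring
    filter_upwards [h1] with t ht
    obtain ⟨d, hgap⟩ := exists_gap hx ht
    obtain ⟨c, hc, hsep⟩ := hgap.exists_sepAt
    have hcr := (hsep 0 x (z t) 0 (near_self (by linarith [hgap.pos]) _ _)
      fun i => by simpa using (by linarith [hgap.pos] : (0 : ℝ) ≤ d / 4)).vdm_ne_zero hc
    rw [ofReal_zero, flow_zero] at hcr
    have h2 := h.lineDiff_real_eq_zero hm hgap hb hx
    simp only [lineDiff, redInt, prod_const_one, mul_one, reduced_eq_core, hMm, defRed,
      integral_div] at h2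
    have h3 := hcr.2.2
    rw [hf, hg]
    beta_reduce
    set J := ∫ σ : Fin n → ℝ,
      core m m (P.eval (𝐂 1)) (lineExp m ν μ 1) (fun i => (σ i : ℂ)) x *
      cross (fun i => expo (x i - (σ i : ℂ) / 2)) (expo (z t))
      ∂pow(n, (Set.Ioi 0))
    have h4 := hcr.2.1
    rw [sub_eq_zero, ← div_div, ← mul_div_assoc, ← mul_div_assoc] at h2
    exact (div_left_inj' h3).1 h2
  have h1 : Tendsto f (𝓝[>] 0) (𝓝 (f 0)) := (hfc.tendsto 0).mono_left nhdsWithin_le_nhds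
  have h2 : Tendsto g (𝓝[>] 0) (𝓝 (g 0)) := (hgc.tendsto 0).mono_left nhdsWithin_le_nhds
  have h3 := tendsto_nhds_unique h1 (h2.congr' (hev.mono fun t ht => ht.symm))
  simpa [hf, hg, hz] using h3

end

/-! ### The Selberg-type integral -/

/-- The one-variable part of the substitution w = u e^{-s}: the diagonal factor of A^*, the two
powers of w and the Jacobian combine to a power of u and the Euler factor. -/
theorem integrand_factor (M : ℤ) (a s ν μ : ℂ) :
    (expo (a - s / 2) - expo a) ^ M * powx (a - s / 2) (-μ - (M + 3) / 2) * powx (a - s / 2) ν *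
      (expo a * exp (-s))
    = powx a (ν - μ + (M - 1) / 2) * (exp (-s * (ν - μ - (M + 1) / 2)) * (exp (-s) - 1) ^ M) := by
  rw [expo_sub_half, show expo a * exp (-s) - expo a = expo a * (exp (-s) - 1) by ring,
    mul_zpow, show expo a ^ M = powx a M by rw [expo, powx, ← exp_int_mul]; congr 1; ring]
  have : powx a M * powx (a - s / 2) (-μ - (M + 3) / 2) * powx (a - s / 2) ν * (expo a * exp (-s))
      = powx a (ν - μ + (M - 1) / 2) * exp (-s * (ν - μ - (M + 1) / 2)) := by
    simp only [powx, expo, ← exp_add]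
    congr 1
    ring
  linear_combination (exp (-s) - 1) ^ M * this

/-- The integrand in terms of the reduced one. -/
theorem integrand_eq (M : ℤ) (k : ℕ) (N : ℂ) (p : Poly(n)) (ν σ : Fin n → ℂ) (μ : ℂ)
    {x : Fin n → ℂ} (y : ℂ) (hu : vdm expos(x) ≠ 0) :
    crossStar shifted(σ, x) expos(x) ^ M *
      cross shifted(σ, x) (expo y) / vdm shifted(σ, x) ^ M *
      (∏ i, powx (x i - σ i / 2) (-μ - (M + 3) / 2)) * baForm k N p ν (fun i => x i - σ i / 2) *
      ∏ i, (expo (x i) * exp (-σ i))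
    = (vdm expos(x) ^ M / N * ∏ i, powx (x i) (ν i - μ + (M - 1) / 2)) *
      (core M k p (fun i => ν i - μ - (M + 1) / 2) σ x *
        cross shifted(σ, x) (expo y)) := by
  have h1 := prod_congr (s₁ := univ) rfl fun i _ => integrand_factor M (x i) (σ i) (ν i) μ
  simp only [prod_mul_distrib, prod_zpow] at h1
  rw [crossStar_eq, core, prod_pairFactor, baForm, prod_mul_distrib, prod_mul_distrib,
    mul_zpow, div_zpow, mul_zpow, prod_zpow]
  have hu' := zpow_ne_zero M hu
  set V := vdm expos(x) ^ M
  set W := vdm shifted(σ, x) ^ M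
  set X := (∏ i, ∏ j ∈ Ioi i, (expo (x i - σ i / 2) - expo (x j)) *
    (expo (x i) - expo (x j - σ j / 2))) ^ M
  set D := vdm shifted(σ, x) ^ k
  set c := cross shifted(σ, x) (expo y)
  have h2 : ∀ R : ℂ, V * (X / (W * V)) * R = X / W * R := fun R => by
    rw [mul_comm W V, ← mul_div_assoc, mul_div_mul_left _ _ hu']
  linear_combination (X * c / W * (eval shifted(σ, x) p / (D * N))) * h1
    - c * (eval shifted(σ, x) p) / D / N *
     (∏ i, powx (x i) (ν i - μ + (M - 1) / 2)) * (∏ i, exp (-σ i * (ν i - μ - (M + 1) / 2))) *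
     (∏ i, (exp (-σ i) - 1)) ^ M * h2 1

/-- Exponential coordinates on the cube. -/
def expNeg (σ : Fin n → ℝ) (i : Fin n) : ℝ := Real.exp (-σ i)

theorem hasFDerivAt_expNeg (σ : Fin n → ℝ) : HasFDerivAt expNeg
    (ContinuousLinearMap.pi fun i => ((-Real.exp (-σ i)) • ContinuousLinearMap.id ℝ ℝ).comp
      (ContinuousLinearMap.proj (R := ℝ) (φ := fun _ : Fin n => ℝ) i)) σ := by
  rw [hasFDerivAt_pi']
  intro i
  have h1 : HasDerivAt (fun s : ℝ => Real.exp (-s)) (-Real.exp (-σ i)) (σ i) := by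
    simpa using (hasDerivAt_neg (σ i)).exp
  have h2 := h1.hasFDerivAt.comp σ (hasFDerivAt_apply (𝕜 := ℝ) i σ)
  refine h2.congr_fderiv ?_
  ext v
  simp [mul_comm]

theorem image_expNeg : expNeg '' {σ : Fin n → ℝ | ∀ i, 0 < σ i} = Set.univ.pi fun _ => Ioo 0 1 := by
  ext τ
  simp only [Set.mem_image, Set.mem_pi, Set.mem_univ, true_imp_iff, Set.mem_Ioo]
  constructor
  · rintro ⟨σ, hσ, rfl⟩ i
    exact ⟨exp_pos _, Real.exp_lt_one_iff.2 (neg_lt_zero.2 (hσ i))⟩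
  · intro h
    refine ⟨fun i => -Real.log (τ i), fun i => neg_pos.2 (Real.log_neg (h i).1 (h i).2), ?_⟩
    funext i
    rw [expNeg, neg_neg, Real.exp_log (h i).1]

theorem expNeg_injective : Injective (expNeg : (Fin n → ℝ) → _) := by
  intro a b h
  funext i
  have := congrFun h i
  simpa [expNeg] using this

theorem restrict_Icc_eq : (volume : Measure (Fin n → ℝ)).restrict (Icc 0 1)
    = volume.restrict (Set.univ.pi fun _ => Ioo 0 1) :=
  Measure.restrict_congr_set (Measure.univ_pi_Ioo_ae_eq_Icc (f := (0 : Fin n → ℝ)) (g := 1)).symm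

/-- Substitution of exponential coordinates on the cube. -/
theorem integral_cube (f : (Fin n → ℝ) → ℂ) :
    (IntegrableOn f (Icc (0 : Fin n → ℝ) 1) ↔ Integrable (fun σ => f (expNeg σ) *
      ∏ i, exp (-(σ i : ℂ))) pow(n, (Set.Ioi 0))) ∧
    ∫ τ in Icc (0 : Fin n → ℝ) 1, f τ = ∫ σ : Fin n → ℝ, f (expNeg σ) *
      ∏ i, exp (-(σ i : ℂ)) ∂pow(n, (Set.Ioi 0)) := by
  have hdet : ∀ σ : Fin n → ℝ, ((|(ContinuousLinearMap.pi fun i => ((-Real.exp (-σ i)) •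
      ContinuousLinearMap.id ℝ ℝ).comp (ContinuousLinearMap.proj (R := ℝ) (φ := fun _ : Fin n => ℝ) i)).det| :
      ℝ) • f (expNeg σ)) = f (expNeg σ) * ∏ i, exp (-(σ i : ℂ)) := fun σ => by
    rw [ContinuousLinearMap.det_pi, Finset.abs_prod, real_smul, mul_comm]
    congr 1
    rw [Complex.ofReal_prod]
    refine prod_congr rfl fun i _ => ?_
    simp [ContinuousLinearMap.det]
  have h1 := integrableOn_image_iff_integrableOn_abs_det_fderiv_smul volume
    (measurableSet_orthant (n := n)) (fun σ _ => (hasFDerivAt_expNeg σ).hasFDerivWithinAt)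
    expNeg_injective.injOn f
  have h2 := integral_image_eq_integral_abs_det_fderiv_smul volume
    (measurableSet_orthant (n := n)) (fun σ _ => (hasFDerivAt_expNeg σ).hasFDerivWithinAt)
    expNeg_injective.injOn f
  simp only [hdet, image_expNeg] at h1 h2
  rw [pi_restrict_Ioi, IntegrableOn, restrict_Icc_eq]
  exact ⟨h1, h2⟩

/-- As long as the shift stays in the principal strip, the continuation of the powers from u along
the path is simply the coordinate a - s/2. -/
theorem liftLog_expo_sub (a s : ℂ) (h₁ : -π < (-s).im) (h₂ : (-s).im ≤ π) :
    liftLog a (expo (a - s / 2)) = a - s / 2 := by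
  rw [liftLog, expo_sub_half, mul_div_cancel_left₀ _ (expo_ne_zero a), Complex.log_exp h₁ h₂]
  ring

/-- If the imaginary parts differed by a multiple of π, the two exponentials would be positive
multiples of each other. -/
theorem sin_im_sub_ne_zero {a b : ℂ} (h : (expo a).arg ≠ (expo b).arg) : sin (a - b).im ≠ 0 := by
  intro h0
  obtain ⟨k, hk⟩ := Real.sin_eq_zero_iff.1 h0
  apply h
  have h1 : expo a = (Real.exp (2 * (a - b).re) : ℝ) * expo b := by
    rw [ofReal_exp, expo, expo, ← exp_add, Complex.exp_eq_exp_iff_exists_int]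
    refine ⟨k, Complex.ext ?_ ?_⟩
    · simp
      ring
    · simp only [mul_im, add_im, Complex.ofReal_im, sub_re, sub_im,
        mul_re] at hk ⊢
      simp
      linarith
  rw [h1, Complex.arg_real_mul _ (exp_pos _)]

theorem gamma_add_nat (m : ℕ) {b : ℂ} (hb : 0 < b.re) :
    Gamma (b + m) = (∏ l ∈ range m, (b + l)) * Gamma b := by
  induction m with
  | zero => simp
  | succ m ih =>
    have h0 : b + m ≠ 0 := fun h => by
      have := congrArg re h
      simp at this
      linarith [m.cast_nonneg (α := ℝ)]
    rw [Finset.prod_range_succ, Nat.cast_succ, ← add_assoc, Complex.Gamma_add_one _ h0, ih]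
    ring

/-- The substitution τ_i = e^{-σ_i} carries the cube to the orthant and the integrand to that of
`Line.integral_core_eq` at T = 1. The condition on Re(ν_i - μ) is m(n-1) < Re b_i for the exponents
b_i there; it also gives C(ν, μ) ≠ 0. -/
theorem selberg_formula {m : ℕ} (hm : 0 < m) {Φ : (Fin n → ℂ) → (Fin n → ℂ) → ℂ}
    (hΦ : IsTrigBA n (m : ℤ) Φ) {F : (Fin n → ℂ) → ℂ → (Fin n → ℂ) → ℂ → ℂ}
    (hF : IsDefTrigBA n (m : ℤ) F) (x : Fin n → ℂ) (y : ℂ) (ν : Fin n → ℂ) (μ : ℂ)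
    (hx : Injective fun i => (expo (x i)).arg)
    (hy : cross expos(x) (expo y) ≠ 0) (hN : normC m ν ≠ 0)
    (hν : ∀ i, ((m : ℝ) + 1) / 2 + (m : ℝ) * ((n : ℝ) - 1) < (ν i - μ).re) :
    IntegrableOn (segmentPullback (selbergIntegrand m Φ x y ν μ) fun i => expo (x i))
      (Icc (0 : Fin n → ℝ) 1) ∧
    F x y ν μ = ((-1) ^ (n * m) * ∏ i, Gamma (ν i - μ + ((m : ℂ) + 3) / 2) /
        (Gamma ((m : ℂ) + 1) * Gamma (ν i - μ + (1 - (m : ℂ)) / 2))) *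
      ((∏ i, powx (x i) (μ + (1 - (m : ℂ)) / 2)) * powx y (μ / (m : ℂ)) /
        (vdm expos(x) ^ m * cross expos(x) (expo y))) *
      ∫ τ in Icc (0 : Fin n → ℝ) 1,
        segmentPullback (selbergIntegrand m Φ x y ν μ) expos(x) τ := by
  have hMm : mstar (m : ℤ) = m := by rw [mstar, max_eq_left (by omega), Int.toNat_natCast]
  obtain ⟨P, P', h⟩ := exists_line hΦ hF ν μ
  have hsin : ∀ i j, i ≠ j → sin (x i - x j).im ≠ 0 := fun i j hij =>
    sin_im_sub_ne_zero (hx.ne hij)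
  have hu : vdm expos(x) ≠ 0 :=
    vdm_ne_zero fun i j hij => hx (congrArg arg hij)
  have hexp : lineExp m ν μ 1 = fun i => ν i - μ - ((m : ℤ) + 1) / 2 := by
    funext i
    rw [lineExp, lineν_one]
  have hre : ∀ i, ((m * (n - 1) : ℕ) : ℝ) < (lineExp m ν μ 1 i).re := fun i => by
    have h1 := hν i
    have h2 : 1 ≤ n := by have := i.2; omega
    have h3 : (((m : ℤ) : ℂ) + 1) / 2 = ((((m : ℝ) + 1) / 2 : ℝ) : ℂ) := by push_cast; ring
    rw [hexp]
    beta_reduce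
    rw [sub_re, h3, ofReal_re]
    push_cast [h2]
    linarith
  have hre0 : ∀ i, 0 < (lineExp m ν μ 1 i).re := fun i => lt_of_le_of_lt (by positivity) (hre i)
  have hN' : normCdef m ν μ ≠ 0 := by
    refine prod_ne_zero_iff.2 fun i _ h0 => ?_
    have h1 := hre0 i
    rw [hexp, add_comm _ (1 : ℂ)] at h1
    simp only [h0, Complex.zero_re, lt_self_iff_false] at h1
  set p := P.eval (𝐂 1) with hp
  set p' := P'.eval (𝐂 1) with hp'
  set K := vdm expos(x) ^ (m : ℤ) / normC m ν * ∏ i, powx (x i) (ν i - μ + ((m : ℤ) - 1) / 2)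
    with hK
  have hpt : ∀ᵐ σ : Fin n → ℝ ∂pow(n, (Set.Ioi 0)),
      segmentPullback (selbergIntegrand m Φ x y ν μ) expos(x) (expNeg σ) *
        ∏ i, exp (-(σ i : ℂ)) = K * (core m m p (lineExp m ν μ 1) (fun i => (σ i : ℂ)) x *
          cross (fun i => expo (x i - (σ i : ℂ) / 2)) (expo y)) := by
    refine Eventually.of_forall fun σ => ?_
    have hw : (fun i => (expNeg σ i : ℂ) * expo (x i)) = fun i => expo (x i - (σ i : ℂ) / 2) := by
      funext i
      rw [expo_sub_half, expNeg, ofReal_exp, ofReal_neg, mul_comm]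
    have hl : (fun i => liftLog (x i) (expo (x i - (σ i : ℂ) / 2))) = fun i => x i - (σ i : ℂ) / 2 := by
      funext i
      refine liftLog_expo_sub _ _ ?_ ?_ <;> simp [pi_pos, Real.pi_nonneg]
    have hv : vdm (fun i => expo (x i - (σ i : ℂ) / 2)) ≠ 0 := by
      refine prod_ne_zero_iff.2 fun i _ => prod_ne_zero_iff.2 fun j hj => ?_
      refine sub_ne_zero.2 fun he => hsin i j (mem_Ioi.1 hj).ne ?_
      by_contra hne
      have h1 : sin ((x i - (σ i : ℂ) / 2) - (x j - (σ j : ℂ) / 2)).im ≠ 0 := by simpa using hne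
      exact h1 (by
        obtain ⟨k, hk⟩ := Complex.exp_eq_exp_iff_exists_int.1 he
        have := congrArg im hk
        simp at this
        rw [Real.sin_eq_zero_iff]
        exact ⟨k, by simp; linarith⟩)
    have hf := h.form 1 (fun i => x i - (σ i : ℂ) / 2) hv (by rwa [lineν_one, hMm])
    rw [lineν_one, hMm, ← hp] at hf
    have he := integrand_eq (m : ℤ) m (normC m ν) p ν (fun i => (σ i : ℂ)) μ y hu
    have hw' : ∀ i, (expNeg σ i : ℂ) * expo (x i) = expo (x i - (σ i : ℂ) / 2) := congrFun hw
    have hl' : ∀ i, liftLog (x i) (expo (x i - (σ i : ℂ) / 2)) = x i - (σ i : ℂ) / 2 := congrFun hl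
    simp only [segmentPullback, selbergIntegrand, hw', hl', hf, hexp, hK]
    rw [← he, prod_mul_distrib]
    simp only [zpow_natCast, Int.cast_natCast]
    ring
  obtain ⟨c1, c2⟩ := integral_cube (segmentPullback (selbergIntegrand m Φ x y ν μ) fun i => expo (x i))
  refine ⟨c1.2 (((integrable_core_mul_cross m p hsin hre (expo y)).const_mul K).congr
    (hpt.mono fun σ hσ => hσ.symm)), ?_⟩
  have hI := h.integral_core_eq (y := y) hm hre hsin
  rw [c2, integral_congr_ae hpt, integral_const_mul]
  have hFf := h.form' 1 x y hu hy (by rwa [lineν_one, hMm]) (by rwa [lineν_one])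
  rw [lineν_one, hMm, defRed] at hFf
  rw [hFf]
  set J := ∫ σ : Fin n → ℝ, core m m p (lineExp m ν μ 1) (fun i => (σ i : ℂ)) x *
          cross (fun i => expo (x i - (σ i : ℂ) / 2)) (expo y)
          ∂pow(n, (Set.Ioi 0)) with hIdef
  -- The Gamma quotient is the rising product of m + 1 factors starting at b_i + 1, divided by m!,
  -- so the constant of the theorem is the one supplied by `betaPoly`.
  have hG : (-1) ^ (n * m) * (∏ i, Gamma (ν i - μ + ((m : ℂ) + 3) / 2) /
      (Gamma ((m : ℂ) + 1) * Gamma (ν i - μ + (1 - (m : ℂ)) / 2))) *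
      (((-1) ^ m * m.factorial : ℂ) ^ n * normCdef m ν μ) = (betaPoly m ν μ).eval 1 := by
    rw [eval_betaPoly, mul_pow, ← pow_mul, mul_comm m n, hexp, normCdef]
    have h1 : ∀ i, Gamma (ν i - μ + ((m : ℂ) + 3) / 2) /
      (Gamma ((m : ℂ) + 1) * Gamma (ν i - μ + (1 - (m : ℂ)) / 2)) * m.factorial
      = ∏ l ∈ range (m + 1), (ν i - μ - ((m : ℤ) + 1) / 2 + 1 + l) := fun i => by
      have hb := hre0 i
      rw [hexp] at hb
      have hb1 : 0 < (ν i - μ - ((m : ℤ) + 1) / 2 + 1).re := by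
        rw [add_re, one_re]
        linarith
      rw [Complex.Gamma_nat_eq_factorial, show ν i - μ + (1 - (m : ℂ)) / 2
        = ν i - μ - ((m : ℤ) + 1) / 2 + 1 by push_cast; ring, show ν i - μ + ((m : ℂ) + 3) / 2
        = ν i - μ - ((m : ℤ) + 1) / 2 + 1 + ((m + 1 : ℕ) : ℂ) by push_cast; ring, gamma_add_nat _ hb1]
      have g1 := Complex.Gamma_ne_zero_of_re_pos hb1
      have g2 : (m.factorial : ℂ) ≠ 0 := by exact_mod_cast m.factorial_ne_zero
      rw [div_mul_eq_mul_div, div_eq_iff (mul_ne_zero g2 g1)]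
      ring
    rw [prod_mul_distrib, ← prod_congr rfl fun i _ => h1 i, prod_mul_distrib,
      prod_const, card_univ, Fintype.card_fin]
    have h2 : ((-1 : ℂ) ^ (n * m)) * (-1) ^ (n * m) = 1 := by
      rw [← mul_pow]; norm_num
    have h3 : ∏ i, (ν i - μ - (1 + ((m : ℤ) : ℂ)) / 2) = ∏ i, (ν i - μ - (((m : ℤ) : ℂ) + 1) / 2) :=
      prod_congr rfl fun i _ => by ring
    rw [h3]
    linear_combination (∏ i, Gamma (ν i - μ + ((m : ℂ) + 3) / 2) /
      (Gamma ((m : ℂ) + 1) * Gamma (ν i - μ + (1 - (m : ℂ)) / 2))) * m.factorial ^ n *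
      (∏ i, (ν i - μ - (((m : ℤ) : ℂ) + 1) / 2)) * h2
  have hW : (∏ i, powx (x i) (μ + (1 - (m : ℂ)) / 2)) * powx y (μ / (m : ℂ)) *
      (∏ i, powx (x i) (ν i - μ + ((m : ℤ) - 1) / 2)) = planeWave m ν μ x y := by
    have h1 : (∏ i, powx (x i) (μ + (1 - (m : ℂ)) / 2)) * (∏ i, powx (x i) (ν i - μ + ((m : ℤ) - 1) / 2))
        = ∏ i, powx (x i) (ν i) := by
      rw [← prod_mul_distrib]
      refine prod_congr rfl fun i _ => ?_
      rw [powx, powx, powx, ← exp_add]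
      congr 1
      push_cast
      ring
    rw [planeWave, ← h1, Int.cast_natCast]
    ring
  have hc0 : ((-1) ^ m * m.factorial : ℂ) ^ n ≠ 0 := pow_ne_zero _
    (mul_ne_zero (pow_ne_zero _ (by norm_num)) (by exact_mod_cast m.factorial_ne_zero))
  rw [← hG] at hI
  have hV := pow_ne_zero m hu
  rw [hK, ← hW, zpow_natCast]
  set G := (-1) ^ (n * m) * (∏ i, Gamma (ν i - μ + ((m : ℂ) + 3) / 2) /
      (Gamma ((m : ℂ) + 1) * Gamma (ν i - μ + (1 - (m : ℂ)) / 2)))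
  have hI' : G * normCdef m ν μ * J = eval (adjoin expos(x) (expo y)) p' /
      vdm expos(x) ^ m := by
    refine mul_left_cancel₀ hc0 ?_
    rw [← hI]
    ring
  rw [eq_div_iff hV] at hI'
  rw [← hI']
  field_simp

/-! ### Small loops -/

section

/-- A complex factor a only shifts the starting angle of a full turn. Complex radii are needed
because the circle |w_i - u_i| = ε has relative radius ε/u_i. -/
theorem integral_rotate (f : ℂ → ℂ) (a : ℂ) :
    ∫ θ in Ioc (0 : ℝ) (2 * π), f (a * exp (θ * I))
      = ∫ θ in Ioc (0 : ℝ) (2 * π), f (‖a‖ * exp (θ * I)) := by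
  have hp : Function.Periodic (fun θ : ℝ => f (‖a‖ * exp (θ * I))) (2 * π) := by
    intro θ
    beta_reduce
    congr 2
    push_cast
    rw [add_mul, exp_add, Complex.exp_two_pi_mul_I, mul_one]
  have h1 : ∀ θ : ℝ, f (a * exp (θ * I))
      = f (‖a‖ * exp (((θ + a.arg : ℝ) : ℂ) * I)) := fun θ => by
    congr 1
    nth_rewrite 1 [← Complex.norm_mul_exp_arg_mul_I a]
    push_cast
    rw [add_mul, exp_add]
    ring
  simp only [h1]
  rw [← intervalIntegral.integral_of_le two_pi_pos.le,
    ← intervalIntegral.integral_of_le two_pi_pos.le,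
    intervalIntegral.integral_comp_add_right (fun θ : ℝ => f (‖a‖ * exp (θ * I))),
    zero_add, add_comm (2 * π)]
  simpa using hp.intervalIntegral_add_eq a.arg 0

/-- On a circle about 0, dz/z = i dθ; so integrals in the angle are contour integrals with an extra
simple pole. -/
theorem circleIntegral_inv_smul (f : ℂ → ℂ) {R : ℝ} (hR : 0 < R) :
    (∮ z in C(0, R), (z - 0)⁻¹ • f z)
      = I * ∫ θ in Ioc (0 : ℝ) (2 * π), f (R * exp (θ * I)) := by
  rw [circleIntegral, ← intervalIntegral.integral_of_le two_pi_pos.le,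
    ← intervalIntegral.integral_const_mul]
  refine intervalIntegral.integral_congr fun θ _ => ?_
  have h1 : circleMap 0 R θ = R * exp (θ * I) := by simp [circleMap]
  have h2 : (R : ℂ) * exp (θ * I) ≠ 0 :=
    mul_ne_zero (by exact_mod_cast hR.ne') (exp_ne_zero _)
  rw [deriv_circleMap, h1, sub_zero, smul_eq_mul, smul_eq_mul]
  linear_combination (I * f (R * exp (θ * I))) * mul_inv_cancel₀ h2

/-- The mean value property. -/
theorem integral_loop_eq {f : ℂ → ℂ} {R : ℝ} (hf : DifferentiableOn ℂ f (ball 0 R)) {a : ℂ}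
    (ha0 : a ≠ 0) (ha : ‖a‖ < R) :
    ∫ θ in Ioc (0 : ℝ) (2 * π), f (a * exp (θ * I)) = 2 * π * f 0 := by
  have ha' := norm_pos_iff.2 ha0
  have hd : DiffContOnCl ℂ f (ball 0 ‖a‖) := by
    refine DifferentiableOn.diffContOnCl (hf.mono ?_)
    rw [closure_ball _ ha'.ne']
    exact Metric.closedBall_subset_ball ha
  have h1 := hd.circleIntegral_sub_inv_smul (mem_ball_self ha')
  rw [circleIntegral_inv_smul f ha', smul_eq_mul] at h1
  rw [integral_rotate]
  refine mul_left_cancel₀ I_ne_zero (h1.trans ?_)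
  ring

/-- Independence of the radius. -/
theorem integral_loop_radius {f : ℂ → ℂ} {R : ℝ}
    (hf : ∀ z : ℂ, z ≠ 0 → ‖z‖ < R → DifferentiableAt ℂ f z) {a a' : ℂ} (ha0 : a ≠ 0) (ha : ‖a‖ < R)
    (ha0' : a' ≠ 0) (ha' : ‖a'‖ < R) :
    ∫ θ in Ioc (0 : ℝ) (2 * π), f (a * exp (θ * I))
      = ∫ θ in Ioc (0 : ℝ) (2 * π), f (a' * exp (θ * I)) := by
  wlog hle : ‖a‖ ≤ ‖a'‖ generalizing a a'
  · exact (this ha0' ha' ha0 ha (le_of_not_ge hle)).symm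
  have p := norm_pos_iff.2 ha0
  have p' := norm_pos_iff.2 ha0'
  have h1 := Complex.circleIntegral_sub_center_inv_smul_eq_of_differentiable_on_annulus_off_countable
    (c := (0 : ℂ)) p hle (f := f) (s := ∅) Set.countable_empty (fun z hz => by
      rw [Set.mem_sdiff, mem_closedBall_zero_iff, mem_ball_zero_iff, not_lt] at hz
      exact (hf z (norm_pos_iff.1 (p.trans_le hz.2)) (hz.1.trans_lt ha')).continuousAt.continuousWithinAt)
    (fun z hz => by
      rw [Set.sdiff_empty, Set.mem_sdiff, mem_closedBall_zero_iff, mem_ball_zero_iff, not_le] at hz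
      exact hf z (norm_pos_iff.1 (p.trans hz.2)) (hz.1.trans ha'))
  rw [circleIntegral_inv_smul f p', circleIntegral_inv_smul f p] at h1
  rw [integral_rotate f a, integral_rotate f a']
  exact (mul_left_cancel₀ I_ne_zero h1).symm

/-- The loop `e^{-σ} = 1 + a e^{iθ}`. -/
def loop (a : ℂ) (θ : ℝ) : ℂ := -log (1 + a * exp (θ * I))

/-- The derivative of the loop. -/
def loop' (a : ℂ) (θ : ℝ) : ℂ :=
  -(a * exp (θ * I) * I) / (1 + a * exp (θ * I))

variable {a : ℂ}

theorem norm_mul_exp_I (a : ℂ) (θ : ℝ) : ‖a * exp (θ * I)‖ = ‖a‖ := by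
  rw [norm_mul, Complex.norm_exp_ofReal_mul_I, mul_one]

theorem one_add_mem_slitPlane {z : ℂ} (h : ‖z‖ < 1) : 1 + z ∈ Complex.slitPlane :=
  Complex.mem_slitPlane_of_norm_lt_one h

theorem exp_neg_loop (ha : ‖a‖ < 1) (θ : ℝ) :
    exp (-loop a θ) = 1 + a * exp (θ * I) := by
  rw [loop, neg_neg, exp_log (slitPlane_ne_zero
    (one_add_mem_slitPlane (by rwa [norm_mul_exp_I])))]

theorem norm_loop_le (ha : ‖a‖ ≤ 1 / 2) (θ : ℝ) : ‖loop a θ‖ ≤ 2 * ‖a‖ := by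
  have := Complex.norm_log_one_add_half_le_self (z := a * exp (θ * I))
    (by rwa [norm_mul_exp_I])
  rw [norm_mul_exp_I] at this
  rw [loop, norm_neg]
  linarith [norm_nonneg a]

theorem norm_loop'_le (ha : ‖a‖ ≤ 1 / 2) (θ : ℝ) : ‖loop' a θ‖ ≤ 1 := by
  have h1 := norm_mul_exp_I a θ
  have h2 : 1 / 2 ≤ ‖1 + a * exp (θ * I)‖ := by
    have := norm_sub_le_norm_add (1 : ℂ) (a * exp (θ * I))
    rw [norm_one, h1] at this
    linarith
  rw [loop', norm_div, norm_neg, norm_mul, h1, norm_I, mul_one, div_le_one (by linarith)]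
  linarith

theorem hasDerivAt_loop (ha : ‖a‖ < 1) (θ : ℝ) : HasDerivAt (loop a) (loop' a θ) θ := by
  have h1 : HasDerivAt (fun t : ℝ => 1 + a * exp (t * I))
      (a * (exp (θ * I) * I)) θ := by
    have h2 : HasDerivAt (fun t : ℝ => (t : ℂ) * I) I θ := by
      simpa using (Complex.ofRealCLM.hasDerivAt (x := θ)).mul_const I
    exact (h2.cexp.const_mul a).const_add 1
  have h3 := (h1.clog_real (one_add_mem_slitPlane (by rwa [norm_mul_exp_I]))).neg
  convert! h3 using 1
  rw [loop']
  ring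

theorem loop_two_pi (a : ℂ) : loop a (2 * π) = loop a 0 := by
  simp [loop, Complex.exp_two_pi_mul_I]

theorem continuous_loop' (ha : ‖a‖ < 1) : Continuous (loop' a) := by
  unfold loop'
  refine Continuous.div (by fun_prop) (by fun_prop) fun θ => slitPlane_ne_zero
    (one_add_mem_slitPlane (by rwa [norm_mul_exp_I]))

theorem continuous_loop (ha : ‖a‖ < 1) : Continuous (loop a) :=
  continuous_iff_continuousAt.2 fun θ => (hasDerivAt_loop ha θ).continuousAt

/-- The integral of a derivative over a loop. -/
theorem integral_deriv_loop {L : ℂ → ℂ} (ha : ‖a‖ < 1) (hL : ∀ θ, ∀ᶠ z in 𝓝 (loop a θ), DifferentiableAt ℂ L z) :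
    ∫ θ in Ioc (0 : ℝ) (2 * π), deriv L (loop a θ) * loop' a θ = 0 := by
  have h1 : ∀ θ, HasDerivAt (fun t => L (loop a t)) (deriv L (loop a θ) * loop' a θ) θ := fun θ =>
    ((hL θ).self_of_nhds.hasDerivAt).comp_of_eq θ (hasDerivAt_loop ha θ) rfl
  have h2 : Continuous fun θ => deriv L (loop a θ) := by
    rw [continuous_iff_continuousAt]
    intro θ
    have h3 : AnalyticAt ℂ L (loop a θ) := Complex.analyticAt_iff_eventually_differentiableAt.2 (hL θ)
    exact ContinuousAt.comp_of_eq h3.deriv.continuousAt (continuous_loop ha).continuousAt rfl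
  rw [← intervalIntegral.integral_of_le two_pi_pos.le,
    intervalIntegral.integral_eq_sub_of_hasDerivAt (fun θ _ => h1 θ)
      ((h2.mul (continuous_loop' ha)).intervalIntegrable _ _), loop_two_pi, sub_self]

theorem exp_neg_loop_sub_one (ha : ‖a‖ < 1) (θ : ℝ) :
    exp (-loop a θ) - 1 = a * exp (θ * I) := by
  rw [exp_neg_loop ha]; ring

theorem exp_neg_loop_ne_one (ha0 : a ≠ 0) (ha : ‖a‖ < 1) (θ : ℝ) : exp (-loop a θ) ≠ 1 := by
  rw [← sub_ne_zero, exp_neg_loop_sub_one ha]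
  exact mul_ne_zero ha0 (exp_ne_zero _)

/-- The binomial coefficients as residues. -/
theorem integral_beta_loop (ha0 : a ≠ 0) (ha : ‖a‖ < 1) (s : ℕ) : ∀ b : ℂ,
    ∫ θ in Ioc (0 : ℝ) (2 * π), exp (-loop a θ * (b + 1)) *
      (exp (-loop a θ) - 1) ^ (-(s : ℤ) - 1) * loop' a θ
      = -(2 * π * I) * binom b s := by
  induction s with
  | zero =>
    intro b
    have hd : DifferentiableOn ℂ (fun z : ℂ => exp (log (1 + z) * b)) (ball 0 1) := by
      intro z hz
      have := one_add_mem_slitPlane (mem_ball_zero_iff.1 hz)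
      have h2 : DifferentiableAt ℂ (fun z : ℂ => log (1 + z)) z :=
        DifferentiableAt.clog (by fun_prop) this
      exact (h2.mul_const b).cexp.differentiableWithinAt
    have h1 := integral_loop_eq hd ha0 ha
    simp only [add_zero, log_one, zero_mul, exp_zero, mul_one] at h1
    have h2 : ∀ θ : ℝ, exp (-loop a θ * (b + 1)) *
      (exp (-loop a θ) - 1) ^ (-((0 : ℕ) : ℤ) - 1) * loop' a θ
      = -I * exp (log (1 + a * exp (θ * I)) * b) := fun θ => by
      have h3 := exp_neg_loop ha θ
      have h4 : a * exp (θ * I) ≠ 0 := mul_ne_zero ha0 (exp_ne_zero _)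
      have h5 : 1 + a * exp (θ * I) ≠ 0 := slitPlane_ne_zero
        (one_add_mem_slitPlane (by rwa [norm_mul_exp_I]))
      rw [exp_neg_loop_sub_one ha, mul_add, mul_one, exp_add, h3, loop', loop, neg_neg]
      simp only [Nat.cast_zero, neg_zero, zero_sub, zpow_neg_one]
      field_simp
    simp only [h2]
    rw [integral_const_mul, h1, binom]
    simp
    ring
  | succ s ih =>
    intro b
    -- The integral of this exact derivative over the closed loop is 0, which relates the pole order
    -- s + 2 at b to the order s + 1 at b - 1. That is the recursion (s+1) binom(b, s+1) = b
    -- binom(b-1, s).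
    have hL : ∀ z : ℂ, exp (-z) ≠ 1 → HasDerivAt (fun z => exp (-z * b) *
        (exp (-z) - 1) ^ (-((s : ℤ) + 1))) (-b * (exp (-z * b) *
        (exp (-z) - 1) ^ (-((s : ℤ) + 1))) + (s + 1) * (exp (-z * (b + 1)) *
        (exp (-z) - 1) ^ (-((s : ℤ) + 1) - 1))) z := by
      intro z hz
      have h1 : HasDerivAt (fun z : ℂ => exp (-z * b)) (exp (-z * b) * (-1 * b)) z :=
        ((hasDerivAt_neg z).mul_const b).cexp
      have h2 : HasDerivAt (fun z : ℂ => exp (-z) - 1) (exp (-z) * -1) z :=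
        ((hasDerivAt_neg z).cexp).sub_const 1
      have h3 := (hasDerivAt_zpow (-((s : ℤ) + 1)) (exp (-z) - 1)
        (Or.inl (sub_ne_zero.2 hz))).comp z h2
      refine (h1.mul h3).congr_deriv ?_
      rw [mul_add, mul_one, exp_add]
      push_cast
      simp only [comp]
      ring
    have h1 := integral_deriv_loop (L := fun z => exp (-z * b) *
        (exp (-z) - 1) ^ (-((s : ℤ) + 1))) ha fun θ => by
      have : ∀ᶠ z in 𝓝 (loop a θ), exp (-z) ≠ 1 :=
        (by fun_prop : Continuous fun z : ℂ => exp (-z)).continuousAt.eventually_ne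
          (exp_neg_loop_ne_one ha0 ha θ)
      exact this.mono fun z hz => (hL z hz).differentiableAt
    simp only [(hL _ (exp_neg_loop_ne_one ha0 ha _)).deriv] at h1
    have hc : ∀ (c : ℂ) (k : ℤ), Continuous fun θ => exp (-loop a θ * c) *
        (exp (-loop a θ) - 1) ^ k * loop' a θ := fun c k => by
      have := continuous_loop ha
      refine Continuous.mul (Continuous.mul (by fun_prop) (Continuous.zpow₀ (by fun_prop) _ fun θ =>
        Or.inl (sub_ne_zero.2 (exp_neg_loop_ne_one ha0 ha θ)))) (continuous_loop' ha)
    have hi : ∀ (c : ℂ) (k : ℤ), IntegrableOn (fun θ => exp (-loop a θ * c) *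
        (exp (-loop a θ) - 1) ^ k * loop' a θ) (Ioc 0 (2 * π)) := fun c k =>
      ((hc c k).intervalIntegrable 0 (2 * π)).1
    have h2 : ∀ θ, (-b * (exp (-loop a θ * b) *
        (exp (-loop a θ) - 1) ^ (-((s : ℤ) + 1))) + (s + 1) * (exp (-loop a θ * (b + 1)) *
        (exp (-loop a θ) - 1) ^ (-((s : ℤ) + 1) - 1))) * loop' a θ
        = -b * (exp (-loop a θ * (b - 1 + 1)) * (exp (-loop a θ) - 1) ^ (-(s : ℤ) - 1)
          * loop' a θ) + (s + 1) * (exp (-loop a θ * (b + 1)) *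
        (exp (-loop a θ) - 1) ^ (-((s + 1 : ℕ) : ℤ) - 1) * loop' a θ) := fun θ => by
      rw [sub_add_cancel, show -((s : ℤ) + 1) = -(s : ℤ) - 1 by ring]
      push_cast
      rw [show -((s : ℤ) + 1) - 1 = -(s : ℤ) - 1 - 1 by ring]
      ring
    simp only [h2] at h1
    rw [integral_add ((hi _ _).const_mul _) ((hi _ _).const_mul _), integral_const_mul,
      integral_const_mul, ih (b - 1)] at h1
    have hs : (s : ℂ) + 1 ≠ 0 := by exact_mod_cast s.succ_ne_zero
    refine mul_left_cancel₀ hs ?_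
    have hb : ((s : ℂ) + 1) * binom b (s + 1) = b * binom (b - 1) s := by
      have hf : (s.factorial : ℂ) ≠ 0 := by exact_mod_cast s.factorial_ne_zero
      rw [binom, binom, Finset.prod_range_succ', Nat.factorial_succ]
      have : ∏ k ∈ range s, (b - ((k + 1 : ℕ) : ℂ)) = ∏ j ∈ range s, (b - 1 - (j : ℂ)) :=
        prod_congr rfl fun j _ => by push_cast; ring
      rw [this]
      push_cast
      field_simp
      ring
    linear_combination h1 + (2 * π * I) * hb

end

/-! ### Small loops as contours, change of radius, and cancellation of the pole -/

section

/-- The bound for the integrand near a product of loops. -/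
theorem norm_reduced_le_loop {M : ℤ} {k : ℕ} {p : Poly(n)} {b : Fin n → ℂ} {C ε : ℝ}
    (hε : 0 < ε) {σ x : Fin n → ℂ} {y : ℂ} (hσ : ∀ i, ‖σ i‖ ≤ 1)
    (hσε : ∀ i, ε ≤ ‖exp (-σ i) - 1‖)
    (h : ‖ratPart M k p shifted(σ, x) expos(x) (expo y)‖ ≤ C) :
    ‖reduced M k p b σ x y‖ ≤ (∏ i, Real.exp ‖b i‖ * (2 + ε⁻¹) ^ M.natAbs) * C := by
  rw [reduced, norm_mul, norm_prod]
  refine mul_le_mul (Finset.prod_le_prod (fun _ _ => norm_nonneg _) fun i _ => ?_) h (norm_nonneg _)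
    (by positivity)
  rw [norm_mul]
  refine mul_le_mul ?_ (norm_zpow_le ?_ ?_ M) (norm_nonneg _) (exp_pos _).le
  · refine (Complex.norm_exp_le_exp_norm _).trans (exp_le_exp.2 ?_)
    rw [norm_mul, norm_neg]
    exact mul_le_of_le_one_left (norm_nonneg _) (hσ i)
  · have := Complex.norm_exp_sub_one_le (x := -σ i) (by rw [norm_neg]; exact hσ i)
    rw [norm_neg] at this
    have h2 := hσ i
    have h3 : 0 < ε⁻¹ := inv_pos.2 hε
    linarith
  · rw [norm_inv]
    have := inv_anti₀ hε (hσε i)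
    linarith

/-- On the loop itself |e^{-σ} - 1| = |a| ≥ 16δ, and moving σ by δ changes e^{-σ} by at most 4δ.
This keeps a neighbourhood of the loop away from the pole. -/
theorem norm_exp_sub_one_ge {a σ : ℂ} {δ : ℝ} (ha : ‖a‖ ≤ 1 / 16) (hδ : δ ≤ ‖a‖ / 16) {θ : ℝ}
    (h : ‖σ - loop a θ‖ ≤ δ) : 8 * δ ≤ ‖exp (-σ) - 1‖ := by
  have h1 : exp (-σ) - 1 = a * exp (θ * I)
      + exp (-loop a θ) * (exp (-(σ - loop a θ)) - 1) := by
    rw [← exp_neg_loop_sub_one (lt_of_le_of_lt ha (by norm_num)), mul_sub, ← exp_add]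
    ring_nf
  have h2 : ‖exp (-loop a θ)‖ ≤ 2 := by
    rw [exp_neg_loop (lt_of_le_of_lt ha (by norm_num))]
    refine (norm_add_le _ _).trans ?_
    rw [norm_one, norm_mul_exp_I]
    linarith
  have h3 := Complex.norm_exp_sub_one_le (x := -(σ - loop a θ)) (by rw [norm_neg]; linarith)
  rw [norm_neg] at h3
  have h4 : ‖exp (-loop a θ) * (exp (-(σ - loop a θ)) - 1)‖ ≤ 4 * δ := by
    rw [norm_mul]
    nlinarith [norm_nonneg (exp (-(σ - loop a θ)) - 1), norm_nonneg (σ - loop a θ)]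
  have h5 := norm_sub_le_norm_add (a * exp (θ * I))
    (exp (-loop a θ) * (exp (-(σ - loop a θ)) - 1))
  rw [← h1, norm_mul_exp_I] at h5
  linarith [norm_nonneg (σ - loop a θ)]

/-- The product of small loops. -/
theorem Gap.contour_loop {d : ℝ} {x : Fin n → ℂ} {y : ℂ} (h : Gap d x y) {M : ℤ} {k : ℕ}
    {p : Poly(n)} {b : Fin n → ℂ} {C : ℝ} {B : ℕ}
    (hB : RatBound d M k p x y C B) {η : Fin n → ℂ} (hη0 : ∀ i, η i ≠ 0) (hη : ∀ i, ‖η i‖ ≤ 1 / 16)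
    (hηd : ∀ i, 16 * ‖η i‖ ≤ d) {δ : ℝ} (hδ : 0 < δ) (hδd : δ ≤ d / 8) (hδη : ∀ i, δ ≤ ‖η i‖ / 16)
    {r : ℝ} (hr : 0 ≤ r) :
    Contour M k p b (Ioc 0 (2 * π)) (fun i => loop (η i)) (fun i => loop' (η i)) (flow x r) y δ := by
  have hd := h.pos
  obtain ⟨c, hc, hsep⟩ := h.exists_sepAt
  have hη1 : ∀ i, ‖η i‖ < 1 := fun i => (hη i).trans_lt (by norm_num)
  have hη2 : ∀ i, ‖η i‖ ≤ 1 / 2 := fun i => (hη i).trans (by norm_num)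
  have hnorm : ∀ {i θ} {s : ℂ}, ‖s - loop (η i) θ‖ < δ → ‖s‖ ≤ 2 * ‖η i‖ + δ := by
    intro i θ s hs
    have h1 := norm_add_le (s - loop (η i) θ) (loop (η i) θ)
    rw [sub_add_cancel] at h1
    linarith [norm_loop_le (hη2 i) θ]
  have hone : ∀ {i θ} {s : ℂ}, ‖s - loop (η i) θ‖ < δ → exp (-s) ≠ 1 := by
    intro i θ s hs he
    have := norm_exp_sub_one_ge (hη i) (hδη i) hs.le
    rw [he, sub_self, norm_zero] at this
    linarith
  have hbound : ∀ (ξ : Fin n → ℝ) (σ' x' : Fin n → ℂ) (y' : ℂ),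
      (∀ i, ‖σ' i - loop (η i) (ξ i)‖ < δ) → (∀ i, ‖x' i - flow x r i‖ < δ) → ‖y' - y‖ < δ →
      SepAt c σ' x' y' ∧ ‖reduced M k p b σ' x' y' * ∏ i, loop' (η i) (ξ i)‖ ≤
        (∏ i, Real.exp ‖b i‖ * (2 + (8 * δ)⁻¹) ^ M.natAbs) * (C * Real.exp (B * 1)) := by
    intro ξ σ' x' y' hσ hx hy
    obtain ⟨h1, h2⟩ := Near.of_flow (le_trans hδd (by linarith : d / 8 ≤ d / 4)) hx hy
    -- The loop has size at most 2‖η_i‖ ≤ d/8 and the displacement is at most δ ≤ d/8.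
    have him : ∀ i, |(σ' i).im| ≤ d / 4 := fun i =>
      (abs_im_le_norm _).trans ((hnorm (hσ i)).trans (by linarith [hηd i]))
    have h1' : ∀ i, ‖σ' i‖ ≤ 1 := fun i => (hnorm (hσ i)).trans (by linarith [hη i, hδη i])
    have h3 := hsep r _ y' σ' h1 him
    have h4 := hB r hr _ y' σ' 1 h1 him zero_le_one fun i => (abs_re_le_norm _).trans (h1' i)
    rw [h2] at h3 h4
    refine ⟨h3, ?_⟩
    have h5 : ‖∏ i, loop' (η i) (ξ i)‖ ≤ 1 := by
      rw [norm_prod]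
      exact prod_le_one (fun _ _ => norm_nonneg _) fun i _ => norm_loop'_le (hη2 i) _
    rw [norm_mul]
    exact (mul_le_of_le_one_right (norm_nonneg _) h5).trans (norm_reduced_le_loop (by positivity) h1'
      (fun i => norm_exp_sub_one_ge (hη i) (hδη i) (hσ i).le) h4)
  refine ⟨hδ, measurableSet_Ioc, fun i => (continuous_loop (hη1 i)).measurable,
    fun i => (continuous_loop' (hη1 i)).measurable, fun i t _ => exp_neg_loop_ne_one (hη0 i) (hη1 i) t,
    ⟨c, hc, fun _ => (∏ i, Real.exp ‖b i‖ * (2 + (8 * δ)⁻¹) ^ M.natAbs) * (C * Real.exp (B * 1)),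
      integrable_const _, fun ξ _ σ' x' y' hσ hx hy => ?_⟩, fun i ξ hξ => ?_⟩
  · obtain ⟨h1, h2⟩ := hbound ξ σ' x' y' hσ hx hy
    exact ⟨h1, Or.inr fun i => hone (hσ i), h2⟩
  · refine integral_deriv_loop (hη1 i) fun θ => ?_
    filter_upwards [ball_mem_nhds (loop (η i) θ) hδ] with z hz
    have hz' : ∀ j, ‖update (fun j => loop (η j) (ξ j)) i z j
        - loop (η j) (update ξ i θ j)‖ < δ := by
      intro j
      rcases eq_or_ne j i with rfl | hj
      · simpa [dist_eq_norm] using hz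
      · simpa [hj] using hδ
    obtain ⟨h1, -⟩ := hbound _ _ (flow x r) y hz' (fun j => by simpa using hδ) (by simpa using hδ)
    refine differentiableAt_fluxRed k p b i hc (fun j => ?_) h1 (Or.inr fun j => hone (hz' j))
    have := (hasDerivAt_update (fun j => loop (η j) (ξ j)) i 0 z j).differentiableAt
    simpa using this

/-- Separation for all small shifts. -/
def PolySep (ρ : ℝ) (x : Fin n → ℂ) (y : ℂ) : Prop :=
  ∃ c > 0, ∀ σ : Fin n → ℂ, (∀ i, ‖σ i‖ < ρ) → SepAt c σ x y

theorem Gap.polySep {d : ℝ} {x : Fin n → ℂ} {y : ℂ} (h : Gap d x y) : PolySep (d / 4) x y := by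
  obtain ⟨c, hc, hsep⟩ := h.exists_sepAt
  refine ⟨c, hc, fun σ hσ => ?_⟩
  have := hsep 0 x y σ (near_self (by linarith [h.pos]) x y) fun i =>
    (abs_im_le_norm _).trans (hσ i).le
  rwa [ofReal_zero, flow_zero] at this

variable {M : ℤ} {k : ℕ} {p : Poly(n)} {b x : Fin n → ℂ} {y : ℂ} {ρ : ℝ}

theorem norm_log_one_add_lt {z : ℂ} (hρ : ρ ≤ 1) (hz : ‖z‖ < ρ / 2) : ‖-log (1 + z)‖ < ρ := by
  have := Complex.norm_log_one_add_half_le_self (z := z) (by linarith)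
  rw [norm_neg]
  linarith [norm_nonneg z]

theorem differentiableAt_log_one_add {z : ℂ} (hz : ‖z‖ < 1) :
    DifferentiableAt ℂ (fun z : ℂ => -log (1 + z)) z :=
  (DifferentiableAt.clog (by fun_prop) (one_add_mem_slitPlane hz)).neg

theorem update_norm_lt {σ : Fin n → ℂ} {i : Fin n} (hσ : ∀ j, j ≠ i → ‖σ j‖ < ρ) {z : ℂ} (hz : ‖z‖ < ρ)
    (j : Fin n) : ‖update σ i z j‖ < ρ := by
  rcases eq_or_ne j i with rfl | hj
  · simpa using hz
  · simpa [hj] using hσ j hj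

theorem differentiableAt_update {σ : Fin n → ℂ} {i : Fin n} {g : ℂ → ℂ} {z : ℂ}
    (hg : DifferentiableAt ℂ g z) (j : Fin n) :
    DifferentiableAt ℂ (fun z => update σ i (g z) j) z := by
  rcases eq_or_ne j i with rfl | hj
  · simpa using hg
  · simp [hj]

/-- The integral in one variable does not depend on the radius. -/
theorem PolySep.integral_radius (h : PolySep ρ x y) (hρ : ρ ≤ 1) {i : Fin n} {σ : Fin n → ℂ}
    (hσ : ∀ j, j ≠ i → ‖σ j‖ < ρ) (hσ1 : ∀ j, j ≠ i → exp (-σ j) ≠ 1) {a a' : ℂ} (ha0 : a ≠ 0)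
    (ha : ‖a‖ < ρ / 2) (ha0' : a' ≠ 0) (ha' : ‖a'‖ < ρ / 2) :
    ∫ θ in Ioc 0 (2 * π), reduced M k p b (update σ i (loop a θ)) x y * loop' a θ
      = ∫ θ in Ioc 0 (2 * π), reduced M k p b (update σ i (loop a' θ)) x y * loop' a' θ := by
  obtain ⟨c, hc, hsep⟩ := h
  refine integral_loop_radius (f := fun z => reduced M k p b (update σ i (-log (1 + z))) x y
    * (-(z * I) / (1 + z))) (R := ρ / 2) (fun z hz0 hz => ?_) ha0 ha ha0' ha'
  have hz1 : ‖z‖ < 1 := by linarith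
  have hs := hsep _ (update_norm_lt hσ (norm_log_one_add_lt hρ hz))
  have hz2 := slitPlane_ne_zero (one_add_mem_slitPlane hz1)
  refine DifferentiableAt.mul (differentiableAt_reduced M k p b
    (differentiableAt_update (differentiableAt_log_one_add hz1)) (fun _ => differentiableAt_const _)
    (differentiableAt_const _) hc hs (Or.inr fun j => ?_)) (diffAt_div (by fun_prop) (by fun_prop) hz2)
  rcases eq_or_ne j i with rfl | hj
  · rw [update_self, neg_neg, exp_log hz2]
    simpa using hz0
  · rw [update_of_ne hj]
    exact hσ1 j hj

/-- The integral in one variable vanishes when the pole is cancelled. -/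
theorem PolySep.integral_eq_zero {s : ℕ} (h : PolySep ρ x y) (hρ : ρ ≤ 1) {i : Fin n} {σ : Fin n → ℂ}
    (hσ : ∀ j, j ≠ i → ‖σ j‖ < ρ) {Ψ : ℂ → ℂ} (hΨ : Differentiable ℂ Ψ) {a : ℂ} (ha0 : a ≠ 0)
    (ha : ‖a‖ < ρ / 2) :
    ∫ θ in Ioc 0 (2 * π), loop a θ ^ (s + 1) * Ψ (loop a θ) *
      (reduced (-(s : ℤ) - 1) k p b (update σ i (loop a θ)) x y * loop' a θ) = 0 := by
  obtain ⟨c, hc, hsep⟩ := h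
  -- In the variable z = e^{-σ} - 1 one has σ = z ℓ(z) with ℓ holomorphic, so σ^{s+1} contains
  -- exactly the power of z that cancels the pole.
  set ℓ : ℂ → ℂ := dslope (fun z : ℂ => -log (1 + z)) 0 with hℓ
  set D : ℂ := ∏ j ∈ univ.erase i, exp (-σ j * b j) *
    (exp (-σ j) - 1) ^ (-(s : ℤ) - 1) with hD
  set f : ℂ → ℂ := fun z => ℓ z ^ (s + 1) * Ψ (-log (1 + z)) *
    (exp (log (1 + z) * b i) * D * ratPart (-(s : ℤ) - 1) k p
      (fun j => expo (x j - update σ i (-log (1 + z)) j / 2)) (fun j => expo (x j)) (expo y)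
      * (-(z * I) / (1 + z))) with hf
  have hdf : DifferentiableOn ℂ f (ball 0 (ρ / 2)) := by
    intro z hz
    have hz' := mem_ball_zero_iff.1 hz
    have hz1 : ‖z‖ < 1 := by linarith
    have hs := hsep _ (update_norm_lt hσ (norm_log_one_add_lt hρ hz'))
    have hz2 := slitPlane_ne_zero (one_add_mem_slitPlane hz1)
    have hl := differentiableAt_log_one_add hz1
    have hl' : DifferentiableAt ℂ (fun z : ℂ => log (1 + z)) z := by simpa using hl.neg
    have h1 : DifferentiableAt ℂ ℓ z := by
      have : DifferentiableOn ℂ ℓ (ball 0 1) :=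
        (Complex.differentiableOn_dslope (ball_mem_nhds 0 one_pos)).2 fun w hw =>
          (differentiableAt_log_one_add (mem_ball_zero_iff.1 hw)).differentiableWithinAt
      exact this.differentiableAt (isOpen_ball.mem_nhds (mem_ball_zero_iff.2 hz1))
    refine (DifferentiableAt.mul ((h1.pow _).mul (hΨ.differentiableAt.comp z hl)) (DifferentiableAt.mul
      (DifferentiableAt.mul ((hl'.mul_const _).cexp.mul_const _) ?_)
      (diffAt_div (by fun_prop) (by fun_prop) hz2))).differentiableWithinAt
    exact differentiableAt_ratPart _ k p (fun j => differentiableAt_expo ((differentiableAt_const _).sub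
      (diffAt_div (differentiableAt_update hl j) (differentiableAt_const (2 : ℂ)) two_ne_zero)))
      (fun j => differentiableAt_const _) (differentiableAt_const _) hc hs (fun _ => expo_ne_zero _)
      fun _ => expo_ne_zero _
  have h0 := integral_loop_eq hdf ha0 ha
  -- After the cancellation the Jacobian in the angle, -iz/(1+z), still vanishes at z = 0, so the
  -- mean value is 0.
  rw [show f 0 = 0 by simp [hf], mul_zero] at h0
  rw [← h0]
  refine integral_congr_ae (Eventually.of_forall fun θ => ?_)
  have ha1 : ‖a‖ < 1 := by linarith
  have hz0 : a * exp (θ * I) ≠ 0 := mul_ne_zero ha0 (exp_ne_zero _)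
  have h1 : loop a θ = a * exp (θ * I) * ℓ (a * exp (θ * I)) := by
    rw [hℓ, dslope_of_ne _ hz0, slope_def_field]
    simp only [add_zero, log_one, neg_zero, sub_zero]
    rw [mul_div_cancel₀ _ hz0, loop]
  have h2 : -log (1 + a * exp (θ * I)) = loop a θ := rfl
  have h3 : log (1 + a * exp (θ * I)) = -loop a θ := by rw [loop, neg_neg]
  have h4 : -(a * exp (θ * I) * I) / (1 + a * exp (θ * I))
      = loop' a θ := rfl
  have h5 : reduced (-(s : ℤ) - 1) k p b (update σ i (loop a θ)) x y
      = (a * exp (θ * I)) ^ (-(s : ℤ) - 1) * (exp (-loop a θ * b i) * D *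
        ratPart (-(s : ℤ) - 1) k p (fun j => expo (x j - update σ i (loop a θ) j / 2))
          (fun j => expo (x j)) (expo y)) := by
    rw [reduced, ← mul_prod_erase _ _ (mem_univ i), update_self,
      exp_neg_loop_sub_one ha1, prod_congr (s₁ := univ.erase i) rfl fun j hj => by
        rw [update_of_ne (ne_of_mem_erase hj)]]
    ring
  have h6 : (a * exp (θ * I)) ^ (s + 1) * (a * exp (θ * I)) ^ (-(s : ℤ) - 1)
      = 1 := by
    rw [← zpow_natCast, ← zpow_add₀ hz0]
    push_cast
    simp
  simp only [hf, h2, h4]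
  rw [h5, h3]
  nth_rewrite 1 [h1]
  rw [mul_pow]
  linear_combination (ℓ (a * exp (θ * I)) ^ (s + 1) * Ψ (loop a θ) *
    (exp (-loop a θ * b i) * D *
        ratPart (-(s : ℤ) - 1) k p (fun j => expo (x j - update σ i (loop a θ) j / 2))
          (fun j => expo (x j)) (expo y)) * loop' a θ) * h6

end

/-! ### Expansion in the spectral parameter -/

section

theorem differentiable_quot {f : ℂ → ℂ} (hf : Differentiable ℂ f) (k : ℕ) : Differentiable ℂ (quot f k) := by
  induction k with
  | zero => exact hf
  | succ k ih =>
    rw [← differentiableOn_univ] at ih ⊢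
    exact (Complex.differentiableOn_dslope univ_mem).2 ih

/-- The remainder is kept as z^N times an entire function; this is the form in which the loop
integrals annihilate it. -/
theorem exp_eq_sum (N : ℕ) (z : ℂ) : exp z
    = ∑ l ∈ range N, quot exp l 0 * z ^ l + z ^ N * quot exp N z := by
  induction N with
  | zero => simp [quot]
  | succ N ih =>
    rw [Finset.sum_range_succ, pow_succ, ih, quot_eq exp N z]
    ring

/-- The measure on the torus. -/
abbrev torus (n : ℕ) : Measure (Fin n → ℝ) :=
  Measure.pi fun _ : Fin n => (volume : Measure ℝ).restrict (Ioc 0 (2 * π))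

theorem torus_eq (n : ℕ) : torus n = volume.restrict (Icc 0 fun _ => 2 * π) := by
  rw [volume_pi, ← Measure.restrict_congr_set Measure.univ_pi_Ioc_ae_eq_Icc]
  exact (Measure.restrict_pi_pi _ _).symm

theorem integrable_torus {f : (Fin n → ℝ) → ℂ} (hf : Continuous f) : Integrable f (torus n) := by
  rw [torus_eq]
  exact hf.integrableOn_Icc

/-- The point on the product of loops. -/
def loops (η : Fin n → ℂ) (θ : Fin n → ℝ) (i : Fin n) : ℂ := loop (η i) (θ i)

/-- The integrand over the product of loops. -/
def loopRed (M : ℤ) (k : ℕ) (p : Poly(n)) (b η x : Fin n → ℂ) (y : ℂ) (θ : Fin n → ℝ) : ℂ :=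
  reduced M k p b (loops η θ) x y * ∏ i, loop' (η i) (θ i)

theorem loops_update (η : Fin n → ℂ) (θ : Fin n → ℝ) (i : Fin n) (t : ℝ) :
    loops η (update θ i t) = update (loops η θ) i (loop (η i) t) := by
  funext j
  rcases eq_or_ne j i with rfl | hj
  · simp [loops]
  · simp [loops, hj]

theorem norm_loops_lt {ρ : ℝ} {η : Fin n → ℂ} (hρ : ρ ≤ 1) (hη : ∀ i, ‖η i‖ < ρ / 2) (θ : Fin n → ℝ)
    (i : Fin n) : ‖loops η θ i‖ < ρ := by
  have := norm_loop_le (a := η i) (by linarith [hη i]) (θ i)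
  rw [loops]
  linarith [hη i]

theorem prod_loop'_update (η : Fin n → ℂ) (θ : Fin n → ℝ) (i : Fin n) (t : ℝ) :
    ∏ j, loop' (η j) (update θ i t j)
      = loop' (η i) t * ∏ j ∈ univ.erase i, loop' (η j) (θ j) := by
  rw [← mul_prod_erase _ _ (mem_univ i), update_self]
  congr 1
  exact prod_congr rfl fun j hj => by rw [update_of_ne (ne_of_mem_erase hj)]

theorem continuous_loops {η : Fin n → ℂ} (hη : ∀ i, ‖η i‖ < 1) : Continuous (loops η) :=
  continuous_pi fun i => (continuous_loop (hη i)).comp (continuous_apply i)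

section
variable {M : ℤ} {k : ℕ} {p : Poly(n)} {b η x : Fin n → ℂ} {y : ℂ} {ρ : ℝ}

theorem continuous_loopRed_param {X : Type*} [TopologicalSpace X] {φ : X → Fin n → ℂ} (hφ : Continuous φ)
    {c : ℝ} (hc : 0 < c) (hsep : ∀ t σ, (∀ i, ‖σ i‖ < ρ) → SepAt c σ (φ t) y) (hρ : ρ ≤ 1)
    (hη0 : ∀ i, η i ≠ 0) (hη : ∀ i, ‖η i‖ < ρ / 2) :
    Continuous fun q : X × (Fin n → ℝ) => loopRed M k p b η (φ q.1) y q.2 := by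
  have hη1 : ∀ i, ‖η i‖ < 1 := fun i => by linarith [hη i]
  refine Continuous.mul ?_ (continuous_finsetProd _ fun i _ =>
    (continuous_loop' (hη1 i)).comp ((continuous_apply i).comp continuous_snd))
  have hg : Continuous fun q : X × (Fin n → ℝ) => (loops η q.2, φ q.1) :=
    ((continuous_loops hη1).comp continuous_snd).prodMk (hφ.comp continuous_fst)
  rw [continuous_iff_continuousAt]
  intro q
  have h1 := differentiableAt_reduced (E := (Fin n → ℂ) × (Fin n → ℂ)) (σ := Prod.fst) (x := Prod.snd)
    (y := fun _ => y) (t := (loops η q.2, φ q.1)) M k p b (fun i => by fun_prop) (fun i => by fun_prop)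
    (differentiableAt_const _) hc (hsep _ _ (norm_loops_lt hρ hη q.2))
    (Or.inr fun i => exp_neg_loop_ne_one (hη0 i) (hη1 i) _)
  exact h1.continuousAt.comp (f := fun q : X × (Fin n → ℝ) => (loops η q.2, φ q.1)) hg.continuousAt

theorem PolySep.continuous_loopRed (h : PolySep ρ x y) (hρ : ρ ≤ 1) (hη0 : ∀ i, η i ≠ 0)
    (hη : ∀ i, ‖η i‖ < ρ / 2) : Continuous (loopRed M k p b η x y) := by
  obtain ⟨c, hc, hsep⟩ := h
  have h1 := continuous_loopRed_param (X := Unit) (φ := fun _ => x) (M := M) (k := k) (p := p) (b := b)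
    continuous_const hc (fun _ => hsep) hρ hη0 hη
  have h2 := h1.comp (Continuous.prodMk_right ())
  simpa only [comp_def] using h2

/-- The moments of the integrand in the direction of the flow. -/
def loopMoment (M : ℤ) (k : ℕ) (p : Poly(n)) (b η x : Fin n → ℂ) (y : ℂ) (l : ℕ) : ℂ :=
  ∫ θ, (∑ i, kap i * loops η θ i) ^ l * loopRed M k p b η x y θ ∂torus n

/-- High moments vanish. -/
theorem PolySep.integral_pow_mul_eq_zero {s : ℕ} (h : PolySep ρ x y) (hρ : ρ ≤ 1) (hη0 : ∀ i, η i ≠ 0)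
    (hη : ∀ i, ‖η i‖ < ρ / 2) {E : ℂ → ℂ} (hE : Differentiable ℂ E) :
    ∫ θ, (∑ i, kap i * loops η θ i) ^ (n * s + 1) * E (∑ i, kap i * loops η θ i) *
      loopRed (-(s : ℤ) - 1) k p b η x y θ ∂torus n = 0 := by
  have hη1 : ∀ i, ‖η i‖ < 1 := fun i => by linarith [hη i]
  have hcl := continuous_loops hη1
  have hcl' : ∀ i, Continuous fun θ => loops η θ i := fun i => (continuous_apply i).comp hcl
  have hcr := h.continuous_loopRed (M := -(s : ℤ) - 1) (k := k) (p := p) (b := b) hρ hη0 hη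
  simp only [Finset.sum_pow_eq_sum_piAntidiag, sum_mul]
  rw [integral_finsetSum _ fun α _ => integrable_torus (by
    have := hE.continuous
    fun_prop)]
  refine sum_eq_zero fun α hα => ?_
  -- Pigeonhole: n exponents with sum ns + 1 cannot all be at most s. In that variable the pole is
  -- cancelled and the inner integral is zero.
  obtain ⟨i, hi⟩ : ∃ i, s + 1 ≤ α i := by
    by_contra! hcon
    rw [Finset.mem_piAntidiag] at hα
    have := Finset.sum_le_card_nsmul univ α s fun i _ => Nat.lt_succ_iff.1 (hcon i)
    rw [hα.1, card_univ, Fintype.card_fin, smul_eq_mul] at this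
    omega
  refine integral_pi_eq_zero measurableSet_Ioc i _ fun ξ _ => ?_
  set A : ℂ := ∑ j ∈ univ.erase i, kap j * loops η ξ j with hA
  set D : ℂ := ∏ j ∈ univ.erase i, (kap j * loops η ξ j) ^ α j with hD
  set J : ℂ := ∏ j ∈ univ.erase i, loop' (η j) (ξ j) with hJ
  have hΨ : Differentiable ℂ fun z : ℂ => (Nat.multinomial univ α * kap i ^ α i * D : ℂ) *
      z ^ (α i - (s + 1)) * E (kap i * z + A) * J := by
    have : Differentiable ℂ fun z : ℂ => E (kap i * z + A) := hE.comp (by fun_prop)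
    fun_prop
  have h0 := h.integral_eq_zero (s := s) (k := k) (p := p) (b := b) hρ (i := i) (σ := loops η ξ)
    (fun j _ => norm_loops_lt hρ hη ξ j) hΨ (hη0 i) (hη i)
  rw [← h0]
  refine integral_congr_ae (Eventually.of_forall fun t => ?_)
  beta_reduce
  rw [loopRed, prod_loop'_update, loops_update, ← Finset.add_sum_erase _ _ (mem_univ i),
    ← mul_prod_erase _ _ (mem_univ i), update_self,
    sum_congr (s₁ := univ.erase i) rfl fun j hj => by
      rw [update_of_ne (ne_of_mem_erase hj)],
    prod_congr (s₁ := univ.erase i) rfl fun j hj => by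
      rw [update_of_ne (ne_of_mem_erase hj)],
    show loop (η i) t ^ (s + 1) = loop (η i) t ^ (s + 1) from rfl, mul_pow,
    ← Nat.sub_add_cancel hi, pow_add (loop (η i) t), Nat.sub_add_cancel hi]
  ring

/-- T enters through e^{-T κ·σ}, and powers of κ·σ beyond ns integrate to zero. Hence the integral
is a polynomial in T, with the moments as coefficients. -/
theorem PolySep.redInt_eq {s : ℕ} (h : PolySep ρ x y) (hρ : ρ ≤ 1) (hη0 : ∀ i, η i ≠ 0)
    (hη : ∀ i, ‖η i‖ < ρ / 2) (T : ℂ) :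
    redInt (-(s : ℤ) - 1) k (P.eval (𝐂 T)) (lineExp (-(s : ℤ) - 1) ν μ T)
      (Ioc 0 (2 * π)) (fun i => loop (η i)) (fun i => loop' (η i)) x y
    = ∑ j ∈ range (P.natDegree + 1), ∑ l ∈ range (n * s + 1),
      loopMoment (-(s : ℤ) - 1) k (P.coeff j) (lineExp (-(s : ℤ) - 1) ν μ 0) η x y l *
        (quot exp l 0 * (-1) ^ l * T ^ (j + l)) := by
  have hη1 : ∀ i, ‖η i‖ < 1 := fun i => by linarith [hη i]
  have hcl := continuous_loops hη1
  have hcl' : ∀ i, Continuous fun θ => loops η θ i := fun i => (continuous_apply i).comp hcl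
  set S : (Fin n → ℝ) → ℂ := fun θ => ∑ i, kap i * loops η θ i with hS
  have hSc : Continuous S := by fun_prop
  set R : ℕ → (Fin n → ℝ) → ℂ := fun j => loopRed (-(s : ℤ) - 1) k (P.coeff j)
    (lineExp (-(s : ℤ) - 1) ν μ 0) η x y with hR
  have hRc : ∀ j, Continuous (R j) := fun j => h.continuous_loopRed hρ hη0 hη
  have e1 : ∀ θ, reduced (-(s : ℤ) - 1) k (P.eval (𝐂 T)) (lineExp (-(s : ℤ) - 1) ν μ T)
      (fun i => loop (η i) (θ i)) x y * ∏ i, loop' (η i) (θ i)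
      = ∑ j ∈ range (P.natDegree + 1), T ^ j * (exp (-T * S θ) * R j θ) := fun θ => by
    rw [reduced_line, mul_sum, sum_mul]
    refine sum_congr rfl fun j _ => ?_
    simp only [hR, loopRed, hS, neg_mul]
    change _ = T ^ j * (exp (-(T * ∑ i, kap i * loop (η i) (θ i))) *
      (reduced (-(s : ℤ) - 1) k (P.coeff j) (lineExp (-(s : ℤ) - 1) ν μ 0)
        (fun i => loop (η i) (θ i)) x y * ∏ i, loop' (η i) (θ i)))
    ring
  have e2 : ∀ j, ∫ θ, exp (-T * S θ) * R j θ ∂torus n = ∑ l ∈ range (n * s + 1),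
      quot exp l 0 * (-T) ^ l * ∫ θ, S θ ^ l * R j θ ∂torus n := fun j => by
    have hE : Differentiable ℂ fun z : ℂ => quot exp (n * s + 1) (-T * z) :=
      (differentiable_quot Complex.differentiable_exp _).comp (by fun_prop)
    have h0 := h.integral_pow_mul_eq_zero (s := s) (k := k) (p := P.coeff j)
      (b := lineExp (-(s : ℤ) - 1) ν μ 0) hρ hη0 hη hE
    have e3 : ∀ θ, exp (-T * S θ) * R j θ = (∑ l ∈ range (n * s + 1),
        quot exp l 0 * (-T) ^ l * (S θ ^ l * R j θ)) + (-T) ^ (n * s + 1) *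
        (S θ ^ (n * s + 1) * quot exp (n * s + 1) (-T * S θ) * R j θ) := fun θ => by
      rw [exp_eq_sum (n * s + 1), add_mul, sum_mul]
      congr 1
      · exact sum_congr rfl fun l _ => by ring
      · ring
    have hEc := hE.continuous
    have c1 : ∀ l, Continuous fun θ => quot exp l 0 * (-T) ^ l * (S θ ^ l * R j θ) := fun l => by
      have := hRc j
      fun_prop
    have c2 : Continuous fun θ => (-T) ^ (n * s + 1) *
        (S θ ^ (n * s + 1) * quot exp (n * s + 1) (-T * S θ) * R j θ) :=
      continuous_const.mul (((hSc.pow _).mul (hEc.comp hSc)).mul (hRc j))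
    simp only [e3]
    rw [integral_add (integrable_finsetSum _ fun l _ => integrable_torus (c1 l)) (integrable_torus c2),
      integral_finsetSum _ fun l _ => integrable_torus (c1 l), integral_const_mul, h0, mul_zero, add_zero]
    exact sum_congr rfl fun l _ => integral_const_mul _ _
  simp only [redInt, e1]
  rw [integral_finsetSum _ fun j _ => integrable_torus (by have := hRc j; fun_prop)]
  refine sum_congr rfl fun j _ => ?_
  rw [integral_const_mul, e2, mul_sum]
  refine sum_congr rfl fun l _ => ?_
  rw [loopMoment, neg_pow T, pow_add]
  ring

end
end

/-! ### Loops: the difference as a polynomial in the spectral parameter -/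

section
variable {s : ℕ} {η x : Fin n → ℂ} {y : ℂ} {ρ : ℝ}

/-- The exponents as polynomials in the spectral parameter. -/
def expPoly (M : ℤ) (ν : Fin n → ℂ) (μ : ℂ) (i : Fin n) : Polynomial ℂ :=
  Polynomial.C (lineExp M ν μ 0 i) + Polynomial.C (kap i : ℂ) * Polynomial.X

theorem eval_expPoly (M : ℤ) (ν : Fin n → ℂ) (μ T : ℂ) (i : Fin n) :
    (expPoly M ν μ i).eval T = lineExp M ν μ T i := by
  rw [lineExp_eq, expPoly]
  simp
  ring

/-- The residues of the leading terms. -/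
def binomPoly (M : ℤ) (s : ℕ) (ν : Fin n → ℂ) (μ : ℂ) : Polynomial ℂ :=
  ∏ i, Polynomial.C (-(2 * π * I) / s.factorial) *
    ∏ j ∈ range s, (expPoly M ν μ i - Polynomial.C (j : ℂ))

theorem eval_binomPoly (M : ℤ) (s : ℕ) (ν : Fin n → ℂ) (μ T : ℂ) :
    (binomPoly M s ν μ).eval T = ∏ i, -(2 * π * I) * binom (lineExp M ν μ T i) s := by
  simp only [binomPoly, eval_prod, eval_mul, eval_C,
    eval_sub, eval_expPoly, binom]
  exact prod_congr rfl fun i _ => by ring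

/-- The one-variable integrals are -2πi times binomial coefficients in the exponents b_i, and ∏ b_i
is C(ν, μ); both sides are therefore already polynomial in T. -/
theorem prod_expPoly_mul_integral (hη0 : ∀ i, η i ≠ 0) (hη : ∀ i, ‖η i‖ < 1) (ν : Fin n → ℂ) (μ T : ℂ) :
    (∏ i, expPoly (-(s : ℤ) - 1) ν μ i).eval T * ∏ i, ∫ t in Ioc 0 (2 * π),
      exp (-loop (η i) t * (lineExp (-(s : ℤ) - 1) ν μ T i + 1)) *
      (exp (-loop (η i) t) - 1) ^ (-(s : ℤ) - 1) * loop' (η i) t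
    = (binomPoly (-(s : ℤ) - 1) s ν μ).eval T * normCdef (-(s : ℤ) - 1) (lineν ν T) μ := by
  rw [eval_binomPoly, eval_prod, normCdef, ← prod_mul_distrib, ← prod_mul_distrib]
  refine prod_congr rfl fun i _ => ?_
  rw [integral_beta_loop (hη0 i) (hη i), eval_expPoly, mul_comm, lineExp, add_comm (1 : ℂ)]

/-- The coefficients of the difference as a polynomial in the spectral parameter. -/
def loopCoeff (s : ℕ) (ν : Fin n → ℂ) (μ : ℂ) (P : Polynomial Poly(n))
    (P' : Polynomial DefPoly(n)) (η : Fin n → ℂ) (k : ℕ) (x : Fin n → ℂ) (y : ℂ) : ℂ :=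
  (∑ j ∈ range (P.natDegree + 1), ∑ l ∈ range (n * s + 1),
    loopMoment (-(s : ℤ) - 1) s (P.coeff j) (lineExp (-(s : ℤ) - 1) ν μ 0) η x y l *
      ((∏ i, expPoly (-(s : ℤ) - 1) ν μ i) *
        (Polynomial.C (quot exp l 0 * (-1) ^ l) * Polynomial.X ^ (j + l))).coeff k)
  - ∑ j ∈ range (P'.natDegree + 1), defRed s (P'.coeff j) x y *
      (binomPoly (-(s : ℤ) - 1) s ν μ * Polynomial.X ^ j).coeff k

/-- A bound for the degree of the difference. -/
def loopDegree (s : ℕ) (ν : Fin n → ℂ) (μ : ℂ) (P : Polynomial Poly(n))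
    (P' : Polynomial DefPoly(n)) : ℕ :=
  (∏ i, expPoly (-(s : ℤ) - 1) ν μ i).natDegree + (P.natDegree + n * s)
    + ((binomPoly (-(s : ℤ) - 1) s ν μ).natDegree + P'.natDegree) + 1

theorem natDegree_left_lt {j l : ℕ} (hj : j ∈ range (P.natDegree + 1))
    (hl : l ∈ range (n * s + 1)) (c : ℂ) : ((∏ i, expPoly (-(s : ℤ) - 1) ν μ i) *
        (Polynomial.C c * Polynomial.X ^ (j + l))).natDegree < loopDegree s ν μ P P' := by
  have h1 := natDegree_mul_le (p := ∏ i, expPoly (-(s : ℤ) - 1) ν μ i)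
    (q := Polynomial.C c * Polynomial.X ^ (j + l))
  have h2 := Polynomial.natDegree_C_mul_X_pow_le c (j + l)
  rw [mem_range] at hj hl
  unfold loopDegree
  omega

theorem natDegree_right_lt {j : ℕ} (hj : j ∈ range (P'.natDegree + 1)) :
    (binomPoly (-(s : ℤ) - 1) s ν μ * Polynomial.X ^ j).natDegree < loopDegree s ν μ P P' := by
  have h1 := natDegree_mul_le (p := binomPoly (-(s : ℤ) - 1) s ν μ)
    (q := (Polynomial.X ^ j : Polynomial ℂ))
  have h2 := Polynomial.natDegree_X_pow_le (R := ℂ) j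
  rw [mem_range] at hj
  unfold loopDegree
  omega

theorem loopCoeff_eq_zero {k : ℕ} (hk : loopDegree s ν μ P P' ≤ k) (x : Fin n → ℂ) (y : ℂ) :
    loopCoeff s ν μ P P' η k x y = 0 := by
  rw [loopCoeff, sum_eq_zero fun j hj => sum_eq_zero fun l hl => by
    rw [coeff_eq_zero_of_natDegree_lt ((natDegree_left_lt hj hl _).trans_le hk), mul_zero],
    sum_eq_zero fun j hj => by
    rw [coeff_eq_zero_of_natDegree_lt ((natDegree_right_lt hj).trans_le hk), mul_zero], sub_zero]

theorem mstar_neg (s : ℕ) : mstar (-(s : ℤ) - 1) = s := by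
  rw [mstar, max_eq_right (by omega)]
  omega

/-- Collecting powers of T. Unlike on the real contour the expansion is finite and exact, so no
asymptotic argument replaces it. -/
theorem PolySep.lineDiff_eq (h : PolySep ρ x y) (hρ : ρ ≤ 1) (hη0 : ∀ i, η i ≠ 0)
    (hη : ∀ i, ‖η i‖ < ρ / 2) (T : ℂ) :
    lineDiff (-(s : ℤ) - 1) ν μ P P' (Ioc 0 (2 * π)) (fun i => loop (η i))
      (fun i => loop' (η i)) ((∏ i, expPoly (-(s : ℤ) - 1) ν μ i).eval T)
      ((binomPoly (-(s : ℤ) - 1) s ν μ).eval T) T x y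
    = ∑ k ∈ range (loopDegree s ν μ P P'), T ^ k * loopCoeff s ν μ P P' η k x y := by
  simp only [loopCoeff, mul_sub, mul_sum, sum_sub_distrib]
  rw [sum_comm, sum_congr rfl fun j _ => sum_comm,
    sum_comm (t := range (P'.natDegree + 1)), lineDiff, mstar_neg,
    h.redInt_eq hρ hη0 hη, defRed_eval_C, mul_sum, mul_sum]
  congr 1
  · refine sum_congr rfl fun j hj => ?_
    rw [mul_sum]
    refine sum_congr rfl fun l hl => ?_
    have := eval_eq_sum_range' (natDegree_left_lt (P' := P') (ν := ν) (μ := μ) hj hl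
      (quot exp l 0 * (-1) ^ l)) T
    rw [eval_mul, eval_mul, eval_C, eval_pow,
      eval_X] at this
    rw [mul_left_comm, this, mul_sum]
    exact sum_congr rfl fun k _ => by ring
  · refine sum_congr rfl fun j hj => ?_
    have := eval_eq_sum_range' (natDegree_right_lt (s := s) (P := P) (ν := ν) (μ := μ) hj) T
    rw [eval_mul, eval_pow, eval_X] at this
    rw [← mul_assoc, this, sum_mul]
    exact sum_congr rfl fun k _ => by ring

/-- The loops are compact and stay at a positive distance from the pole, so the bound for the
rational part along the flow bounds all moments uniformly. -/
theorem Gap.loopCoeff_le {d : ℝ} (h : Gap d x y)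
    (hP : ∀ j α, s * vdmWt n < wt kap α → (P.coeff j).coeff α = 0)
    (hP' : ∀ j α, s * vdmWt n + ∑ i : Fin n, kap i < wt kapDef α → (P'.coeff j).coeff α = 0)
    (hη0 : ∀ i, η i ≠ 0) (hη : ∀ i, ‖η i‖ ≤ 1 / 16) (hηd : ∀ i, 16 * ‖η i‖ ≤ d) (k : ℕ) :
    ∃ C : ℝ, ∀ r : ℝ, 0 ≤ r → ∀ (x' : Fin n → ℂ) (y' : ℂ), Near (d / 4) x y x' y' →
      ‖loopCoeff s ν μ P P' η k (flow x' r) y'‖ ≤ C := by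
  obtain ⟨C, B, hC, hCB⟩ := h.ratPart_coeff_le (-(s : ℤ) - 1) s P hP
  obtain ⟨C', hC', hCB'⟩ := h.defRed_coeff_le s P' hP'
  have hev : ∀ᶠ ε : ℝ in 𝓝[>] 0, ∀ i, ε < ‖η i‖ := by
    rw [eventually_all]
    exact fun i => nhdsWithin_le_nhds (gt_mem_nhds (norm_pos_iff.2 (hη0 i)))
  obtain ⟨ε, hεη, hε⟩ := (hev.and self_mem_nhdsWithin).exists
  have hη1 : ∀ i, ‖η i‖ < 1 := fun i => (hη i).trans_lt (by norm_num)
  have hη2 : ∀ i, ‖η i‖ ≤ 1 / 2 := fun i => (hη i).trans (by norm_num)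
  set b := lineExp (-(s : ℤ) - 1) ν μ 0
  set A := (∏ i, Real.exp ‖b i‖ * (2 + ε⁻¹) ^ (-(s : ℤ) - 1).natAbs) * (C * Real.exp (B * 1))
  have hε0 : 0 < ε := hε
  have hA : 0 ≤ A := by positivity
  have hmom : ∀ r : ℝ, 0 ≤ r → ∀ (x' : Fin n → ℂ) (y' : ℂ), Near (d / 4) x y x' y' → ∀ j l,
      ‖loopMoment (-(s : ℤ) - 1) s (P.coeff j) b η (flow x' r) y' l‖
        ≤ ((∑ i : Fin n, (kap i : ℝ)) ^ l * A) * (torus n).real Set.univ := by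
    intro r hr x' y' hn j l
    refine norm_integral_le_of_norm_le_const (Eventually.of_forall fun θ => ?_)
    have h1 : ∀ i, ‖loops η θ i‖ ≤ 2 * ‖η i‖ := fun i => norm_loop_le (hη2 i) _
    have h2 : ∀ i, ‖loops η θ i‖ ≤ 1 := fun i => (h1 i).trans (by linarith [hη i])
    have h3 := hCB j r hr x' y' (loops η θ) 1 hn (fun i => (abs_im_le_norm _).trans
      ((h1 i).trans (by linarith [hηd i, h.pos]))) zero_le_one
      fun i => (abs_re_le_norm _).trans (h2 i)
    have h4 := norm_reduced_le_loop (b := b) hε0 h2 (fun i => by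
      rw [loops, exp_neg_loop_sub_one (hη1 i), norm_mul_exp_I]
      exact (hεη i).le) h3
    have h5 : ‖∏ i, loop' (η i) (θ i)‖ ≤ 1 := by
      rw [norm_prod]
      exact prod_le_one (fun _ _ => norm_nonneg _) fun i _ => norm_loop'_le (hη2 i) _
    have h6 : ‖∑ i, kap i * loops η θ i‖ ≤ ∑ i : Fin n, (kap i : ℝ) := by
      refine (norm_sum_le _ _).trans (sum_le_sum fun i _ => ?_)
      rw [norm_mul, Complex.norm_natCast]
      exact mul_le_of_le_one_right (by positivity) (h2 i)
    rw [norm_mul, norm_pow, loopRed, norm_mul]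
    exact mul_le_mul (pow_le_pow_left₀ (norm_nonneg _) h6 _)
      ((mul_le_of_le_one_right (norm_nonneg _) h5).trans h4) (by positivity) (by positivity)
  refine ⟨(∑ j ∈ range (P.natDegree + 1), ∑ l ∈ range (n * s + 1),
    (((∑ i : Fin n, (kap i : ℝ)) ^ l * A) * (torus n).real Set.univ) *
      ‖((∏ i, expPoly (-(s : ℤ) - 1) ν μ i) *
        (Polynomial.C (quot exp l 0 * (-1) ^ l) * Polynomial.X ^ (j + l))).coeff k‖) +
    ∑ j ∈ range (P'.natDegree + 1), C' *
      ‖(binomPoly (-(s : ℤ) - 1) s ν μ * Polynomial.X ^ j).coeff k‖, fun r hr x' y' hn => ?_⟩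
  unfold loopCoeff
  refine (norm_sub_le _ _).trans (add_le_add ((norm_sum_le _ _).trans (sum_le_sum fun j _ =>
    (norm_sum_le _ _).trans (sum_le_sum fun l _ => ?_)))
    ((norm_sum_le _ _).trans (sum_le_sum fun j _ => ?_)))
  · rw [norm_mul]
    exact mul_le_mul_of_nonneg_right (hmom r hr x' y' hn j l) (norm_nonneg _)
  · rw [norm_mul]
    exact mul_le_mul_of_nonneg_right (hCB' j r hr x' y' hn) (norm_nonneg _)

end

/-! ### Loops: vanishing of the difference -/

section
variable {s : ℕ} {η : Fin n → ℂ}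

theorem PolySep.mono {ρ ρ' : ℝ} {x : Fin n → ℂ} {y : ℂ} (h : PolySep ρ x y) (hρ : ρ' ≤ ρ) :
    PolySep ρ' x y := by
  obtain ⟨c, hc, hs⟩ := h
  exact ⟨c, hc, fun σ hσ => hs σ fun i => (hσ i).trans_le hρ⟩

/-- The two sides agree on small loops along the line of spectral parameters. -/
theorem Gap.loopDiff_eq {d : ℝ} {x : Fin n → ℂ} {y : ℂ} (h : Gap d x y) (hη0 : ∀ i, η i ≠ 0)
    (hη : ∀ i, ‖η i‖ ≤ 1 / 16) (hηd : ∀ i, 16 * ‖η i‖ < d) (T : ℂ) :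
    lineDiff (-(s : ℤ) - 1) ν μ P P' (Ioc 0 (2 * π)) (fun i => loop (η i))
      (fun i => loop' (η i)) ((∏ i, expPoly (-(s : ℤ) - 1) ν μ i).eval T)
      ((binomPoly (-(s : ℤ) - 1) s ν μ).eval T) T x y
    = ∑ k ∈ range (loopDegree s ν μ P P'), T ^ k * loopCoeff s ν μ P P' η k x y :=
  (h.polySep.mono (min_le_left _ 1)).lineDiff_eq (min_le_right _ _) hη0 (fun i => by
    rcases min_choice (d / 4) 1 with h1 | h1 <;> rw [h1]
    · linarith [hηd i, norm_nonneg (η i), h.pos]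
    · linarith [hη i]) T

/-- Descending induction on k, with j counting down from the degree. Once the coefficients above k
vanish at all points with a large enough gap, the k-th one is the limit of T^{-k} times the
difference, and `limit_eq_zero` applies. The loops η stay fixed during the induction. -/
theorem Line.loopCoeff_eq_zero (h : Line (-(s : ℤ) - 1) Φ F ν μ P P') (hη0 : ∀ i, η i ≠ 0)
    (hη : ∀ i, ‖η i‖ ≤ 1 / 16) (j : ℕ) : ∀ k, loopDegree s ν μ P P' ≤ k + j →
    ∀ {d : ℝ} {x : Fin n → ℂ} {y : ℂ}, Gap d x y → (∀ i, 16 * ‖η i‖ < d) →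
      loopCoeff s ν μ P P' η k x y = 0 := by
  induction j with
  | zero => exact fun k hk d x y _ _ => TrigBA.loopCoeff_eq_zero hk x y
  | succ j ih =>
    intro k hk d x y hg hηd
    by_cases hkK : loopDegree s ν μ P P' ≤ k
    · exact TrigBA.loopCoeff_eq_zero hkK x y
    have hd := hg.pos
    have hM : (-(s : ℤ) - 1) ≠ 0 := by omega
    have hms := mstar_neg s
    have hη1 : ∀ i, ‖η i‖ < 1 := fun i => (hη i).trans_lt (by norm_num)
    obtain ⟨c0, hc0, hsep⟩ := hg.exists_sepAt
    have hw := h.weight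
    have hw' := h.weight'
    rw [hms] at hw hw'
    obtain ⟨B, hB⟩ := hg.ratPart_line_le (-(s : ℤ) - 1) s P hw
    choose Cb hCb using fun k => hg.loopCoeff_le (ν := ν) (μ := μ) hw hw' hη0 hη (fun i => (hηd i).le) k
    -- The last condition leaves neighbouring points a gap d - 2δ that still exceeds 16‖η_i‖, so
    -- that the induction hypothesis covers them.
    have hδev : ∀ᶠ δ : ℝ in 𝓝[>] 0, (δ < d / 8 ∧ ∀ i, δ < ‖η i‖ / 16) ∧ ∀ i, δ < (d - 16 * ‖η i‖) / 2 := by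
      refine ((?_ : ∀ᶠ δ : ℝ in 𝓝[>] 0, δ < d / 8).and (eventually_all.2 fun i => ?_)).and
        (eventually_all.2 fun i => ?_)
      · exact nhdsWithin_le_nhds (gt_mem_nhds (by positivity))
      · exact nhdsWithin_le_nhds (gt_mem_nhds (div_pos (norm_pos_iff.2 (hη0 i)) (by norm_num)))
      · exact nhdsWithin_le_nhds (gt_mem_nhds (div_pos (by linarith [hηd i]) (by norm_num)))
    obtain ⟨δ, ⟨⟨hδd, hδη⟩, hδg⟩, hδ0⟩ := (hδev.and self_mem_nhdsWithin).exists
    have hδ : 0 < δ := hδ0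
    have hself := near_self (d := d / 4) (by linarith) x y
    have hnear : ∀ x' y', (∀ i, ‖x' i - x i‖ < δ) → ‖y' - y‖ < δ → Near (d / 4) x y x' y' :=
      fun x' y' h1 h2 => ⟨fun i => (h1 i).trans (by linarith), h2.trans (by linarith)⟩
    have hev : ∀ᶠ T : ℝ in atTop, (normC (mstar (-(s : ℤ) - 1)) (lineν ν T) ≠ 0 ∧
        normCdef (-(s : ℤ) - 1) (lineν ν T) μ ≠ 0) ∧ 1 ≤ T :=
      ((eventually_normC_lineν _ ν).and (eventually_normCdef_lineν _ ν μ)).and (eventually_ge_atTop 1)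
    obtain ⟨T₁, hT₁⟩ := eventually_atTop.1 hev
    have hcont : ∀ T : ℝ, ∀ r : ℝ, 0 ≤ r → Contour (-(s : ℤ) - 1) (mstar (-(s : ℤ) - 1))
        (P.eval (𝐂 (T : ℂ))) (lineExp (-(s : ℤ) - 1) ν μ T) (Ioc 0 (2 * π))
        (fun i => loop (η i)) (fun i => loop' (η i)) (flow x r) y δ := by
      intro T r hr
      obtain ⟨C, hC, hCB⟩ := hB T
      rw [hms]
      exact hg.contour_loop hCB hη0 hη (fun i => (hηd i).le) hδ hδd.le (fun i => (hδη i).le) hr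
    refine limit_eq_zero (M := -(s : ℤ) - 1) (ν := ν) (μ := μ) (T₁ := T₁) (δ := δ)
      (g := fun T x y => ((T : ℂ) ^ k)⁻¹ *
        lineDiff (-(s : ℤ) - 1) ν μ P P' (Ioc 0 (2 * π)) (fun i => loop (η i))
        (fun i => loop' (η i)) ((∏ i, expPoly (-(s : ℤ) - 1) ν μ i).eval (T : ℂ))
        ((binomPoly (-(s : ℤ) - 1) s ν μ).eval (T : ℂ)) T x y)
      (e := fun x y => loopCoeff s ν μ P P' η k x y) (C := ∑ k' ∈ range k, Cb k') (C' := Cb k)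
      (V := (norm_potential_le (n := n) (-(s : ℤ) - 1) hc0).choose)
      (by exact_mod_cast hM) hδ ?_ ?_ ?_ ?_ ?_
    · intro T hT r hr
      obtain ⟨⟨hN, hN'⟩, hT1⟩ := hT₁ T hT
      simp only [← lineDiff_mul]
      refine h.eigenAt hM hN hN' _ _ (fun x' y' hx' hy' => ?_) (hcont T r hr)
      obtain ⟨h1, h2⟩ := Near.of_flow (hδd.le.trans (by linarith : d / 8 ≤ d / 4)) hx' hy'
      have := (hsep r _ y' 0 h1 fun i => by simpa using (by linarith : (0 : ℝ) ≤ d / 4)).vdm_ne_zero hc0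
      rw [h2] at this
      exact this.2
    · intro r hr
      exact (norm_potential_le (n := n) (-(s : ℤ) - 1) hc0).choose_spec _ _ _
        (hsep r x y 0 hself fun i => by simpa using (by linarith : (0 : ℝ) ≤ d / 4))
    · intro T hT r hr x' y' hx' hy'
      obtain ⟨⟨hN, hN'⟩, hT1⟩ := hT₁ T hT
      have hT0 : (T : ℂ) ≠ 0 := by
        have : T ≠ 0 := by linarith
        exact_mod_cast this
      have hn := hnear x' y' hx' hy'
      have hg' : Gap (d - 2 * δ) (flow x' r) y' := hg.shrink ⟨hx', hy'⟩ (by linarith) r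
      have hηd' : ∀ i, 16 * ‖η i‖ < d - 2 * δ := fun i => by linarith [hδg i]
      rw [hg'.loopDiff_eq hη0 hη hηd']
      -- The induction hypothesis, at the moved point, truncates the polynomial to degree k; the
      -- terms below k then contribute O(1/T).
      have h1 : ∑ k' ∈ range (loopDegree s ν μ P P'), (T : ℂ) ^ k' *
          loopCoeff s ν μ P P' η k' (flow x' r) y' = ∑ k' ∈ range (k + 1), (T : ℂ) ^ k' *
          loopCoeff s ν μ P P' η k' (flow x' r) y' := by
        refine (Finset.sum_subset (Finset.range_subset_range.2 (by omega)) fun k' _ hk' => ?_).symm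
        rw [mem_range, not_lt] at hk'
        rw [ih k' (by omega) hg' hηd', mul_zero]
      rw [h1, Finset.sum_range_succ, mul_add, inv_mul_cancel_left₀ (pow_ne_zero _ hT0),
        add_sub_cancel_right, mul_sum, sum_div]
      refine (norm_sum_le _ _).trans (sum_le_sum fun k' hk' => ?_)
      rw [mem_range] at hk'
      have h2 := hCb k' r hr x' y' hn
      have h3 : ‖((T : ℂ) ^ k)⁻¹ * (T : ℂ) ^ k'‖ ≤ 1 / T := by
        have hTp : 0 < T := by linarith
        rw [norm_mul, norm_inv, norm_pow, norm_pow, norm_real, norm_of_nonneg hTp.le,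
          inv_mul_eq_div, div_le_div_iff₀ (by positivity) hTp, one_mul, ← pow_succ]
        exact pow_le_pow_right₀ hT1 hk'
      rw [← mul_assoc, norm_mul]
      exact (mul_le_mul h3 h2 (norm_nonneg _) (by positivity)).trans_eq (by ring)
    · intro r hr x' y' hx' hy'
      exact hCb k r hr x' y' (hnear x' y' hx' hy')
    · intro T hT
      obtain ⟨⟨hN, hN'⟩, hT1⟩ := hT₁ T hT
      obtain ⟨C, hC, hCB⟩ := hB T
      have hη2 : ∀ i, ‖η i‖ ≤ 1 / 2 := fun i => (hη i).trans (by norm_num)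
      rw [show (0 : ℂ) = ((T : ℂ) ^ k)⁻¹ * 0 by rw [mul_zero]]
      refine Tendsto.const_mul _ (h.tendsto hN hN' measurableSet_Ioc
        (fun i => (continuous_loop (hη1 i)).measurable) (fun i => (continuous_loop' (hη1 i)).measurable)
        (prod_expPoly_mul_integral hη0 hη1 ν μ T) (B := fun _ =>
          (∏ i, Real.exp ‖lineExp (-(s : ℤ) - 1) ν μ T i‖ * (2 + (8 * δ)⁻¹) ^ (-(s : ℤ) - 1).natAbs) *
            (C * Real.exp (B * 1))) (integrable_const _) fun r hr ξ _ => ?_)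
      have h1 : ∀ i, ‖loop (η i) (ξ i)‖ ≤ 2 * ‖η i‖ := fun i => norm_loop_le (hη2 i) _
      have h2 : ∀ i, ‖loop (η i) (ξ i)‖ ≤ 1 := fun i => (h1 i).trans (by linarith [hη i])
      have h3 := hCB r hr x y (fun i => loop (η i) (ξ i)) 1 hself (fun i =>
        (abs_im_le_norm _).trans ((h1 i).trans (by linarith [hηd i]))) zero_le_one
        fun i => (abs_re_le_norm _).trans (h2 i)
      have h5 : ‖∏ i, loop' (η i) (ξ i)‖ ≤ 1 := by
        rw [norm_prod]
        exact prod_le_one (fun _ _ => norm_nonneg _) fun i _ => norm_loop'_le (hη2 i) _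
      rw [norm_mul, hms]
      refine (mul_le_of_le_one_right (norm_nonneg _) h5).trans
        (norm_reduced_le_loop (by positivity) h2 (fun i => ?_) h3)
      rw [exp_neg_loop_sub_one (hη1 i), norm_mul_exp_I]
      linarith [hδη i]

theorem Line.loopDiff_eq_zero (h : Line (-(s : ℤ) - 1) Φ F ν μ P P') (hη0 : ∀ i, η i ≠ 0)
    (hη : ∀ i, ‖η i‖ ≤ 1 / 16) {d : ℝ} {x : Fin n → ℂ} {y : ℂ} (hg : Gap d x y)
    (hηd : ∀ i, 16 * ‖η i‖ < d) (T : ℂ) :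
    lineDiff (-(s : ℤ) - 1) ν μ P P' (Ioc 0 (2 * π)) (fun i => loop (η i))
      (fun i => loop' (η i)) ((∏ i, expPoly (-(s : ℤ) - 1) ν μ i).eval T)
      ((binomPoly (-(s : ℤ) - 1) s ν μ).eval T) T x y = 0 := by
  rw [hg.loopDiff_eq hη0 hη hηd]
  exact sum_eq_zero fun k _ => by
    rw [h.loopCoeff_eq_zero hη0 hη _ k (Nat.le_add_left _ _) hg hηd, mul_zero]

end

/-! ### The residue formula -/

section

theorem eventually_mul_norm_le {X : Type*} [TopologicalSpace X] {f g : ℝ × X → ℂ} (hf : Continuous f)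
    (hg : Continuous g) {z : X} (h : g (0, z) ≠ 0) : ∀ᶠ q in 𝓝 ((0 : ℝ), z), q.1 * ‖f q‖ ≤ ‖g q‖ := by
  refine ((continuous_fst.mul hf.norm).continuousAt.eventually_lt hg.norm.continuousAt ?_).mono
    fun _ h => h.le
  simpa using h

/-- Separation for all small shifts of all nearby points. -/
theorem exists_sepAt {x : Fin n → ℂ} {y : ℂ} (hx : Injective fun i => expo (x i))
    (hy : cross expos(x) (expo y) ≠ 0) : ∃ ρ > 0, ρ ≤ 1 ∧ ∃ c > 0, ∀ x' : Fin n → ℂ,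
    (∀ i, ‖x' i - x i‖ < ρ) → ∀ σ : Fin n → ℂ, (∀ i, ‖σ i‖ < ρ) → SepAt c σ x' y := by
  have hx' : ∀ i j, i ≠ j → expo (x i) - expo (x j) ≠ 0 := fun i j h => sub_ne_zero.2 (hx.ne h)
  have hy' : ∀ i, expo (x i) - expo y ≠ 0 := fun i => prod_ne_zero_iff.1 hy i (mem_univ i)
  have hu : ∀ i, Continuous fun q : ℝ × (Fin n → ℂ) × (Fin n → ℂ) => expo (q.2.1 i) := fun i => by
    unfold expo
    fun_prop
  have hw : ∀ i, Continuous fun q : ℝ × (Fin n → ℂ) × (Fin n → ℂ) => expo (q.2.1 i - q.2.2 i / 2) :=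
    fun i => by
      unfold expo
      fun_prop
  -- The separation constant is treated as one more variable q.1. At q.1 = 0, x' = x, σ = 0 the
  -- inequalities are strict because the points are distinct, so they persist nearby.
  have key : ∀ᶠ q in 𝓝 ((0 : ℝ), x, (0 : Fin n → ℂ)), SepAt q.1 q.2.2 q.2.1 y := by
    have h1 : ∀ᶠ q in 𝓝 ((0 : ℝ), x, (0 : Fin n → ℂ)), ∀ i j, i ≠ j →
        q.1 * ‖expo (q.2.1 i)‖ ≤ ‖expo (q.2.1 i) - expo (q.2.1 j)‖ := by
      simp only [eventually_all]
      exact fun i j hij => eventually_mul_norm_le (hu i) ((hu i).sub (hu j)) (hx' i j hij)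
    have h2 : ∀ᶠ q in 𝓝 ((0 : ℝ), x, (0 : Fin n → ℂ)), ∀ i j, i ≠ j →
        q.1 * ‖expo (q.2.1 i - q.2.2 i / 2)‖
          ≤ ‖expo (q.2.1 i - q.2.2 i / 2) - expo (q.2.1 j - q.2.2 j / 2)‖ := by
      simp only [eventually_all]
      exact fun i j hij => eventually_mul_norm_le (hw i) ((hw i).sub (hw j)) (by simpa using hx' i j hij)
    have h3 : ∀ᶠ q in 𝓝 ((0 : ℝ), x, (0 : Fin n → ℂ)), ∀ i j, i ≠ j →
        q.1 * ‖expo (q.2.1 i - q.2.2 i / 2)‖ ≤ ‖expo (q.2.1 i - q.2.2 i / 2) - expo (q.2.1 j)‖ ∧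
        q.1 * ‖expo (q.2.1 j)‖ ≤ ‖expo (q.2.1 i - q.2.2 i / 2) - expo (q.2.1 j)‖ := by
      simp only [eventually_all, eventually_and]
      exact fun i j hij => ⟨eventually_mul_norm_le (hw i) ((hw i).sub (hu j)) (by simpa using hx' i j hij),
        eventually_mul_norm_le (hu j) ((hw i).sub (hu j)) (by simpa using hx' i j hij)⟩
    have h4 : ∀ᶠ q in 𝓝 ((0 : ℝ), x, (0 : Fin n → ℂ)), ∀ i,
        (q.1 * ‖expo (q.2.1 i)‖ ≤ ‖expo (q.2.1 i) - expo y‖ ∧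
        q.1 * ‖expo y‖ ≤ ‖expo (q.2.1 i) - expo y‖) ∧
        q.1 * ‖expo (q.2.1 i - q.2.2 i / 2)‖ ≤ ‖expo (q.2.1 i - q.2.2 i / 2) - expo y‖ := by
      simp only [eventually_all, eventually_and]
      exact fun i => ⟨⟨eventually_mul_norm_le (hu i) ((hu i).sub continuous_const) (hy' i),
        eventually_mul_norm_le continuous_const ((hu i).sub continuous_const) (hy' i)⟩,
        eventually_mul_norm_le (hw i) ((hw i).sub continuous_const) (by simpa using hy' i)⟩
    filter_upwards [h1, h2, h3, h4] with q q1 q2 q3 q4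
    exact ⟨q1, q2, q3, fun i => (q4 i).1, fun i => (q4 i).2⟩
  obtain ⟨ε, hε, h⟩ := Metric.eventually_nhds_iff_ball.1 key
  have hρ : 0 < min ε 1 := lt_min hε one_pos
  refine ⟨min ε 1, hρ, min_le_right _ _, min ε 1 / 2, by positivity, fun x' hx' σ hσ =>
    h (min ε 1 / 2, x', σ) ?_⟩
  refine Metric.ball_subset_ball (min_le_left ε 1) ?_
  simp only [mem_ball, Prod.dist_eq, max_lt_iff, dist_pi_lt_iff hρ]
  refine ⟨?_, fun i => by simpa [dist_eq_norm] using hx' i, fun i => by simpa using hσ i⟩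
  rw [Real.dist_0_eq_abs, abs_of_pos (by positivity)]
  linarith

variable {M : ℤ} {k : ℕ} {p : Poly(n)} {b η η' x : Fin n → ℂ} {y : ℂ} {ρ : ℝ}

theorem PolySep.continuous_reduced_update (h : PolySep ρ x y) (hρ : ρ ≤ 1) {i : Fin n} {σ : Fin n → ℂ}
    (hσ : ∀ j, j ≠ i → ‖σ j‖ < ρ) (hσ1 : ∀ j, j ≠ i → exp (-σ j) ≠ 1) {a : ℂ} (ha0 : a ≠ 0)
    (ha : ‖a‖ < ρ / 2) :
    Continuous fun t => reduced M k p b (update σ i (loop a t)) x y * loop' a t := by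
  obtain ⟨c, hc, hsep⟩ := h
  have ha1 : ‖a‖ < 1 := by linarith
  refine Continuous.mul ?_ (continuous_loop' ha1)
  rw [continuous_iff_continuousAt]
  intro t
  have hl : ‖loop a t‖ < ρ := norm_loops_lt (n := 1) (η := fun _ => a) hρ (fun _ => ha) (fun _ => t) 0
  have h1 := differentiableAt_reduced (E := ℂ) (σ := fun z => update σ i z) (x := fun _ => x)
    (y := fun _ => y) (t := loop a t) M k p b (differentiableAt_update differentiableAt_id)
    (fun i => differentiableAt_const _) (differentiableAt_const _) hc (hsep _ (update_norm_lt hσ hl))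
    (Or.inr fun j => by
      rcases eq_or_ne j i with rfl | hj
      · simpa using exp_neg_loop_ne_one ha0 ha1 t
      · simpa [hj] using hσ1 j hj)
  exact h1.continuousAt.comp (f := loop a) (continuous_loop ha1).continuousAt

/-- The integral over a product of loops does not depend on one of the radii. -/
theorem PolySep.integral_update (h : PolySep ρ x y) (hρ : ρ ≤ 1) (hη0 : ∀ i, η i ≠ 0)
    (hη : ∀ i, ‖η i‖ < ρ / 2) (i : Fin n) {a : ℂ} (ha0 : a ≠ 0) (ha : ‖a‖ < ρ / 2) :
    ∫ θ, loopRed M k p b (update η i a) x y θ ∂torus n = ∫ θ, loopRed M k p b η x y θ ∂torus n := by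
  have hu0 : ∀ j, update η i a j ≠ 0 := fun j => by
    rcases eq_or_ne j i with rfl | hj
    · simpa using ha0
    · simpa [hj] using hη0 j
  have hu := fun j => update_norm_lt (fun j _ => hη j) (i := i) ha j
  rw [← sub_eq_zero, ← integral_sub (integrable_torus (h.continuous_loopRed hρ hu0 hu))
    (integrable_torus (h.continuous_loopRed hρ hη0 hη))]
  refine integral_pi_eq_zero measurableSet_Ioc i _ fun θ _ => ?_
  have e1 : ∀ t, update (loops (update η i a) θ) i t = update (loops η θ) i t :=
    fun t => by
      funext j
      rcases eq_or_ne j i with rfl | hj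
      · simp
      · simp [hj, loops]
  have e2 : ∏ j ∈ univ.erase i, loop' (update η i a j) (θ j)
      = ∏ j ∈ univ.erase i, loop' (η j) (θ j) :=
    prod_congr rfl fun j hj => by rw [update_of_ne (ne_of_mem_erase hj)]
  have hσ : ∀ j, ‖loops η θ j‖ < ρ := norm_loops_lt hρ hη θ
  simp only [loopRed, loops_update, prod_loop'_update, e1, e2, update_self, ← mul_assoc,
    ← sub_mul]
  have hη1 := fun j => show ‖η j‖ < 1 by linarith [hη j]
  have hint : ∀ {a : ℂ}, a ≠ 0 → ‖a‖ < ρ / 2 → Integrable (fun t => reduced M k p b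
      (update (loops η θ) i (loop a t)) x y * loop' a t) (volume.restrict (Ioc 0 (2 * π))) :=
    fun ha0 ha => (h.continuous_reduced_update hρ (fun j _ => hσ j)
      (fun j _ => exp_neg_loop_ne_one (hη0 j) (hη1 j) _) ha0 ha).integrableOn_Ioc
  rw [integral_mul_const, integral_sub (hint ha0 ha) (hint (hη0 i) (hη i)), h.integral_radius hρ
    (fun j _ => hσ j) (fun j _ => exp_neg_loop_ne_one (hη0 j) (hη1 j) _) ha0 ha (hη0 i) (hη i), sub_self,
    zero_mul]

/-- The radii are exchanged one variable at a time, running through the finite subsets of indices.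
-/
theorem PolySep.integral_eq (h : PolySep ρ x y) (hρ : ρ ≤ 1) (hη0 : ∀ i, η i ≠ 0)
    (hη : ∀ i, ‖η i‖ < ρ / 2) (hη0' : ∀ i, η' i ≠ 0) (hη' : ∀ i, ‖η' i‖ < ρ / 2) :
    ∫ θ, loopRed M k p b η' x y θ ∂torus n = ∫ θ, loopRed M k p b η x y θ ∂torus n := by
  have key : ∀ s : Finset (Fin n), ∫ θ, loopRed M k p b (s.piecewise η' η) x y θ ∂torus n
      = ∫ θ, loopRed M k p b η x y θ ∂torus n := fun s => by
    induction s using induction_on with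
    | empty => simp
    | insert i s _ ih =>
      rw [Finset.piecewise_insert, ← ih]
      refine h.integral_update hρ (fun j => ?_) (fun j => ?_) i (hη0' i) (hη' i) <;>
      · rw [Finset.piecewise]
        split_ifs
        exacts [by simp [hη0', hη'], by simp [hη0, hη]]
  simpa using key univ

variable {s : ℕ}

/-- The identity for small loops around arbitrary distinct points. -/
theorem Line.integral_loopRed_eq (h : Line (-(s : ℤ) - 1) Φ F ν μ P P') {c : ℝ} (hc : 0 < c) (hρ0 : 0 < ρ)
    (hρ : ρ ≤ 1) (hsep : ∀ x' : Fin n → ℂ, (∀ i, ‖x' i - x i‖ < ρ) → ∀ σ : Fin n → ℂ, (∀ i, ‖σ i‖ < ρ) →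
      SepAt c σ x' y) (hη0 : ∀ i, η i ≠ 0) (hη : ∀ i, ‖η i‖ < ρ / 2) (T : ℂ) :
    (∏ i, expPoly (-(s : ℤ) - 1) ν μ i).eval T * ∫ θ, loopRed (-(s : ℤ) - 1) s (P.eval (𝐂 T))
      (lineExp (-(s : ℤ) - 1) ν μ T) η x y θ ∂torus n
    = (binomPoly (-(s : ℤ) - 1) s ν μ).eval T * defRed s (P'.eval (𝐂 T)) x y := by
  set a : ℝ := ρ / (2 * (n + 1)) with ha
  have ha0 : 0 < a := by positivity
  -- The imaginary flow moves the x_i with distinct nonzero speeds κ_i while y is fixed, so a gap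
  -- opens for all small t > 0. Clamping t to [0, a] keeps the curve within distance ρ of x and
  -- makes the integral continuous in t on the whole line.
  let φ : ℝ → Fin n → ℂ := fun t => flow x ((max 0 (min t a) : ℝ) * I)
  have hφc : Continuous φ := by
    unfold φ flow
    fun_prop
  have hφ0 : φ 0 = x := by simp [φ, ha0.le, flow_zero]
  have hφn : ∀ t i, ‖φ t i - x i‖ < ρ := fun t i => by
    have h1 : (kap i : ℝ) ≤ n + 1 := by
      have : kap i ≤ n + 1 := by unfold kap; omega
      exact_mod_cast this
    have h2 : |max 0 (min t a)| ≤ a := by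
      rw [abs_of_nonneg (le_max_left _ _)]
      exact max_le ha0.le (min_le_right _ _)
    simp only [φ, flow, add_sub_cancel_left, norm_mul, norm_real, norm_I, mul_one,
      Complex.norm_natCast, norm_eq_abs]
    calc _ ≤ a * (n + 1) := by gcongr
      _ = ρ / 2 := by rw [ha]; field_simp
      _ < ρ := by linarith
  have hps : ∀ t, PolySep ρ (φ t) y := fun t => ⟨c, hc, hsep _ (hφn t)⟩
  have hcont : Continuous fun t => ∫ θ, loopRed (-(s : ℤ) - 1) s (P.eval (𝐂 T))
      (lineExp (-(s : ℤ) - 1) ν μ T) η (φ t) y θ ∂torus n := by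
    rw [torus_eq]
    refine continuous_parametric_integral_of_continuous (f := fun t θ => loopRed (-(s : ℤ) - 1) s
      (P.eval (𝐂 T)) (lineExp (-(s : ℤ) - 1) ν μ T) η (φ t) y θ) ?_ isCompact_Icc
    exact continuous_loopRed_param hφc hc (fun t => hsep _ (hφn t)) hρ hη0 hη
  have hv : ∀ t, vdm (fun i => expo (φ t i)) ≠ 0 ∧ cross (fun i => expo (φ t i)) (expo y) ≠ 0 := fun t =>
    ((hsep _ (hφn t) 0 fun i => by simpa using hρ0).vdm_ne_zero hc).2
  have hcont' : Continuous fun t => defRed s (P'.eval (𝐂 T)) (φ t) y := by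
    rw [continuous_iff_continuousAt]
    exact fun t => (differentiableAt_defRed s (P'.eval (𝐂 T)) (hv t).1 (hv t).2).continuousAt.comp
      (f := fun t => (φ t, y)) (hφc.prodMk continuous_const).continuousAt
  have hsin : ∀ᶠ t : ℝ in 𝓝[>] 0, (∀ i j, i ≠ j → sin (φ t i - φ t j).im ≠ 0) ∧
      ∀ i, sin (φ t i - y).im ≠ 0 := by
    have h1 : ∀ᶠ t : ℝ in 𝓝[>] 0, 0 < t := eventually_mem_nhdsWithin
    have h2 : ∀ᶠ t : ℝ in 𝓝[>] 0, t < a := nhdsWithin_le_nhds (eventually_lt_nhds ha0)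
    have h3 : ∀ᶠ t : ℝ in 𝓝[>] 0, ∀ i j : Fin n, i ≠ j →
        sin ((x i - x j).im + ((kap i : ℝ) - kap j) * t) ≠ 0 := by
      simp only [eventually_all]
      intro i j hij
      refine eventually_sin_ne_zero _ (sub_ne_zero.2 fun he => ?_)
      rcases lt_or_gt_of_ne hij with hl | hl
      · exact (kap_lt hl).ne' (by exact_mod_cast he)
      · exact (kap_lt hl).ne (by exact_mod_cast he)
    have h4 : ∀ᶠ t : ℝ in 𝓝[>] 0, ∀ i : Fin n, sin ((x i - y).im + (kap i : ℝ) * t) ≠ 0 :=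
      eventually_all.2 fun i => eventually_sin_ne_zero _ (by exact_mod_cast (kap_pos i).ne')
    filter_upwards [h1, h2, h3, h4] with t t1 t2 t3 t4
    have he : max 0 (min t a) = t := by rw [min_eq_left t2.le, max_eq_right t1.le]
    refine ⟨fun i j hij => ?_, fun i => ?_⟩
    · convert t3 i j hij using 2
      simp [φ, flow, he]
      ring
    · convert t4 i using 2
      simp [φ, flow, he]
      ring
  have hzero : ∀ᶠ t : ℝ in 𝓝[>] 0, (∏ i, expPoly (-(s : ℤ) - 1) ν μ i).eval T *
      (∫ θ, loopRed (-(s : ℤ) - 1) s (P.eval (𝐂 T))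
      (lineExp (-(s : ℤ) - 1) ν μ T) η (φ t) y θ ∂torus n)
      = (binomPoly (-(s : ℤ) - 1) s ν μ).eval T * defRed s (P'.eval (𝐂 T)) (φ t) y := by
    filter_upwards [hsin] with t ht
    obtain ⟨d, hd⟩ := exists_gap ht.1 ht.2
    have hd0 := hd.pos
    -- The gap d closes as t → 0, so the identity is available only on loops that shrink with t;
    -- independence of the radii carries it to the fixed loops η.
    obtain ⟨r, hr0, hr⟩ : ∃ r : ℝ, 0 < r ∧ r < min (min (d / 16) (1 / 16)) (ρ / 2) :=
      exists_between (by positivity)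
    simp only [lt_min_iff] at hr
    have hrn : ‖(r : ℂ)‖ = r := by rw [norm_real, norm_of_nonneg hr0.le]
    have hr0' : (r : ℂ) ≠ 0 := by exact_mod_cast hr0.ne'
    have h1 := h.loopDiff_eq_zero (η := fun _ => (r : ℂ)) (fun _ => hr0') (fun _ => by linarith) hd
      (fun _ => by linarith) T
    rw [lineDiff, mstar_neg, sub_eq_zero] at h1
    rw [← h1, ← (hps t).integral_eq hρ hη0 hη (η' := fun _ => (r : ℂ)) (fun _ => hr0')
      (fun _ => by linarith)]
    rfl
  have h1 := tendsto_nhds_unique ((((hcont.const_mul _).tendsto 0).mono_left nhdsWithin_le_nhds).congr' hzero)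
    (((hcont'.const_mul _).tendsto 0).mono_left nhdsWithin_le_nhds)
  simpa only [hφ0] using h1

/-- The integrand on the product of circles. -/
theorem Line.residueIntegrand_eq (h : Line (-(s : ℤ) - 1) Φ F ν μ P P') (hps : PolySep ρ x y) (hρ : ρ ≤ 1)
    (hN : normC s ν ≠ 0) {ε : ℝ} (hη : ∀ i, ‖ε / expo (x i)‖ < ρ / 2) (θ : Fin n → ℝ) :
    (∏ i, (ε : ℂ) * exp (θ i * I) * I) *
      residueIntegrand s Φ x y ν μ (torusMap expos(x) (fun _ => ε) θ)
    = (-1) ^ n * ((vdm expos(x) ^ (s + 1))⁻¹ / normC s ν *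
        ∏ i, powx (x i) (ν i - μ - ((s : ℂ) + 2) / 2)) * cross expos(x) (expo y) *
      loopRed (-(s : ℤ) - 1) s (P.eval (𝐂 1)) (lineExp (-(s : ℤ) - 1) ν μ 1)
        (fun i => ε / expo (x i)) x y θ := by
  have hη1 : ∀ i, ‖ε / expo (x i)‖ < 1 / 2 := fun i => by linarith [hη i]
  obtain ⟨c, hc, hsep⟩ := hps
  set σ := loops (fun i => ε / expo (x i)) θ with hσ
  obtain ⟨hv, hu, hcr⟩ := (hsep σ (norm_loops_lt hρ hη θ)).vdm_ne_zero hc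
  have he : ∀ i, exp (-σ i) = 1 + ε / expo (x i) * exp (θ i * I) := fun i =>
    exp_neg_loop (by linarith [hη1 i]) _
  have hw : torusMap expos(x) (fun _ => ε) θ = fun i => expo (x i - σ i / 2) := by
    funext i
    rw [expo_sub_half, he, torusMap]
    have := expo_ne_zero (x i)
    field_simp
  have hl : ∀ i, liftLog (x i) (expo (x i - σ i / 2)) = x i - σ i / 2 := fun i => by
    have h1 : ‖σ i‖ ≤ 1 := (norm_loop_le (hη1 i).le (θ i)).trans (by linarith [hη1 i])
    have h2 := abs_le.1 ((abs_im_le_norm (-σ i)).trans ((norm_neg _).trans_le h1))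
    exact liftLog_expo_sub _ _ (by linarith [h2.1, Real.pi_gt_three]) (by linarith [h2.2, Real.pi_gt_three])
  -- In w = u e^{-σ} one has dw = -w dσ. The sign, once per variable, meets the sign in -2πi from
  -- the one-variable integrals.
  have hj : ∀ i, (ε : ℂ) * exp (θ i * I) * I
      = -1 * (expo (x i) * exp (-σ i)) * loop' (ε / expo (x i)) (θ i) := fun i => by
    have h1 := expo_ne_zero (x i)
    have h2 := exp_ne_zero (-σ i)
    rw [loop', ← he]
    field_simp
  have hf := h.form 1 _ hv (by rwa [lineν_one, mstar_neg])
  rw [lineν_one, mstar_neg] at hf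
  have hb : lineExp (-(s : ℤ) - 1) ν μ 1 = fun i => ν i - μ - (((-(s : ℤ) - 1 : ℤ) : ℂ) + 1) / 2 := by
    funext i
    rw [lineExp, lineν_one]
  have hi := integrand_eq (-(s : ℤ) - 1) s (normC s ν) (P.eval (𝐂 1)) ν σ μ y hu
  have hr := reduced_eq_core (-(s : ℤ) - 1) s (P.eval (𝐂 1))
    (lineExp (-(s : ℤ) - 1) ν μ 1) σ x y
  rw [eq_div_iff hcr, hb] at hr
  have hz : ∀ z : ℂ, z ^ (-(s : ℤ) - 1) = (z ^ (s + 1))⁻¹ := fun z => by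
    rw [← neg_add', zpow_neg]
    exact_mod_cast rfl
  have e1 : -μ - (((-(s : ℤ) - 1 : ℤ) : ℂ) + 3) / 2 = -μ + (s : ℂ) / 2 - 1 := by push_cast; ring
  have e2 : ∀ i, ν i - μ + (((-(s : ℤ) - 1 : ℤ) : ℂ) - 1) / 2 = ν i - μ - ((s : ℂ) + 2) / 2 := fun i => by
    push_cast; ring
  rw [← hr] at hi
  simp only [hz, e1, e2, div_inv_eq_mul] at hi
  rw [hw, residueIntegrand, loopRed, hb, prod_congr rfl fun i _ => hj i, prod_mul_distrib,
    prod_mul_distrib, prod_const, card_univ, Fintype.card_fin]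
  simp only [hl, hf]
  linear_combination ((-1) ^ n * ∏ i, loop' (ε / expo (x i)) (θ i)) * hi

/-- The circle of radius ε about u_i is the loop with parameter ε/u_i, so for small ε the torus
integral is the loop integral of `Line.integral_loopRed_eq` at T = 1. The binomial condition permits
dividing by the constant. -/
theorem residue_formula {s : ℕ} {Φ : (Fin n → ℂ) → (Fin n → ℂ) → ℂ} (hΦ : IsTrigBA n (-(s : ℤ) - 1) Φ)
    {F : (Fin n → ℂ) → ℂ → (Fin n → ℂ) → ℂ → ℂ} (hF : IsDefTrigBA n (-(s : ℤ) - 1) F)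
    (x : Fin n → ℂ) (y : ℂ) (ν : Fin n → ℂ) (μ : ℂ) (hx : Injective fun i => expo (x i))
    (hy : cross expos(x) (expo y) ≠ 0) (hN : normC s ν ≠ 0)
    (hN' : normCdef (-(s : ℤ) - 1) ν μ ≠ 0) (hB : ∀ i, binom (ν i - μ + (s : ℂ) / 2) s ≠ 0) :
    ∀ᶠ ε : ℝ in 𝓝[>] 0,
      TorusIntegrable (residueIntegrand s Φ x y ν μ) expos(x) (fun _ => ε) ∧
      F x y ν μ = ((2 * (π : ℂ) * I) ^ n * ∏ i, binom (ν i - μ + (s : ℂ) / 2) s)⁻¹ *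
        ((∏ i, powx (x i) (μ + ((s : ℂ) + 2) / 2)) * powx y (μ / (-(s : ℂ) - 1)) *
          vdm expos(x) ^ (s + 1) / cross expos(x) (expo y)) *
        torusIntegral (residueIntegrand s Φ x y ν μ) expos(x) (fun _ => ε) := by
  obtain ⟨P, P', h⟩ := exists_line hΦ hF ν μ
  obtain ⟨ρ, hρ0, hρ, c, hc, hsep⟩ := exists_sepAt hx hy
  have hps : PolySep ρ x y := ⟨c, hc, hsep x fun i => by simpa using hρ0⟩
  have hu := vdm_ne_zero hx
  have hsmall : ∀ᶠ ε : ℝ in 𝓝[>] 0, ∀ i, ‖ε / expo (x i)‖ < ρ / 2 := by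
    refine nhdsWithin_le_nhds (eventually_all.2 fun i => ?_)
    have h1 : Continuous fun ε : ℝ => ‖(ε : ℂ) / expo (x i)‖ := by fun_prop
    exact h1.continuousAt.eventually_lt continuousAt_const (by simpa using hρ0)
  filter_upwards [hsmall, eventually_mem_nhdsWithin] with ε hη hε
  have hε0 : (ε : ℂ) ≠ 0 := by exact_mod_cast (Set.mem_Ioi.1 hε).ne'
  have hη0 : ∀ i, ε / expo (x i) ≠ 0 := fun i => div_ne_zero hε0 (expo_ne_zero _)
  have heq := h.residueIntegrand_eq hps hρ hN hη
  have hjac : ∀ θ : Fin n → ℝ, ∏ i, (ε : ℂ) * exp (θ i * I) * I ≠ 0 := fun θ =>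
    prod_ne_zero_iff.2 fun i _ =>
      mul_ne_zero (mul_ne_zero hε0 (exp_ne_zero _)) I_ne_zero
  constructor
  · have h1 : Continuous fun θ => residueIntegrand s Φ x y ν μ (torusMap expos(x) (fun _ => ε) θ) := by
      simp only [fun θ => eq_div_of_mul_eq (hjac θ) ((mul_comm _ _).trans (heq θ))]
      exact ((hps.continuous_loopRed hρ hη0 hη).const_mul _).div (by fun_prop) hjac
    exact h1.integrableOn_Icc
  · have hb : ∀ i, lineExp (-(s : ℤ) - 1) ν μ 1 i = ν i - μ + (s : ℂ) / 2 := fun i => by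
      rw [lineExp, lineν_one]
      push_cast
      ring
    have hI := h.integral_loopRed_eq hc hρ0 hρ hsep hη0 hη 1
    have hc1 : (∏ i, expPoly (-(s : ℤ) - 1) ν μ i).eval 1 = normCdef (-(s : ℤ) - 1) ν μ := by
      rw [eval_prod, normCdef]
      refine prod_congr rfl fun i _ => ?_
      rw [eval_expPoly, hb]
      push_cast
      ring
    rw [hc1, eval_binomPoly, prod_mul_distrib, prod_const, card_univ,
      Fintype.card_fin, neg_pow, prod_congr rfl fun i _ => congrArg (binom · s) (hb i), torus_eq] at hI
    have hFf := h.form' 1 x y hu hy (by rwa [lineν_one, mstar_neg]) (by rwa [lineν_one])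
    rw [lineν_one, mstar_neg, planeWave] at hFf
    have hpow : ∀ i, powx (x i) (ν i) = powx (x i) (μ + ((s : ℂ) + 2) / 2) *
        powx (x i) (ν i - μ - ((s : ℂ) + 2) / 2) := fun i => by
      rw [powx, powx, powx, ← exp_add]
      ring_nf
    rw [hFf, torusIntegral]
    simp only [smul_eq_mul, heq, integral_const_mul]
    rw [prod_congr rfl fun i _ => hpow i, prod_mul_distrib]
    have hB' := prod_ne_zero_iff.2 fun i (_ : i ∈ univ) => hB i
    have hpi := pow_ne_zero n Complex.two_pi_I_ne_zero
    have h1 : ((-1 : ℂ) ^ n) * (-1) ^ n = 1 := by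
      rw [← mul_pow]; norm_num
    push_cast
    generalize (2 * (π : ℂ) * I) ^ n = G at *
    generalize ∏ i, binom (ν i - μ + (s : ℂ) / 2) s = B at *
    generalize (-1 : ℂ) ^ n = e at *
    generalize ∏ i, powx (x i) (μ + ((s : ℂ) + 2) / 2) = X at *
    generalize ∏ i, powx (x i) (ν i - μ - ((s : ℂ) + 2) / 2) = Y at *
    generalize defRed s (P'.eval (𝐂 1)) x y = D at *
    generalize ∫ θ in Icc (0 : Fin n → ℝ) fun _ => 2 * π, loopRed (-(s : ℤ) - 1) s
      (P.eval (𝐂 1)) (lineExp (-(s : ℤ) - 1) ν μ 1) (fun i => ε / expo (x i)) x y θ = R at *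
    have hV := pow_ne_zero (s + 1) hu
    generalize vdm expos(x) ^ (s + 1) = V at *
    field_simp
    linear_combination (-X * Y * powx y (μ / (-s - 1)) * e) * hI -
      X * Y * powx y (μ / (-s - 1)) * D * G * B * h1

end

end TrigBA

end

theorem mainTheorem10 (n : ℕ) :
    (∀ m : ℕ, 0 < m →
      ∀ Φ : (Fin n → ℂ) → (Fin n → ℂ) → ℂ, TrigBA.IsTrigBA n (m : ℤ) Φ →
      ∀ F : (Fin n → ℂ) → ℂ → (Fin n → ℂ) → ℂ → ℂ, TrigBA.IsDefTrigBA n (m : ℤ) F →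
      ∀ (x : Fin n → ℂ) (y : ℂ) (ν : Fin n → ℂ) (μ : ℂ),
        Function.Injective (fun i => (TrigBA.expo (x i)).arg) →
        TrigBA.cross (fun i => TrigBA.expo (x i)) (TrigBA.expo y) ≠ 0 →
        TrigBA.normC m ν ≠ 0 →
        (∀ i, ((m : ℝ) + 1) / 2 + (m : ℝ) * ((n : ℝ) - 1) < (ν i - μ).re) →
        IntegrableOn
          (TrigBA.segmentPullback (TrigBA.selbergIntegrand m Φ x y ν μ)
            (fun i => TrigBA.expo (x i)))
          (Set.Icc (0 : Fin n → ℝ) 1) ∧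
        F x y ν μ =
          ((-1) ^ (n * m) *
            ∏ i, Complex.Gamma (ν i - μ + ((m : ℂ) + 3) / 2) /
              (Complex.Gamma ((m : ℂ) + 1) * Complex.Gamma (ν i - μ + (1 - (m : ℂ)) / 2))) *
          ((∏ i, TrigBA.powx (x i) (μ + (1 - (m : ℂ)) / 2)) * TrigBA.powx y (μ / (m : ℂ)) /
            (TrigBA.vdm (fun i => TrigBA.expo (x i)) ^ m *
              TrigBA.cross (fun i => TrigBA.expo (x i)) (TrigBA.expo y))) *
          ∫ τ in Set.Icc (0 : Fin n → ℝ) 1,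
            TrigBA.segmentPullback (TrigBA.selbergIntegrand m Φ x y ν μ)
              (fun i => TrigBA.expo (x i)) τ) ∧
    (∀ s : ℕ,
      ∀ Φ : (Fin n → ℂ) → (Fin n → ℂ) → ℂ, TrigBA.IsTrigBA n (-(s : ℤ) - 1) Φ →
      ∀ F : (Fin n → ℂ) → ℂ → (Fin n → ℂ) → ℂ → ℂ, TrigBA.IsDefTrigBA n (-(s : ℤ) - 1) F →
      ∀ (x : Fin n → ℂ) (y : ℂ) (ν : Fin n → ℂ) (μ : ℂ),
        Function.Injective (fun i => TrigBA.expo (x i)) →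
        TrigBA.cross (fun i => TrigBA.expo (x i)) (TrigBA.expo y) ≠ 0 →
        TrigBA.normC s ν ≠ 0 →
        TrigBA.normCdef (-(s : ℤ) - 1) ν μ ≠ 0 →
        (∀ i, TrigBA.binom (ν i - μ + (s : ℂ) / 2) s ≠ 0) →
        ∀ᶠ ε : ℝ in 𝓝[>] 0,
          TorusIntegrable (TrigBA.residueIntegrand s Φ x y ν μ)
            (fun i => TrigBA.expo (x i)) (fun _ => ε) ∧
          F x y ν μ =
            ((2 * (Real.pi : ℂ) * Complex.I) ^ n *
              ∏ i, TrigBA.binom (ν i - μ + (s : ℂ) / 2) s)⁻¹ *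
            ((∏ i, TrigBA.powx (x i) (μ + ((s : ℂ) + 2) / 2)) *
              TrigBA.powx y (μ / (-(s : ℂ) - 1)) *
              TrigBA.vdm (fun i => TrigBA.expo (x i)) ^ (s + 1) /
              TrigBA.cross (fun i => TrigBA.expo (x i)) (TrigBA.expo y)) *
            torusIntegral (TrigBA.residueIntegrand s Φ x y ν μ)
              (fun i => TrigBA.expo (x i)) (fun _ => ε)) :=
  ⟨fun _ hm _ hΦ _ hF x y ν μ hx hy hN hν => TrigBA.selberg_formula hm hΦ hF x y ν μ hx hy hN hν,
    fun _ _ hΦ _ hF x y ν μ hx hy hN hN' hB => TrigBA.residue_formula hΦ hF x y ν μ hx hy hN hN' hB⟩
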